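/- Let $k_1\ge 1$ and $k_2\ge 2$ be integers. Let $V_i$ be the irreducible $S^1$-representation of weight $i$, let $\mathbb Z_2=\{\pm1\}\subset S^1$, and let $\mathbb R_-$ and $\mathbb R$ be the nontrivial and the trivial one-dimensional real representation of $\mathbb Z_2$. For a representation $V$ write $S(V)$, $D(V)$, $P(V)$ for its unit sphere, its closed unit disc and its projectivization. Put $$M_1=S(V_1^{k_1}\oplus V_2^{k_2}\oplus\mathbb R),\qquad M_2=S^1\times_{\mathbb Z_2}\bigl(P(\mathbb R^3\oplus\mathbb R_-)\times S(\mathbb R_-^{2k_1-1}\oplus\mathbb R^{2k_2-2})\bigr),$$ with $S^1$ acting trivially on the summand $\mathbb R$ in $M_1$ and by multiplication on the first factor in $M_2$. Then: 1. $M_1$ is a closed orientable smooth $S^1$-manifold; $M_1^{\mathbb Z_2}=S(V_2^{k_2}\oplus\mathbb R)$ is connected and contains $M_1^{S^1}$, which has exactly two points. 2. $M_2$ is a closed orientable smooth $S^1$-manifold, and $C_2=(S^1/\mathbb Z_2)\times P(\mathbb R^3)\times S(\mathbb R^{2k_2-2})$ is a connected component of $M_2^{\mathbb Z_2}$ and a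 non-orientable embedded submanifold of dimension $2k_2$. 3. There are orbits $O_1\subset M_1^{\mathbb Z_2}$ and $O_2\subset C_2$ having invariant neighbourhoods $U_i\subset M_i$ that are equivariantly diffeomorphic to $S^1\times_{\mathbb Z_2}D(\mathbb R_-^{2k_1}\oplus\mathbb R^{2k_2-1})$ with $O_i$ as zero section. (The diffeomorphism is required to extend to an equivariant diffeomorphism of the open tube $S^1\times_{\mathbb Z_2}(\mathbb R_-^{2k_1}\oplus\mathbb R^{2k_2-1})$ onto an open subset of $M_i$.) 4. For all such $O_1,O_2,U_1,U_2$ (and identifications), the manifolds $M_1\setminus\dot U_1$ and $M_2\setminus\dot U_2$ can be glued along $\partial U_1=\partial U_2$ (identified through $S^1\times_{\mathbb Z_2}S(\mathbb R_-^{2k_1}\oplus\mathbb R^{2k_2-1})$) to a closed orientable smooth $S^1$-manifold $M$ of dimension $2k_1+2k_2$ such that $F=(M_1^{\mathbb Z_2}\setminus\dot U_1)\cup(C_2\setminus\dot U_2)\subset M$ is a connected component of $M^{\mathbb Z_2}$, is a non-orientable embedded submanifold of dimension $2k_2$, and contains $M^{S^1}$, which is non-empty. In particular, a component of the $\mathbb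 Z_2$-fixed point set of an even-dimensional orientable $S^1$-manifold that contains $S^1$-fixed points need not be orientable. -/

import Mathlib

open Set MulAction
open scoped Manifold ContDiff

noncomputable section

/-! ### Orientability -/

/-- A boundaryless smooth manifold is orientable if it is covered by charts of its smooth structure
all of whose transition maps have positive Jacobian determinant. -/
def Orientable {E H : Type*} [NormedAddCommGroup E] [NormedSpace ℝ E] [TopologicalSpace H]
    (I : ModelWithCorners ℝ E H) [I.Boundaryless]
    (M : Type*) [TopologicalSpace M] [ChartedSpace H M] : Prop :=
  ∃ A ⊆ IsManifold.maximalAtlas I ∞ M,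
    (∀ x : M, ∃ e ∈ A, x ∈ e.source) ∧
    ∀ e ∈ A, ∀ e' ∈ A, ∀ x ∈ e.source ∩ e'.source,
      0 < (fderiv ℝ (e'.extend I ∘ (e.extend I).symm) (e.extend I x)).det

/-- `C` is a `d`-dimensional embedded smooth submanifold of `M` which is not orientable. -/
def IsNonorientableSubmanifold {E H : Type*} [NormedAddCommGroup E] [NormedSpace ℝ E]
    [TopologicalSpace H] (I : ModelWithCorners ℝ E H)
    {M : Type*} [TopologicalSpace M] [ChartedSpace H M] (d : ℕ) (C : Set M) : Prop :=
  ∃ (N : Type) (_ : TopologicalSpace N) (_ : ChartedSpace (EuclideanSpace ℝ (Fin d)) N)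
    (ι : N → M), IsManifold (𝓡 d) ∞ N ∧ Manifold.IsSmoothEmbedding (𝓡 d) I ∞ ι ∧
      range ι = C ∧ ¬ Orientable (𝓡 d) N

/-- `C` is a connected component of the subspace `S`. -/
def IsComponentOf {M : Type*} [TopologicalSpace M] (C S : Set M) : Prop :=
  ∃ x ∈ S, C = connectedComponentIn S x

/-- `M` is a closed smooth manifold with a smooth action of the circle group. -/
structure IsClosedCircleManifold {E H : Type*} [NormedAddCommGroup E] [NormedSpace ℝ E]
    [TopologicalSpace H] (I : ModelWithCorners ℝ E H) [I.Boundaryless]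
    (M : Type*) [TopologicalSpace M] [ChartedSpace H M] [MulAction Circle M] : Prop where
  isManifold : IsManifold I ∞ M
  t2Space : T2Space M
  compactSpace : CompactSpace M
  contMDiffSMul : ContMDiffSMul (𝓡 1) I ∞ Circle M

/-! ### The subgroup of order two -/

/-- The subgroup `ℤ₂ = {1, -1}` of the circle group. -/
def Z2 : Subgroup Circle := (powMonoidHom 2).ker

theorem mem_Z2_iff (z : Circle) : z ∈ Z2 ↔ z = 1 ∨ z = -1 := by
  have h : z ∈ Z2 ↔ z ^ 2 = 1 := Iff.rfl
  rw [h, Circle.ext_iff, Circle.ext_iff, Circle.ext_iff]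
  have hneg : ((-1 : Circle) : ℂ) = -1 := rfl
  rw [hneg, Circle.coe_pow, Circle.coe_one]
  exact sq_eq_one_iff

instance : Finite Z2 := by
  have h : (Z2 : Set Circle) ⊆ {1, -1} := fun z hz => (mem_Z2_iff z).1 hz
  exact ((Set.toFinite ({1, -1} : Set Circle)).subset h).to_subtype

/-! ### Orthogonal representations, their unit spheres and projectivizations -/

section Reps

variable {G : Type} [Group G]
variable {E F : Type} [NormedAddCommGroup E] [InnerProductSpace ℝ E]
  [NormedAddCommGroup F] [InnerProductSpace ℝ F]

/-- The direct sum of two orthogonal representations. -/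
def sumRep (ρ : G →* (E ≃ₗᵢ[ℝ] E)) (σ : G →* (F ≃ₗᵢ[ℝ] F)) :
    G →* (WithLp 2 (E × F) ≃ₗᵢ[ℝ] WithLp 2 (E × F)) where
  toFun g := LinearIsometryEquiv.withLpProdCongr 2 (ρ g) (σ g)
  map_one' := by rw [map_one, map_one]; rfl
  map_mul' g h := by rw [map_mul, map_mul]; rfl

/-- The representation space of `ρ`, with its linear action. -/
def RepSpace (_ρ : G →* (E ≃ₗᵢ[ℝ] E)) : Type := E

/-- The unit sphere `S(V)` of an orthogonal representation `V`. -/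
def RepSphere (_ρ : G →* (E ≃ₗᵢ[ℝ] E)) : Type := Metric.sphere (0 : E) 1

variable (ρ : G →* (E ≃ₗᵢ[ℝ] E))

instance : NormedAddCommGroup (RepSpace ρ) := inferInstanceAs (NormedAddCommGroup E)
instance : InnerProductSpace ℝ (RepSpace ρ) := inferInstanceAs (InnerProductSpace ℝ E)
instance [FiniteDimensional ℝ E] : FiniteDimensional ℝ (RepSpace ρ) :=
  inferInstanceAs (FiniteDimensional ℝ E)
instance [FiniteDimensional ℝ E] : LocallyCompactSpace (RepSpace ρ) :=
  have : ProperSpace (RepSpace ρ) := FiniteDimensional.proper_real _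
  inferInstance

instance : MulAction G (RepSpace ρ) where
  smul g x := ρ g x
  one_smul x := by change ρ 1 x = x; rw [map_one]; rfl
  mul_smul g h x := by change ρ (g * h) x = ρ g (ρ h x); rw [map_mul]; rfl

instance : ContinuousConstSMul G (RepSpace ρ) where
  continuous_const_smul g := (ρ g).continuous

instance : TopologicalSpace (RepSphere ρ) :=
  inferInstanceAs (TopologicalSpace (Metric.sphere (0 : E) 1))
instance : T2Space (RepSphere ρ) := inferInstanceAs (T2Space (Metric.sphere (0 : E) 1))
instance [FiniteDimensional ℝ E] : CompactSpace (RepSphere ρ) :=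
  have : ProperSpace E := FiniteDimensional.proper_real _
  inferInstanceAs (CompactSpace (Metric.sphere (0 : E) 1))
instance {n : ℕ} [Fact (Module.finrank ℝ E = n + 1)] :
    ChartedSpace (EuclideanSpace ℝ (Fin n)) (RepSphere ρ) :=
  inferInstanceAs (ChartedSpace (EuclideanSpace ℝ (Fin n)) (Metric.sphere (0 : E) 1))
instance {n : ℕ} [Fact (Module.finrank ℝ E = n + 1)] : IsManifold (𝓡 n) ∞ (RepSphere ρ) :=
  inferInstanceAs (IsManifold (𝓡 n) ∞ (Metric.sphere (0 : E) 1))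

variable {ρ}

/-- The inclusion of the unit sphere into the representation space. -/
def RepSphere.val (x : RepSphere ρ) : E := Subtype.val x

theorem RepSphere.norm_val (x : RepSphere ρ) : ‖x.val‖ = 1 := mem_sphere_zero_iff_norm.1 x.2

theorem RepSphere.ext {x y : RepSphere ρ} (h : x.val = y.val) : x = y := Subtype.ext h

theorem RepSphere.continuous_val : Continuous (RepSphere.val : RepSphere ρ → E) :=
  continuous_subtype_val

variable (ρ)

instance : MulAction G (RepSphere ρ) where
  smul g x := ⟨ρ g x.val, by simp [x.norm_val]⟩
  one_smul x := RepSphere.ext (by change ρ 1 x.val = x.val; rw [map_one]; rfl)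
  mul_smul g h x := RepSphere.ext (by
    change ρ (g * h) x.val = ρ g (ρ h x.val); rw [map_mul]; rfl)

instance : ContinuousConstSMul G (RepSphere ρ) where
  continuous_const_smul g :=
    ((ρ g).continuous.comp RepSphere.continuous_val).subtype_mk _

/-- The antipodal action of `{1, -1}` on the unit sphere. -/
instance : MulAction ℤˣ (RepSphere ρ) where
  smul ε x := ⟨((ε : ℤ) : ℝ) • x.val, by
    rcases Int.units_eq_one_or ε with rfl | rfl <;> simp [x.norm_val]⟩
  one_smul x := RepSphere.ext (by
    change (((1 : ℤˣ) : ℤ) : ℝ) • x.val = x.val; simp)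
  mul_smul ε δ x := RepSphere.ext (by
    change (((ε * δ : ℤˣ) : ℤ) : ℝ) • x.val = ((ε : ℤ) : ℝ) • ((δ : ℤ) : ℝ) • x.val
    rw [Units.val_mul, Int.cast_mul, mul_smul])

theorem RepSphere.val_smul (g : G) (x : RepSphere ρ) : (g • x).val = ρ g x.val := rfl

theorem RepSphere.val_units_smul (ε : ℤˣ) (x : RepSphere ρ) :
    (ε • x).val = ((ε : ℤ) : ℝ) • x.val := rfl

instance : ContinuousConstSMul ℤˣ (RepSphere ρ) where
  continuous_const_smul ε := (RepSphere.continuous_val.const_smul ((ε : ℤ) : ℝ)).subtype_mk _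

instance : IsCancelSMul ℤˣ (RepSphere ρ) where
  left_cancel' ε x y h := by simpa using congrArg (fun t => ε⁻¹ • t) h
  right_cancel' ε δ x h := by
    have h1 : ((ε : ℤ) : ℝ) • x.val = ((δ : ℤ) : ℝ) • x.val := congrArg RepSphere.val h
    have h0 : x.val ≠ 0 := by
      intro h0
      have := x.norm_val
      rw [h0, norm_zero] at this
      exact zero_ne_one this
    have h2 := smul_left_injective ℝ h0 h1
    exact Units.ext (by exact_mod_cast h2)

/-- The projectivization `P(V) = S(V)/{1, -1}` of a representation `V`. -/
def RepProj : Type := orbitRel.Quotient ℤˣ (RepSphere ρ)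

instance : TopologicalSpace (RepProj ρ) :=
  inferInstanceAs (TopologicalSpace (orbitRel.Quotient ℤˣ (RepSphere ρ)))
instance [FiniteDimensional ℝ E] : T2Space (RepProj ρ) :=
  inferInstanceAs (T2Space (Quotient (orbitRel ℤˣ (RepSphere ρ))))
instance [FiniteDimensional ℝ E] : CompactSpace (RepProj ρ) :=
  inferInstanceAs (CompactSpace (Quotient (orbitRel ℤˣ (RepSphere ρ))))
instance [FiniteDimensional ℝ E] {n : ℕ} [Fact (Module.finrank ℝ E = n + 1)] :
    ChartedSpace (EuclideanSpace ℝ (Fin n)) (RepProj ρ) :=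
  inferInstanceAs (ChartedSpace (EuclideanSpace ℝ (Fin n)) (orbitRel.Quotient ℤˣ (RepSphere ρ)))

variable {ρ} in
/-- The line through a unit vector. -/
def RepProj.mk (x : RepSphere ρ) : RepProj ρ := Quotient.mk (orbitRel ℤˣ (RepSphere ρ)) x

theorem RepSphere.smul_units_smul (g : G) (ε : ℤˣ) (x : RepSphere ρ) :
    g • ε • x = ε • g • x :=
  RepSphere.ext (map_smul (ρ g) ((ε : ℤ) : ℝ) x.val)

/-- The action on the projectivization, `g • [x] = [g • x]`. -/
instance : MulAction G (RepProj ρ) where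
  smul g := Quotient.map (fun x => g • x) (by
    rintro _ y ⟨ε, rfl⟩
    exact ⟨ε, (RepSphere.smul_units_smul ρ g ε y).symm⟩)
  one_smul := by
    rintro ⟨x⟩
    exact congrArg RepProj.mk (one_smul G x)
  mul_smul g h := by
    rintro ⟨x⟩
    exact congrArg RepProj.mk (mul_smul g h x)

instance : ContinuousConstSMul G (RepProj ρ) where
  continuous_const_smul g := by
    refine continuous_quot_lift _ ?_
    exact continuous_quotient_mk'.comp (continuous_const_smul g)

end Reps

/-- The `k`-fold sum `V_j^k` of the irreducible representation of the circle group of weight `j`. -/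
def weightRep (j k : ℕ) :
    Circle →* (EuclideanSpace ℂ (Fin k) ≃ₗᵢ[ℝ] EuclideanSpace ℂ (Fin k)) where
  toFun z := LinearIsometryEquiv.piLpCongrRight 2 (fun _ => rotation (z ^ j))
  map_one' := by ext x; simp
  map_mul' z w := by ext x; simp [mul_pow]

open Classical in
/-- The `n`-fold sum `ℝ₋ⁿ` of the nontrivial irreducible real representation of `ℤ₂`. -/
def signRep (n : ℕ) :
    Z2 →* (EuclideanSpace ℝ (Fin n) ≃ₗᵢ[ℝ] EuclideanSpace ℝ (Fin n)) where
  toFun ε := if ε = 1 then 1 else LinearIsometryEquiv.neg ℝ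
  map_one' := by simp
  map_mul' := by
    have key : ∀ ε : Z2, ε ≠ 1 → ∀ δ : Z2, δ ≠ 1 → ε * δ = 1 := by
      rintro ⟨ε, hε⟩ h1 ⟨δ, hδ⟩ h2
      rw [mem_Z2_iff] at hε hδ
      have e1 : ε = -1 := hε.resolve_left fun h => h1 (Subtype.ext h)
      have e2 : δ = -1 := hδ.resolve_left fun h => h2 (Subtype.ext h)
      subst e1 e2
      exact Subtype.ext (by simp)
    intro ε δ
    by_cases h1 : ε = 1
    · simp [h1]
    by_cases h2 : δ = 1
    · simp [h2]
    · rw [if_pos (key ε h1 δ h2), if_neg h1, if_neg h2]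
      ext x
      simp

/-- The `ℤ₂`-representation `ℝ₋ᵃ ⊕ ℝᵇ`. -/
def signTrivRep (a b : ℕ) :=
  sumRep (signRep a) (1 : Z2 →* (EuclideanSpace ℝ (Fin b) ≃ₗᵢ[ℝ] EuclideanSpace ℝ (Fin b)))

/-- The `ℤ₂`-representation `ℝ³ ⊕ ℝ₋`. -/
def trivThreeSignRep :=
  sumRep (1 : Z2 →* (EuclideanSpace ℝ (Fin 3) ≃ₗᵢ[ℝ] EuclideanSpace ℝ (Fin 3))) (signRep 1)

/-! ### The associated bundle `S¹ ×_{ℤ₂} X` -/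

section Assoc

variable (X : Type) [MulAction Z2 X]

/-- `S¹ ×_{ℤ₂} X`, the quotient of `S¹ × X` by the diagonal action of `ℤ₂`. -/
def AssocBundle : Type := orbitRel.Quotient Z2 (Circle × X)

variable {X} in
/-- The class `[z, x]` in `S¹ ×_{ℤ₂} X`. -/
def AssocBundle.mk (z : Circle) (x : X) : AssocBundle X :=
  Quotient.mk (orbitRel Z2 (Circle × X)) (z, x)

/-- The circle acts on `S¹ ×_{ℤ₂} X` by `w • [z, x] = [w * z, x]`. -/
instance : MulAction Circle (AssocBundle X) where
  smul w := Quotient.map (fun p : Circle × X => (w * p.1, p.2)) (by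
    rintro _ ⟨z, x⟩ ⟨ε, rfl⟩
    refine ⟨ε, Prod.ext ?_ rfl⟩
    change (ε : Circle) * (w * z) = w * ((ε : Circle) * z)
    exact mul_left_comm _ _ _)
  one_smul := by
    rintro ⟨z, x⟩
    exact congrArg (fun t => AssocBundle.mk t x) (one_mul z)
  mul_smul w w' := by
    rintro ⟨z, x⟩
    exact congrArg (fun t => AssocBundle.mk t x) (mul_assoc w w' z)

instance : IsCancelSMul Z2 (Circle × X) where
  left_cancel' ε x y h := by simpa using congrArg (fun t => ε⁻¹ • t) h
  right_cancel' ε δ x h := Subtype.ext (mul_right_cancel (congrArg Prod.fst h))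

variable [TopologicalSpace X]

instance : TopologicalSpace (AssocBundle X) :=
  inferInstanceAs (TopologicalSpace (orbitRel.Quotient Z2 (Circle × X)))

variable [ContinuousConstSMul Z2 X] [T2Space X] [LocallyCompactSpace X]

instance {H : Type} [TopologicalSpace H] [ChartedSpace H X] :
    ChartedSpace (ModelProd (EuclideanSpace ℝ (Fin 1)) H) (AssocBundle X) :=
  inferInstanceAs (ChartedSpace (ModelProd (EuclideanSpace ℝ (Fin 1)) H)
    (orbitRel.Quotient Z2 (Circle × X)))

end Assoc

/-! ### The two manifolds to be glued -/

section Pieces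

variable (k₁ k₂ : ℕ)

/-- The representation `V₁^{k₁} ⊕ V₂^{k₂} ⊕ ℝ` of the circle group. -/
def repOne := sumRep (sumRep (weightRep 1 k₁) (weightRep 2 k₂)) (1 : Circle →* (ℝ ≃ₗᵢ[ℝ] ℝ))

instance : Fact (Module.finrank ℝ (WithLp 2 (WithLp 2 (EuclideanSpace ℂ (Fin k₁) ×
    EuclideanSpace ℂ (Fin k₂)) × ℝ)) = (2 * k₁ + 2 * k₂) + 1) := by
  have h (k : ℕ) : Module.finrank ℝ (EuclideanSpace ℂ (Fin k)) = 2 * k := by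
    rw [(WithLp.linearEquiv 2 ℝ (Fin k → ℂ)).finrank_eq, Module.finrank_pi_fintype]
    simp [mul_comm]
  refine ⟨?_⟩
  rw [(WithLp.linearEquiv 2 ℝ _).finrank_eq, Module.finrank_prod,
    (WithLp.linearEquiv 2 ℝ _).finrank_eq, Module.finrank_prod, h, h, Module.finrank_self]

/-- `M₁ = S(V₁^{k₁} ⊕ V₂^{k₂} ⊕ ℝ)`. -/
abbrev MOne : Type := RepSphere (repOne k₁ k₂)

theorem finrank_sum_euclidean (a b : ℕ) : Module.finrank ℝ
    (WithLp 2 (EuclideanSpace ℝ (Fin a) × EuclideanSpace ℝ (Fin b))) = a + b := by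
  rw [(WithLp.linearEquiv 2 ℝ _).finrank_eq, Module.finrank_prod, finrank_euclideanSpace_fin,
    finrank_euclideanSpace_fin]

instance : Fact (Module.finrank ℝ
    (WithLp 2 (EuclideanSpace ℝ (Fin 3) × EuclideanSpace ℝ (Fin 1))) = 3 + 1) :=
  ⟨finrank_sum_euclidean 3 1⟩

instance [h₁ : Fact (1 ≤ k₁)] [h₂ : Fact (2 ≤ k₂)] : Fact (Module.finrank ℝ
    (WithLp 2 (EuclideanSpace ℝ (Fin (2 * k₁ - 1)) × EuclideanSpace ℝ (Fin (2 * k₂ - 2)))) =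
      (2 * k₁ + 2 * k₂ - 4) + 1) := by
  refine ⟨(finrank_sum_euclidean _ _).trans ?_⟩
  have := h₁.out
  have := h₂.out
  omega

/-- `M₂ = S¹ ×_{ℤ₂} (P(ℝ³ ⊕ ℝ₋) × S(ℝ₋^{2k₁-1} ⊕ ℝ^{2k₂-2}))`. -/
abbrev MTwo : Type :=
  AssocBundle (RepProj trivThreeSignRep × RepSphere (signTrivRep (2 * k₁ - 1) (2 * k₂ - 2)))

/-- The model with corners of `M₁`. -/
abbrev IOne := 𝓡 (2 * k₁ + 2 * k₂)

/-- The model with corners of `M₂`. -/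
abbrev ITwo := (𝓡 1).prod ((𝓡 3).prod (𝓡 (2 * k₁ + 2 * k₂ - 4)))

/-- The subset `(S¹/ℤ₂) × P(ℝ³) × S(ℝ^{2k₂-2})` of `M₂`. -/
def componentTwo : Set (MTwo k₁ k₂) :=
  {p | ∃ (z : Circle) (x : RepSphere trivThreeSignRep)
    (y : RepSphere (signTrivRep (2 * k₁ - 1) (2 * k₂ - 2))),
    x.val.snd = 0 ∧ y.val.fst = 0 ∧ p = AssocBundle.mk z (RepProj.mk x, y)}

/-! ### Tubes around orbits and gluing -/

/-- The open tube `S¹ ×_{ℤ₂} (ℝ₋^{2k₁} ⊕ ℝ^{2k₂-1})`. -/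
abbrev Tube : Type := AssocBundle (RepSpace (signTrivRep (2 * k₁) (2 * k₂ - 1)))

/-- The model with corners of the open tube. -/
abbrev ITube := (𝓡 1).prod 𝓘(ℝ, RepSpace (signTrivRep (2 * k₁) (2 * k₂ - 1)))

/-- The orbit at the centre of the tube. -/
def tubeCore : Set (Tube k₁ k₂) := {p | ∃ z : Circle, p = AssocBundle.mk z 0}

/-- The interior of the disc bundle `S¹ ×_{ℤ₂} D(ℝ₋^{2k₁} ⊕ ℝ^{2k₂-1})`. -/
def tubeOpenDisc : Set (Tube k₁ k₂) := {p | ∃ z w, ‖w‖ < 1 ∧ p = AssocBundle.mk z w}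

/-- The boundary `S¹ ×_{ℤ₂} S(ℝ₋^{2k₁} ⊕ ℝ^{2k₂-1})` of the disc bundle. -/
def tubeBoundary : Set (Tube k₁ k₂) := {p | ∃ z w, ‖w‖ = 1 ∧ p = AssocBundle.mk z w}

variable {k₁ k₂}

/-- `φ` is an equivariant diffeomorphism of the open tube onto an open subset of `M`. The image of
the closed unit disc bundle is then an invariant neighbourhood, of the form
`S¹ ×_{ℤ₂} D(ℝ₋^{2k₁} ⊕ ℝ^{2k₂-1})`, of the orbit `φ '' tubeCore k₁ k₂`. -/
structure IsTube {E H : Type} [NormedAddCommGroup E] [NormedSpace ℝ E] [TopologicalSpace H]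
    (I : ModelWithCorners ℝ E H) {M : Type} [TopologicalSpace M] [ChartedSpace H M]
    [MulAction Circle M] (φ : Tube k₁ k₂ → M) : Prop where
  injective : Function.Injective φ
  isLocalDiffeomorph : IsLocalDiffeomorph (ITube k₁ k₂) I ∞ φ
  equivariant : ∀ (z : Circle) (p : Tube k₁ k₂), φ (z • p) = z • φ p

/-- `j` restricts to an equivariant smooth embedding into `M` of the complement `P` of an open disc
bundle, a codimension zero submanifold with boundary; that is, near `P` it is a diffeomorphism onto
an open subset of `M`. -/
structure IsPieceEmbedding {E H E' H' : Type} [NormedAddCommGroup E] [NormedSpace ℝ E]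
    [TopologicalSpace H] [NormedAddCommGroup E'] [NormedSpace ℝ E'] [TopologicalSpace H']
    (I : ModelWithCorners ℝ E H) (I' : ModelWithCorners ℝ E' H')
    {L M : Type} [TopologicalSpace L] [ChartedSpace H L] [MulAction Circle L]
    [TopologicalSpace M] [ChartedSpace H' M] [MulAction Circle M]
    (j : L → M) (P : Set L) : Prop where
  smooth : ∃ N : Set L, IsOpen N ∧ P ⊆ N ∧ InjOn j N ∧ IsLocalDiffeomorphOn I I' ∞ j N
  equivariant : ∀ (z : Circle), ∀ x ∈ P, j (z • x) = z • j x

/-- The complement in `L` of the interior of the closed tube given by `φ`. -/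
def outside {L : Type} (φ : Tube k₁ k₂ → L) : Set L := (φ '' tubeOpenDisc k₁ k₂)ᶜ

/-- `M` is obtained by gluing the complements of the open disc bundles in `M₁` and `M₂` along their
boundaries, which are identified by means of the tubes `φ₁` and `φ₂`; `j₁` and `j₂` are the
inclusions of the two pieces. -/
structure IsGluing [Fact (1 ≤ k₁)] [Fact (2 ≤ k₂)]
    {M : Type} [TopologicalSpace M] [ChartedSpace (EuclideanSpace ℝ (Fin (2 * k₁ + 2 * k₂))) M]
    [MulAction Circle M] (φ₁ : Tube k₁ k₂ → MOne k₁ k₂) (φ₂ : Tube k₁ k₂ → MTwo k₁ k₂)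
    (j₁ : MOne k₁ k₂ → M) (j₂ : MTwo k₁ k₂ → M) : Prop where
  piece_one : IsPieceEmbedding (IOne k₁ k₂) (𝓡 (2 * k₁ + 2 * k₂)) j₁ (outside φ₁)
  piece_two : IsPieceEmbedding (ITwo k₁ k₂) (𝓡 (2 * k₁ + 2 * k₂)) j₂ (outside φ₂)
  union_eq : j₁ '' outside φ₁ ∪ j₂ '' outside φ₂ = univ
  inter_eq : j₁ '' outside φ₁ ∩ j₂ '' outside φ₂ = j₁ '' (φ₁ '' tubeBoundary k₁ k₂)
  glue : ∀ p ∈ tubeBoundary k₁ k₂, j₁ (φ₁ p) = j₂ (φ₂ p)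

end Pieces

end

/-!
# An orientable `S¹`-manifold with a non-orientable component of the fixed point set of `ℤ₂`

All orientability questions are settled by explicit Jacobians. An orientation over an open set is
encoded as a function whose sign is, locally and up to a constant, that of the Jacobian of a map to
the model space (`IsOrientationOn`); a manifold is orientable if and only if it carries one
(`IsOrientationOn.orientable`, `Orientable.exists_isOrientationOn`), and two orientations over open
sets with connected intersection can be combined (`IsOrientationOn.exists_union`).

The manifolds in question are presented as quotients of open sets of vector spaces by radial maps
(`IsPresentation`). The sphere `M₁` is presented by the nonzero vectors. The manifold `M₂` is
presented by the triples `(z, x, y)` of nonzero vectors of `ℂ`, `ℝ³ ⊕ ℝ₋` and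
`ℝ₋^{2k₁-1} ⊕ ℝ^{2k₂-2}` through `(z, x, y) ↦ [z / |z|, [x], y / |y|]`. Two triples have the same
image if and only if, up to positive scalings, they differ by `(z, x, y) ↦ (εz, δεx, εy)` with
signs `ε`, `δ`. Such a map has positive determinant, since `ε` occurs with multiplicity
`2 + 1 + (2k₁-1)` and `δ` with multiplicity `4` (`det_deck_pos`), and therefore `M₂` is orientable
(`IsPresentation.orientable`). For the component `C₂`, on the other hand, the second vector lies in
`ℝ³`, and `(z, x, y) ↦ (z, -x, y)` preserves the fibres of the presentation and reverses
orientation, although the set of triples under consideration is connected; so `C₂` is not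
orientable (`IsPresentation.not_orientable`, `HasSliceAt.isNonorientableSubmanifold`). The same
argument works for the triples with `y` in an open half-space. As `y / |y|` is constant on
an orbit in `C₂`, one of these halves of `C₂` avoids the given orbit (`IsTube.exists_halfTriples`).
It survives in the glued set `F`, which is therefore non-orientable as well.

The tubes are obtained from affine slices: the vectors whose distinguished coordinates are equal to
`1` are projected radially to the spheres, and the resulting equivariant map of the slice extends
to the associated bundle (`isTube_lift`, `exists_isTube_one`, `exists_isTube_two`).

For the gluing it is convenient to have open overlaps. The complements of the two centres are
glued along the punctured tubes by the inversion `[z, w] ↦ [z, w / |w|²]` (`tubeInv`,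
`tubeGluing`), which fixes the unit sphere bundle and exchanges its inside and its outside; so the
result is the union of the complements of the open disc bundles, glued along their boundaries
(`tubeGluing_union`, `tubeGluing_inter`). The overlap is connected, which gives the orientation
(`tubeGluing_orientable`). The `ℤ₂`-fixed part of a punctured tube is connected too, because
`2k₂ - 1 ≥ 2`. Hence `F` is connected (`isConnected_gluedSet`), and it is a component of the fixed
point set, because the remaining fixed points come from the part of `M₂^{ℤ₂}` other than `C₂`,
which is closed and disjoint from the tubes (`fixedPoints_Z2_tubeGluing`,
`isComponentOf_gluedSet`). Finally, the circle acts without fixed points on `M₂` and on the tubes,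
so its fixed points in the glued manifold are the two poles of `M₁`, and these lie in `F`.
-/

noncomputable section

open Filter Topology

set_option linter.unusedSectionVars false

/-! ### Jacobian signs and orientations of open subsets -/

section JacobianSign

variable {E H M : Type*} [NormedAddCommGroup E] [NormedSpace ℝ E]
  [TopologicalSpace H] {I : ModelWithCorners ℝ E H} [TopologicalSpace M] [ChartedSpace H M]

/-- The Jacobian determinant at `x` of a map `g` from a manifold to its model vector space. The
tangent space at `x` is identified with the model space by the preferred chart at `x`, so only the
comparison of Jacobians of different maps at the same point is meaningful. -/
def jac (I : ModelWithCorners ℝ E H) (g : M → E) (x : M) : ℝ :=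
  ContinuousLinearMap.det (M := E) (mfderiv I 𝓘(ℝ, E) g x)

theorem Filter.EventuallyEq.jac_eq {g g' : M → E} {x : M} (h : g =ᶠ[𝓝 x] g') :
    jac I g x = jac I g' x := by
  unfold jac; rw [h.mfderiv_eq]

/-- The chain rule for Jacobians. -/
theorem jac_comp {k : E → E} {g : M → E} {x : M} (hk : DifferentiableAt ℝ k (g x))
    (hg : MDifferentiableAt I 𝓘(ℝ, E) g x) :
    jac I (k ∘ g) x = (fderiv ℝ k (g x)).det * jac I g x := by
  unfold jac ContinuousLinearMap.det
  rw [mfderiv_comp x hk.mdifferentiableAt hg, mfderiv_eq_fderiv]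
  erw [← LinearMap.det_comp]
  rfl

theorem contDiffAt_comp_extChartAt_symm [I.Boundaryless] {g : M → E} {x : M}
    (hg : ContMDiffAt I 𝓘(ℝ, E) 1 g x) :
    ContDiffAt ℝ 1 (g ∘ (extChartAt I x).symm) (extChartAt I x x) := by
  have h := (contMDiffAt_iff.1 hg).2
  rw [I.range_eq_univ, contDiffWithinAt_univ] at h
  exact h

theorem jac_eventually_eq_chart [I.Boundaryless] [IsManifold I ∞ M] {g : M → E} {x : M}
    (hg : ContMDiffAt I 𝓘(ℝ, E) 1 g x) :
    ∀ᶠ y in 𝓝 x, jac I g y =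
      (fderiv ℝ (g ∘ (extChartAt I x).symm) (extChartAt I x y)).det * jac I (extChartAt I x) y := by
  have h1 := contDiffAt_comp_extChartAt_symm hg
  have h2 : ∀ᶠ z in 𝓝 (extChartAt I x x),
      ContDiffAt ℝ 1 (g ∘ (extChartAt I x).symm) z := h1.eventually (by simp)
  have h3 := (continuousAt_extChartAt (I := I) x).eventually h2
  have hs := extChartAt_source_mem_nhds (I := I) x
  have hs' := (isOpen_extChartAt_source (I := I) x).mem_nhds (mem_extChartAt_source (I := I) x)
  filter_upwards [h3, hs'] with y hy hys
  have hmd : MDifferentiableAt I 𝓘(ℝ, E) (extChartAt I x) y :=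
    mdifferentiableAt_extChartAt (by simpa using hys)
  rw [← jac_comp (hy.differentiableAt (by simp)) hmd]
  refine Filter.EventuallyEq.jac_eq ?_
  filter_upwards [(isOpen_extChartAt_source (I := I) x).mem_nhds hys] with w hw
  exact congrArg g ((extChartAt I x).left_inv hw).symm

theorem jac_extChartAt_ne_zero [IsManifold I ∞ M] [FiniteDimensional ℝ E] [I.Boundaryless]
    {x y : M} (hy : y ∈ (extChartAt I x).source) : jac I (extChartAt I x) y ≠ 0 := by
  have h := isInvertible_mfderiv_extChartAt (I := I) hy
  obtain ⟨L, hL⟩ := h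
  have : jac I (extChartAt I x) y =
      LinearMap.det ((show E ≃L[ℝ] E from L).toLinearEquiv : E →ₗ[ℝ] E) := by
    unfold jac; rw [← hL]; rfl
  rw [this]
  exact (LinearEquiv.isUnit_det' _).ne_zero

/-- The relative sign of the Jacobians of two `C¹` maps is locally constant. -/
theorem eventually_jac_mul_pos [I.Boundaryless] [IsManifold I ∞ M] [FiniteDimensional ℝ E]
    {g g' : M → E} {x : M}
    (hg : ContMDiffAt I 𝓘(ℝ, E) 1 g x) (hg' : ContMDiffAt I 𝓘(ℝ, E) 1 g' x)
    (h : jac I g x ≠ 0) (h' : jac I g' x ≠ 0) :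
    ∀ᶠ y in 𝓝 x, 0 < (jac I g x * jac I g' x) * (jac I g y * jac I g' y) := by
  set e := extChartAt I x with he
  have cont : ∀ {k : M → E}, ContMDiffAt I 𝓘(ℝ, E) 1 k x →
      ContinuousAt (fun y => (fderiv ℝ (k ∘ e.symm) (e y)).det) x := by
    intro k hk
    have h1 := (contDiffAt_comp_extChartAt_symm hk).fderiv_right (m := 0) (by simp)
    have h2 : ContinuousAt (fun z => (fderiv ℝ (k ∘ e.symm) z).det) (e x) :=
      (ContinuousLinearMap.continuous_det).continuousAt.comp h1.continuousAt
    exact ContinuousAt.comp (f := e) h2 (continuousAt_extChartAt x)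
  have e1 := jac_eventually_eq_chart hg
  have e2 := jac_eventually_eq_chart hg'
  rw [← he] at e1 e2
  set D : M → ℝ := fun y => (fderiv ℝ (g ∘ e.symm) (e y)).det *
    (fderiv ℝ (g' ∘ e.symm) (e y)).det with hD
  have hDc : ContinuousAt D x := (cont hg).mul (cont hg')
  have hs' := (isOpen_extChartAt_source (I := I) x).mem_nhds (mem_extChartAt_source (I := I) x)
  have hx1 := e1.self_of_nhds
  have hx2 := e2.self_of_nhds
  have hDx : D x ≠ 0 := by
    intro h0
    rcases mul_eq_zero.1 h0 with h0 | h0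
    · exact h (by rw [hx1, h0, zero_mul])
    · exact h' (by rw [hx2, h0, zero_mul])
  have hpos : ∀ᶠ y in 𝓝 x, 0 < D x * D y := by
    have : ContinuousAt (fun y => D x * D y) x := hDc.const_mul _
    exact this.eventually_const_lt (mul_self_pos.2 hDx)
  filter_upwards [e1, e2, hs', hpos] with y h1 h2 h3 h4
  have j1 := jac_extChartAt_ne_zero (I := I) h3
  have j0 := jac_extChartAt_ne_zero (I := I) (mem_extChartAt_source (I := I) x)
  rw [hx1, hx2, h1, h2]
  have : 0 < (D x * D y) * ((jac I e x * jac I e y) * (jac I e x * jac I e y)) := by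
    have : jac I e x * jac I e y ≠ 0 := mul_ne_zero j0 j1
    exact mul_pos h4 (mul_self_pos.2 this)
  calc _ < _ := this
    _ = _ := by simp only [hD]; ring

variable (I) in
/-- `s` is an orientation of the manifold over `U`: near each point of `U`, the sign of `s` agrees
up to a constant factor with the sign of the Jacobian of some `C¹` map to the model space. -/
def IsOrientationOn (s : M → ℝ) (U : Set M) : Prop :=
  ∀ x ∈ U, ∃ g : M → E, ContMDiffAt I 𝓘(ℝ, E) 1 g x ∧
    ∀ᶠ y in 𝓝 x, 0 < (s x * jac I g x) * (s y * jac I g y)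

theorem pos_of_mul_sq_pos {a b : ℝ} (h : 0 < a * b ^ 2) : 0 < a :=
  pos_of_mul_pos_left h (sq_nonneg b)

theorem IsOrientationOn.ne_zero {s : M → ℝ} {U : Set M} (h : IsOrientationOn I s U) {x : M}
    (hx : x ∈ U) : s x ≠ 0 := by
  obtain ⟨g, -, hg⟩ := h x hx
  intro h0
  have := hg.self_of_nhds
  simp [h0] at this

/-- Near a point of the oriented part, the sign of `s * jac g` is constant. -/
theorem IsOrientationOn.eventually_pos [I.Boundaryless] [IsManifold I ∞ M] [FiniteDimensional ℝ E]
    {s : M → ℝ} {U : Set M} (h : IsOrientationOn I s U) {x : M} (hx : x ∈ U) {g : M → E}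
    (hg : ContMDiffAt I 𝓘(ℝ, E) 1 g x) (hg0 : jac I g x ≠ 0) :
    ∀ᶠ y in 𝓝 x, 0 < (s x * jac I g x) * (s y * jac I g y) := by
  obtain ⟨k, hk, hks⟩ := h x hx
  have hk0 : jac I k x ≠ 0 := fun h0 => by simpa [h0] using hks.self_of_nhds
  filter_upwards [hks, eventually_jac_mul_pos hk hg hk0 hg0] with y h1 h2
  apply pos_of_mul_sq_pos (b := jac I k x * jac I k y)
  calc 0 < ((s x * jac I k x) * (s y * jac I k y)) *
          (jac I k x * jac I g x * (jac I k y * jac I g y)) := mul_pos h1 h2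
      _ = _ := by ring

/-- Two orientations differ by a locally constant sign. -/
theorem IsOrientationOn.eventually_mul_pos [I.Boundaryless] [IsManifold I ∞ M]
    [FiniteDimensional ℝ E] {s t : M → ℝ} {U V : Set M} (hs : IsOrientationOn I s U)
    (ht : IsOrientationOn I t V) {x : M} (hxU : x ∈ U) (hxV : x ∈ V) :
    ∀ᶠ y in 𝓝 x, 0 < (s x * t x) * (s y * t y) := by
  obtain ⟨k, hk, hks⟩ := hs x hxU
  have hk0 : jac I k x ≠ 0 := fun h0 => by simpa [h0] using hks.self_of_nhds
  filter_upwards [hks, ht.eventually_pos hxV hk hk0] with y h1 h2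
  apply pos_of_mul_sq_pos (b := jac I k x * jac I k y)
  calc 0 < ((s x * jac I k x) * (s y * jac I k y)) *
        (t x * jac I k x * (t y * jac I k y)) := mul_pos h1 h2
      _ = _ := by ring

end JacobianSign

/-- A real function whose sign is locally constant on a preconnected set has the same sign at any
two of its points. -/
theorem mul_pos_of_isPreconnected {X : Type*} [TopologicalSpace X] {W : Set X}
    (hW : IsPreconnected W) {c : X → ℝ} (hc : ∀ x ∈ W, ∀ᶠ y in 𝓝[W] x, 0 < c x * c y)
    {x y : X} (hx : x ∈ W) (hy : y ∈ W) : 0 < c x * c y := by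
  have h0 : ∀ z ∈ W, c z ≠ 0 := by
    intro z hz h
    have := (hc z hz).self_of_nhdsWithin hz
    simp [h] at this
  have hcont : ContinuousOn (fun z => decide (0 < c z)) W := by
    intro z hz
    refine (continuousWithinAt_const (b := decide (0 < c z))).congr_of_eventuallyEq ?_ rfl
    filter_upwards [hc z hz] with w hw
    rcases lt_or_gt_of_ne (h0 z hz) with h | h
    · have : ¬ 0 < c w := fun h' => (mul_neg_of_neg_of_pos h h').not_gt hw
      simp [this, h.le]
    · have : 0 < c w := (pos_iff_pos_of_mul_pos hw).1 h
      simp [this, h]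
  have := hW.constant hcont hx hy
  rcases lt_or_gt_of_ne (h0 x hx) with h | h
  · have h' : ¬ 0 < c y := by
      have h1 : ¬ 0 < c x := h.not_gt
      simpa [h1] using this
    exact mul_pos_of_neg_of_neg h (lt_of_le_of_ne (not_lt.1 h') (h0 y hy))
  · have h' : 0 < c y := by simpa [h] using this
    exact mul_pos h h'

section Gluing

variable {E H M : Type*} [NormedAddCommGroup E] [NormedSpace ℝ E] [FiniteDimensional ℝ E]
  [TopologicalSpace H] {I : ModelWithCorners ℝ E H} [I.Boundaryless]
  [TopologicalSpace M] [ChartedSpace H M] [IsManifold I ∞ M]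

/-- Orientations of two open sets with preconnected intersection can be combined: on the
intersection they differ by a constant sign, and one of them can be reversed. -/
theorem IsOrientationOn.exists_union {s t : M → ℝ} {U V : Set M} (hU : IsOpen U) (hV : IsOpen V)
    (hs : IsOrientationOn I s U) (ht : IsOrientationOn I t V) (hUV : IsPreconnected (U ∩ V)) :
    ∃ r : M → ℝ, IsOrientationOn I r (U ∪ V) := by
  classical
  obtain ⟨c, hc⟩ : ∃ c : ℝ, c ≠ 0 ∧ ∀ x ∈ U ∩ V, 0 < s x * (c * t x) := by
    rcases (U ∩ V).eq_empty_or_nonempty with h | ⟨x₀, hx₀⟩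
    · exact ⟨1, one_ne_zero, by simp [h]⟩
    · refine ⟨s x₀ * t x₀, mul_ne_zero (hs.ne_zero hx₀.1) (ht.ne_zero hx₀.2), fun x hx => ?_⟩
      have := mul_pos_of_isPreconnected hUV (c := fun x => s x * t x)
        (fun z hz => (hs.eventually_mul_pos ht hz.1 hz.2).filter_mono nhdsWithin_le_nhds) hx₀ hx
      calc 0 < _ := this
        _ = _ := by ring
  obtain ⟨hc0, hc⟩ := hc
  refine ⟨fun x => if x ∈ U then s x else c * t x, ?_⟩
  rintro x (hx | hx)
  · obtain ⟨g, hg, hgs⟩ := hs x hx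
    refine ⟨g, hg, ?_⟩
    filter_upwards [hgs, hU.mem_nhds hx] with y h1 h2
    simpa [h2, hx] using h1
  · obtain ⟨g, hg, hgs⟩ := ht x hx
    refine ⟨g, hg, ?_⟩
    have key : ∀ y ∈ V, 0 < (if y ∈ U then s y else c * t y) * (c * t y) := by
      intro y hy
      split_ifs with hyU
      · exact hc y ⟨hyU, hy⟩
      · exact mul_self_pos.2 (mul_ne_zero hc0 (ht.ne_zero hy))
    filter_upwards [hgs, hV.mem_nhds hx] with y h1 h2
    apply pos_of_mul_sq_pos (b := c * t x * t y)
    calc 0 < (((if x ∈ U then s x else c * t x) * (c * t x)) *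
          ((if y ∈ U then s y else c * t y) * (c * t y))) *
          (t x * jac I g x * (t y * jac I g y)) := mul_pos (mul_pos (key x hx) (key y h2)) h1
      _ = _ := by ring

end Gluing

/-! ### Pushing orientations forward along submersions -/

section Submersion

variable {E H M : Type*} [NormedAddCommGroup E] [NormedSpace ℝ E] [FiniteDimensional ℝ E]
  [TopologicalSpace H] {I : ModelWithCorners ℝ E H} [I.Boundaryless]
  [TopologicalSpace M] [ChartedSpace H M] [IsManifold I ∞ M]
  {E' H' Y : Type*} [NormedAddCommGroup E'] [NormedSpace ℝ E'] [FiniteDimensional ℝ E']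
  [TopologicalSpace H'] {I' : ModelWithCorners ℝ E' H'} [I'.Boundaryless]
  [TopologicalSpace Y] [ChartedSpace H' Y] [IsManifold I' ∞ Y]
  {K : Type*} [NormedAddCommGroup K] [NormedSpace ℝ K] [FiniteDimensional ℝ K]

/-- The Jacobian of `(g ∘ f, r)`, where `f : Y → M` and `r : Y → K` are such that `(f, r)` is meant
to be a local diffeomorphism to `M × K`, and `g` maps `M` to its model space. -/
def relJac (I' : ModelWithCorners ℝ E' H') (J : (E × K) ≃L[ℝ] E') (f : Y → M) (r : Y → K)
    (g : M → E) (w : Y) : ℝ :=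
  jac I' (fun y => J (g (f y), r y)) w

/-- Completing a linear map by the identity does not change its determinant, so a submersion followed
by a change of coordinates of the base has its relative Jacobian multiplied by that of the change. -/
theorem det_prodMap_id (T : E →L[ℝ] E) (J : (E × K) ≃L[ℝ] E') :
    ((J : (E × K) →L[ℝ] E') ∘L (T.prodMap (ContinuousLinearMap.id ℝ K)) ∘L
      (J.symm : E' →L[ℝ] E × K)).det = T.det := by
  unfold ContinuousLinearMap.det
  have h := LinearMap.det_conj ((T.prodMap (ContinuousLinearMap.id ℝ K) : E × K →L[ℝ] E × K) :
    (E × K) →ₗ[ℝ] (E × K)) J.toLinearEquiv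
  have h2 := LinearMap.det_prodMap (T : E →ₗ[ℝ] E) (LinearMap.id : K →ₗ[ℝ] K)
  rw [LinearMap.det_id, mul_one] at h2
  rw [← h2]
  exact h

theorem relJac_comp (J : (E × K) ≃L[ℝ] E') {f : Y → M} {r : Y → K} {w : Y} {k : E → E} {g : M → E}
    (hf : MDifferentiableAt I' I f w) (hr : MDifferentiableAt I' 𝓘(ℝ, K) r w)
    (hg : MDifferentiableAt I 𝓘(ℝ, E) g (f w)) (hk : DifferentiableAt ℝ k (g (f w))) :
    relJac I' J f r (k ∘ g) w = (fderiv ℝ k (g (f w))).det * relJac I' J f r g w := by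
  unfold relJac
  set k' : E' → E' := fun v => J (k (J.symm v).1, (J.symm v).2) with hk'
  set F : Y → E' := fun y => J (g (f y), r y) with hF
  have hFw : J.symm (F w) = (g (f w), r w) := by simp [hF]
  have hgf : MDifferentiableAt I' 𝓘(ℝ, E) (g ∘ f) w := hg.comp w hf
  have hFd : MDifferentiableAt I' 𝓘(ℝ, E') F w := by
    have h1 : MDifferentiableAt I' 𝓘(ℝ, E × K) (fun y => (g (f y), r y)) w :=
      hgf.prodMk_space hr
    exact (J.differentiableAt.mdifferentiableAt).comp w h1
  have hd : HasFDerivAt k' ((J : (E × K) →L[ℝ] E') ∘L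
      ((fderiv ℝ k (g (f w))).prodMap (ContinuousLinearMap.id ℝ K)) ∘L
      (J.symm : E' →L[ℝ] E × K)) (F w) := by
    have h1 : HasFDerivAt (fun p : E × K => (k p.1, p.2))
        ((fderiv ℝ k (g (f w))).prodMap (ContinuousLinearMap.id ℝ K)) (J.symm (F w)) := by
      rw [hFw]
      exact HasFDerivAt.prodMap (f := k) (f₂ := id) (g (f w), r w) hk.hasFDerivAt (hasFDerivAt_id _)
    exact J.hasFDerivAt.comp _ (h1.comp _ J.symm.hasFDerivAt)
  have h2 := jac_comp (k := k') hd.differentiableAt hFd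
  rw [hd.fderiv, det_prodMap_id] at h2
  rw [← h2]
  congr 1
  funext y
  simp [hk', hF]

theorem relJac_congr (J : (E × K) ≃L[ℝ] E') {f : Y → M} {r : Y → K} {w : Y} {g g' : M → E}
    (hf : ContinuousAt f w) (h : g =ᶠ[𝓝 (f w)] g') :
    relJac I' J f r g w = relJac I' J f r g' w := by
  apply Filter.EventuallyEq.jac_eq
  filter_upwards [hf.eventually h] with y hy
  simp only [hy]

/-- The maps `g` enter `relJac I' J f r g w` and `jac I g (f w)` with the same sign. -/
theorem relJac_mul_jac_pos (J : (E × K) ≃L[ℝ] E') {f : Y → M} {r : Y → K} {w : Y}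
    {g g' : M → E} (hf : MDifferentiableAt I' I f w) (hr : MDifferentiableAt I' 𝓘(ℝ, K) r w)
    (hg : ContMDiffAt I 𝓘(ℝ, E) 1 g (f w)) (hg' : ContMDiffAt I 𝓘(ℝ, E) 1 g' (f w))
    (h0 : jac I g (f w) ≠ 0) (h0' : jac I g' (f w) ≠ 0) (h1 : relJac I' J f r g w ≠ 0) :
    0 < (relJac I' J f r g w * jac I g (f w)) * (relJac I' J f r g' w * jac I g' (f w)) := by
  set e := extChartAt I (f w) with he
  have hmd : MDifferentiableAt I 𝓘(ℝ, E) e (f w) := mdifferentiableAt_extChartAt (by simp)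
  have key : ∀ {k : M → E}, ContMDiffAt I 𝓘(ℝ, E) 1 k (f w) → ∃ c : ℝ,
      relJac I' J f r k w = c * relJac I' J f r e w ∧ jac I k (f w) = c * jac I e (f w) := by
    intro k hk
    have hd := (contDiffAt_comp_extChartAt_symm hk).differentiableAt (by simp)
    have heq : k =ᶠ[𝓝 (f w)] (k ∘ e.symm) ∘ e := by
      filter_upwards [(isOpen_extChartAt_source (I := I) (f w)).mem_nhds
        (mem_extChartAt_source (I := I) (f w))] with y hy
      exact congrArg k ((extChartAt I (f w)).left_inv hy).symm
    refine ⟨(fderiv ℝ (k ∘ e.symm) (e (f w))).det, ?_, ?_⟩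
    · rw [relJac_congr J hf.continuousAt heq]
      exact relJac_comp J hf hr hmd hd
    · rw [heq.jac_eq]
      exact jac_comp hd hmd
  obtain ⟨c, h2, h3⟩ := key hg
  obtain ⟨c', h4, h5⟩ := key hg'
  rw [h2] at h1
  rw [h3] at h0
  rw [h5] at h0'
  rw [h2, h3, h4, h5]
  have : (c * c' * relJac I' J f r e w * jac I e (f w)) ≠ 0 :=
    mul_ne_zero (mul_ne_zero (mul_ne_zero (left_ne_zero_of_mul h0) (left_ne_zero_of_mul h0'))
      (right_ne_zero_of_mul h1)) (right_ne_zero_of_mul h0)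
  calc 0 < (c * c' * relJac I' J f r e w * jac I e (f w)) ^ 2 := by positivity
    _ = _ := by ring

/-- Orientations push forward along `f : Y → M` if some `r : Y → K` makes `(f, r)` a local
diffeomorphism to `M × K` such that the induced orientation at `f w` depends on `f w` only. -/
theorem exists_isOrientationOn_image {f : Y → M} {r : Y → K} {W : Set Y} (hW : IsOpen W)
    {t : Y → ℝ} (ht : IsOrientationOn I' t W) (J : (E × K) ≃L[ℝ] E')
    (hf : ContMDiffOn I' I 1 f W) (hr : ContMDiffOn I' 𝓘(ℝ, K) 1 r W)
    (hinj : ∀ w ∈ W, ∀ g : M → E, ContMDiffAt I 𝓘(ℝ, E) 1 g (f w) → jac I g (f w) ≠ 0 →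
      relJac I' J f r g w ≠ 0)
    (hopen : ∀ w ∈ W, ∀ U ∈ 𝓝 w, f '' U ∈ 𝓝 (f w))
    (hind : ∀ w ∈ W, ∀ w' ∈ W, f w = f w' → ∀ g : M → E, ContMDiffAt I 𝓘(ℝ, E) 1 g (f w) →
      jac I g (f w) ≠ 0 → 0 < (t w * relJac I' J f r g w) * (t w' * relJac I' J f r g w')) :
    ∃ s : M → ℝ, IsOrientationOn I s (f '' W) := by
  classical
  rcases W.eq_empty_or_nonempty with rfl | ⟨w₀, -⟩
  · exact ⟨0, by simp [IsOrientationOn]⟩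
  have : Nonempty Y := ⟨w₀⟩
  have hfa : ∀ w ∈ W, MDifferentiableAt I' I f w := fun w hw =>
    ((hf w hw).contMDiffAt (hW.mem_nhds hw)).mdifferentiableAt (by simp)
  have hra : ∀ w ∈ W, MDifferentiableAt I' 𝓘(ℝ, K) r w := fun w hw =>
    ((hr w hw).contMDiffAt (hW.mem_nhds hw)).mdifferentiableAt (by simp)
  set v : M → Y := Function.invFunOn f W with hv
  set s : M → ℝ := fun x => t (v x) * relJac I' J f r (extChartAt I x) (v x) *
    jac I (extChartAt I x) x with hs
  -- the sign of `s` may be computed from any point of the fibre and any map to the model space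
  have key : ∀ w ∈ W, ∀ g : M → E, ContMDiffAt I 𝓘(ℝ, E) 1 g (f w) → jac I g (f w) ≠ 0 →
      0 < (s (f w) * jac I g (f w)) * (t w * relJac I' J f r g w) := by
    intro w hw g hg hg0
    have hvW : v (f w) ∈ W := Function.invFunOn_mem ⟨w, hw, rfl⟩
    have hvf : f (v (f w)) = f w := Function.invFunOn_eq ⟨w, hw, rfl⟩
    have he : ContMDiffAt I 𝓘(ℝ, E) 1 (extChartAt I (f w)) (f w) := contMDiffAt_extChartAt
    have he0 : jac I (extChartAt I (f w)) (f w) ≠ 0 :=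
      jac_extChartAt_ne_zero (mem_extChartAt_source _)
    have h1 := relJac_mul_jac_pos (I := I) (I' := I') J (hfa w hw) (hra w hw) he hg he0 hg0
      (hinj w hw _ he he0)
    have h2 := hind (v (f w)) hvW w hw hvf (extChartAt I (f w)) (by rwa [hvf]) (by rwa [hvf])
    apply pos_of_mul_sq_pos (b := relJac I' J f r (extChartAt I (f w)) w)
    calc 0 < _ := mul_pos h1 h2
      _ = _ := by simp only [hs]; ring
  refine ⟨s, ?_⟩
  rintro _ ⟨w, hw, rfl⟩
  set e := extChartAt I (f w) with he
  have hsrc := (isOpen_extChartAt_source (I := I) (f w)).mem_nhds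
    (mem_extChartAt_source (I := I) (f w))
  have hesm : ∀ x ∈ e.source, ContMDiffAt I 𝓘(ℝ, E) 1 e x := fun x hx =>
    (contMDiffAt_extChartAt' (n := ∞) (by simpa [he] using hx)).of_le (by simp)
  have hej : ∀ x ∈ e.source, jac I e x ≠ 0 := fun x hx => jac_extChartAt_ne_zero hx
  have hxs : f w ∈ e.source := mem_extChartAt_source _
  refine ⟨e, hesm _ hxs, ?_⟩
  have hF : ContMDiffAt I' 𝓘(ℝ, E') 1 (fun y => J (e (f y), r y)) w := by
    have h1 : ContMDiffAt I' 𝓘(ℝ, E) 1 (fun y => e (f y)) w :=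
      (hesm _ hxs).comp w ((hf w hw).contMDiffAt (hW.mem_nhds hw))
    have h2 : ContMDiffAt I' 𝓘(ℝ, E × K) 1 (fun y => (e (f y), r y)) w :=
      h1.prodMk_space ((hr w hw).contMDiffAt (hW.mem_nhds hw))
    exact (J.contDiff.contMDiff.contMDiffAt).comp w h2
  have h3 := ht.eventually_pos hw hF (hinj w hw e (hesm _ hxs) (hej _ hxs))
  have h4 : ∀ᶠ y in 𝓝 w, y ∈ W := hW.mem_nhds hw
  have h5 : ∀ᶠ y in 𝓝 w, f y ∈ e.source := (hfa w hw).continuousAt.eventually hsrc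
  filter_upwards [hopen w hw _ (h3.and (h4.and h5))] with x hx
  obtain ⟨y, ⟨hy1, hy2, hy3⟩, rfl⟩ := hx
  have k1 := key w hw e (hesm _ hxs) (hej _ hxs)
  have k2 := key y hy2 e (hesm _ hy3) (hej _ hy3)
  apply pos_of_mul_sq_pos (b := t w * relJac I' J f r e w * (t y * relJac I' J f r e y))
  calc 0 < _ := mul_pos (mul_pos k1 k2) hy1
    _ = _ := by simp only [relJac]; ring

end Submersion

/-! ### Smooth charts and the comparison with oriented atlases -/

section ModelCharts

variable {E H M : Type*} [NormedAddCommGroup E] [NormedSpace ℝ E]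
  [TopologicalSpace H] {I : ModelWithCorners ℝ E H}
  [TopologicalSpace M] [ChartedSpace H M]
  {F : Type*} [NormedAddCommGroup F] [NormedSpace ℝ F]

/-- A local homeomorphism from a manifold to a normed space which is smooth in both directions. -/
structure IsSmoothChart (I : ModelWithCorners ℝ E H) (φ : OpenPartialHomeomorph M F) : Prop where
  contMDiffOn : ContMDiffOn I 𝓘(ℝ, F) ∞ φ φ.source
  contMDiffOn_symm : ContMDiffOn 𝓘(ℝ, F) I ∞ φ.symm φ.target

theorem IsSmoothChart.trans_equiv {φ : OpenPartialHomeomorph M F} (hφ : IsSmoothChart I φ)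
    {F' : Type*} [NormedAddCommGroup F'] [NormedSpace ℝ F'] (L : F ≃L[ℝ] F') :
    IsSmoothChart I (φ ≫ₕ L.toHomeomorph.toOpenPartialHomeomorph) where
  contMDiffOn := by
    have h : ContMDiffOn I 𝓘(ℝ, F') ∞ (L ∘ φ) φ.source :=
      L.contDiff.contMDiff.comp_contMDiffOn hφ.contMDiffOn
    exact h.mono (by simp)
  contMDiffOn_symm := by
    have h : ContMDiffOn 𝓘(ℝ, F') I ∞ (φ.symm ∘ L.symm) (L.symm ⁻¹' φ.target) :=
      hφ.contMDiffOn_symm.comp L.symm.contDiff.contMDiff.contMDiffOn (by intro x hx; exact hx)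
    exact h.mono (by intro x hx; simpa using hx)

theorem IsSmoothChart.restr {φ : OpenPartialHomeomorph M F} (hφ : IsSmoothChart I φ)
    {s : Set M} (hs : IsOpen s) : IsSmoothChart I (φ.restrOpen s hs) where
  contMDiffOn := hφ.contMDiffOn.mono (by simp)
  contMDiffOn_symm := hφ.contMDiffOn_symm.mono (by intro x hx; exact hx.1)

variable [I.Boundaryless]

/-- A local homeomorphism to the model vector space, as one to the model space. -/
def toModel (I : ModelWithCorners ℝ E H) [I.Boundaryless] (φ : OpenPartialHomeomorph M E) :
    OpenPartialHomeomorph M H :=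
  φ ≫ₕ I.toHomeomorph.symm.toOpenPartialHomeomorph

theorem toModel_source (φ : OpenPartialHomeomorph M E) : (toModel I φ).source = φ.source := by
  simp [toModel]

theorem coe_toModel_extend (φ : OpenPartialHomeomorph M E) :
    ((toModel I φ).extend I : M → E) = φ := by
  funext x
  simp [toModel]
  exact I.right_inv (by simp [I.range_eq_univ])

theorem coe_toModel_extend_symm (φ : OpenPartialHomeomorph M E) :
    (((toModel I φ).extend I).symm : E → M) = φ.symm := by
  funext x
  simp [toModel]
  exact congrArg φ.symm (I.right_inv (by simp [I.range_eq_univ]))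

theorem IsSmoothChart.toModel_mem [IsManifold I ∞ M] {φ : OpenPartialHomeomorph M E}
    (hφ : IsSmoothChart I φ) : toModel I φ ∈ IsManifold.maximalAtlas I ∞ M := by
  have hI : ContMDiff 𝓘(ℝ, E) I ∞ I.symm := by
    have := I.contMDiffOn_symm (n := ∞)
    rwa [I.range_eq_univ, contMDiffOn_univ] at this
  refine (toModel I φ).mem_maximalAtlas_of_contMDiffOn ?_ ?_
  · have h : ContMDiffOn I I ∞ (I.symm ∘ φ) φ.source := hI.comp_contMDiffOn hφ.contMDiffOn
    exact h.mono (by simp [toModel])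
  · have h : ContMDiffOn I I ∞ (φ.symm ∘ I) (I ⁻¹' φ.target) :=
      hφ.contMDiffOn_symm.comp I.contMDiff.contMDiffOn (by intro x hx; exact hx)
    exact h.mono (by intro x hx; simpa [toModel] using hx)

variable (I) in
/-- The preferred extended chart at `x`, as a local homeomorphism. -/
def extChartHomeo (x : M) : OpenPartialHomeomorph M E :=
  chartAt H x ≫ₕ I.toHomeomorph.toOpenPartialHomeomorph

theorem coe_extChartHomeo (x : M) : (extChartHomeo I x : M → E) = extChartAt I x := by
  funext y; rfl

theorem extChartHomeo_source (x : M) : (extChartHomeo I x).source = (extChartAt I x).source := by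
  simp [extChartHomeo]

theorem mem_extChartHomeo_source (x : M) : x ∈ (extChartHomeo I x).source := by
  simp [extChartHomeo]

theorem isSmoothChart_extChartHomeo [IsManifold I ∞ M] (x : M) :
    IsSmoothChart I (extChartHomeo I x) where
  contMDiffOn := by
    have h := contMDiffOn_extChartAt (I := I) (n := ∞) (x := x)
    exact h.mono (by simp [extChartHomeo])
  contMDiffOn_symm := by
    have h := contMDiffOn_extChartAt_symm (I := I) (n := ∞) x
    exact h.mono (by intro y hy; simpa [extChartHomeo, extChartAt_target, I.range_eq_univ] using hy)

end ModelCharts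

section Orientable

variable {E H M : Type*} [NormedAddCommGroup E] [NormedSpace ℝ E] [FiniteDimensional ℝ E]
  [TopologicalSpace H] {I : ModelWithCorners ℝ E H} [I.Boundaryless]
  [TopologicalSpace M] [ChartedSpace H M] [IsManifold I ∞ M]

theorem jac_eq_fderiv_mul_jac {φ : OpenPartialHomeomorph M E} (hφ : IsSmoothChart I φ) {k : M → E}
    {y : M} (hk : ContMDiffAt I 𝓘(ℝ, E) 1 k y) (hy : y ∈ φ.source) :
    jac I k y = (fderiv ℝ (k ∘ φ.symm) (φ y)).det * jac I φ y := by
  have h1 : MDifferentiableAt I 𝓘(ℝ, E) φ y :=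
    (hφ.contMDiffOn.contMDiffAt (φ.open_source.mem_nhds hy)).mdifferentiableAt (by simp)
  have h2 : MDifferentiableAt 𝓘(ℝ, E) I φ.symm (φ y) :=
    (hφ.contMDiffOn_symm.contMDiffAt
      (φ.open_target.mem_nhds (φ.map_source hy))).mdifferentiableAt (by simp)
  have h3 : DifferentiableAt ℝ (k ∘ φ.symm) (φ y) := by
    rw [← mdifferentiableAt_iff_differentiableAt]
    refine MDifferentiableAt.comp (φ y) ?_ h2
    rw [φ.left_inv hy]
    exact hk.mdifferentiableAt (by simp)
  rw [← jac_comp h3 h1]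
  apply Filter.EventuallyEq.jac_eq
  filter_upwards [φ.open_source.mem_nhds hy] with w hw
  simp [φ.left_inv hw]

theorem IsSmoothChart.jac_ne_zero {φ : OpenPartialHomeomorph M E} (hφ : IsSmoothChart I φ)
    {y : M} (hy : y ∈ φ.source) : jac I φ y ≠ 0 := by
  have h := jac_eq_fderiv_mul_jac hφ (k := extChartAt I y) contMDiffAt_extChartAt hy
  have h1 := jac_extChartAt_ne_zero (I := I) (mem_extChartAt_source (I := I) y)
  rw [h] at h1
  exact right_ne_zero_of_mul h1

/-- A nonzero finite-dimensional vector space has a linear automorphism of negative determinant. -/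
theorem exists_equiv_det_neg (h : Module.finrank ℝ E ≠ 0) :
    ∃ L : E ≃L[ℝ] E, (L : E →L[ℝ] E).det < 0 := by
  classical
  let b := Module.finBasis ℝ E
  let i₀ : Fin (Module.finrank ℝ E) := ⟨0, Nat.pos_of_ne_zero h⟩
  let A : Matrix (Fin (Module.finrank ℝ E)) (Fin (Module.finrank ℝ E)) ℝ :=
    Matrix.diagonal fun i => if i = i₀ then -1 else 1
  have hA : LinearMap.det (Matrix.toLin b b A) = -1 := by
    rw [LinearMap.det_toLin, Matrix.det_diagonal, Finset.prod_ite_eq']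
    simp
  have hu : IsUnit (LinearMap.det (Matrix.toLin b b A)) := by rw [hA]; norm_num
  refine ⟨(LinearEquiv.ofIsUnitDet (f := Matrix.toLin b b A) (v := b) (v' := b) ?_).toContinuousLinearEquiv, ?_⟩
  · rwa [LinearMap.det_toMatrix]
  · have : LinearMap.det (Matrix.toLin b b A) < 0 := by rw [hA]; norm_num
    exact this

/-- A manifold with an orientation is orientable. -/
theorem IsOrientationOn.orientable {s : M → ℝ} (hs : IsOrientationOn I s univ) :
    Orientable I M := by
  by_cases h0 : Module.finrank ℝ E = 0
  · refine ⟨IsManifold.maximalAtlas I ∞ M, subset_rfl,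
      fun x => ⟨chartAt H x, IsManifold.chart_mem_maximalAtlas x, mem_chart_source H x⟩, ?_⟩
    intro e _ e' _ x _
    unfold ContinuousLinearMap.det
    rw [LinearMap.det_eq_one_of_finrank_eq_zero h0]
    exact one_pos
  obtain ⟨R, hR⟩ := exists_equiv_det_neg h0
  refine ⟨{e | ∃ φ : OpenPartialHomeomorph M E, IsSmoothChart I φ ∧ e = toModel I φ ∧
    ∀ x ∈ φ.source, 0 < s x * jac I φ x}, ?_, ?_, ?_⟩
  · rintro e ⟨φ, hφ, rfl, -⟩
    exact hφ.toModel_mem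
  · intro x
    obtain ⟨φ, hφ, hx, hpos⟩ : ∃ φ : OpenPartialHomeomorph M E, IsSmoothChart I φ ∧ x ∈ φ.source ∧
        0 < s x * jac I φ x := by
      have hφ := isSmoothChart_extChartHomeo (I := I) x
      have hx := mem_extChartHomeo_source (I := I) x
      rcases lt_or_gt_of_ne (mul_ne_zero (hs.ne_zero (mem_univ x)) (hφ.jac_ne_zero hx)) with h | h
      · refine ⟨_, hφ.trans_equiv R, by simpa using hx, ?_⟩
        have hm : MDifferentiableAt I 𝓘(ℝ, E) (extChartHomeo I x) x :=
          (hφ.contMDiffOn.contMDiffAt ((extChartHomeo I x).open_source.mem_nhds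
            hx)).mdifferentiableAt (by simp)
        have h2 := jac_comp (k := R) R.differentiableAt hm
        rw [R.fderiv] at h2
        have h3 : 0 < (R : E →L[ℝ] E).det * (s x * jac I (extChartHomeo I x) x) :=
          mul_pos_of_neg_of_neg hR h
        calc 0 < _ := h3
          _ = s x * ((R : E →L[ℝ] E).det * jac I (extChartHomeo I x) x) := by ring
          _ = _ := by rw [← h2]; rfl
      · exact ⟨_, hφ, hx, h⟩
    have hsm : ContMDiffAt I 𝓘(ℝ, E) 1 φ x :=
      (hφ.contMDiffOn.contMDiffAt (φ.open_source.mem_nhds hx)).of_le (by simp)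
    have hev := hs.eventually_pos (mem_univ x) hsm (hφ.jac_ne_zero hx)
    obtain ⟨U, hU, hUo, hxU⟩ := eventually_nhds_iff.1 hev
    refine ⟨_, ⟨φ.restrOpen U hUo, hφ.restr hUo, rfl, ?_⟩, ?_⟩
    · intro y hy
      exact (pos_iff_pos_of_mul_pos (hU y hy.2)).1 hpos
    · rw [toModel_source]; exact ⟨hx, hxU⟩
  · rintro _ ⟨φ, hφ, rfl, hφp⟩ _ ⟨ψ, hψ, rfl, hψp⟩ x ⟨hx1, hx2⟩
    rw [toModel_source] at hx1 hx2
    rw [coe_toModel_extend, coe_toModel_extend, coe_toModel_extend_symm]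
    have h := jac_eq_fderiv_mul_jac hφ (k := ψ)
      ((hψ.contMDiffOn.contMDiffAt (ψ.open_source.mem_nhds hx2)).of_le (by simp)) hx1
    have h1 := hφp x hx1
    have h2 := hψp x hx2
    apply pos_of_mul_sq_pos (b := s x * jac I φ x)
    calc 0 < _ := mul_pos h1 h2
      _ = _ := by rw [h]; ring

theorem isSmoothChart_extend {e : OpenPartialHomeomorph M H}
    (he : e ∈ IsManifold.maximalAtlas I ∞ M) :
    IsSmoothChart I (e ≫ₕ I.toHomeomorph.toOpenPartialHomeomorph) where
  contMDiffOn := by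
    have h := contMDiffOn_of_mem_maximalAtlas he
    have h2 : ContMDiffOn I 𝓘(ℝ, E) ∞ (I ∘ e) e.source := I.contMDiff.comp_contMDiffOn h
    exact h2.mono (by simp)
  contMDiffOn_symm := by
    have h := contMDiffOn_extend_symm he
    exact h.mono (by
      intro y hy
      have hy' : I.symm y ∈ e.target := by simpa using hy
      simpa using ⟨I.symm y, hy', I.right_inv (by simp [I.range_eq_univ])⟩)

/-- An orientable manifold has an orientation. -/
theorem Orientable.exists_isOrientationOn (h : Orientable I M) :
    ∃ s : M → ℝ, IsOrientationOn I s univ := by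
  obtain ⟨A, hA, hcov, hpos⟩ := h
  choose e heA hxe using hcov
  set φ : M → OpenPartialHomeomorph M E := fun x =>
    e x ≫ₕ I.toHomeomorph.toOpenPartialHomeomorph with hφ
  have hsm : ∀ x, IsSmoothChart I (φ x) := fun x => isSmoothChart_extend (hA (heA x))
  have hxs : ∀ x, x ∈ (φ x).source := fun x => by simpa [hφ] using hxe x
  have h1 : ∀ x, ∀ y ∈ (φ x).source, ContMDiffAt I 𝓘(ℝ, E) 1 (φ x) y := fun x y hy =>
    ((hsm x).contMDiffOn.contMDiffAt ((φ x).open_source.mem_nhds hy)).of_le (by simp)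
  refine ⟨fun x => jac I (φ x) x, fun x _ => ⟨φ x, h1 x x (hxs x), ?_⟩⟩
  have key : ∀ y ∈ (φ x).source, 0 < jac I (φ y) y * jac I (φ x) y := by
    intro y hy
    have h2 := hpos (e x) (heA x) (e y) (heA y) y ⟨by simpa [hφ] using hy, hxe y⟩
    rw [jac_eq_fderiv_mul_jac (hsm x) (h1 y y (hxs y)) hy]
    have h3 : 0 < (fderiv ℝ (φ y ∘ (φ x).symm) (φ x y)).det := h2
    have h4 : 0 < jac I (φ x) y ^ 2 := by
      have := (hsm x).jac_ne_zero hy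
      positivity
    calc 0 < _ := mul_pos h3 h4
      _ = _ := by ring
  filter_upwards [(φ x).open_source.mem_nhds (hxs x)] with y hy
  exact mul_pos (key x (hxs x)) (key y hy)

end Orientable

/-! ### Local sections and local diffeomorphisms -/

section LocalSections

variable {E H X E' H' Y E'' H'' Z : Type*}
  [NormedAddCommGroup E] [NormedSpace ℝ E] [TopologicalSpace H] {I : ModelWithCorners ℝ E H}
  [TopologicalSpace X] [ChartedSpace H X]
  [NormedAddCommGroup E'] [NormedSpace ℝ E'] [TopologicalSpace H'] {I' : ModelWithCorners ℝ E' H'}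
  [TopologicalSpace Y] [ChartedSpace H' Y]
  [NormedAddCommGroup E''] [NormedSpace ℝ E''] [TopologicalSpace H'']
  {I'' : ModelWithCorners ℝ E'' H''} [TopologicalSpace Z] [ChartedSpace H'' Z]

/-- `f : Y → X` has a smooth section through `y`, defined near `f y`. -/
def HasLocalSection (I' : ModelWithCorners ℝ E' H') (I : ModelWithCorners ℝ E H) (f : Y → X)
    (y : Y) : Prop :=
  ∃ (σ : X → Y) (U : Set X), IsOpen U ∧ f y ∈ U ∧ ContMDiffOn I I' ∞ σ U ∧ σ (f y) = y ∧
    ∀ x ∈ U, f (σ x) = x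

theorem IsLocalDiffeomorphAt.hasLocalSection {f : Y → X} {y : Y}
    (h : IsLocalDiffeomorphAt I' I ∞ f y) : HasLocalSection I' I f y :=
  ⟨h.localInverse, h.localInverse.source, h.localInverse_open_source, h.localInverse_mem_source,
    h.contmdiffOn_localInverse, h.localInverse_left_inv h.localInverse_mem_target,
    fun _ hx => h.localInverse_right_inv hx⟩

theorem HasLocalSection.comp {f : Y → X} {g : Z → Y} {z : Z} (hf : HasLocalSection I' I f (g z))
    (hg : HasLocalSection I'' I' g z) : HasLocalSection I'' I (f ∘ g) z := by
  obtain ⟨σ, U, hU, hfU, hσ, hσf, hfσ⟩ := hf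
  obtain ⟨τ, V, hV, hgV, hτ, hτg, hgτ⟩ := hg
  refine ⟨τ ∘ σ, U ∩ σ ⁻¹' V, hσ.continuousOn.isOpen_inter_preimage hU hV,
    ⟨hfU, by simpa [hσf] using hgV⟩, ?_, ?_, ?_⟩
  · exact hτ.comp (hσ.mono inter_subset_left) fun x hx => hx.2
  · simp [hσf, hτg]
  · rintro x ⟨hx, hx'⟩
    simp only [Function.comp_apply]
    rw [hgτ _ hx', hfσ _ hx]

/-- Near `f y`, smoothness of a map may be tested after composition with `f`. -/
theorem HasLocalSection.contMDiffAt {f : Y → X} {y : Y} (hf : HasLocalSection I' I f y) {g : X → Z}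
    (hg : ContMDiffAt I' I'' ∞ (g ∘ f) y) : ContMDiffAt I I'' ∞ g (f y) := by
  obtain ⟨σ, U, hU, hfU, hσ, hσf, hfσ⟩ := hf
  have h1 : ContMDiffAt I I'' ∞ ((g ∘ f) ∘ σ) (f y) := by
    refine ContMDiffAt.comp (f y) ?_ (hσ.contMDiffAt (hU.mem_nhds hfU))
    rwa [hσf]
  refine h1.congr_of_eventuallyEq ?_
  filter_upwards [hU.mem_nhds hfU] with x hx
  simp [hfσ x hx]

theorem HasLocalSection.image_mem_nhds {f : Y → X} {y : Y} (hf : HasLocalSection I' I f y)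
    {U : Set Y} (hU : U ∈ 𝓝 y) : f '' U ∈ 𝓝 (f y) := by
  obtain ⟨σ, V, hV, hfV, hσ, hσf, hfσ⟩ := hf
  have h1 : ContinuousAt σ (f y) := hσ.continuousOn.continuousAt (hV.mem_nhds hfV)
  have h2 : σ ⁻¹' U ∈ 𝓝 (f y) := h1 (by rwa [hσf])
  filter_upwards [h2, hV.mem_nhds hfV] with x hx hx'
  exact ⟨σ x, hx, hfσ x hx'⟩

/-- A smooth map which is injective on an open set and has local sections through its points is a
local diffeomorphism there. -/
theorem isLocalDiffeomorphOn_of_hasLocalSection {f : Y → X} {N : Set Y} (hN : IsOpen N)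
    (hf : ContMDiffOn I' I ∞ f N) (hinj : InjOn f N)
    (hs : ∀ y ∈ N, HasLocalSection I' I f y) : IsLocalDiffeomorphOn I' I ∞ f N := by
  rintro ⟨y, hy⟩
  obtain ⟨σ, U, hU, hfU, hσ, hσf, hfσ⟩ := hs y hy
  refine ⟨{ toFun := f, invFun := σ, source := N ∩ f ⁻¹' (U ∩ σ ⁻¹' N), target := U ∩ σ ⁻¹' N,
            map_source' := fun x hx => hx.2
            map_target' := fun x hx => ⟨hx.2, by
              have : f (σ x) = x := hfσ x hx.1
              simpa only [mem_preimage, this] using hx⟩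
            left_inv' := fun x hx => hinj hx.2.2 hx.1 (hfσ _ hx.2.1)
            right_inv' := fun x hx => hfσ x hx.1
            open_source := ?_, open_target := ?_, contMDiffOn_toFun := ?_,
            contMDiffOn_invFun := ?_ }, ?_, ?_⟩
  · exact hf.continuousOn.isOpen_inter_preimage hN (hσ.continuousOn.isOpen_inter_preimage hU hN)
  · exact hσ.continuousOn.isOpen_inter_preimage hU hN
  · exact hf.mono inter_subset_left
  · exact hσ.mono inter_subset_left
  · exact ⟨hy, hfU, by simpa only [mem_preimage, hσf] using hy⟩
  · exact eqOn_refl _ _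

theorem IsLocalDiffeomorph.hasLocalSection {f : Y → X} (h : IsLocalDiffeomorph I' I ∞ f) (y : Y) :
    HasLocalSection I' I f y := (h y).hasLocalSection

end LocalSections

section Transfer

variable {E H M : Type*} [NormedAddCommGroup E] [NormedSpace ℝ E] [FiniteDimensional ℝ E]
  [TopologicalSpace H] {I : ModelWithCorners ℝ E H} [I.Boundaryless]
  [TopologicalSpace M] [ChartedSpace H M] [IsManifold I ∞ M]
  {E' H' Y : Type*} [NormedAddCommGroup E'] [NormedSpace ℝ E'] [FiniteDimensional ℝ E']
  [TopologicalSpace H'] {I' : ModelWithCorners ℝ E' H'} [I'.Boundaryless]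
  [TopologicalSpace Y] [ChartedSpace H' Y] [IsManifold I' ∞ Y]
  {K : Type*} [NormedAddCommGroup K] [NormedSpace ℝ K] [FiniteDimensional ℝ K]

/-- If `(f, r)` has a differentiable left inverse near `w`, then `relJac` does not vanish there. -/
theorem relJac_ne_zero (J : (E × K) ≃L[ℝ] E') {f : Y → M} {r : Y → K} {w : Y} {g : M → E}
    (hf : MDifferentiableAt I' I f w) (hr : MDifferentiableAt I' 𝓘(ℝ, K) r w)
    (hg : ContMDiffAt I 𝓘(ℝ, E) 1 g (f w)) (hg0 : jac I g (f w) ≠ 0)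
    {h : M × K → Y} (hh : MDifferentiableAt (I.prod 𝓘(ℝ, K)) I' h (f w, r w))
    (hw : ∀ᶠ y in 𝓝 w, h (f y, r y) = y) : relJac I' J f r g w ≠ 0 := by
  set e := extChartAt I' w with he
  have hmd : MDifferentiableAt I 𝓘(ℝ, E) (extChartAt I (f w)) (f w) :=
    mdifferentiableAt_extChartAt (by simp)
  have he1 : ContMDiffAt I 𝓘(ℝ, E) 1 (extChartAt I (f w)) (f w) := contMDiffAt_extChartAt
  have he0 : jac I (extChartAt I (f w)) (f w) ≠ 0 :=
    jac_extChartAt_ne_zero (mem_extChartAt_source _)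
  -- it suffices to treat the preferred chart in place of `g`
  suffices hmain : relJac I' J f r (extChartAt I (f w)) w ≠ 0 by
    have := relJac_mul_jac_pos J hf hr he1 hg he0 hg0 hmain
    intro h0
    simp [h0] at this
  set a := extChartAt I (f w) with ha
  set F : Y → E' := fun y => J (a (f y), r y) with hF
  -- the map `k` inverts `F` in the chart `e`
  set k : E' → E' := fun v => e (h (a.symm (J.symm v).1, (J.symm v).2)) with hk
  have hsrc := (isOpen_extChartAt_source (I := I) (f w)).mem_nhds
    (mem_extChartAt_source (I := I) (f w))
  have hFd : MDifferentiableAt I' 𝓘(ℝ, E') F w := by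
    have h1 : MDifferentiableAt I' 𝓘(ℝ, E × K) (fun y => (a (f y), r y)) w :=
      MDifferentiableAt.prodMk_space (hmd.comp w hf) hr
    exact (J.differentiableAt.mdifferentiableAt).comp w h1
  have hJF : J.symm (F w) = (a (f w), r w) := by simp [hF]
  have hasymm : MDifferentiableAt 𝓘(ℝ, E) I a.symm (a (f w)) := by
    have := contMDiffOn_extChartAt_symm (I := I) (n := ∞) (f w)
    have h2 := this.contMDiffAt ((isOpen_extChartAt_target (I := I) (f w)).mem_nhds
      (mem_extChartAt_target (I := I) (f w)))
    exact h2.mdifferentiableAt (by simp)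
  have hkd : DifferentiableAt ℝ k (F w) := by
    rw [← mdifferentiableAt_iff_differentiableAt]
    have h1 : MDifferentiableAt 𝓘(ℝ, E') 𝓘(ℝ, E) (fun v => (J.symm v).1) (F w) :=
      (J.symm.differentiableAt.fst).mdifferentiableAt
    have h2 : MDifferentiableAt 𝓘(ℝ, E') 𝓘(ℝ, K) (fun v => (J.symm v).2) (F w) :=
      (J.symm.differentiableAt.snd).mdifferentiableAt
    have h3 : MDifferentiableAt 𝓘(ℝ, E') I (fun v => a.symm (J.symm v).1) (F w) := by
      refine MDifferentiableAt.comp (F w) ?_ h1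
      rw [hJF]; exact hasymm
    have h4 : MDifferentiableAt 𝓘(ℝ, E') (I.prod 𝓘(ℝ, K))
        (fun v => (a.symm (J.symm v).1, (J.symm v).2)) (F w) := h3.prodMk h2
    have hpt : (a.symm (J.symm (F w)).1, (J.symm (F w)).2) = (f w, r w) := by
      rw [hJF]; simp [ha]
    have h5 : MDifferentiableAt 𝓘(ℝ, E') I' (fun v => h (a.symm (J.symm v).1, (J.symm v).2)) (F w) :=
      MDifferentiableAt.comp (F w) (by rw [hpt]; exact hh) h4
    refine MDifferentiableAt.comp (F w) ?_ h5
    rw [hpt, hw.self_of_nhds]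
    exact mdifferentiableAt_extChartAt (by simp)
  have h6 := jac_comp (k := k) hkd hFd
  have h7 : k ∘ F =ᶠ[𝓝 w] e := by
    filter_upwards [hw, hf.continuousAt hsrc] with y hy hy2
    have : a.symm (a (f y)) = f y := a.left_inv hy2
    simp [hk, hF, this, hy]
  rw [h7.jac_eq] at h6
  intro h0
  have h8 : jac I' F w = 0 := h0
  rw [h8, mul_zero] at h6
  exact jac_extChartAt_ne_zero (I := I') (mem_extChartAt_source w) h6

/-- Orientations push forward along injective local diffeomorphisms. -/
theorem IsOrientationOn.exists_image {f : Y → M} {W : Set Y} (hW : IsOpen W) {t : Y → ℝ}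
    (ht : IsOrientationOn I' t W) (L : E ≃L[ℝ] E') (hf : IsLocalDiffeomorphOn I' I ∞ f W)
    (hinj : InjOn f W) : ∃ s : M → ℝ, IsOrientationOn I s (f '' W) := by
  let J : (E × (Fin 0 → ℝ)) ≃L[ℝ] E' := (ContinuousLinearEquiv.prodUnique ℝ E (Fin 0 → ℝ)).trans L
  have hr : ContMDiffOn I' 𝓘(ℝ, Fin 0 → ℝ) ∞ (fun _ : Y => (0 : Fin 0 → ℝ)) W :=
    contMDiffOn_const
  have h0 : ∀ w ∈ W, ∀ g : M → E, ContMDiffAt I 𝓘(ℝ, E) 1 g (f w) → jac I g (f w) ≠ 0 →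
      relJac I' J f (fun _ => (0 : Fin 0 → ℝ)) g w ≠ 0 := by
    intro w hw g hg hg0
    have hl := hf ⟨w, hw⟩
    refine relJac_ne_zero (h := fun p => hl.localInverse p.1) J
      (hl.mdifferentiableAt (by simp)) mdifferentiableAt_const hg hg0 ?_ ?_
    · exact MDifferentiableAt.comp (f w, (0 : Fin 0 → ℝ)) (hl.localInverse_mdifferentiableAt (by simp))
        mdifferentiableAt_fst
    · exact hl.localInverse_eventuallyEq_left
  refine exists_isOrientationOn_image hW ht J (hf.contMDiffOn.of_le (by simp))
    (hr.of_le (by simp)) h0 ?_ ?_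
  · intro w hw U hU
    exact (hf ⟨w, hw⟩).hasLocalSection.image_mem_nhds hU
  · intro w hw w' hw' heq g hg hg0
    obtain rfl := hinj hw hw' heq
    exact mul_self_pos.2 (mul_ne_zero (ht.ne_zero hw) (h0 w hw g hg hg0))

end Transfer

/-! ### Presentations of manifolds by open sets of vector spaces -/

section LinearSubmersion

variable {E H M : Type*} [NormedAddCommGroup E] [NormedSpace ℝ E] [FiniteDimensional ℝ E]
  [TopologicalSpace H] {I : ModelWithCorners ℝ E H} [I.Boundaryless]
  [TopologicalSpace M] [ChartedSpace H M] [IsManifold I ∞ M]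
  {V : Type*} [NormedAddCommGroup V] [NormedSpace ℝ V] [FiniteDimensional ℝ V]
  {K : Type*} [NormedAddCommGroup K] [NormedSpace ℝ K] [FiniteDimensional ℝ K]

theorem jac_vectorSpace (F : V → V) (w : V) : jac 𝓘(ℝ, V) F w = (fderiv ℝ F w).det := by
  unfold jac
  rw [mfderiv_eq_fderiv]
  rfl

theorem jac_id (w : V) : jac 𝓘(ℝ, V) (id : V → V) w = 1 := by
  rw [jac_vectorSpace, fderiv_id]
  exact LinearMap.det_id

theorem isOrientationOn_one (W : Set V) : IsOrientationOn 𝓘(ℝ, V) (fun _ => 1) W := fun x _ =>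
  ⟨id, contMDiffAt_id, by simp [jac_id]⟩

/-- A presentation of a piece of a manifold `M` as a quotient of an open subset `W` of a vector
space `V`: the map `f` together with the fibre coordinates `r` has differentiable local left
inverses, and `f` is open. -/
structure IsPresentation (I : ModelWithCorners ℝ E H) (f : V → M) (r : V → K) (W : Set V) :
    Prop where
  isOpen : IsOpen W
  contMDiffOn : ContMDiffOn 𝓘(ℝ, V) I 1 f W
  contDiffOn : ContDiffOn ℝ 1 r W
  leftInverse : ∀ w ∈ W, ∃ h : M × K → V, MDifferentiableAt (I.prod 𝓘(ℝ, K)) 𝓘(ℝ, V) h (f w, r w) ∧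
    ∀ᶠ y in 𝓝 w, h (f y, r y) = y

namespace IsPresentation

variable {f : V → M} {r : V → K} {W : Set V}

theorem contMDiffAt (h : IsPresentation I f r W) {w : V} (hw : w ∈ W) :
    ContMDiffAt 𝓘(ℝ, V) I 1 f w := (h.contMDiffOn w hw).contMDiffAt (h.isOpen.mem_nhds hw)

theorem contMDiffAt' (h : IsPresentation I f r W) {w : V} (hw : w ∈ W) :
    ContMDiffAt 𝓘(ℝ, V) 𝓘(ℝ, K) 1 r w :=
  (h.contDiffOn.contDiffAt (h.isOpen.mem_nhds hw)).contMDiffAt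

theorem relJac_ne_zero (h : IsPresentation I f r W) (J : (E × K) ≃L[ℝ] V) {w : V} (hw : w ∈ W)
    {g : M → E} (hg : ContMDiffAt I 𝓘(ℝ, E) 1 g (f w)) (hg0 : jac I g (f w) ≠ 0) :
    relJac 𝓘(ℝ, V) J f r g w ≠ 0 := by
  obtain ⟨k, hk, hk'⟩ := h.leftInverse w hw
  exact _root_.relJac_ne_zero J ((h.contMDiffAt hw).mdifferentiableAt (by simp))
    ((h.contMDiffAt' hw).mdifferentiableAt (by simp)) hg hg0 hk hk'

theorem contMDiffAt_pair (h : IsPresentation I f r W) (J : (E × K) ≃L[ℝ] V) {w : V} (hw : w ∈ W)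
    {g : M → E} (hg : ContMDiffAt I 𝓘(ℝ, E) 1 g (f w)) :
    ContMDiffAt 𝓘(ℝ, V) 𝓘(ℝ, V) 1 (fun y => J (g (f y), r y)) w := by
  have h1 : ContMDiffAt 𝓘(ℝ, V) 𝓘(ℝ, E) 1 (fun y => g (f y)) w := hg.comp w (h.contMDiffAt hw)
  have h2 : ContMDiffAt 𝓘(ℝ, V) 𝓘(ℝ, E × K) 1 (fun y => (g (f y), r y)) w :=
    h1.prodMk_space (h.contMDiffAt' hw)
  exact (J.contDiff.contMDiff.contMDiffAt).comp w h2

/-- The effect on `relJac` of a linear map preserving the fibres. -/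
theorem relJac_map (h : IsPresentation I f r W) (J : (E × K) ≃L[ℝ] V) {w : V} {A : V →L[ℝ] V}
    (hAw : A w ∈ W) (hf : ∀ᶠ y in 𝓝 w, f (A y) = f y) {c : K}
    (hr : ∀ᶠ y in 𝓝 w, r (A y) = r y + c) {g : M → E}
    (hg : ContMDiffAt I 𝓘(ℝ, E) 1 g (f (A w))) :
    relJac 𝓘(ℝ, V) J f r g w = relJac 𝓘(ℝ, V) J f r g (A w) * A.det := by
  unfold relJac
  set F : V → V := fun y => J (g (f y), r y) with hF
  have hFd : DifferentiableAt ℝ F (A w) :=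
    ((h.contMDiffAt_pair J hAw hg).mdifferentiableAt (by simp)).differentiableAt
  have h1 := jac_comp (I := 𝓘(ℝ, V)) (k := F) (g := A) (x := w) hFd
    A.differentiableAt.mdifferentiableAt
  rw [jac_vectorSpace A, A.fderiv] at h1
  rw [jac_vectorSpace F (A w), ← h1, jac_vectorSpace, jac_vectorSpace]
  have h2 : F ∘ A =ᶠ[𝓝 w] fun y => F y + J (0, c) := by
    filter_upwards [hf, hr] with y hy1 hy2
    simp only [hF, Function.comp_apply, hy1, hy2, ← map_add]
    simp
  rw [h2.fderiv_eq, fderiv_add_const]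

/-- A manifold is orientable if it is presented as a quotient of an open subset of a vector space
in such a way that points with the same image are related by linear maps of positive determinant
preserving the fibres. -/
theorem orientable (h : IsPresentation I f r W) (J : (E × K) ≃L[ℝ] V) (hsurj : f '' W = univ)
    (hopen : ∀ w ∈ W, ∀ U ∈ 𝓝 w, f '' U ∈ 𝓝 (f w))
    (hdeck : ∀ w ∈ W, ∀ w' ∈ W, f w = f w' → ∃ A : V →L[ℝ] V, 0 < A.det ∧ A w = w' ∧
      (∀ᶠ y in 𝓝 w, f (A y) = f y) ∧ ∃ c, ∀ᶠ y in 𝓝 w, r (A y) = r y + c) :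
    Orientable I M := by
  obtain ⟨s, hs⟩ := exists_isOrientationOn_image h.isOpen (isOrientationOn_one W) J h.contMDiffOn
    (contMDiffOn_iff_contDiffOn.2 h.contDiffOn) (fun w hw g hg hg0 => h.relJac_ne_zero J hw hg hg0)
    hopen (by
      intro w hw w' hw' heq g hg hg0
      obtain ⟨A, hA, rfl, hfA, c, hrA⟩ := hdeck w hw w' hw' heq
      have h0 := h.relJac_ne_zero J hw' (by rwa [← heq]) (by rwa [← heq])
      rw [h.relJac_map J hw' hfA hrA (by rwa [← heq])]
      have := mul_self_pos.2 h0
      calc 0 < _ := mul_pos this hA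
        _ = _ := by ring)
  rw [hsurj] at hs
  exact hs.orientable

/-- A manifold is not orientable if a preconnected open subset of a vector space maps
submersively to it in such a way that some linear map of negative determinant preserves the
fibres. -/
theorem not_orientable (h : IsPresentation I f r W) (J : (E × K) ≃L[ℝ] V) (hW : IsPreconnected W)
    {A : V →L[ℝ] V} (hA : A.det < 0) {w : V} (hw : w ∈ W) (hAw : A w ∈ W)
    (hf : ∀ᶠ y in 𝓝 w, f (A y) = f y) (hr : ∀ᶠ y in 𝓝 w, r (A y) = r y) :
    ¬ Orientable I M := by
  intro hor
  obtain ⟨s, hs⟩ := hor.exists_isOrientationOn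
  set c : V → ℝ := fun y => s (f y) * (relJac 𝓘(ℝ, V) J f r (extChartAt I (f y)) y *
    jac I (extChartAt I (f y)) (f y)) with hc
  have he : ∀ x : M, ContMDiffAt I 𝓘(ℝ, E) 1 (extChartAt I x) x := fun x => contMDiffAt_extChartAt
  have he0 : ∀ x : M, jac I (extChartAt I x) x ≠ 0 := fun x =>
    jac_extChartAt_ne_zero (mem_extChartAt_source x)
  have hloc : ∀ x ∈ W, ∀ᶠ y in 𝓝[W] x, 0 < c x * c y := by
    intro x hx
    set e := extChartAt I (f x) with hedef
    have hesm : ∀ z ∈ e.source, ContMDiffAt I 𝓘(ℝ, E) 1 e z := fun z hz =>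
      (contMDiffAt_extChartAt' (n := ∞) (by simpa [hedef] using hz)).of_le (by simp)
    have hsrc := (isOpen_extChartAt_source (I := I) (f x)).mem_nhds
      (mem_extChartAt_source (I := I) (f x))
    have hcont := (h.contMDiffAt hx).continuousAt
    have h1 := hcont.eventually (hs.eventually_pos (mem_univ (f x)) (he (f x)) (he0 (f x)))
    have h2 := eventually_jac_mul_pos (h.contMDiffAt_pair J hx (he (f x)))
      (contMDiffAt_id (I := 𝓘(ℝ, V)) (x := x)) (h.relJac_ne_zero J hx (he (f x)) (he0 (f x)))
      (by rw [jac_id]; exact one_ne_zero)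
    simp only [jac_id, mul_one] at h2
    have h3 := hcont.eventually hsrc
    filter_upwards [nhdsWithin_le_nhds h1, nhdsWithin_le_nhds h2, nhdsWithin_le_nhds h3,
      self_mem_nhdsWithin] with y h1 h2 h3 hyW
    have h4 := relJac_mul_jac_pos J ((h.contMDiffAt hyW).mdifferentiableAt (by simp))
      ((h.contMDiffAt' hyW).mdifferentiableAt (by simp)) (he (f y)) (hesm _ h3) (he0 (f y))
      (jac_extChartAt_ne_zero h3) (h.relJac_ne_zero J hyW (he (f y)) (he0 (f y)))
    apply pos_of_mul_sq_pos (b := relJac 𝓘(ℝ, V) J f r e y * jac I e (f y))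
    calc 0 < ((s (f x) * jac I e (f x)) * (s (f y) * jac I e (f y))) *
          (relJac 𝓘(ℝ, V) J f r e x * relJac 𝓘(ℝ, V) J f r e y) *
          ((relJac 𝓘(ℝ, V) J f r (extChartAt I (f y)) y * jac I (extChartAt I (f y)) (f y)) *
            (relJac 𝓘(ℝ, V) J f r e y * jac I e (f y))) := mul_pos (mul_pos h1 h2) h4
      _ = _ := by simp only [hc, ← hedef]; ring
  have h5 := mul_pos_of_isPreconnected hW hloc hw hAw
  have h6 := hf.self_of_nhds
  have h7 := h.relJac_map J hAw hf (c := 0) (by simpa using hr) (he (f (A w)))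
  have h8 : c w = c (A w) * A.det := by
    simp only [hc]
    rw [← h6, h7]
    ring
  rw [h8] at h5
  have h9 : 0 ≤ c (A w) * c (A w) := mul_self_nonneg _
  have : c (A w) * A.det * c (A w) ≤ 0 := by
    calc _ = (c (A w) * c (A w)) * A.det := by ring
      _ ≤ 0 := mul_nonpos_of_nonneg_of_nonpos h9 hA.le
  exact absurd h5 this.not_gt

end IsPresentation

end LinearSubmersion

/-! ### Slice charts and submanifolds -/

section ManifoldOfCharts

variable {E M : Type*} [NormedAddCommGroup E] [NormedSpace ℝ E] [TopologicalSpace M]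

/-- The charted space structure given by a family of charts covering the space. -/
@[reducible] def chartedSpaceOfCharts (P : Set (OpenPartialHomeomorph M E))
    (hP : ∀ x : M, ∃ c ∈ P, x ∈ c.source) : ChartedSpace E M where
  atlas := P
  chartAt x := (hP x).choose
  mem_chart_source x := (hP x).choose_spec.2
  chart_mem_atlas x := (hP x).choose_spec.1

theorem isManifold_of_charts (P : Set (OpenPartialHomeomorph M E))
    (hP : ∀ x : M, ∃ c ∈ P, x ∈ c.source)
    (h : ∀ c ∈ P, ∀ c' ∈ P, ContDiffOn ℝ ∞ (c' ∘ c.symm) (c.symm ≫ₕ c').source) :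
    letI := chartedSpaceOfCharts P hP
    IsManifold 𝓘(ℝ, E) ∞ M := by
  let _ := chartedSpaceOfCharts P hP
  refine isManifold_of_contDiffOn 𝓘(ℝ, E) ∞ M fun c c' hc hc' => ?_
  simpa using h c hc c' hc'

theorem isSmoothChart_of_mem (P : Set (OpenPartialHomeomorph M E))
    (hP : ∀ x : M, ∃ c ∈ P, x ∈ c.source)
    (h : ∀ c ∈ P, ∀ c' ∈ P, ContDiffOn ℝ ∞ (c' ∘ c.symm) (c.symm ≫ₕ c').source)
    {c : OpenPartialHomeomorph M E} (hc : c ∈ P) :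
    letI := chartedSpaceOfCharts P hP
    IsSmoothChart 𝓘(ℝ, E) c := by
  let _ := chartedSpaceOfCharts P hP
  have := isManifold_of_charts P hP h
  have hm : c ∈ IsManifold.maximalAtlas 𝓘(ℝ, E) ∞ M := IsManifold.subset_maximalAtlas hc
  exact ⟨contMDiffOn_of_mem_maximalAtlas hm, contMDiffOn_symm_of_mem_maximalAtlas hm⟩

end ManifoldOfCharts

section Submanifold

variable {E H M : Type} [NormedAddCommGroup E] [NormedSpace ℝ E]
  [TopologicalSpace H] {I : ModelWithCorners ℝ E H} [TopologicalSpace M] [ChartedSpace H M]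
  {D K : Type} [NormedAddCommGroup D] [NormedSpace ℝ D] [NormedAddCommGroup K] [NormedSpace ℝ K]

/-- A chart with values in `D × K` in which the subset `C` is given by the equation `k = 0`. -/
structure IsSliceChart (I : ModelWithCorners ℝ E H) (C : Set M)
    (φ : OpenPartialHomeomorph M (D × K)) : Prop extends IsSmoothChart I φ where
  mem_iff : ∀ x ∈ φ.source, x ∈ C ↔ (φ x).2 = 0

/-- `C` is a submanifold with tangent model `D` and normal model `K`. -/
def IsLocallyFlat (I : ModelWithCorners ℝ E H) (D K : Type) [NormedAddCommGroup D]
    [NormedSpace ℝ D] [NormedAddCommGroup K] [NormedSpace ℝ K] (C : Set M) : Prop :=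
  ∀ x ∈ C, ∃ φ : OpenPartialHomeomorph M (D × K), IsSliceChart I C φ ∧ x ∈ φ.source

open Classical in
/-- The chart of the submanifold `C` given by a slice chart. The base point supplies the value of
the inverse outside the target. -/
def sliceRestrict {C : Set M} (x₀ : C) (φ : OpenPartialHomeomorph M (D × K))
    (hφ : ∀ x ∈ φ.source, x ∈ C ↔ (φ x).2 = 0) : OpenPartialHomeomorph C D where
  toFun x := (φ x).1
  invFun d := if h : (d, (0 : K)) ∈ φ.target then
    ⟨φ.symm (d, 0), (hφ _ (φ.map_target h)).2 (by rw [φ.right_inv h])⟩ else x₀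
  source := (↑) ⁻¹' φ.source
  target := {d | (d, (0 : K)) ∈ φ.target}
  map_source' x hx := by
    have h := (hφ x hx).1 x.2
    have h2 := φ.map_source hx
    rwa [← Prod.mk.eta (p := φ x), h] at h2
  map_target' d hd := by
    rw [mem_ofPred_eq] at hd
    simp [hd]
  left_inv' x hx := by
    have h := (hφ x hx).1 x.2
    have h2 := φ.map_source hx
    have h3 : ((φ x).1, (0 : K)) = φ x := Prod.ext rfl h.symm
    rw [← h3] at h2
    rw [dif_pos h2]
    ext
    simp only [h3]
    exact φ.left_inv hx
  right_inv' d hd := by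
    rw [mem_ofPred_eq] at hd
    simp [hd, φ.right_inv hd]
  open_source := φ.open_source.preimage continuous_subtype_val
  open_target := φ.open_target.preimage (by fun_prop)
  continuousOn_toFun := (φ.continuousOn.comp continuous_subtype_val.continuousOn
    (fun x hx => hx)).fst
  continuousOn_invFun := by
    rw [IsInducing.subtypeVal.continuousOn_iff]
    have h : ContinuousOn (fun d : D => φ.symm (d, (0 : K))) {d | (d, (0 : K)) ∈ φ.target} :=
      φ.continuousOn_symm.comp (by fun_prop) fun d hd => hd
    refine h.congr fun d hd => ?_
    rw [mem_ofPred_eq] at hd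
    simp [hd]

theorem coe_sliceRestrict_symm {C : Set M} (x₀ : C) (φ : OpenPartialHomeomorph M (D × K))
    (hφ : ∀ x ∈ φ.source, x ∈ C ↔ (φ x).2 = 0) {d : D} (hd : (d, (0 : K)) ∈ φ.target) :
    (((sliceRestrict x₀ φ hφ).symm d : C) : M) = φ.symm (d, 0) := by
  simp [sliceRestrict, hd]

variable [I.Boundaryless] [IsManifold I ∞ M]

/-- A nonempty locally flat subset is an embedded submanifold, and a map to it is smooth if it is
smooth as a map to the ambient manifold. -/
theorem IsLocallyFlat.exists_chartedSpace {C : Set M} (hC : IsLocallyFlat I D K C)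
    (hne : C.Nonempty) (L : (D × K) ≃L[ℝ] E) :
    ∃ _ : ChartedSpace D C, IsManifold 𝓘(ℝ, D) ∞ C ∧
      Manifold.IsSmoothEmbedding 𝓘(ℝ, D) I ∞ ((↑) : C → M) ∧
      ∀ {V : Type} [NormedAddCommGroup V] [NormedSpace ℝ V] (f : V → C) (w : V),
        ContMDiffAt 𝓘(ℝ, V) I 1 (fun v => (f v : M)) w → ContMDiffAt 𝓘(ℝ, V) 𝓘(ℝ, D) 1 f w := by
  obtain ⟨x₀, hx₀⟩ := hne
  set P : Set (OpenPartialHomeomorph C D) := {c | ∃ (φ : OpenPartialHomeomorph M (D × K))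
    (hφ : IsSliceChart I C φ), c = sliceRestrict ⟨x₀, hx₀⟩ φ hφ.mem_iff} with hPdef
  have hP : ∀ x : C, ∃ c ∈ P, x ∈ c.source := by
    intro x
    obtain ⟨φ, hφ, hx⟩ := hC x x.2
    exact ⟨_, ⟨φ, hφ, rfl⟩, hx⟩
  have hd0 : ContDiff ℝ ∞ (fun d : D => (d, (0 : K))) := contDiff_id.prodMk contDiff_const
  have htrans : ∀ c ∈ P, ∀ c' ∈ P, ContDiffOn ℝ ∞ (c' ∘ c.symm) (c.symm ≫ₕ c').source := by
    rintro _ ⟨φ, hφ, rfl⟩ _ ⟨ψ, hψ, rfl⟩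
    have h1 : ContDiffOn ℝ ∞ (ψ ∘ φ.symm) (φ.target ∩ φ.symm ⁻¹' ψ.source) := by
      rw [← contMDiffOn_iff_contDiffOn]
      exact hψ.contMDiffOn.comp (hφ.contMDiffOn_symm.mono inter_subset_left) fun x hx => hx.2
    have h2 : ContDiffOn ℝ ∞ (fun d : D => (ψ (φ.symm (d, (0 : K)))).1)
        ((fun d : D => (d, (0 : K))) ⁻¹' (φ.target ∩ φ.symm ⁻¹' ψ.source)) :=
      (h1.comp hd0.contDiffOn fun d hd => hd).fst
    refine (h2.mono ?_).congr ?_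
    · intro d hd
      have hd1 : (d, (0 : K)) ∈ φ.target := hd.1
      have hd2 := hd.2
      refine ⟨hd1, ?_⟩
      rw [mem_preimage, ← coe_sliceRestrict_symm ⟨x₀, hx₀⟩ φ hφ.mem_iff hd1]
      exact hd2
    · intro d hd
      have hd1 : (d, (0 : K)) ∈ φ.target := hd.1
      rw [← coe_sliceRestrict_symm ⟨x₀, hx₀⟩ φ hφ.mem_iff hd1]
      rfl
  let inst : ChartedSpace D C := chartedSpaceOfCharts P hP
  have hman : IsManifold 𝓘(ℝ, D) ∞ C := isManifold_of_charts P hP htrans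
  refine ⟨inst, hman, ⟨?_, IsEmbedding.subtypeVal⟩, ?_⟩
  · refine ⟨K, inferInstance, inferInstance, fun x => ?_⟩
    obtain ⟨φ, hφ, hx⟩ := hC x x.2
    refine Manifold.IsImmersionAtOfComplement.mk_of_continuousAt
      continuous_subtype_val.continuousAt L
      (sliceRestrict ⟨x₀, hx₀⟩ φ hφ.mem_iff)
      (toModel I (φ ≫ₕ L.toHomeomorph.toOpenPartialHomeomorph)) hx ?_ ?_ ?_ ?_
    · rw [toModel_source]; simpa using hx
    · exact IsManifold.subset_maximalAtlas ⟨φ, hφ, rfl⟩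
    · exact (hφ.toIsSmoothChart.trans_equiv L).toModel_mem
    · intro d hd
      have hd0 : d ∈ (sliceRestrict ⟨x₀, hx₀⟩ φ hφ.mem_iff).target := by simpa using hd
      have hd1 : (d, (0 : K)) ∈ φ.target := hd0
      rw [coe_toModel_extend]
      have h3 := coe_sliceRestrict_symm ⟨x₀, hx₀⟩ φ hφ.mem_iff hd1
      change L (φ (((sliceRestrict ⟨x₀, hx₀⟩ φ hφ.mem_iff).symm d : C) : M)) = L (d, 0)
      rw [h3, φ.right_inv hd1]
  · intro V _ _ f w hf
    obtain ⟨φ, hφ, hx⟩ := hC (f w) (f w).2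
    set c := sliceRestrict ⟨x₀, hx₀⟩ φ hφ.mem_iff with hc
    have hcs : IsSmoothChart 𝓘(ℝ, D) c := isSmoothChart_of_mem P hP htrans ⟨φ, hφ, rfl⟩
    have hfc : ContinuousAt f w := by
      rw [IsInducing.subtypeVal.continuousAt_iff]; exact hf.continuousAt
    have hxc : f w ∈ c.source := hx
    have h1 : ContMDiffAt 𝓘(ℝ, V) 𝓘(ℝ, D) 1 (fun v => (φ (f v)).1) w := by
      have h2 : ContMDiffAt I 𝓘(ℝ, D × K) 1 φ (f w) :=
        (hφ.contMDiffOn.contMDiffAt (φ.open_source.mem_nhds hx)).of_le (by simp)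
      have h3 : ContMDiffAt 𝓘(ℝ, V) 𝓘(ℝ, D × K) 1 (fun v => φ (f v)) w := h2.comp w hf
      exact (contDiff_fst.contMDiff.contMDiffAt).comp w h3
    have h4 : ContMDiffAt 𝓘(ℝ, V) 𝓘(ℝ, D) 1 (fun v => c.symm (c (f v))) w := by
      have h5 : ContMDiffAt 𝓘(ℝ, D) 𝓘(ℝ, D) 1 c.symm (c (f w)) :=
        (hcs.contMDiffOn_symm.contMDiffAt
          (c.open_target.mem_nhds (c.map_source hxc))).of_le (by simp)
      exact h5.comp w h1
    refine h4.congr_of_eventuallyEq ?_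
    filter_upwards [hfc.eventually (c.open_source.mem_nhds hxc)] with v hv
    exact (c.left_inv hv).symm

end Submanifold

section NonorientableSubmanifold

variable {E H M : Type} [NormedAddCommGroup E] [NormedSpace ℝ E]
  [TopologicalSpace H] {I : ModelWithCorners ℝ E H} [TopologicalSpace M] [ChartedSpace H M]
  [I.Boundaryless] [IsManifold I ∞ M]
  {K V K' : Type} [NormedAddCommGroup K] [NormedSpace ℝ K]
  [NormedAddCommGroup V] [NormedSpace ℝ V] [FiniteDimensional ℝ V]
  [NormedAddCommGroup K'] [NormedSpace ℝ K'] [FiniteDimensional ℝ K']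

/-- A locally flat subset is a nonorientable submanifold if a preconnected open subset of a vector
space maps submersively to it, with fibres preserved by a linear map of negative determinant. -/
theorem IsLocallyFlat.isNonorientableSubmanifold {d : ℕ} {C : Set M}
    (hC : IsLocallyFlat I (EuclideanSpace ℝ (Fin d)) K C)
    (L : (EuclideanSpace ℝ (Fin d) × K) ≃L[ℝ] E) {f : V → M} {r : V → K'} {W : Set V}
    (h : ∀ w ∈ W, ContMDiffAt 𝓘(ℝ, V) I 1 f w) (hWo : IsOpen W) (hr : ContDiffOn ℝ 1 r W)
    (hinv : ∀ w ∈ W, ∃ k : M × K' → V,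
      MDifferentiableAt (I.prod 𝓘(ℝ, K')) 𝓘(ℝ, V) k (f w, r w) ∧ ∀ᶠ y in 𝓝 w, k (f y, r y) = y)
    (J : (EuclideanSpace ℝ (Fin d) × K') ≃L[ℝ] V)
    (hW : IsPreconnected W) (hfC : MapsTo f W C) {A : V →L[ℝ] V} (hA : A.det < 0)
    (hAW : MapsTo A W W) (hne : W.Nonempty)
    (hfA : ∀ y ∈ W, f (A y) = f y) (hrA : ∀ y ∈ W, r (A y) = r y) :
    IsNonorientableSubmanifold I d C := by
  classical
  obtain ⟨w₀, hw₀⟩ := hne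
  obtain ⟨_, hman, hemb, hsm⟩ := hC.exists_chartedSpace ⟨f w₀, hfC hw₀⟩ L
  refine ⟨C, inferInstance, inferInstance, (↑), hman, hemb, Subtype.range_coe, ?_⟩
  set f' : V → C := fun v => if h : f v ∈ C then ⟨f v, h⟩ else ⟨f w₀, hfC hw₀⟩ with hf'
  have hval : ∀ y ∈ W, (f' y : M) = f y := fun y hy => by
    simp only [hf']; rw [dif_pos (hfC hy)]
  have hpres : IsPresentation (𝓡 d) f' r W := by
    refine ⟨hWo, fun w hw => ?_, hr, fun w hw => ?_⟩
    · refine (hsm f' w ((h w hw).congr_of_eventuallyEq ?_)).contMDiffWithinAt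
      filter_upwards [hWo.mem_nhds hw] with y hy
      exact hval y hy
    · obtain ⟨k, hk, hk'⟩ := hinv w hw
      refine ⟨fun p => k (p.1, p.2), ?_, ?_⟩
      · have h1 : MDifferentiableAt ((𝓡 d).prod 𝓘(ℝ, K')) I
            (fun p : C × K' => (p.1 : M)) (f' w, r w) :=
          ((hemb.contMDiff.mdifferentiable (by simp)) (f' w)).comp (f' w, r w)
            mdifferentiableAt_fst
        have h2 : MDifferentiableAt ((𝓡 d).prod 𝓘(ℝ, K')) (I.prod 𝓘(ℝ, K'))
            (fun p : C × K' => ((p.1 : M), p.2)) (f' w, r w) := h1.prodMk mdifferentiableAt_snd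
        refine MDifferentiableAt.comp (f' w, r w) ?_ h2
        simp only [hval w hw]
        exact hk
      · filter_upwards [hk', hWo.mem_nhds hw] with y hy hyW
        rw [hval y hyW, hy]
  refine hpres.not_orientable J hW hA hw₀ (hAW hw₀) ?_ ?_
  · filter_upwards [hWo.mem_nhds hw₀] with y hy
    ext
    rw [hval _ (hAW hy), hval y hy, hfA y hy]
  · filter_upwards [hWo.mem_nhds hw₀] with y hy using hrA y hy

end NonorientableSubmanifold

/-! ### Quotients of manifolds by properly discontinuous free actions -/

section QuotientManifold

variable {E H M G : Type*} [NormedAddCommGroup E] [NormedSpace ℝ E]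
  [TopologicalSpace H] {I : ModelWithCorners ℝ E H} [I.Boundaryless]
  [TopologicalSpace M] [ChartedSpace H M] [IsManifold I ∞ M]
  [Group G] [MulAction G M] [ProperlyDiscontinuousSMul G M] [ContinuousConstSMul G M]
  [IsCancelSMul G M] [T2Space M] [LocallyCompactSpace M]

theorem isLocalHomeomorph_quotientMk :
    IsLocalHomeomorph (Quotient.mk (orbitRel G M) : M → orbitRel.Quotient G M) :=
  isQuotientCoveringMap_quotientMk_of_properlyDiscontinuousSMul.isCoveringMap.isLocalHomeomorph

/-- Two points of the same orbit: near the first one, any continuous local inverse of the projection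
through the second one is translation by a group element, hence smooth. -/
theorem contMDiffAt_section_comp_mk (hG : ∀ g : G, ContMDiff I I ∞ (fun x : M => g • x))
    {φ : OpenPartialHomeomorph (orbitRel.Quotient G M) M}
    (hφ : ∀ y ∈ φ.source, Quotient.mk (orbitRel G M) (φ y) = y) {x : M}
    (hx : Quotient.mk (orbitRel G M) x ∈ φ.source) :
    ContMDiffAt I I ∞ (fun z => φ (Quotient.mk (orbitRel G M) z)) x := by
  set p : M → orbitRel.Quotient G M := Quotient.mk (orbitRel G M) with hp
  have hpc : Continuous p := continuous_quotient_mk'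
  obtain ⟨g, hg⟩ : ∃ g : G, g • x = φ (p x) := Quotient.exact (hφ _ hx)
  refine (hG g).contMDiffAt.congr_of_eventuallyEq ?_
  obtain ⟨e, he, hpe⟩ := isLocalHomeomorph_quotientMk (G := G) (M := M) (g • x)
  have h1 : ∀ᶠ z in 𝓝 x, g • z ∈ e.source :=
    (continuous_const_smul g).continuousAt.eventually (e.open_source.mem_nhds he)
  have h2 : ∀ᶠ z in 𝓝 x, p z ∈ φ.source :=
    hpc.continuousAt.eventually (φ.open_source.mem_nhds hx)
  have h3 : ∀ᶠ z in 𝓝 x, φ (p z) ∈ e.source := by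
    have hc : ContinuousAt (fun z => φ (p z)) x :=
      ContinuousAt.comp (φ.continuousAt hx) hpc.continuousAt
    exact hc.eventually (e.open_source.mem_nhds (by simpa only [← hg] using he))
  filter_upwards [h1, h2, h3] with z hz1 hz2 hz3
  refine e.injOn hz3 hz1 ?_
  rw [← hpe]
  have h4 : p (g • z) = p z := Quotient.sound ⟨g, rfl⟩
  exact (hφ _ hz2).trans h4.symm

theorem contMDiffOn_section_comp_mk (hG : ∀ g : G, ContMDiff I I ∞ (fun x : M => g • x)) (x₀ : M) :
    ContMDiffOn I I ∞ (fun z => (isLocalHomeomorph_quotientMk (G := G) (M := M)).localInverseAt x₀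
      (Quotient.mk (orbitRel G M) z)) {z | Quotient.mk (orbitRel G M) z ∈
        ((isLocalHomeomorph_quotientMk (G := G) (M := M)).localInverseAt x₀).source} := fun _ hz =>
  (contMDiffAt_section_comp_mk hG
    (fun _ hy => isLocalHomeomorph_quotientMk.apply_localInverseAt_of_mem hy)
      hz).contMDiffWithinAt

/-- The quotient of a manifold by a free, properly discontinuous smooth action is a manifold. -/
theorem isManifold_quotient (hG : ∀ g : G, ContMDiff I I ∞ (fun x : M => g • x)) :
    IsManifold I ∞ (orbitRel.Quotient G M) := by
  refine isManifold_of_contDiffOn I ∞ _ ?_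
  have hI : ContMDiff 𝓘(ℝ, E) I ∞ I.symm := by
    have := I.contMDiffOn_symm (n := ∞)
    rwa [I.range_eq_univ, contMDiffOn_univ] at this
  have hp := isLocalHomeomorph_quotientMk (G := G) (M := M)
  rintro _ _ ⟨q, rfl⟩ ⟨q', rfl⟩
  set g := (Quotient.mk_surjective (s := orbitRel G M)).hasRightInverse.choose
  have h1 := contMDiffOn_section_comp_mk (I := I) hG (g q')
  have h2 : ContMDiffOn 𝓘(ℝ, E) I ∞ ((chartAt H (g q)).symm ∘ I.symm)
      (I.symm ⁻¹' (chartAt H (g q)).target) :=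
    contMDiffOn_chart_symm.comp hI.contMDiffOn fun x hx => hx
  have h3 := (I.contMDiff (n := ∞)).comp_contMDiffOn (contMDiffOn_chart (I := I) (x := g q'))
  have h4 := h3.comp' (h1.comp' h2)
  rw [← contMDiffOn_iff_contDiffOn]
  refine (h4.mono ?_).congr ?_
  · rintro x ⟨hx, -⟩
    simp only [mfld_simps, IsLocalHomeomorph.localInverseAt_symm] at hx
    exact ⟨⟨hx.1.1, hx.2.1⟩, hx.2.2⟩
  · rintro x ⟨hx, -⟩
    simp [mfld_simps, IsLocalHomeomorph.localInverseAt_symm]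

/-- The projection to the quotient by a free, properly discontinuous smooth action is a local
diffeomorphism. -/
theorem isLocalDiffeomorph_quotientMk (hG : ∀ g : G, ContMDiff I I ∞ (fun x : M => g • x)) :
    IsLocalDiffeomorph I I ∞ (Quotient.mk (orbitRel G M) : M → orbitRel.Quotient G M) := by
  have hman := isManifold_quotient (I := I) hG
  have hp := isLocalHomeomorph_quotientMk (G := G) (M := M)
  have hpc : Continuous (Quotient.mk (orbitRel G M) : M → orbitRel.Quotient G M) :=
    continuous_quotient_mk'
  set g := (Quotient.mk_surjective (s := orbitRel G M)).hasRightInverse.choose with hg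
  have hgr : ∀ q, Quotient.mk (orbitRel G M) (g q) = q :=
    (Quotient.mk_surjective (s := orbitRel G M)).hasRightInverse.choose_spec
  -- the preferred charts of the quotient
  have hchart : ∀ q : orbitRel.Quotient G M,
      chartAt H q = (hp.localInverseAt (g q)).trans (chartAt H (g q)) := fun q => rfl
  have hsmooth : ContMDiff I I ∞ (Quotient.mk (orbitRel G M) : M → orbitRel.Quotient G M) := by
    intro x
    set q : orbitRel.Quotient G M := Quotient.mk (orbitRel G M) x with hq
    have hs : q ∈ (hp.localInverseAt (g q)).source := by
      have := hp.apply_self_mem_localInverseAt_source (x := g q)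
      rwa [hgr] at this
    have hgq : hp.localInverseAt (g q) q = g q := by
      have := hp.localInverseAt_apply_self (x := g q)
      rwa [hgr] at this
    have h1 : ContMDiffAt I I ∞ (fun z => hp.localInverseAt (g q) (Quotient.mk (orbitRel G M) z)) x :=
      contMDiffAt_section_comp_mk hG (fun _ hy => hp.apply_localInverseAt_of_mem hy) hs
    have h2 : ContMDiffAt I I ∞ (fun z => chartAt H (g q)
        (hp.localInverseAt (g q) (Quotient.mk (orbitRel G M) z))) x := by
      refine ContMDiffAt.comp x ?_ h1
      rw [← hq, hgq]
      exact (contMDiffOn_chart (I := I)).contMDiffAt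
        ((chartAt H (g q)).open_source.mem_nhds (mem_chart_source H (g q)))
    have h3 : ContMDiffAt I I ∞ (fun z => (chartAt H q).symm (chartAt H (g q)
        (hp.localInverseAt (g q) (Quotient.mk (orbitRel G M) z)))) x := by
      refine ContMDiffAt.comp x ?_ h2
      have h4 := (chartAt H q).map_source (mem_chart_source H q)
      refine (contMDiffOn_chart_symm (I := I)).contMDiffAt
        ((chartAt H q).open_target.mem_nhds ?_)
      exact h4
    refine h3.congr_of_eventuallyEq ?_
    filter_upwards [hpc.continuousAt.eventually
      ((chartAt H q).open_source.mem_nhds (mem_chart_source H q))] with z hz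
    exact ((chartAt H q).left_inv hz).symm
  intro x
  set σ := hp.localInverseAt x with hσ
  have hσs : ContMDiffOn I I ∞ σ σ.source := by
    intro q hq
    have hq1 := mem_chart_source H q
    have h1 : ContMDiffAt I I ∞ (chartAt H q) q :=
      (contMDiffOn_chart (I := I)).contMDiffAt ((chartAt H q).open_source.mem_nhds hq1)
    have hmem : chartAt H q q ∈ (chartAt H (g q)).target := by
      have := (chartAt H q).map_source hq1
      rw [hchart] at this
      exact this.1
    have h2 : ContMDiffAt I I ∞ (chartAt H (g q)).symm (chartAt H q q) :=
      (contMDiffOn_chart_symm (I := I)).contMDiffAt ((chartAt H (g q)).open_target.mem_nhds hmem)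
    have h3 : ContMDiffAt I I ∞ (fun y => (chartAt H (g q)).symm (chartAt H q y)) q :=
      ContMDiffAt.comp q h2 h1
    have heq : ∀ y ∈ (chartAt H q).source,
        Quotient.mk (orbitRel G M) ((chartAt H (g q)).symm (chartAt H q y)) = y := by
      intro y hy
      have h5 := (chartAt H q).left_inv hy
      rw [hchart, OpenPartialHomeomorph.trans_symm_eq_symm_trans_symm,
        OpenPartialHomeomorph.coe_trans, IsLocalHomeomorph.localInverseAt_symm] at h5
      exact h5
    have h4 : ContMDiffAt I I ∞ (fun y => σ (Quotient.mk (orbitRel G M)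
        ((chartAt H (g q)).symm (chartAt H q y)))) q := by
      refine ContMDiffAt.comp (g := fun z => σ (Quotient.mk (orbitRel G M) z)) q ?_ h3
      refine contMDiffAt_section_comp_mk hG (fun _ hy => hp.apply_localInverseAt_of_mem hy) ?_
      rw [heq q hq1]
      exact hq
    refine (h4.congr_of_eventuallyEq ?_).contMDiffWithinAt
    filter_upwards [(chartAt H q).open_source.mem_nhds hq1] with y hy
    rw [heq y hy]
  refine ⟨{ toPartialEquiv := σ.symm.toPartialEquiv, open_source := σ.open_target,
            open_target := σ.open_source, contMDiffOn_toFun := ?_, contMDiffOn_invFun := hσs },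
    hp.self_mem_localInverseAt_target, ?_⟩
  · have h : (σ.symm : M → _) = Quotient.mk (orbitRel G M) := hp.localInverseAt_symm x
    change ContMDiffOn I I ∞ σ.symm _
    rw [h]
    exact hsmooth.contMDiffOn
  · intro y hy
    exact (congrFun (hp.localInverseAt_symm x) y).symm

end QuotientManifold

/-! ### Spheres, projective spaces, the circle and associated bundles -/

section Sphere

variable {E : Type} [NormedAddCommGroup E] [InnerProductSpace ℝ E]
  {n : ℕ} [hn : Fact (Module.finrank ℝ E = n + 1)]
  {E' H' Z : Type*} [NormedAddCommGroup E'] [NormedSpace ℝ E'] [TopologicalSpace H']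
  {J : ModelWithCorners ℝ E' H'} [TopologicalSpace Z] [ChartedSpace H' Z]

open Metric Module in
/-- A map to the unit sphere is smooth at a point if it is smooth there as a map to the ambient
space. -/
theorem contMDiffAt_codRestrict_sphere {m : WithTop ℕ∞} {f : Z → sphere (0 : E) 1} {z : Z}
    (hf : ContMDiffAt J 𝓘(ℝ, E) m (fun x => (f x : E)) z) : ContMDiffAt J (𝓡 n) m f z := by
  rw [contMDiffAt_iff_target]
  refine ⟨?_, ?_⟩
  · rw [IsInducing.subtypeVal.continuousAt_iff]; exact hf.continuousAt
  · let v : sphere (0 : E) 1 := -f z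
    let U : _ ≃ₗᵢ[ℝ] _ :=
      (OrthonormalBasis.fromOrthogonalSpanSingleton (𝕜 := ℝ) n (ne_zero_of_mem_unit_sphere v)).repr
    have h1 : ContDiffAt ℝ m (fun x => U (stereoToFun (v : E) x)) (f z : E) := by
      refine U.contDiff.contDiffAt.comp _ ?_
      refine (contDiffOn_stereoToFun (v := (v : E)) (n := m)).contDiffAt ?_
      refine IsOpen.mem_nhds ?_ ?_
      · exact isOpen_ne_fun (by fun_prop) (by fun_prop)
      · simp [v]
        norm_num
    exact ContMDiffAt.comp (g := fun x : E => U (stereoToFun (v : E) x)) z h1.contMDiffAt hf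

end Sphere

section RepSphere

variable {G : Type} [Group G] {E : Type} [NormedAddCommGroup E] [InnerProductSpace ℝ E]
  {ρ : G →* (E ≃ₗᵢ[ℝ] E)} {n : ℕ} [hn : Fact (Module.finrank ℝ E = n + 1)]
  {E' H' Z : Type*} [NormedAddCommGroup E'] [NormedSpace ℝ E'] [TopologicalSpace H']
  {J : ModelWithCorners ℝ E' H'} [TopologicalSpace Z] [ChartedSpace H' Z]

theorem RepSphere.contMDiff_val :
    ContMDiff (𝓡 n) 𝓘(ℝ, E) ∞ (RepSphere.val : RepSphere ρ → E) :=
  contMDiff_coe_sphere (E := E) (n := n)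

theorem RepSphere.contMDiffAt_of_val {m : WithTop ℕ∞} {f : Z → RepSphere ρ} {z : Z}
    (hf : ContMDiffAt J 𝓘(ℝ, E) m (fun x => (f x).val) z) : ContMDiffAt J (𝓡 n) m f z :=
  contMDiffAt_codRestrict_sphere (E := E) (n := n) (f := f) hf

theorem RepSphere.val_ne_zero (x : RepSphere ρ) : x.val ≠ 0 := by
  intro h
  have := x.norm_val
  simp [h] at this

/-- A unit vector as a point of the unit sphere. -/
def RepSphere.ofNorm (x : E) (h : ‖x‖ = 1) : RepSphere ρ := ⟨x, mem_sphere_zero_iff_norm.2 h⟩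

theorem RepSphere.val_ofNorm (x : E) (h : ‖x‖ = 1) :
    (RepSphere.ofNorm x h : RepSphere ρ).val = x := rfl

variable (ρ) in
open Classical in
/-- The radial projection to the unit sphere, with an arbitrary value at zero. -/
def toSphere [Nonempty (RepSphere ρ)] (x : E) : RepSphere ρ :=
  if h : x = 0 then Classical.arbitrary _ else
    RepSphere.ofNorm (‖x‖⁻¹ • x) (by simp [norm_smul, h])

theorem val_toSphere [Nonempty (RepSphere ρ)] {x : E} (h : x ≠ 0) :
    (toSphere ρ x).val = ‖x‖⁻¹ • x := by
  rw [toSphere, dif_neg h, RepSphere.val_ofNorm]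

theorem toSphere_val [Nonempty (RepSphere ρ)] (x : RepSphere ρ) : toSphere ρ x.val = x :=
  RepSphere.ext (by rw [val_toSphere x.val_ne_zero, x.norm_val]; simp)

theorem toSphere_smul [Nonempty (RepSphere ρ)] {c : ℝ} (hc : 0 < c) (x : E) :
    toSphere ρ (c • x) = toSphere ρ x := by
  by_cases h : x = 0
  · simp [h]
  · apply RepSphere.ext
    rw [val_toSphere h, val_toSphere (smul_ne_zero hc.ne' h), norm_smul, Real.norm_of_nonneg hc.le,
      smul_smul]
    congr 1
    field_simp

theorem toSphere_neg [Nonempty (RepSphere ρ)] {x : E} (h : x ≠ 0) :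
    toSphere ρ (-x) = (-1 : ℤˣ) • toSphere ρ x := by
  apply RepSphere.ext
  rw [RepSphere.val_units_smul, val_toSphere h, val_toSphere (neg_ne_zero.2 h)]
  simp

theorem smul_toSphere [Nonempty (RepSphere ρ)] {x : E} (h : x ≠ 0) (g : G) :
    g • toSphere ρ x = toSphere ρ (ρ g x) := by
  apply RepSphere.ext
  have h' : ρ g x ≠ 0 := by simpa using h
  rw [RepSphere.val_smul, val_toSphere h, val_toSphere h']
  simp

theorem contMDiffAt_toSphere [Nonempty (RepSphere ρ)] {x : E} (h : x ≠ 0) :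
    ContMDiffAt 𝓘(ℝ, E) (𝓡 n) ∞ (toSphere ρ) x := by
  apply RepSphere.contMDiffAt_of_val
  have h1 : ContDiffAt ℝ ∞ (fun y : E => ‖y‖⁻¹ • y) x :=
    ((contDiffAt_norm ℝ h).inv (norm_ne_zero_iff.2 h)).smul contDiffAt_id
  refine h1.contMDiffAt.congr_of_eventuallyEq ?_
  filter_upwards [isOpen_ne.mem_nhds h] with y hy
  exact val_toSphere hy

theorem RepSphere.contMDiff_units_smul (ε : ℤˣ) :
    ContMDiff (𝓡 n) (𝓡 n) ∞ (fun x : RepSphere ρ => ε • x) := fun _ => by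
  apply RepSphere.contMDiffAt_of_val
  exact ((contDiff_const_smul ((ε : ℤ) : ℝ)).contMDiff.comp RepSphere.contMDiff_val).contMDiffAt

theorem RepSphere.contMDiff_smul (g : G) :
    ContMDiff (𝓡 n) (𝓡 n) ∞ (fun x : RepSphere ρ => g • x) := fun _ => by
  apply RepSphere.contMDiffAt_of_val
  exact ((ρ g).contDiff.contMDiff.comp RepSphere.contMDiff_val).contMDiffAt

end RepSphere

section RepProj

variable {G : Type} [Group G] {E : Type} [NormedAddCommGroup E] [InnerProductSpace ℝ E]
  [FiniteDimensional ℝ E]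
  {ρ : G →* (E ≃ₗᵢ[ℝ] E)} {n : ℕ} [hn : Fact (Module.finrank ℝ E = n + 1)]

instance : IsManifold (𝓡 n) ∞ (RepProj ρ) :=
  isManifold_quotient (M := RepSphere ρ) (G := ℤˣ) RepSphere.contMDiff_units_smul

theorem RepProj.isLocalDiffeomorph_mk :
    IsLocalDiffeomorph (𝓡 n) (𝓡 n) ∞ (RepProj.mk : RepSphere ρ → RepProj ρ) :=
  isLocalDiffeomorph_quotientMk (M := RepSphere ρ) (G := ℤˣ) RepSphere.contMDiff_units_smul

theorem RepProj.surjective_mk : Function.Surjective (RepProj.mk : RepSphere ρ → RepProj ρ) :=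
  Quotient.mk_surjective

theorem RepProj.smul_mk (g : G) (x : RepSphere ρ) : g • RepProj.mk x = RepProj.mk (g • x) := rfl

theorem RepProj.contMDiff_smul (g : G) :
    ContMDiff (𝓡 n) (𝓡 n) ∞ (fun x : RepProj ρ => g • x) := by
  intro p
  obtain ⟨x, rfl⟩ := RepProj.surjective_mk p
  refine (RepProj.isLocalDiffeomorph_mk.hasLocalSection x).contMDiffAt ?_
  exact (RepProj.isLocalDiffeomorph_mk.contMDiff.comp (RepSphere.contMDiff_smul g)).contMDiffAt

end RepProj

section Circle

attribute [local instance] finrank_real_complex_fact'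

/-- A complex number of modulus one as a point of the circle. -/
def circleOfNorm (ζ : ℂ) (h : ‖ζ‖ = 1) : Circle := ⟨ζ, mem_sphere_zero_iff_norm.2 h⟩

theorem coe_circleOfNorm (ζ : ℂ) (h : ‖ζ‖ = 1) : (circleOfNorm ζ h : ℂ) = ζ := rfl

open Classical in
/-- The radial projection `ζ ↦ ζ / |ζ|` to the circle, with value `1` at zero. -/
def toCircle (ζ : ℂ) : Circle :=
  if h : ζ = 0 then 1 else circleOfNorm (ζ / ‖ζ‖) (by simp [h])

theorem coe_toCircle {ζ : ℂ} (h : ζ ≠ 0) : (toCircle ζ : ℂ) = ζ / ‖ζ‖ := by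
  rw [toCircle, dif_neg h, coe_circleOfNorm]

theorem toCircle_coe (z : Circle) : toCircle (z : ℂ) = z :=
  Circle.ext (by rw [coe_toCircle z.coe_ne_zero, Circle.norm_coe, Complex.ofReal_one, div_one])

theorem toCircle_mul (ζ ξ : ℂ) (h : ζ ≠ 0) (h' : ξ ≠ 0) :
    toCircle (ζ * ξ) = toCircle ζ * toCircle ξ := by
  apply Circle.ext
  rw [Circle.coe_mul, coe_toCircle h, coe_toCircle h', coe_toCircle (mul_ne_zero h h')]
  push_cast [norm_mul]
  exact mul_div_mul_comm ζ ξ _ _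

theorem toCircle_ofReal {c : ℝ} (hc : 0 < c) : toCircle c = 1 := by
  apply Circle.ext
  have : (c : ℂ) ≠ 0 := by exact_mod_cast hc.ne'
  rw [coe_toCircle this, Complex.norm_real, Real.norm_of_nonneg hc.le, div_self this]
  rfl

theorem contMDiff_circle_coe : ContMDiff (𝓡 1) 𝓘(ℝ, ℂ) ∞ (fun z : Circle => (z : ℂ)) :=
  contMDiff_coe_sphere (E := ℂ) (n := 1)

variable {E' H' Z : Type*} [NormedAddCommGroup E'] [NormedSpace ℝ E'] [TopologicalSpace H']
  {J : ModelWithCorners ℝ E' H'} [TopologicalSpace Z] [ChartedSpace H' Z]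

theorem contMDiffAt_circle_of_coe {m : WithTop ℕ∞} {f : Z → Circle} {z : Z}
    (hf : ContMDiffAt J 𝓘(ℝ, ℂ) m (fun x => (f x : ℂ)) z) : ContMDiffAt J (𝓡 1) m f z :=
  contMDiffAt_codRestrict_sphere (E := ℂ) (n := 1) (f := f) hf

theorem contMDiffAt_toCircle {ζ : ℂ} (h : ζ ≠ 0) :
    ContMDiffAt 𝓘(ℝ, ℂ) (𝓡 1) ∞ toCircle ζ := by
  apply contMDiffAt_circle_of_coe
  have h1 : ContDiffAt ℝ ∞ (fun y : ℂ => ‖y‖⁻¹ • y) ζ :=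
    ((contDiffAt_norm ℝ h).inv (norm_ne_zero_iff.2 h)).smul contDiffAt_id
  refine h1.contMDiffAt.congr_of_eventuallyEq ?_
  filter_upwards [isOpen_ne.mem_nhds h] with y hy
  rw [coe_toCircle hy, div_eq_inv_mul, Complex.real_smul]
  push_cast
  rfl

end Circle

section AssocBundle

variable {X : Type} [MulAction Z2 X] [TopologicalSpace X] [ContinuousConstSMul Z2 X] [T2Space X]
  [LocallyCompactSpace X] {E H : Type} [NormedAddCommGroup E] [NormedSpace ℝ E]
  [TopologicalSpace H] {I : ModelWithCorners ℝ E H} [I.Boundaryless] [ChartedSpace H X]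
  [IsManifold I ∞ X]

theorem contMDiff_Z2_smul (hX : ∀ ε : Z2, ContMDiff I I ∞ (fun x : X => ε • x)) (ε : Z2) :
    ContMDiff ((𝓡 1).prod I) ((𝓡 1).prod I) ∞ (fun p : Circle × X => ε • p) := by
  have h1 : ContMDiff (𝓡 1) (𝓡 1) ∞ (fun z : Circle => (ε : Circle) * z) := contMDiff_mul_left
  exact (h1.comp contMDiff_fst).prodMk ((hX ε).comp contMDiff_snd)

theorem AssocBundle.isManifold (hX : ∀ ε : Z2, ContMDiff I I ∞ (fun x : X => ε • x)) :
    IsManifold ((𝓡 1).prod I) ∞ (AssocBundle X) :=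
  have : IsManifold (𝓡 1) ∞ Circle := inferInstance
  isManifold_quotient (M := Circle × X) (G := Z2) (contMDiff_Z2_smul hX)

/-- The projection `(z, x) ↦ [z, x]`. -/
def AssocBundle.proj (p : Circle × X) : AssocBundle X := AssocBundle.mk p.1 p.2

theorem AssocBundle.isLocalDiffeomorph_proj
    (hX : ∀ ε : Z2, ContMDiff I I ∞ (fun x : X => ε • x)) :
    IsLocalDiffeomorph ((𝓡 1).prod I) ((𝓡 1).prod I) ∞
      (AssocBundle.proj : Circle × X → AssocBundle X) :=
  isLocalDiffeomorph_quotientMk (M := Circle × X) (G := Z2) (contMDiff_Z2_smul hX)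

theorem AssocBundle.surjective_proj :
    Function.Surjective (AssocBundle.proj : Circle × X → AssocBundle X) :=
  Quotient.mk_surjective

theorem AssocBundle.continuous_proj :
    Continuous (AssocBundle.proj : Circle × X → AssocBundle X) := continuous_quotient_mk'

instance : T2Space (AssocBundle X) :=
  inferInstanceAs (T2Space (Quotient (orbitRel Z2 (Circle × X))))

instance [CompactSpace X] : CompactSpace (AssocBundle X) :=
  inferInstanceAs (CompactSpace (Quotient (orbitRel Z2 (Circle × X))))

theorem AssocBundle.smul_mk (w z : Circle) (x : X) :
    w • AssocBundle.mk z x = AssocBundle.mk (w * z) x := rfl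

theorem AssocBundle.mk_eq_iff {z z' : Circle} {x x' : X} :
    AssocBundle.mk z x = AssocBundle.mk z' x' ↔
      ∃ ε : Z2, z = ε * z' ∧ x = ε • x' := by
  constructor
  · intro h
    obtain ⟨ε, hε⟩ : ∃ ε : Z2, ε • (z', x') = (z, x) := Quotient.exact h
    exact ⟨ε, (congrArg Prod.fst hε).symm, (congrArg Prod.snd hε).symm⟩
  · rintro ⟨ε, rfl, rfl⟩
    exact Quotient.sound ⟨ε, rfl⟩

/-- The circle acts smoothly on `S¹ ×_{ℤ₂} X`. -/
theorem AssocBundle.contMDiffSMul (hX : ∀ ε : Z2, ContMDiff I I ∞ (fun x : X => ε • x)) :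
    ContMDiffSMul (𝓡 1) ((𝓡 1).prod I) ∞ Circle (AssocBundle X) := by
  refine ⟨fun p => ?_⟩
  obtain ⟨w, q⟩ := p
  obtain ⟨⟨z, x⟩, rfl⟩ := AssocBundle.surjective_proj q
  have hq := AssocBundle.isLocalDiffeomorph_proj hX
  obtain ⟨σ, U, hU, hmem, hσ, hσx, hsec⟩ := hq.hasLocalSection (z, x)
  have h1 : ContMDiffAt ((𝓡 1).prod ((𝓡 1).prod I)) ((𝓡 1).prod I) ∞
      (fun p : Circle × AssocBundle X => AssocBundle.proj (p.1 * (σ p.2).1, (σ p.2).2))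
      (w, AssocBundle.proj (z, x)) := by
    refine hq.contMDiff.contMDiffAt.comp _ ?_
    have h2 : ContMDiffAt ((𝓡 1).prod ((𝓡 1).prod I)) ((𝓡 1).prod I) ∞
        (fun p : Circle × AssocBundle X => σ p.2) (w, AssocBundle.proj (z, x)) :=
      ContMDiffAt.comp (g := σ) _ (hσ.contMDiffAt (hU.mem_nhds hmem)) contMDiffAt_snd
    have h3 : ContMDiffAt ((𝓡 1).prod ((𝓡 1).prod I)) (𝓡 1) ∞
        (fun p : Circle × AssocBundle X => p.1 * (σ p.2).1) (w, AssocBundle.proj (z, x)) :=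
      contMDiffAt_fst.mul h2.fst
    exact h3.prodMk h2.snd
  refine h1.congr_of_eventuallyEq ?_
  have h4 : ∀ᶠ p : Circle × AssocBundle X in 𝓝 (w, AssocBundle.proj (z, x)), p.2 ∈ U :=
    continuous_snd.continuousAt.eventually (hU.mem_nhds hmem)
  filter_upwards [h4] with p hp
  conv_lhs => rw [← hsec p.2 hp]
  rfl

end AssocBundle

/-! ### Gluing manifolds along open subsets -/

/-- A local homeomorphism is a local diffeomorphism if it carries enough charts to charts. -/
theorem isLocalDiffeomorphOn_of_charts {Y S : Type} [TopologicalSpace Y] [TopologicalSpace S]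
    {F K E : Type*} [NormedAddCommGroup F] [NormedSpace ℝ F] [TopologicalSpace K]
    [NormedAddCommGroup E] [NormedSpace ℝ E] {J : ModelWithCorners ℝ F K} [ChartedSpace K Y]
    [ChartedSpace E S] (i : OpenPartialHomeomorph Y S)
    (hi : ∀ y ∈ i.source, ∃ φ : OpenPartialHomeomorph Y E, IsSmoothChart J φ ∧ y ∈ φ.source ∧
      IsSmoothChart 𝓘(ℝ, E) (i.symm ≫ₕ φ)) : IsLocalDiffeomorphOn J 𝓘(ℝ, E) ∞ i i.source := by
  intro y
  refine ⟨⟨i.toPartialEquiv, i.open_source, i.open_target, ?_, ?_⟩, y.2, fun _ _ => rfl⟩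
  · intro z hz
    obtain ⟨φ, hφ, hzφ, hcs⟩ := hi z hz
    have h1 : ContMDiffAt J 𝓘(ℝ, E) ∞ φ z :=
      hφ.contMDiffOn.contMDiffAt (φ.open_source.mem_nhds hzφ)
    have h2 : ContMDiffAt 𝓘(ℝ, E) 𝓘(ℝ, E) ∞ (i.symm ≫ₕ φ).symm (φ z) :=
      hcs.contMDiffOn_symm.contMDiffAt ((i.symm ≫ₕ φ).open_target.mem_nhds
        ⟨φ.map_source hzφ, by simpa [φ.left_inv hzφ] using hz⟩)
    have h3 := h2.comp z h1
    refine (h3.congr_of_eventuallyEq ?_).contMDiffWithinAt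
    filter_upwards [φ.open_source.mem_nhds hzφ] with w hw
    simp [φ.left_inv hw]
  · intro p hp
    obtain ⟨φ, hφ, hzφ, hcs⟩ := hi (i.symm p) (i.map_target hp)
    have hps : p ∈ (i.symm ≫ₕ φ).source := ⟨hp, hzφ⟩
    have h1 : ContMDiffAt 𝓘(ℝ, E) 𝓘(ℝ, E) ∞ (i.symm ≫ₕ φ) p :=
      hcs.contMDiffOn.contMDiffAt ((i.symm ≫ₕ φ).open_source.mem_nhds hps)
    have h2 : ContMDiffAt 𝓘(ℝ, E) J ∞ φ.symm (φ (i.symm p)) :=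
      hφ.contMDiffOn_symm.contMDiffAt (φ.open_target.mem_nhds (φ.map_source hzφ))
    have h3 : ContMDiffAt 𝓘(ℝ, E) J ∞ (fun q => φ.symm (φ (i.symm q))) p :=
      ContMDiffAt.comp (g := φ.symm) p h2 h1
    refine (h3.congr_of_eventuallyEq ?_).contMDiffWithinAt
    filter_upwards [(i.symm ≫ₕ φ).open_source.mem_nhds hps] with q hq
    exact (φ.left_inv hq.2).symm
/-- Open subsets of two spaces together with a homeomorphism between open subsets of them, along
which they are to be glued. -/
structure GluingData (X₁ X₂ : Type) [TopologicalSpace X₁] [TopologicalSpace X₂] where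
  /-- The open part of the first space. -/
  left : Set X₁
  /-- The open part of the second space. -/
  right : Set X₂
  /-- The identification. -/
  map : OpenPartialHomeomorph X₁ X₂
  isOpen_left : IsOpen left
  isOpen_right : IsOpen right
  source_subset : map.source ⊆ left
  target_subset : map.target ⊆ right
  left_nonempty : left.Nonempty
  right_nonempty : right.Nonempty

namespace GluingData

variable {X₁ X₂ : Type} [TopologicalSpace X₁] [TopologicalSpace X₂] (D : GluingData X₁ X₂)

open Classical in
/-- A point of the first space, paired with the point of the second space it is identified with. -/
def preInl (x : X₁) : Option X₁ × Option X₂ :=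
  (some x, if x ∈ D.map.source then some (D.map x) else none)

open Classical in
/-- A point of the second space, paired with the point of the first space it is identified with. -/
def preInr (y : X₂) : Option X₁ × Option X₂ :=
  (if y ∈ D.map.target then some (D.map.symm y) else none, some y)

/-- The space obtained by gluing. A point is encoded by its representatives in the two spaces, at
least one of which exists; this avoids quotients. -/
def Space : Type :=
  {p : Option X₁ × Option X₂ // (∃ x ∈ D.left, D.preInl x = p) ∨ ∃ y ∈ D.right, D.preInr y = p}

instance : Nonempty D.Space :=
  ⟨⟨_, Or.inl ⟨D.left_nonempty.some, D.left_nonempty.some_mem, rfl⟩⟩⟩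

open Classical in
/-- The inclusion of the first part, with an arbitrary value outside of it. -/
def inl (x : X₁) : D.Space :=
  if hx : x ∈ D.left then ⟨D.preInl x, Or.inl ⟨x, hx, rfl⟩⟩ else Classical.arbitrary _

open Classical in
/-- The inclusion of the second part, with an arbitrary value outside of it. -/
def inr (y : X₂) : D.Space :=
  if hy : y ∈ D.right then ⟨D.preInr y, Or.inr ⟨y, hy, rfl⟩⟩ else Classical.arbitrary _

variable {D}

theorem val_inl {x : X₁} (hx : x ∈ D.left) : (D.inl x).1 = D.preInl x :=
  congrArg Subtype.val (dif_pos hx :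
    D.inl x = (⟨D.preInl x, Or.inl ⟨x, hx, rfl⟩⟩ : D.Space))

theorem val_inr {y : X₂} (hy : y ∈ D.right) : (D.inr y).1 = D.preInr y :=
  congrArg Subtype.val (dif_pos hy :
    D.inr y = (⟨D.preInr y, Or.inr ⟨y, hy, rfl⟩⟩ : D.Space))

theorem injOn_inl : InjOn D.inl D.left := by
  intro x hx x' hx' h
  have h1 := congrArg (fun p : D.Space => p.1.1) h
  simp only [val_inl hx, val_inl hx', preInl, Option.some.injEq] at h1
  exact h1

theorem injOn_inr : InjOn D.inr D.right := by
  intro x hx x' hx' h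
  have h1 := congrArg (fun p : D.Space => p.1.2) h
  simp only [val_inr hx, val_inr hx', preInr, Option.some.injEq] at h1
  exact h1

theorem inl_eq_inr_iff {x : X₁} {y : X₂} (hx : x ∈ D.left) (hy : y ∈ D.right) :
    D.inl x = D.inr y ↔ x ∈ D.map.source ∧ D.map x = y := by
  have h0 : D.inl x = D.inr y ↔ (D.inl x).1 = (D.inr y).1 := ⟨congrArg Subtype.val, Subtype.ext⟩
  rw [h0, val_inl hx, val_inr hy, Prod.ext_iff, preInl, preInr]
  constructor
  · rintro ⟨-, h⟩
    by_cases hs : x ∈ D.map.source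
    · simpa [hs] using h
    · simp [hs] at h
  · rintro ⟨hs, rfl⟩
    simp [hs]

theorem inl_eq_inr_map {x : X₁} (hx : x ∈ D.map.source) : D.inl x = D.inr (D.map x) :=
  (inl_eq_inr_iff (D.source_subset hx) (D.target_subset (D.map.map_source hx))).2 ⟨hx, rfl⟩

theorem exists_rep (p : D.Space) : (∃ x ∈ D.left, D.inl x = p) ∨ ∃ y ∈ D.right, D.inr y = p := by
  obtain ⟨p, ⟨x, hx, rfl⟩ | ⟨y, hy, rfl⟩⟩ := p
  · exact Or.inl ⟨x, hx, Subtype.ext (val_inl hx)⟩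
  · exact Or.inr ⟨y, hy, Subtype.ext (val_inr hy)⟩

instance : TopologicalSpace D.Space where
  IsOpen U := IsOpen (D.left ∩ D.inl ⁻¹' U) ∧ IsOpen (D.right ∩ D.inr ⁻¹' U)
  isOpen_univ := by simpa using ⟨D.isOpen_left, D.isOpen_right⟩
  isOpen_inter U V hU hV := by
    refine ⟨?_, ?_⟩
    · rw [preimage_inter, inter_inter_distrib_left]; exact hU.1.inter hV.1
    · rw [preimage_inter, inter_inter_distrib_left]; exact hU.2.inter hV.2
  isOpen_sUnion S hS := by
    refine ⟨?_, ?_⟩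
    · rw [preimage_sUnion, inter_iUnion₂]
      exact isOpen_biUnion fun U hU => (hS U hU).1
    · rw [preimage_sUnion, inter_iUnion₂]
      exact isOpen_biUnion fun U hU => (hS U hU).2

theorem continuousOn_inl : ContinuousOn D.inl D.left :=
  (continuousOn_open_iff D.isOpen_left).2 fun _ hU => hU.1

theorem continuousOn_inr : ContinuousOn D.inr D.right :=
  (continuousOn_open_iff D.isOpen_right).2 fun _ hU => hU.2

theorem isOpen_image_inl {U : Set X₁} (hU : IsOpen U) (hUL : U ⊆ D.left) : IsOpen (D.inl '' U) := by
  refine ⟨?_, ?_⟩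
  · convert hU
    ext x
    constructor
    · rintro ⟨hx, x', hx', h⟩
      rwa [← injOn_inl (hUL hx') hx h]
    · exact fun hx => ⟨hUL hx, x, hx, rfl⟩
  · suffices h : D.right ∩ D.inr ⁻¹' (D.inl '' U) = D.map '' (D.map.source ∩ U) by
      rw [h]; exact D.map.isOpen_image_source_inter hU
    ext y
    constructor
    · rintro ⟨hy, x, hx, h⟩
      obtain ⟨hs, rfl⟩ := (inl_eq_inr_iff (hUL hx) hy).1 h
      exact ⟨x, ⟨hs, hx⟩, rfl⟩
    · rintro ⟨x, ⟨hs, hx⟩, rfl⟩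
      exact ⟨D.target_subset (D.map.map_source hs), x, hx, inl_eq_inr_map hs⟩

theorem isOpen_image_inr {U : Set X₂} (hU : IsOpen U) (hUR : U ⊆ D.right) :
    IsOpen (D.inr '' U) := by
  refine ⟨?_, ?_⟩
  · suffices h : D.left ∩ D.inl ⁻¹' (D.inr '' U) = D.map.source ∩ D.map ⁻¹' U by
      rw [h]; exact D.map.isOpen_inter_preimage hU
    ext x
    constructor
    · rintro ⟨hx, y, hy, h⟩
      obtain ⟨hs, rfl⟩ := (inl_eq_inr_iff hx (hUR hy)).1 h.symm
      exact ⟨hs, hy⟩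
    · rintro ⟨hs, hy⟩
      exact ⟨D.source_subset hs, D.map x, hy, (inl_eq_inr_map hs).symm⟩
  · convert hU
    ext x
    constructor
    · rintro ⟨hx, x', hx', h⟩
      rwa [← injOn_inr (hUR hx') hx h]
    · exact fun hx => ⟨hUR hx, x, hx, rfl⟩

theorem isOpenMap_domRestrict_inl : IsOpenMap (D.left.domRestrict D.inl) := by
  intro U hU
  have h : D.left.domRestrict D.inl '' U = D.inl '' (Subtype.val '' U) := by
    rw [← image_comp]; rfl
  rw [h]
  exact isOpen_image_inl (D.isOpen_left.isOpenMap_subtype_val _ hU)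
    (by rintro _ ⟨x, -, rfl⟩; exact x.2)

variable (D) in
/-- The inclusion of the first part as a local homeomorphism. -/
def inlHomeo : OpenPartialHomeomorph X₁ D.Space :=
  have : Nonempty X₁ := ⟨D.left_nonempty.some⟩
  OpenPartialHomeomorph.ofContinuousOpenRestrict (injOn_inl.toPartialEquiv D.inl D.left)
    continuousOn_inl isOpenMap_domRestrict_inl D.isOpen_left

theorem isOpenMap_domRestrict_inr : IsOpenMap (D.right.domRestrict D.inr) := by
  intro U hU
  have h : D.right.domRestrict D.inr '' U = D.inr '' (Subtype.val '' U) := by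
    rw [← image_comp]; rfl
  rw [h]
  exact isOpen_image_inr (D.isOpen_right.isOpenMap_subtype_val _ hU)
    (by rintro _ ⟨x, -, rfl⟩; exact x.2)

variable (D) in
/-- The inclusion of the second part as a local homeomorphism. -/
def inrHomeo : OpenPartialHomeomorph X₂ D.Space :=
  have : Nonempty X₂ := ⟨D.right_nonempty.some⟩
  OpenPartialHomeomorph.ofContinuousOpenRestrict (injOn_inr.toPartialEquiv D.inr D.right)
    continuousOn_inr isOpenMap_domRestrict_inr D.isOpen_right

theorem coe_inlHomeo : (D.inlHomeo : X₁ → D.Space) = D.inl := rfl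

theorem coe_inrHomeo : (D.inrHomeo : X₂ → D.Space) = D.inr := rfl

/-- The glued space is Hausdorff if the parts that are not identified have neighbourhoods which
are disjoint in the glued space. -/
theorem t2Space [T2Space X₁] [T2Space X₂] {A : Set X₁} {B : Set X₂} (hA : IsOpen A) (hB : IsOpen B)
    (hA' : D.left \ D.map.source ⊆ A) (hB' : D.right \ D.map.target ⊆ B)
    (hAB : ∀ x ∈ D.map.source, x ∈ A → D.map x ∉ B) : T2Space D.Space := by
  have hL : ∀ x ∈ D.left, ∀ x' ∈ D.left, x ≠ x' → ∃ u v : Set D.Space,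
      IsOpen u ∧ IsOpen v ∧ D.inl x ∈ u ∧ D.inl x' ∈ v ∧ Disjoint u v := by
    intro x hx x' hx' hne
    obtain ⟨u, v, hu, hv, hxu, hxv, huv⟩ := t2_separation hne
    refine ⟨D.inl '' (u ∩ D.left), D.inl '' (v ∩ D.left),
      isOpen_image_inl (hu.inter D.isOpen_left) inter_subset_right,
      isOpen_image_inl (hv.inter D.isOpen_left) inter_subset_right, ⟨x, ⟨hxu, hx⟩, rfl⟩,
      ⟨x', ⟨hxv, hx'⟩, rfl⟩, ?_⟩
    rw [Set.disjoint_left]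
    rintro _ ⟨z, hz, rfl⟩ ⟨w, hw, hwz⟩
    rw [injOn_inl hw.2 hz.2 hwz] at hw
    exact Set.disjoint_left.1 huv hz.1 hw.1
  have hR : ∀ x ∈ D.right, ∀ x' ∈ D.right, x ≠ x' → ∃ u v : Set D.Space,
      IsOpen u ∧ IsOpen v ∧ D.inr x ∈ u ∧ D.inr x' ∈ v ∧ Disjoint u v := by
    intro x hx x' hx' hne
    obtain ⟨u, v, hu, hv, hxu, hxv, huv⟩ := t2_separation hne
    refine ⟨D.inr '' (u ∩ D.right), D.inr '' (v ∩ D.right),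
      isOpen_image_inr (hu.inter D.isOpen_right) inter_subset_right,
      isOpen_image_inr (hv.inter D.isOpen_right) inter_subset_right, ⟨x, ⟨hxu, hx⟩, rfl⟩,
      ⟨x', ⟨hxv, hx'⟩, rfl⟩, ?_⟩
    rw [Set.disjoint_left]
    rintro _ ⟨z, hz, rfl⟩ ⟨w, hw, hwz⟩
    rw [injOn_inr hw.2 hz.2 hwz] at hw
    exact Set.disjoint_left.1 huv hz.1 hw.1
  have hLR : ∀ x ∈ D.left, ∀ y ∈ D.right, D.inl x ≠ D.inr y → ∃ u v : Set D.Space,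
      IsOpen u ∧ IsOpen v ∧ D.inl x ∈ u ∧ D.inr y ∈ v ∧ Disjoint u v := by
    intro x hx y hy hne
    by_cases hs : x ∈ D.map.source
    · rw [inl_eq_inr_map hs] at hne ⊢
      exact hR _ (D.target_subset (D.map.map_source hs)) _ hy fun h => hne (by rw [h])
    by_cases ht : y ∈ D.map.target
    · have h1 := inl_eq_inr_map (D.map.map_target ht)
      rw [D.map.right_inv ht] at h1
      rw [← h1] at hne ⊢
      exact hL _ hx _ (D.source_subset (D.map.map_target ht)) fun h => hne (by rw [h])
    refine ⟨D.inl '' (A ∩ D.left), D.inr '' (B ∩ D.right),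
      isOpen_image_inl (hA.inter D.isOpen_left) inter_subset_right,
      isOpen_image_inr (hB.inter D.isOpen_right) inter_subset_right,
      ⟨x, ⟨hA' ⟨hx, hs⟩, hx⟩, rfl⟩, ⟨y, ⟨hB' ⟨hy, ht⟩, hy⟩, rfl⟩, ?_⟩
    rw [Set.disjoint_left]
    rintro _ ⟨z, hz, rfl⟩ ⟨w, hw, hwz⟩
    obtain ⟨hzs, rfl⟩ := (inl_eq_inr_iff hz.2 hw.2).1 hwz.symm
    exact hAB z hzs hz.1 hw.1
  refine ⟨fun p q hpq => ?_⟩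
  rcases exists_rep p with ⟨x, hx, rfl⟩ | ⟨x, hx, rfl⟩ <;>
    rcases exists_rep q with ⟨y, hy, rfl⟩ | ⟨y, hy, rfl⟩
  · exact hL x hx y hy fun h => hpq (by rw [h])
  · exact hLR x hx y hy hpq
  · obtain ⟨u, v, hu, hv, h1, h2, h3⟩ := hLR y hy x hx hpq.symm
    exact ⟨v, u, hv, hu, h2, h1, h3.symm⟩
  · exact hR x hx y hy fun h => hpq (by rw [h])

theorem compactSpace {A : Set X₁} {B : Set X₂} (hA : IsCompact A) (hB : IsCompact B)
    (hA' : A ⊆ D.left) (hB' : B ⊆ D.right) (hAB : D.inl '' A ∪ D.inr '' B = univ) :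
    CompactSpace D.Space := by
  refine ⟨?_⟩
  rw [← hAB]
  exact (hA.image_of_continuousOn (continuousOn_inl.mono hA')).union
    (hB.image_of_continuousOn (continuousOn_inr.mono hB'))

section Smooth

variable {E₁ H₁ E₂ H₂ E : Type*} [NormedAddCommGroup E₁] [NormedSpace ℝ E₁] [TopologicalSpace H₁]
  {I₁ : ModelWithCorners ℝ E₁ H₁} [I₁.Boundaryless] [ChartedSpace H₁ X₁] [IsManifold I₁ ∞ X₁]
  [NormedAddCommGroup E₂] [NormedSpace ℝ E₂] [TopologicalSpace H₂]
  {I₂ : ModelWithCorners ℝ E₂ H₂} [I₂.Boundaryless] [ChartedSpace H₂ X₂] [IsManifold I₂ ∞ X₂]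
  [NormedAddCommGroup E] [NormedSpace ℝ E]

theorem contDiffOn_transition {Y Y' : Type} [TopologicalSpace Y] [TopologicalSpace Y']
    {F F' K K' : Type*} [NormedAddCommGroup F] [NormedSpace ℝ F] [TopologicalSpace K]
    {J : ModelWithCorners ℝ F K} [ChartedSpace K Y] [NormedAddCommGroup F'] [NormedSpace ℝ F']
    [TopologicalSpace K'] {J' : ModelWithCorners ℝ F' K'} [ChartedSpace K' Y']
    {i : OpenPartialHomeomorph Y D.Space} {i' : OpenPartialHomeomorph Y' D.Space}
    (h : ContMDiffOn J J' ∞ (i'.symm ∘ i) (i.source ∩ i ⁻¹' i'.target))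
    {φ : OpenPartialHomeomorph Y E} {φ' : OpenPartialHomeomorph Y' E} (hφ : IsSmoothChart J φ)
    (hφ' : IsSmoothChart J' φ') :
    ContDiffOn ℝ ∞ ((i'.symm ≫ₕ φ') ∘ (i.symm ≫ₕ φ).symm)
      ((i.symm ≫ₕ φ).symm ≫ₕ (i'.symm ≫ₕ φ')).source := by
  rw [← contMDiffOn_iff_contDiffOn]
  have h1 := hφ'.contMDiffOn.comp' (h.comp' hφ.contMDiffOn_symm)
  refine (h1.mono ?_).congr ?_
  · intro x hx
    simp only [mfld_simps] at hx
    exact ⟨⟨hx.1.1, hx.1.2, hx.2.1⟩, hx.2.2⟩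
  · intro x hx
    simp [mfld_simps]

/-- Gluing manifolds along a diffeomorphism gives a manifold. -/
theorem exists_chartedSpace (L₁ : E₁ ≃L[ℝ] E) (L₂ : E₂ ≃L[ℝ] E)
    (h : ContMDiffOn I₁ I₂ ∞ D.map D.map.source)
    (h' : ContMDiffOn I₂ I₁ ∞ D.map.symm D.map.target) :
    ∃ _ : ChartedSpace E D.Space, IsManifold 𝓘(ℝ, E) ∞ D.Space ∧
      IsLocalDiffeomorphOn I₁ 𝓘(ℝ, E) ∞ D.inl D.left ∧
      IsLocalDiffeomorphOn I₂ 𝓘(ℝ, E) ∞ D.inr D.right := by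
  set P : Set (OpenPartialHomeomorph D.Space E) :=
    {c | ∃ φ : OpenPartialHomeomorph X₁ E, IsSmoothChart I₁ φ ∧ c = D.inlHomeo.symm ≫ₕ φ} ∪
    {c | ∃ φ : OpenPartialHomeomorph X₂ E, IsSmoothChart I₂ φ ∧ c = D.inrHomeo.symm ≫ₕ φ} with hPd
  have hex₁ : ∀ x : X₁, ∃ φ : OpenPartialHomeomorph X₁ E, IsSmoothChart I₁ φ ∧ x ∈ φ.source :=
    fun x => ⟨_, (isSmoothChart_extChartHomeo x).trans_equiv L₁,
      by simpa using mem_extChartHomeo_source (I := I₁) x⟩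
  have hex₂ : ∀ x : X₂, ∃ φ : OpenPartialHomeomorph X₂ E, IsSmoothChart I₂ φ ∧ x ∈ φ.source :=
    fun x => ⟨_, (isSmoothChart_extChartHomeo x).trans_equiv L₂,
      by simpa using mem_extChartHomeo_source (I := I₂) x⟩
  have hl : ∀ x ∈ D.left, D.inlHomeo.symm (D.inl x) = x := fun x hx => D.inlHomeo.left_inv hx
  have hr : ∀ x ∈ D.right, D.inrHomeo.symm (D.inr x) = x := fun x hx => D.inrHomeo.left_inv hx
  have hP : ∀ p : D.Space, ∃ c ∈ P, p ∈ c.source := by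
    intro p
    rcases exists_rep p with ⟨x, hx, rfl⟩ | ⟨x, hx, rfl⟩
    · obtain ⟨φ, hφ, hxφ⟩ := hex₁ x
      refine ⟨_, Or.inl ⟨φ, hφ, rfl⟩, ⟨x, hx, rfl⟩, ?_⟩
      rw [mem_preimage]
      change D.inlHomeo.symm (D.inl x) ∈ φ.source
      rwa [hl x hx]
    · obtain ⟨φ, hφ, hxφ⟩ := hex₂ x
      refine ⟨_, Or.inr ⟨φ, hφ, rfl⟩, ⟨x, hx, rfl⟩, ?_⟩
      rw [mem_preimage]
      change D.inrHomeo.symm (D.inr x) ∈ φ.source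
      rwa [hr x hx]
  have t11 : ContMDiffOn I₁ I₁ ∞ (D.inlHomeo.symm ∘ D.inlHomeo)
      (D.inlHomeo.source ∩ D.inlHomeo ⁻¹' D.inlHomeo.target) :=
    contMDiffOn_id.congr fun x hx => hl x hx.1
  have t22 : ContMDiffOn I₂ I₂ ∞ (D.inrHomeo.symm ∘ D.inrHomeo)
      (D.inrHomeo.source ∩ D.inrHomeo ⁻¹' D.inrHomeo.target) :=
    contMDiffOn_id.congr fun x hx => hr x hx.1
  have t12 : ContMDiffOn I₁ I₂ ∞ (D.inrHomeo.symm ∘ D.inlHomeo)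
      (D.inlHomeo.source ∩ D.inlHomeo ⁻¹' D.inrHomeo.target) := by
    have hsub : ∀ x ∈ D.inlHomeo.source ∩ D.inlHomeo ⁻¹' D.inrHomeo.target, x ∈ D.map.source := by
      rintro x ⟨hx, y, hy, hxy⟩
      exact ((inl_eq_inr_iff hx hy).1 hxy.symm).1
    refine (h.mono hsub).congr fun x hx => ?_
    simp only [Function.comp_apply, coe_inlHomeo]
    rw [inl_eq_inr_map (hsub x hx), hr _ (D.target_subset (D.map.map_source (hsub x hx)))]
  have t21 : ContMDiffOn I₂ I₁ ∞ (D.inlHomeo.symm ∘ D.inrHomeo)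
      (D.inrHomeo.source ∩ D.inrHomeo ⁻¹' D.inlHomeo.target) := by
    have hsub : ∀ x ∈ D.inrHomeo.source ∩ D.inrHomeo ⁻¹' D.inlHomeo.target, x ∈ D.map.target := by
      rintro x ⟨hx, y, hy, hxy⟩
      obtain ⟨h1, rfl⟩ := (inl_eq_inr_iff hy hx).1 hxy
      exact D.map.map_source h1
    refine (h'.mono hsub).congr fun x hx => ?_
    simp only [Function.comp_apply, coe_inrHomeo]
    have h1 := inl_eq_inr_map (D.map.map_target (hsub x hx))
    rw [D.map.right_inv (hsub x hx)] at h1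
    rw [← h1, hl _ (D.source_subset (D.map.map_target (hsub x hx)))]
  have htrans : ∀ c ∈ P, ∀ c' ∈ P, ContDiffOn ℝ ∞ (c' ∘ c.symm) (c.symm ≫ₕ c').source := by
    rintro _ (⟨φ, hφ, rfl⟩ | ⟨φ, hφ, rfl⟩) _ (⟨φ', hφ', rfl⟩ | ⟨φ', hφ', rfl⟩)
    · exact contDiffOn_transition t11 hφ hφ'
    · exact contDiffOn_transition t12 hφ hφ'
    · exact contDiffOn_transition t21 hφ hφ'
    · exact contDiffOn_transition t22 hφ hφ'
  let _ : ChartedSpace E D.Space := chartedSpaceOfCharts P hP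
  have hman : IsManifold 𝓘(ℝ, E) ∞ D.Space := isManifold_of_charts P hP htrans
  refine ⟨inferInstance, hman, ?_, ?_⟩
  · exact isLocalDiffeomorphOn_of_charts D.inlHomeo fun y _ => by
      obtain ⟨φ, hφ, hy⟩ := hex₁ y
      exact ⟨φ, hφ, hy, isSmoothChart_of_mem P hP htrans (Or.inl ⟨φ, hφ, rfl⟩)⟩
  · exact isLocalDiffeomorphOn_of_charts D.inrHomeo fun y _ => by
      obtain ⟨φ, hφ, hy⟩ := hex₂ y
      exact ⟨φ, hφ, hy, isSmoothChart_of_mem P hP htrans (Or.inr ⟨φ, hφ, rfl⟩)⟩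

end Smooth

section Action

variable {G : Type} [Group G] [MulAction G X₁] [MulAction G X₂]

/-- Actions on the two parts which are compatible with the identification glue. -/
theorem exists_mulAction (hl : ∀ (g : G), ∀ x ∈ D.left, g • x ∈ D.left)
    (hr : ∀ (g : G), ∀ y ∈ D.right, g • y ∈ D.right)
    (hs : ∀ (g : G), ∀ x ∈ D.map.source, g • x ∈ D.map.source ∧ D.map (g • x) = g • D.map x) :
    ∃ _ : MulAction G D.Space, (∀ (g : G), ∀ x ∈ D.left, D.inl (g • x) = g • D.inl x) ∧
      ∀ (g : G), ∀ y ∈ D.right, D.inr (g • y) = g • D.inr y := by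
  have hs' : ∀ (g : G) (x : X₁), g • x ∈ D.map.source ↔ x ∈ D.map.source := fun g x =>
    ⟨fun h => by simpa using (hs g⁻¹ _ h).1, fun h => (hs g x h).1⟩
  have hsymm : ∀ (g : G), ∀ y ∈ D.map.target, g • y ∈ D.map.target ∧
      D.map.symm (g • y) = g • D.map.symm y := by
    intro g y hy
    have h1 := hs g _ (D.map.map_target hy)
    rw [D.map.right_inv hy] at h1
    rw [← h1.2]
    exact ⟨D.map.map_source h1.1, D.map.left_inv h1.1⟩
  have ht' : ∀ (g : G) (y : X₂), g • y ∈ D.map.target ↔ y ∈ D.map.target := fun g x =>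
    ⟨fun h => by simpa using (hsymm g⁻¹ _ h).1, fun h => (hsymm g x h).1⟩
  have hpl : ∀ (g : G) (x : X₁), D.preInl (g • x) = g • D.preInl x := by
    intro g x
    by_cases h : x ∈ D.map.source
    · simp [preInl, h, hs', (hs g x h).2]
    · simp [preInl, h, hs']
  have hpr : ∀ (g : G) (x : X₂), D.preInr (g • x) = g • D.preInr x := by
    intro g x
    by_cases h : x ∈ D.map.target
    · simp [preInr, h, ht', (hsymm g x h).2]
    · simp [preInr, h, ht']
  refine ⟨{ smul := fun g p => ⟨g • p.1, ?_⟩, one_smul := fun p => Subtype.ext (one_smul G p.1),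
            mul_smul := fun g g' p => Subtype.ext (mul_smul g g' p.1) }, ?_, ?_⟩
  · rcases p.2 with ⟨x, hx, h⟩ | ⟨x, hx, h⟩
    · exact Or.inl ⟨g • x, hl g x hx, by rw [hpl, h]⟩
    · exact Or.inr ⟨g • x, hr g x hx, by rw [hpr, h]⟩
  · intro g x hx
    apply Subtype.ext
    rw [val_inl (hl g x hx), hpl, ← val_inl hx]
    rfl
  · intro g x hx
    apply Subtype.ext
    rw [val_inr (hr g x hx), hpr, ← val_inr hx]
    rfl

end Action

end GluingData

/-! ### Connectedness and slice charts -/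

section Connected

variable {X : Type*} [TopologicalSpace X]

/-- A closed subset may be removed from a preconnected set without disconnecting it if this is so
in a neighbourhood of the subset. -/
theorem IsPreconnected.diff_of_isOpen {C K T : Set X} (hC : IsPreconnected C) (hK : IsClosed K)
    (hT : IsOpen T) (hKT : C ∩ K ⊆ T) (h : IsPreconnected ((C ∩ T) \ K)) :
    IsPreconnected (C \ K) := by
  rw [isPreconnected_iff_subset_of_disjoint] at hC h ⊢
  have key : ∀ u v : Set X, IsOpen u → IsOpen v → C \ K ⊆ u ∪ v → C \ K ∩ (u ∩ v) = ∅ →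
      (C ∩ T) \ K ⊆ u → C \ K ⊆ u ∨ C \ K ⊆ v := by
    intro u v hu hv huv hdis hTu
    have h1 : C ⊆ (u \ K ∪ T) ∪ v \ K := by
      intro x hx
      by_cases hxK : x ∈ K
      · exact Or.inl (Or.inr (hKT ⟨hx, hxK⟩))
      · rcases huv ⟨hx, hxK⟩ with h2 | h2
        · exact Or.inl (Or.inl ⟨h2, hxK⟩)
        · exact Or.inr ⟨h2, hxK⟩
    have h2 : C ∩ ((u \ K ∪ T) ∩ (v \ K)) = ∅ := by
      rw [eq_empty_iff_forall_notMem] at hdis ⊢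
      rintro x ⟨hx, hxu | hxT, hxv, hxK⟩
      · exact hdis x ⟨⟨hx, hxK⟩, hxu.1, hxv⟩
      · exact hdis x ⟨⟨hx, hxK⟩, hTu ⟨⟨hx, hxT⟩, hxK⟩, hxv⟩
    rcases hC _ _ ((hu.sdiff hK).union hT) (hv.sdiff hK) h1 h2 with h1 | h1
    · left
      rintro x ⟨hx, hxK⟩
      rcases h1 hx with h2 | h2
      · exact h2.1
      · exact hTu ⟨⟨hx, h2⟩, hxK⟩
    · right
      exact fun x hx => (h1 hx.1).1
  intro u v hu hv huv hdis
  rcases h u v hu hv (fun x hx => huv ⟨hx.1.1, hx.2⟩) (by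
    rw [eq_empty_iff_forall_notMem] at hdis ⊢
    exact fun x hx => hdis x ⟨⟨hx.1.1.1, hx.1.2⟩, hx.2⟩) with h1 | h1
  · exact key u v hu hv huv hdis h1
  · exact (key v u hv hu (by rwa [union_comm]) (by rwa [inter_comm v u]) h1).symm

/-- A connected set whose complement in `S` is separated from it is a connected component. -/
theorem isComponentOf_of_isClosed {A B S : Set X} (hA : IsConnected A) (hAS : A ⊆ S)
    (hAc : IsClosed A) (hBc : IsClosed B) (hS : S ⊆ A ∪ B) (hAB : Disjoint A B) :
    IsComponentOf A S := by
  obtain ⟨x, hx⟩ := hA.nonempty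
  refine ⟨x, hAS hx, Subset.antisymm (hA.isPreconnected.subset_connectedComponentIn hx hAS) ?_⟩
  have h := isPreconnected_connectedComponentIn (x := x) (F := S)
  rw [isPreconnected_iff_subset_of_disjoint_closed] at h
  rcases h A B hAc hBc ((connectedComponentIn_subset S x).trans hS)
    (by rw [hAB.inter_eq, inter_empty]) with h1 | h1
  · exact h1
  · exact absurd (h1 (mem_connectedComponentIn (hAS hx))) (Set.disjoint_left.1 hAB hx)

end Connected

section Slices

theorem IsSmoothChart.prod {E H M E' H' M' F F' : Type*}
    [NormedAddCommGroup E] [NormedSpace ℝ E] [TopologicalSpace H] {I : ModelWithCorners ℝ E H}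
    [TopologicalSpace M] [ChartedSpace H M]
    [NormedAddCommGroup E'] [NormedSpace ℝ E'] [TopologicalSpace H']
    {I' : ModelWithCorners ℝ E' H'} [TopologicalSpace M'] [ChartedSpace H' M']
    [NormedAddCommGroup F] [NormedSpace ℝ F] [NormedAddCommGroup F'] [NormedSpace ℝ F']
    {φ : OpenPartialHomeomorph M F} {ψ : OpenPartialHomeomorph M' F'} (hφ : IsSmoothChart I φ)
    (hψ : IsSmoothChart I' ψ) : IsSmoothChart (I.prod I') (φ.prod ψ) := by
  constructor
  · refine ContMDiffOn.prodMk_space (f := fun p : M × M' => φ p.1) (g := fun p => ψ p.2) ?_ ?_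
    · exact hφ.contMDiffOn.comp contMDiffOn_fst fun p hp => hp.1
    · exact hψ.contMDiffOn.comp contMDiffOn_snd fun p hp => hp.2
  · refine ContMDiffOn.prodMk (f := fun p : F × F' => φ.symm p.1) (g := fun p => ψ.symm p.2) ?_ ?_
    · exact hφ.contMDiffOn_symm.comp contDiff_fst.contMDiff.contMDiffOn fun p hp => hp.1
    · exact hψ.contMDiffOn_symm.comp contDiff_snd.contMDiff.contMDiffOn fun p hp => hp.2

variable {E H M : Type} [NormedAddCommGroup E] [NormedSpace ℝ E]
  [TopologicalSpace H] {I : ModelWithCorners ℝ E H} [TopologicalSpace M] [ChartedSpace H M]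
  {E' H' M' : Type} [NormedAddCommGroup E'] [NormedSpace ℝ E']
  [TopologicalSpace H'] {I' : ModelWithCorners ℝ E' H'} [TopologicalSpace M'] [ChartedSpace H' M']
  {D K F D' K' : Type} [NormedAddCommGroup D] [NormedSpace ℝ D]
  [NormedAddCommGroup K] [NormedSpace ℝ K] [NormedAddCommGroup F] [NormedSpace ℝ F]
  [NormedAddCommGroup D'] [NormedSpace ℝ D'] [NormedAddCommGroup K'] [NormedSpace ℝ K']

variable (I D K) in
/-- There is a slice chart for `C` around `x`. -/
def HasSliceAt (C : Set M) (x : M) : Prop :=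
  ∃ φ : OpenPartialHomeomorph M (D × K), IsSliceChart I C φ ∧ x ∈ φ.source

/-- A surjective linear map becomes a projection in suitable coordinates. -/
theorem exists_equiv_prod_of_surjective [FiniteDimensional ℝ D] [FiniteDimensional ℝ K]
    [FiniteDimensional ℝ F] {T : F →ₗ[ℝ] K} (hT : Function.Surjective T)
    (hdim : Module.finrank ℝ D + Module.finrank ℝ K = Module.finrank ℝ F) :
    ∃ L : F ≃L[ℝ] (D × K), ∀ x, (L x).2 = T x := by
  obtain ⟨G, hG⟩ := (LinearMap.ker T).exists_isCompl
  have h1 : Module.finrank ℝ D = Module.finrank ℝ (LinearMap.ker T) := by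
    have := LinearMap.finrank_range_add_finrank_ker T
    rw [LinearMap.range_eq_top.2 hT, finrank_top] at this
    omega
  let e : D ≃ₗ[ℝ] LinearMap.ker T := LinearEquiv.ofFinrankEq _ _ h1
  let P : F →ₗ[ℝ] D := e.symm.toLinearMap ∘ₗ (LinearMap.ker T).projectionOnto G hG
  have hP : LinearMap.range P = ⊤ := by
    rw [LinearMap.range_comp, Submodule.range_projectionOnto]
    simp
  have hPk : LinearMap.ker P = G := by
    rw [LinearMap.ker_comp]
    simp
  exact ⟨(LinearMap.equivProdOfSurjectiveOfIsCompl P T hP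
    (LinearMap.range_eq_top.2 hT) (by rw [hPk]; exact hG.symm)).toContinuousLinearEquiv,
    fun _ => rfl⟩

/-- A surjective linear map which cuts out `C` in a chart gives a slice chart. -/
theorem IsSmoothChart.hasSliceAt [FiniteDimensional ℝ D] [FiniteDimensional ℝ K]
    [FiniteDimensional ℝ F] {φ : OpenPartialHomeomorph M F} (hφ : IsSmoothChart I φ)
    {T : F →ₗ[ℝ] K} (hT : Function.Surjective T)
    (hdim : Module.finrank ℝ D + Module.finrank ℝ K = Module.finrank ℝ F) {C : Set M}
    (hC : ∀ y ∈ φ.source, y ∈ C ↔ T (φ y) = 0) {x : M} (hx : x ∈ φ.source) :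
    HasSliceAt I D K C x := by
  obtain ⟨L, hL⟩ := exists_equiv_prod_of_surjective (D := D) hT hdim
  refine ⟨_, ⟨hφ.trans_equiv L, ?_⟩, by simpa using hx⟩
  intro y hy
  rw [hC y (by simpa using hy), ← hL]
  rfl

theorem HasSliceAt.prod {C : Set M} {C' : Set M'} {x : M} {x' : M'} (h : HasSliceAt I D K C x)
    (h' : HasSliceAt I' D' K' C' x') :
    HasSliceAt (I.prod I') (D × D') (K × K') (C ×ˢ C') (x, x') := by
  obtain ⟨φ, hφ, hx⟩ := h
  obtain ⟨ψ, hψ, hx'⟩ := h'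
  let L : ((D × K) × (D' × K')) ≃L[ℝ] ((D × D') × (K × K')) :=
    ContinuousLinearEquiv.prodProdProdComm ℝ D K D' K'
  refine ⟨_, ⟨(hφ.toIsSmoothChart.prod hψ.toIsSmoothChart).trans_equiv L, ?_⟩, ?_⟩
  · rintro ⟨y, y'⟩ hy
    have hy' : y ∈ φ.source ∧ y' ∈ ψ.source := by simpa using hy
    rw [Set.mem_prod, hφ.mem_iff y hy'.1, hψ.mem_iff y' hy'.2]
    exact (Prod.mk_eq_zero (x := (φ y).2) (y := (ψ y').2)).symm
  · simpa using ⟨hx, hx'⟩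

theorem HasSliceAt.congr_equiv {C : Set M} {x : M} (h : HasSliceAt I D K C x) (e : D ≃L[ℝ] D')
    (e' : K ≃L[ℝ] K') : HasSliceAt I D' K' C x := by
  obtain ⟨φ, hφ, hx⟩ := h
  refine ⟨_, ⟨hφ.toIsSmoothChart.trans_equiv (e.prodCongr e'), ?_⟩, by simpa using hx⟩
  intro y hy
  rw [hφ.mem_iff y (by simpa using hy)]
  exact (map_eq_zero_iff e' e'.injective (x := (φ y).2)).symm

/-- Slice charts may be transported along local diffeomorphisms. -/
theorem HasSliceAt.image {C : Set M} {C' : Set M'} {x : M} {f : M → M'}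
    (h : HasSliceAt I D K C x) (hf : IsLocalDiffeomorphAt I I' ∞ f x)
    (hC : ∀ᶠ y in 𝓝 x, f y ∈ C' ↔ y ∈ C) : HasSliceAt I' D K C' (f x) := by
  obtain ⟨φ, hφ, hx⟩ := h
  obtain ⟨Φ, hxΦ, hΦ⟩ := hf
  obtain ⟨U, hU, hUo, hxU⟩ := eventually_nhds_iff.1 hC
  let χ : OpenPartialHomeomorph M' (D × K) :=
    (Φ.toOpenPartialHomeomorph.restrOpen U hUo).symm ≫ₕ φ
  have hχs : ∀ y, y ∈ χ.source ↔ y ∈ Φ.target ∧ Φ.symm y ∈ U ∧ Φ.symm y ∈ φ.source := by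
    intro y
    have h1 : y ∈ χ.source ↔ (y ∈ Φ.target ∧ Φ.symm y ∈ U) ∧ Φ.symm y ∈ φ.source := by
      simp only [χ, mfld_simps]
      rfl
    rw [h1, and_assoc]
  have hχt : ∀ d, d ∈ χ.target ↔ d ∈ φ.target ∧ φ.symm d ∈ Φ.source ∧ φ.symm d ∈ U := by
    intro d
    simp only [χ, mfld_simps]
    rfl
  have hleft : ∀ y ∈ Φ.target, f (Φ.symm y) = y := fun y hy =>
    (hΦ (Φ.toPartialEquiv.map_target hy)).trans (Φ.toPartialEquiv.right_inv hy)
  refine ⟨χ, ⟨⟨?_, ?_⟩, ?_⟩, ?_⟩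
  · have h1 : ContMDiffOn I' I ∞ Φ.symm Φ.target := Φ.contMDiffOn_invFun
    exact hφ.contMDiffOn.comp (h1.mono fun y hy => ((hχs y).1 hy).1)
      fun y hy => ((hχs y).1 hy).2.2
  · have h1 : ContMDiffOn I I' ∞ Φ Φ.source := Φ.contMDiffOn_toFun
    exact h1.comp (hφ.contMDiffOn_symm.mono fun d hd => ((hχt d).1 hd).1)
      fun d hd => ((hχt d).1 hd).2.1
  · intro y hy
    have h1 := (hχs y).1 hy
    have h2 := hφ.mem_iff _ h1.2.2
    rw [← hU _ h1.2.1, hleft y h1.1] at h2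
    exact h2
  · have h3 : Φ.symm (f x) = x := by
      rw [hΦ hxΦ]; exact Φ.toPartialEquiv.left_inv hxΦ
    rw [hχs, h3]
    refine ⟨?_, hxU, hx⟩
    rw [hΦ hxΦ]
    exact Φ.toPartialEquiv.map_source hxΦ

end Slices

section SphereSlices

variable {G : Type} [Group G] {E : Type} [NormedAddCommGroup E] [InnerProductSpace ℝ E]
  [FiniteDimensional ℝ E]
  {ρ : G →* (E ≃ₗᵢ[ℝ] E)} {n : ℕ} [hn : Fact (Module.finrank ℝ E = n + 1)]
  {D K : Type} [NormedAddCommGroup D] [NormedSpace ℝ D] [FiniteDimensional ℝ D]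
  [NormedAddCommGroup K] [NormedSpace ℝ K] [FiniteDimensional ℝ K]

open Metric in
/-- In the stereographic projection from a point of it, a linear subsphere is a linear subspace. -/
theorem RepSphere.hasSliceAt {T : E →ₗ[ℝ] K} (hT : Function.Surjective T)
    (hdim : Module.finrank ℝ D + Module.finrank ℝ K = n) {x : RepSphere ρ} (hx : T x.val = 0) :
    HasSliceAt (𝓡 n) D K {y : RepSphere ρ | T y.val = 0} x := by
  let x' : sphere (0 : E) 1 := x
  let v : sphere (0 : E) 1 := -x'
  have hv : T v = 0 := by
    have h : (v : E) = -x.val := coe_neg_sphere x'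
    rw [h, map_neg, hx, neg_zero]
  let U : _ ≃ₗᵢ[ℝ] _ :=
    (OrthonormalBasis.fromOrthogonalSpanSingleton (𝕜 := ℝ) n (ne_zero_of_mem_unit_sphere v)).repr
  let T' : EuclideanSpace ℝ (Fin n) →ₗ[ℝ] K :=
    T ∘ₗ (ℝ ∙ (v : E))ᗮ.subtype ∘ₗ U.symm.toLinearEquiv.toLinearMap
  have hproj : ∀ y : E, T ((ℝ ∙ (v : E))ᗮ.orthogonalProjectionOnto y : E) = T y := by
    intro y
    have h1 : y - ((ℝ ∙ (v : E))ᗮ.orthogonalProjectionOnto y : E) ∈ (ℝ ∙ (v : E)) := by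
      have := Submodule.sub_starProjection_mem_orthogonal (K := (ℝ ∙ (v : E))ᗮ) y
      rwa [Submodule.orthogonal_orthogonal] at this
    obtain ⟨c, hc⟩ := Submodule.mem_span_singleton.1 h1
    have h2 := congrArg T hc
    rw [map_smul, hv, smul_zero, map_sub] at h2
    exact (sub_eq_zero.1 h2.symm).symm
  have hT' : Function.Surjective T' := by
    intro b
    obtain ⟨a, rfl⟩ := hT b
    refine ⟨U ((ℝ ∙ (v : E))ᗮ.orthogonalProjectionOnto a), ?_⟩
    simp only [T', LinearMap.comp_apply]
    rw [← hproj a]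
    refine congrArg T ?_
    change ((U.symm (U _) : (ℝ ∙ (v : E))ᗮ) : E) = _
    rw [U.symm_apply_apply]
  refine (isSmoothChart_extChartHomeo (I := 𝓡 n) x).hasSliceAt hT' (by simpa using hdim) ?_
    (mem_extChartHomeo_source x)
  intro y hy
  rw [extChartHomeo_source, extChartAt_source] at hy
  have hy' : (y : sphere (0 : E) 1) ≠ v := by
    have h1 : (y : sphere (0 : E) 1) ∈ (stereographic' n v).source := hy
    rw [stereographic'_source] at h1
    exact h1
  rw [coe_extChartHomeo]
  have h1 : extChartAt (𝓡 n) x y = U (stereoToFun (v : E) y.val) := rfl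
  have h2 : T' (extChartAt (𝓡 n) x y) = (2 / (1 - innerSL ℝ (v : E) y.val)) • T y.val := by
    rw [h1, ← hproj, ← map_smul]
    simp only [T', LinearMap.comp_apply]
    congr 1
    change ((U.symm (U _) : (ℝ ∙ (v : E))ᗮ) : E) = _
    rw [U.symm_apply_apply, stereoToFun_apply]
    rfl
  have h3 : (2 / (1 - innerSL ℝ (v : E) y.val) : ℝ) ≠ 0 := by
    refine div_ne_zero two_ne_zero (sub_ne_zero.2 fun h => hy' ?_)
    have h4 := (inner_eq_one_iff_of_norm_eq_one (𝕜 := ℝ) (mem_sphere_zero_iff_norm.1 v.2)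
      y.norm_val).1 h.symm
    exact Subtype.ext h4.symm
  rw [h2, smul_eq_zero_iff_right h3]
  rfl

end SphereSlices

/-! ### The sphere `M₁` -/

section WithLpProd

variable {E F Z : Type*} [NormedAddCommGroup E] [NormedSpace ℝ E] [NormedAddCommGroup F]
  [NormedSpace ℝ F] [NormedAddCommGroup Z] [NormedSpace ℝ Z] {m : WithTop ℕ∞}

theorem contDiff_withLp_fst : ContDiff ℝ m (fun x : WithLp 2 (E × F) => x.fst) :=
  contDiff_fst.comp WithLp.contDiff_ofLp

theorem contDiff_withLp_snd : ContDiff ℝ m (fun x : WithLp 2 (E × F) => x.snd) :=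
  contDiff_snd.comp WithLp.contDiff_ofLp

theorem ContDiff.withLp_mk {f : Z → E} {g : Z → F} (hf : ContDiff ℝ m f) (hg : ContDiff ℝ m g) :
    ContDiff ℝ m (fun z => (WithLp.toLp 2 (f z, g z) : WithLp 2 (E × F))) :=
  WithLp.contDiff_toLp.comp (hf.prodMk hg)

theorem withLp_eq {x y : WithLp 2 (E × F)} (h1 : x.fst = y.fst) (h2 : x.snd = y.snd) : x = y :=
  WithLp.ofLp_injective 2 (Prod.ext h1 h2)

theorem withLp_eq_zero_iff {x : WithLp 2 (E × F)} : x = 0 ↔ x.fst = 0 ∧ x.snd = 0 :=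
  ⟨fun h => by simp [h], fun h => withLp_eq h.1 h.2⟩

theorem eq_zero_of_neg_eq_self {x : E} (h : -x = x) : x = 0 := by
  have h1 : (2 : ℝ) • x = 0 := by
    rw [two_smul]; nth_rewrite 1 [← h]; exact neg_add_cancel x
  exact (smul_eq_zero.1 h1).resolve_left two_ne_zero

end WithLpProd

theorem finrank_euclideanSpace_complex (k : ℕ) :
    Module.finrank ℝ (EuclideanSpace ℂ (Fin k)) = 2 * k := by
  rw [(WithLp.linearEquiv 2 ℝ (Fin k → ℂ)).finrank_eq, Module.finrank_pi_fintype]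
  simp [mul_comm]

section Sphere

variable {E : Type} [NormedAddCommGroup E] [InnerProductSpace ℝ E]
  {n : ℕ} [hn : Fact (Module.finrank ℝ E = n + 1)]

theorem RepSphere.nonempty {G : Type} [Group G] (ρ : G →* (E ≃ₗᵢ[ℝ] E))
    (h : Module.finrank ℝ E = n + 1) : Nonempty (RepSphere ρ) := by
  have : Nontrivial E := Module.nontrivial_of_finrank_pos (R := ℝ) (by omega)
  obtain ⟨x, hx⟩ := exists_norm_eq E (c := 1) zero_le_one
  exact ⟨RepSphere.ofNorm x hx⟩

theorem hasLocalSection_toSphere {G : Type} [Group G] {ρ : G →* (E ≃ₗᵢ[ℝ] E)}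
    [Nonempty (RepSphere ρ)] {w : E} (hw : w ≠ 0) :
    HasLocalSection 𝓘(ℝ, E) (𝓡 n) (toSphere ρ) w := by
  refine ⟨fun x => ‖w‖ • x.val, univ, isOpen_univ, mem_univ _, ?_, ?_, ?_⟩
  · exact ((contDiff_const_smul ‖w‖).contMDiff.comp RepSphere.contMDiff_val).contMDiffOn
  · change ‖w‖ • (toSphere ρ w).val = w
    rw [val_toSphere hw, smul_inv_smul₀ (norm_ne_zero_iff.2 hw)]
  · intro x _
    rw [toSphere_smul (norm_pos_iff.2 hw), toSphere_val]

variable [FiniteDimensional ℝ E]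

/-- Spheres are orientable, being presented as quotients of `E \ {0}` by positive scalars. -/
theorem RepSphere.orientable {G : Type} [Group G] (ρ : G →* (E ≃ₗᵢ[ℝ] E)) :
    Orientable (𝓡 n) (RepSphere ρ) := by
  have : Nonempty (RepSphere ρ) := RepSphere.nonempty ρ hn.out
  have hpos : ∀ w ∈ ({0}ᶜ : Set E), 0 < ‖w‖ := fun w hw => norm_pos_iff.2 hw
  have hpres : IsPresentation (𝓡 n) (toSphere ρ) (fun w : E => Real.log ‖w‖) ({0}ᶜ : Set E) := by
    refine ⟨isOpen_compl_singleton, fun w hw => ?_, fun w hw => ?_, fun w hw => ?_⟩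
    · exact ((contMDiffAt_toSphere hw).of_le (by simp)).contMDiffWithinAt
    · exact ((contDiffAt_norm ℝ hw).log (hpos w hw).ne').contDiffWithinAt
    · refine ⟨fun p => Real.exp p.2 • p.1.val, ?_, ?_⟩
      · have h1 : MDifferentiable ((𝓡 n).prod 𝓘(ℝ, ℝ)) 𝓘(ℝ, E)
            (fun p : RepSphere ρ × ℝ => p.1.val) :=
          (RepSphere.contMDiff_val.mdifferentiable (by simp)).comp mdifferentiable_fst
        have h2 : MDifferentiable ((𝓡 n).prod 𝓘(ℝ, ℝ)) 𝓘(ℝ, ℝ)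
            (fun p : RepSphere ρ × ℝ => Real.exp p.2) :=
          Real.differentiable_exp.mdifferentiable.comp mdifferentiable_snd
        exact (h2 _).smul (h1 _)
      · filter_upwards [isOpen_compl_singleton.mem_nhds hw] with y hy
        rw [Real.exp_log (hpos y hy), val_toSphere hy, smul_inv_smul₀ (hpos y hy).ne']
  have hJ : Module.finrank ℝ (EuclideanSpace ℝ (Fin n) × ℝ) = Module.finrank ℝ E := by
    rw [Module.finrank_prod, finrank_euclideanSpace_fin, Module.finrank_self, hn.out]
  refine hpres.orientable (ContinuousLinearEquiv.ofFinrankEq hJ) ?_ ?_ ?_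
  · exact eq_univ_of_forall fun x => ⟨x.val, x.val_ne_zero, toSphere_val x⟩
  · exact fun w hw U hU => (hasLocalSection_toSphere (n := n) hw).image_mem_nhds hU
  · intro w hw w' hw' heq
    have hc : 0 < ‖w'‖ / ‖w‖ := div_pos (hpos w' hw') (hpos w hw)
    refine ⟨(‖w'‖ / ‖w‖) • ContinuousLinearMap.id ℝ E, ?_, ?_, ?_, Real.log (‖w'‖ / ‖w‖), ?_⟩
    · have h1 := LinearMap.det_smul (‖w'‖ / ‖w‖) (LinearMap.id : E →ₗ[ℝ] E)
      rw [LinearMap.det_id, mul_one] at h1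
      have h2 : ((‖w'‖ / ‖w‖) • ContinuousLinearMap.id ℝ E).det = (‖w'‖ / ‖w‖) ^ Module.finrank ℝ E :=
        h1
      rw [h2]
      positivity
    · have h1 := congrArg RepSphere.val heq
      rw [val_toSphere hw, val_toSphere hw'] at h1
      change (‖w'‖ / ‖w‖) • w = w'
      rw [div_eq_mul_inv, mul_smul, h1, smul_inv_smul₀ (hpos w' hw').ne']
    · exact Eventually.of_forall fun y => toSphere_smul hc y
    · filter_upwards [isOpen_compl_singleton.mem_nhds hw] with y hy
      change Real.log ‖(‖w'‖ / ‖w‖) • y‖ = _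
      rw [norm_smul, Real.norm_of_nonneg hc.le, Real.log_mul hc.ne' (hpos y hy).ne', add_comm]

/-- The circle acts smoothly on the sphere if the representation is the restriction of a smooth
map of the complex numbers. -/
theorem RepSphere.contMDiffSMul {ρ : Circle →* (E ≃ₗᵢ[ℝ] E)} {Ψ : ℂ × E → E}
    (hΨ : ContDiff ℝ ∞ Ψ) (h : ∀ z x, ρ z x = Ψ ((z : ℂ), x)) :
    ContMDiffSMul (𝓡 1) (𝓡 n) ∞ Circle (RepSphere ρ) := by
  refine ⟨fun p => RepSphere.contMDiffAt_of_val ?_⟩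
  have h1 : ContMDiff ((𝓡 1).prod (𝓡 n)) 𝓘(ℝ, ℂ × E) ∞
      (fun p : Circle × RepSphere ρ => ((p.1 : ℂ), p.2.val)) :=
    (contMDiff_circle_coe.comp contMDiff_fst).prodMk_space
      (RepSphere.contMDiff_val.comp contMDiff_snd)
  have h2 : (fun p : Circle × RepSphere ρ => (p.1 • p.2).val) =
      fun p => Ψ ((p.1 : ℂ), p.2.val) := funext fun p => h p.1 p.2.val
  rw [h2]
  exact (hΨ.contMDiff.comp h1).contMDiffAt

end Sphere

section MOne

variable {k₁ k₂ : ℕ}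

instance : Nonempty (MOne k₁ k₂) := 
  RepSphere.nonempty (n := 2 * k₁ + 2 * k₂) (repOne k₁ k₂) Fact.out

theorem weightRep_apply (j k : ℕ) (z : Circle) (v : EuclideanSpace ℂ (Fin k)) :
    weightRep j k z v = (z : ℂ) ^ j • v := by
  ext i
  change rotation (z ^ j) (v i) = (z : ℂ) ^ j * v i
  rw [rotation_apply, Circle.coe_pow]

theorem repOne_apply (z : Circle)
    (v : WithLp 2 (WithLp 2 (EuclideanSpace ℂ (Fin k₁) × EuclideanSpace ℂ (Fin k₂)) × ℝ)) :
    repOne k₁ k₂ z v = WithLp.toLp 2 (WithLp.toLp 2 ((z : ℂ) • v.fst.fst, (z : ℂ) ^ 2 • v.fst.snd),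
      v.snd) := by
  have h1 := weightRep_apply 1 k₁ z v.fst.fst
  have h2 := weightRep_apply 2 k₂ z v.fst.snd
  rw [pow_one] at h1
  rw [← h1, ← h2]
  rfl

theorem MOne.contMDiffSMul :
    ContMDiffSMul (𝓡 1) (IOne k₁ k₂) ∞ Circle (MOne k₁ k₂) := by
  refine RepSphere.contMDiffSMul (Ψ := fun p => WithLp.toLp 2 (WithLp.toLp 2
    (p.1 • p.2.fst.fst, p.1 ^ 2 • p.2.fst.snd), p.2.snd)) ?_ repOne_apply
  refine ContDiff.withLp_mk (ContDiff.withLp_mk ?_ ?_) ?_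
  · exact contDiff_fst.smul (contDiff_withLp_fst.comp (contDiff_withLp_fst.comp contDiff_snd))
  · exact (contDiff_fst.pow 2).smul (contDiff_withLp_snd.comp (contDiff_withLp_fst.comp contDiff_snd))
  · exact contDiff_withLp_snd.comp contDiff_snd

theorem MOne.isClosedCircleManifold :
    IsClosedCircleManifold (IOne k₁ k₂) (MOne k₁ k₂) :=
  ⟨inferInstance, inferInstance, inferInstance, MOne.contMDiffSMul⟩

theorem MOne.smul_eq_iff (z : Circle) (x : MOne k₁ k₂) :
    z • x = x ↔ (z : ℂ) • x.val.fst.fst = x.val.fst.fst ∧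
      (z : ℂ) ^ 2 • x.val.fst.snd = x.val.fst.snd := by
  have h : z • x = x ↔ repOne k₁ k₂ z x.val = x.val :=
    ⟨fun h => congrArg RepSphere.val h, fun h => RepSphere.ext h⟩
  rw [h, repOne_apply]
  constructor
  · intro h
    exact ⟨congrArg (fun v => v.fst.fst) h, congrArg (fun v => v.fst.snd) h⟩
  · rintro ⟨h1, h2⟩
    exact withLp_eq (withLp_eq h1 h2) rfl

theorem neg_one_mem_Z2 : (-1 : Circle) ∈ Z2 := (mem_Z2_iff _).2 (Or.inr rfl)

theorem coe_neg_one_circle : ((-1 : Circle) : ℂ) = -1 := rfl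

theorem fixedPoints_Z2_iff {X : Type*} [MulAction Circle X] {x : X} :
    x ∈ fixedPoints Z2 X ↔ (-1 : Circle) • x = x := by
  constructor
  · exact fun h => h ⟨-1, neg_one_mem_Z2⟩
  · rintro h ⟨ε, hε⟩
    rcases (mem_Z2_iff ε).1 hε with rfl | rfl
    · exact one_smul _ _
    · exact h

theorem fixedPoints_circle_subset (X : Type*) [MulAction Circle X] :
    fixedPoints Circle X ⊆ fixedPoints Z2 X := fun _ hx ε => hx ε

theorem MOne.fixedPoints_Z2 : fixedPoints Z2 (MOne k₁ k₂) = {x | x.val.fst.fst = 0} := by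
  ext x
  rw [fixedPoints_Z2_iff, MOne.smul_eq_iff, coe_neg_one_circle, mem_ofPred_eq]
  constructor
  · rintro ⟨h, -⟩
    rw [neg_smul, one_smul] at h
    exact eq_zero_of_neg_eq_self h
  · intro h
    simp [h]

theorem MOne.mem_fixedPoints_circle_iff {x : MOne k₁ k₂} :
    x ∈ fixedPoints Circle (MOne k₁ k₂) ↔ x.val.fst = 0 := by
  rw [withLp_eq_zero_iff]
  constructor
  · intro h
    refine ⟨?_, ?_⟩
    · have h1 := fixedPoints_circle_subset _ h
      rwa [MOne.fixedPoints_Z2] at h1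
    · have h1 := ((MOne.smul_eq_iff _ x).1 (h (circleOfNorm Complex.I Complex.norm_I))).2
      rw [coe_circleOfNorm, Complex.I_sq, neg_smul, one_smul] at h1
      exact eq_zero_of_neg_eq_self h1
  · rintro ⟨h1, h2⟩ z
    rw [MOne.smul_eq_iff, h1, h2]
    simp

/-- The two poles of `M₁`. -/
def MOne.pole (t : ℝ) (ht : |t| = 1) : MOne k₁ k₂ :=
  RepSphere.ofNorm (WithLp.toLp 2 (0, t)) (by
    rw [WithLp.prod_norm_eq_of_L2]
    simp [ht])

theorem MOne.fixedPoints_circle : fixedPoints Circle (MOne k₁ k₂) =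
    {MOne.pole 1 (by simp), MOne.pole (-1) (by simp)} := by
  ext x
  rw [MOne.mem_fixedPoints_circle_iff]
  constructor
  · intro h
    have h1 := x.norm_val
    rw [WithLp.prod_norm_eq_of_L2, h] at h1
    simp only [norm_zero, ne_eq, OfNat.ofNat_ne_zero, not_false_eq_true, zero_pow, zero_add,
      Real.norm_eq_abs, sq_abs, Real.sqrt_sq_eq_abs] at h1
    rcases (abs_eq zero_le_one).1 h1 with h2 | h2
    · exact Or.inl (RepSphere.ext (withLp_eq h h2))
    · exact Or.inr (RepSphere.ext (withLp_eq h h2))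
  · rintro (rfl | rfl) <;> rfl

theorem MOne.ncard_fixedPoints_circle : (fixedPoints Circle (MOne k₁ k₂)).ncard = 2 := by
  rw [MOne.fixedPoints_circle, ncard_pair]
  intro h
  have h1 : (1 : ℝ) = -1 := congrArg (fun x : MOne k₁ k₂ => x.val.snd) h
  norm_num at h1

theorem MOne.isConnected_fixedPoints_Z2 (hk : 1 ≤ k₂) :
    IsConnected (fixedPoints Z2 (MOne k₁ k₂)) := by
  have hrank : 1 < Module.rank ℝ (EuclideanSpace ℂ (Fin k₂) × ℝ) := by
    have h1 : Module.finrank ℝ (EuclideanSpace ℂ (Fin k₂) × ℝ) = 2 * k₂ + 1 := by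
      rw [Module.finrank_prod, finrank_euclideanSpace_complex, Module.finrank_self]
    exact Module.lt_rank_of_lt_finrank (n := 1) (by omega)
  have h1 := isConnected_compl_singleton_of_one_lt_rank hrank 0
  let ι : EuclideanSpace ℂ (Fin k₂) × ℝ →
      WithLp 2 (WithLp 2 (EuclideanSpace ℂ (Fin k₁) × EuclideanSpace ℂ (Fin k₂)) × ℝ) :=
    fun p => WithLp.toLp 2 (WithLp.toLp 2 (0, p.1), p.2)
  have hι : ContDiff ℝ ∞ ι :=
    ContDiff.withLp_mk (ContDiff.withLp_mk contDiff_const contDiff_fst) contDiff_snd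
  have hι0 : ∀ p ∈ ({0}ᶜ : Set (EuclideanSpace ℂ (Fin k₂) × ℝ)), ι p ≠ 0 := by
    intro p hp h
    rw [withLp_eq_zero_iff] at h
    exact hp (Prod.ext (congrArg (fun v => v.snd) h.1) h.2)
  have h2 : ContinuousOn (fun p => (toSphere (repOne k₁ k₂) (ι p))) {0}ᶜ := by
    intro p hp
    exact ((contMDiffAt_toSphere (n := 2 * k₁ + 2 * k₂) (hι0 p hp)).continuousAt.comp
      hι.continuous.continuousAt).continuousWithinAt
  convert h1.image _ h2
  rw [MOne.fixedPoints_Z2]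
  ext x
  constructor
  · intro hx
    have hx' : ι (x.val.fst.snd, x.val.snd) = x.val := withLp_eq (withLp_eq hx.symm rfl) rfl
    refine ⟨(x.val.fst.snd, x.val.snd), ?_, ?_⟩
    · intro h0
      refine x.val_ne_zero ?_
      have h0' : (x.val.fst.snd, x.val.snd) = 0 := h0
      rw [← hx', h0']
      rfl
    · change toSphere _ (ι _) = x
      rw [hx', toSphere_val]
  · rintro ⟨p, hp, rfl⟩
    change (toSphere _ (ι p)).val.fst.fst = 0
    rw [val_toSphere (hι0 p hp)]
    simp [ι]

theorem MOne.hasSliceAt {D K : Type} [NormedAddCommGroup D] [NormedSpace ℝ D]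
    [FiniteDimensional ℝ D] [NormedAddCommGroup K] [NormedSpace ℝ K] [FiniteDimensional ℝ K]
    (hD : Module.finrank ℝ D = 2 * k₂) (hK : Module.finrank ℝ K = 2 * k₁) {x : MOne k₁ k₂}
    (hx : x ∈ fixedPoints Z2 (MOne k₁ k₂)) :
    HasSliceAt (IOne k₁ k₂) D K (fixedPoints Z2 (MOne k₁ k₂)) x := by
  rw [MOne.fixedPoints_Z2] at hx ⊢
  let T : WithLp 2 (WithLp 2 (EuclideanSpace ℂ (Fin k₁) × EuclideanSpace ℂ (Fin k₂)) × ℝ) →ₗ[ℝ]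
      EuclideanSpace ℂ (Fin k₁) := WithLp.fstₗ 2 ℝ _ _ ∘ₗ WithLp.fstₗ 2 ℝ _ _
  have hT : Function.Surjective T := fun a => ⟨WithLp.toLp 2 (WithLp.toLp 2 (a, 0), 0), rfl⟩
  have h := RepSphere.hasSliceAt (ρ := repOne k₁ k₂) (D := D) (n := 2 * k₁ + 2 * k₂) hT
    (by rw [hD, finrank_euclideanSpace_complex, add_comm]) hx
  exact h.congr_equiv (ContinuousLinearEquiv.refl ℝ D)
    (ContinuousLinearEquiv.ofFinrankEq (by rw [finrank_euclideanSpace_complex, hK]))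

end MOne

/-! ### The presentation of `M₂` -/

section Prod

variable {E H M E' H' M' F K N F' K' N' : Type*}
  [NormedAddCommGroup E] [NormedSpace ℝ E] [TopologicalSpace H] {I : ModelWithCorners ℝ E H}
  [TopologicalSpace M] [ChartedSpace H M]
  [NormedAddCommGroup E'] [NormedSpace ℝ E'] [TopologicalSpace H'] {I' : ModelWithCorners ℝ E' H'}
  [TopologicalSpace M'] [ChartedSpace H' M']
  [NormedAddCommGroup F] [NormedSpace ℝ F] [TopologicalSpace K] {J : ModelWithCorners ℝ F K}
  [TopologicalSpace N] [ChartedSpace K N]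
  [NormedAddCommGroup F'] [NormedSpace ℝ F'] [TopologicalSpace K'] {J' : ModelWithCorners ℝ F' K'}
  [TopologicalSpace N'] [ChartedSpace K' N']

theorem IsLocalDiffeomorphAt.prodMap {f : M → M'} {g : N → N'} {x : M} {y : N}
    (hf : IsLocalDiffeomorphAt I I' ∞ f x) (hg : IsLocalDiffeomorphAt J J' ∞ g y) :
    IsLocalDiffeomorphAt (I.prod J) (I'.prod J') ∞ (Prod.map f g) (x, y) := by
  obtain ⟨Φ, hx, hΦ⟩ := hf
  obtain ⟨Ψ, hy, hΨ⟩ := hg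
  refine ⟨{ toPartialEquiv := Φ.toPartialEquiv.prod Ψ.toPartialEquiv
            open_source := Φ.open_source.prod Ψ.open_source
            open_target := Φ.open_target.prod Ψ.open_target
            contMDiffOn_toFun := Φ.contMDiffOn_toFun.prodMap Ψ.contMDiffOn_toFun
            contMDiffOn_invFun := Φ.contMDiffOn_invFun.prodMap Ψ.contMDiffOn_invFun },
    ⟨hx, hy⟩, ?_⟩
  rintro ⟨a, b⟩ ⟨ha, hb⟩
  exact Prod.ext (hΦ ha) (hΨ hb)

theorem isLocalDiffeomorph_id : IsLocalDiffeomorph I I ∞ (id : M → M) :=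
  (Diffeomorph.refl I M ∞).isLocalDiffeomorph

theorem IsLocalDiffeomorph.prodMap {f : M → M'} {g : N → N'}
    (hf : IsLocalDiffeomorph I I' ∞ f) (hg : IsLocalDiffeomorph J J' ∞ g) :
    IsLocalDiffeomorph (I.prod J) (I'.prod J') ∞ (Prod.map f g) := fun p => (hf p.1).prodMap (hg p.2)

end Prod

section Determinants

variable {G : Type} [Group G] {E F : Type} [NormedAddCommGroup E] [InnerProductSpace ℝ E]
  [NormedAddCommGroup F] [InnerProductSpace ℝ F] [FiniteDimensional ℝ E] [FiniteDimensional ℝ F]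

theorem det_sumRep (ρ : G →* (E ≃ₗᵢ[ℝ] E)) (σ : G →* (F ≃ₗᵢ[ℝ] F)) (g : G) :
    LinearMap.det ((sumRep ρ σ g).toLinearEquiv : WithLp 2 (E × F) →ₗ[ℝ] WithLp 2 (E × F)) =
      LinearMap.det ((ρ g).toLinearEquiv : E →ₗ[ℝ] E) *
        LinearMap.det ((σ g).toLinearEquiv : F →ₗ[ℝ] F) := by
  rw [← LinearMap.det_prodMap, ← LinearMap.det_conj _ (WithLp.linearEquiv 2 ℝ (E × F))]
  rfl

open Classical in
/-- The sign `1` or `-1` of an element of `ℤ₂`. -/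
def Z2.sign (ε : Z2) : ℝ := if ε = 1 then 1 else -1

theorem Z2.sign_mul_self (ε : Z2) : Z2.sign ε * Z2.sign ε = 1 := by
  unfold Z2.sign; split_ifs <;> norm_num

theorem Z2.coe_eq_sign (ε : Z2) : ((ε : Circle) : ℂ) = Z2.sign ε := by
  obtain ⟨ε, hε⟩ := ε
  rcases (mem_Z2_iff ε).1 hε with rfl | rfl
  · have : Z2.sign ⟨1, hε⟩ = 1 := if_pos rfl
    rw [this]; simp
  · have h : (⟨-1, hε⟩ : Z2) ≠ 1 := by
      intro h
      have h1 : ((-1 : Circle) : ℂ) = 1 := congrArg (fun z : Z2 => ((z : Circle) : ℂ)) h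
      rw [coe_neg_one_circle] at h1
      norm_num at h1
    have : Z2.sign ⟨-1, hε⟩ = -1 := if_neg h
    rw [this, coe_neg_one_circle]; simp

theorem Z2.sign_neg_one : Z2.sign ⟨-1, neg_one_mem_Z2⟩ = -1 := by
  have h := Z2.coe_eq_sign ⟨-1, neg_one_mem_Z2⟩
  rw [coe_neg_one_circle] at h
  exact_mod_cast h.symm

theorem signRep_apply (n : ℕ) (ε : Z2) (v : EuclideanSpace ℝ (Fin n)) :
    signRep n ε v = Z2.sign ε • v := by
  classical
  change (if ε = 1 then 1 else LinearIsometryEquiv.neg ℝ :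
    EuclideanSpace ℝ (Fin n) ≃ₗᵢ[ℝ] EuclideanSpace ℝ (Fin n)) v = _
  unfold Z2.sign
  split_ifs
  · simp
  · simp

theorem det_signRep (n : ℕ) (ε : Z2) : LinearMap.det ((signRep n ε).toLinearEquiv :
    EuclideanSpace ℝ (Fin n) →ₗ[ℝ] EuclideanSpace ℝ (Fin n)) = Z2.sign ε ^ n := by
  have h : ((signRep n ε).toLinearEquiv :
      EuclideanSpace ℝ (Fin n) →ₗ[ℝ] EuclideanSpace ℝ (Fin n)) = Z2.sign ε • LinearMap.id := by
    ext1 v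
    exact signRep_apply n ε v
  rw [h, LinearMap.det_smul, LinearMap.det_id, mul_one, finrank_euclideanSpace_fin]

theorem det_trivRep (g : G) : LinearMap.det (((1 : G →* (E ≃ₗᵢ[ℝ] E)) g).toLinearEquiv :
    E →ₗ[ℝ] E) = 1 := LinearMap.det_id

theorem trivThreeSignRep_apply (ε : Z2)
    (v : WithLp 2 (EuclideanSpace ℝ (Fin 3) × EuclideanSpace ℝ (Fin 1))) :
    trivThreeSignRep ε v = WithLp.toLp 2 (v.fst, Z2.sign ε • v.snd) := by
  rw [← signRep_apply]
  rfl

theorem signTrivRep_apply (a b : ℕ) (ε : Z2)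
    (v : WithLp 2 (EuclideanSpace ℝ (Fin a) × EuclideanSpace ℝ (Fin b))) :
    signTrivRep a b ε v = WithLp.toLp 2 (Z2.sign ε • v.fst, v.snd) := by
  rw [← signRep_apply]
  rfl

end Determinants

section MTwo

variable {k₁ k₂ : ℕ} [h₁ : Fact (1 ≤ k₁)] [h₂ : Fact (2 ≤ k₂)]

/-- The space `ℝ³ ⊕ ℝ₋`. -/
abbrev VThree : Type := WithLp 2 (EuclideanSpace ℝ (Fin 3) × EuclideanSpace ℝ (Fin 1))

/-- The space `ℝ₋^{2k₁-1} ⊕ ℝ^{2k₂-2}`. -/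
abbrev VSign (k₁ k₂ : ℕ) : Type :=
  WithLp 2 (EuclideanSpace ℝ (Fin (2 * k₁ - 1)) × EuclideanSpace ℝ (Fin (2 * k₂ - 2)))

/-- The unit sphere of `ℝ³ ⊕ ℝ₋`. -/
abbrev SThree : Type := RepSphere trivThreeSignRep

/-- The unit sphere of `ℝ₋^{2k₁-1} ⊕ ℝ^{2k₂-2}`. -/
abbrev SSign (k₁ k₂ : ℕ) : Type := RepSphere (signTrivRep (2 * k₁ - 1) (2 * k₂ - 2))

/-- The model with corners of `S¹ × (S(ℝ³ ⊕ ℝ₋) × S(ℝ₋^{2k₁-1} ⊕ ℝ^{2k₂-2}))`. -/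
abbrev ICover (k₁ k₂ : ℕ) := (𝓡 1).prod ((𝓡 3).prod (𝓡 (2 * k₁ + 2 * k₂ - 4)))

instance : Nonempty SThree := RepSphere.nonempty (n := 3) trivThreeSignRep Fact.out

instance : Nonempty (SSign k₁ k₂) :=
  RepSphere.nonempty (n := 2 * k₁ + 2 * k₂ - 4) (signTrivRep (2 * k₁ - 1) (2 * k₂ - 2)) Fact.out

theorem contMDiff_Z2_smul_fibre (ε : Z2) :
    ContMDiff ((𝓡 3).prod (𝓡 (2 * k₁ + 2 * k₂ - 4))) ((𝓡 3).prod (𝓡 (2 * k₁ + 2 * k₂ - 4))) ∞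
      (fun x : RepProj trivThreeSignRep × SSign k₁ k₂ => ε • x) :=
  ContMDiff.prodMap (RepProj.contMDiff_smul ε) (RepSphere.contMDiff_smul ε)

instance MTwo.isManifold : IsManifold (ITwo k₁ k₂) ∞ (MTwo k₁ k₂) :=
  AssocBundle.isManifold contMDiff_Z2_smul_fibre

theorem MTwo.isClosedCircleManifold : IsClosedCircleManifold (ITwo k₁ k₂) (MTwo k₁ k₂) :=
  ⟨inferInstance, inferInstance, inferInstance, AssocBundle.contMDiffSMul contMDiff_Z2_smul_fibre⟩

/-- The covering `S¹ × S(ℝ³ ⊕ ℝ₋) × S(ℝ₋^{2k₁-1} ⊕ ℝ^{2k₂-2}) → M₂`. -/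
def MTwo.cover (p : Circle × (SThree × SSign k₁ k₂)) : MTwo k₁ k₂ :=
  AssocBundle.mk p.1 (RepProj.mk p.2.1, p.2.2)

theorem MTwo.isLocalDiffeomorph_cover :
    IsLocalDiffeomorph (ICover k₁ k₂) (ITwo k₁ k₂) ∞
      (MTwo.cover : Circle × (SThree × SSign k₁ k₂) → MTwo k₁ k₂) := by
  intro p
  have h1 : IsLocalDiffeomorph (ICover k₁ k₂) (ICover k₁ k₂) ∞
      (Prod.map id (Prod.map RepProj.mk id) : Circle × (SThree × SSign k₁ k₂) → _) :=
    isLocalDiffeomorph_id.prodMap (RepProj.isLocalDiffeomorph_mk.prodMap isLocalDiffeomorph_id)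
  exact (h1 p).comp _ _ (AssocBundle.isLocalDiffeomorph_proj contMDiff_Z2_smul_fibre _)

theorem MTwo.surjective_cover :
    Function.Surjective (MTwo.cover : Circle × (SThree × SSign k₁ k₂) → MTwo k₁ k₂) := by
  intro p
  obtain ⟨⟨z, x, y⟩, rfl⟩ := AssocBundle.surjective_proj p
  obtain ⟨x, rfl⟩ := RepProj.surjective_mk x
  exact ⟨(z, x, y), rfl⟩

/-- The fibres of the covering: the sign `ε` comes from the associated bundle, the sign `δ` from the
projectivization. -/
theorem MTwo.cover_eq_iff {z z' : Circle} {x x' : SThree} {y y' : SSign k₁ k₂} :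
    MTwo.cover (z, x, y) = MTwo.cover (z', x', y') ↔ ∃ (ε : Z2) (δ : ℤˣ), z = ε * z' ∧
      x = δ • ε • x' ∧ y = ε • y' := by
  unfold MTwo.cover
  rw [AssocBundle.mk_eq_iff]
  refine exists_congr fun ε => ?_
  have h1 : RepProj.mk x = ε • RepProj.mk x' ↔ ∃ δ : ℤˣ, x = δ • ε • x' := by
    rw [RepProj.smul_mk]
    constructor
    · intro h
      obtain ⟨δ, hδ⟩ : ∃ δ : ℤˣ, δ • (ε • x') = x := Quotient.exact h
      exact ⟨δ, hδ.symm⟩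
    · rintro ⟨δ, rfl⟩
      exact Quotient.sound ⟨δ, rfl⟩
  have h2 : ((RepProj.mk x, y) : RepProj trivThreeSignRep × SSign k₁ k₂) =
      ε • (RepProj.mk x', y') ↔ RepProj.mk x = ε • RepProj.mk x' ∧ y = ε • y' := Prod.ext_iff
  simp only [h2, h1]
  constructor
  · rintro ⟨a, ⟨δ, b⟩, c⟩; exact ⟨δ, a, b, c⟩
  · rintro ⟨δ, a, b, c⟩; exact ⟨a, ⟨δ, b⟩, c⟩

/-- The radial coordinates `(z, x, y) ↦ (log |z|, log |x|, log |y|)`. -/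
def radialLog {A B C : Type*} [NormedAddCommGroup A] [NormedAddCommGroup B] [NormedAddCommGroup C]
    (w : A × (B × C)) : ℝ × (ℝ × ℝ) :=
  (Real.log ‖w.1‖, Real.log ‖w.2.1‖, Real.log ‖w.2.2‖)

/-- The triples of nonzero vectors. -/
def nonzeroTriples (A B C : Type*) [Zero A] [Zero B] [Zero C] : Set (A × (B × C)) :=
  {w | w.1 ≠ 0 ∧ w.2.1 ≠ 0 ∧ w.2.2 ≠ 0}

theorem isOpen_nonzeroTriples (A B C : Type*) [NormedAddCommGroup A] [NormedAddCommGroup B]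
    [NormedAddCommGroup C] : IsOpen (nonzeroTriples A B C) :=
  (isOpen_ne.preimage continuous_fst).inter
    ((isOpen_ne.preimage (continuous_fst.comp continuous_snd)).inter
      (isOpen_ne.preimage (continuous_snd.comp continuous_snd)))

theorem contDiffAt_radialLog {A B C : Type*} [NormedAddCommGroup A] [InnerProductSpace ℝ A]
    [NormedAddCommGroup B] [InnerProductSpace ℝ B] [NormedAddCommGroup C] [InnerProductSpace ℝ C]
    {w : A × (B × C)} (hw : w ∈ nonzeroTriples A B C) {m : WithTop ℕ∞} :
    ContDiffAt ℝ m radialLog w := by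
  obtain ⟨h1, h2, h3⟩ := hw
  refine ContDiffAt.prodMk ?_ (ContDiffAt.prodMk ?_ ?_)
  · exact (contDiffAt_fst.norm ℝ h1).log (norm_ne_zero_iff.2 h1)
  · exact ((contDiffAt_fst.comp w contDiffAt_snd).norm ℝ h2).log (norm_ne_zero_iff.2 h2)
  · exact ((contDiffAt_snd.comp w contDiffAt_snd).norm ℝ h3).log (norm_ne_zero_iff.2 h3)

/-- The radial projection of triples of vectors to triples of unit vectors. -/
def radialProj (w : ℂ × (VThree × VSign k₁ k₂)) : Circle × (SThree × SSign k₁ k₂) :=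
  (toCircle w.1, toSphere _ w.2.1, toSphere _ w.2.2)

/-- The triple of vectors with given directions and radial coordinates. -/
def radialExp (p : (Circle × (SThree × SSign k₁ k₂)) × (ℝ × (ℝ × ℝ))) :
    ℂ × (VThree × VSign k₁ k₂) :=
  (Real.exp p.2.1 • (p.1.1 : ℂ), Real.exp p.2.2.1 • p.1.2.1.val, Real.exp p.2.2.2 • p.1.2.2.val)

theorem radialProj_radialExp (p : Circle × (SThree × SSign k₁ k₂)) (r : ℝ × (ℝ × ℝ)) :
    radialProj (radialExp (p, r)) = p := by
  obtain ⟨z, x, y⟩ := p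
  obtain ⟨a, b, c⟩ := r
  refine Prod.ext ?_ (Prod.ext ?_ ?_)
  · change toCircle (Real.exp a • (z : ℂ)) = z
    rw [Complex.real_smul, toCircle_mul _ _ (by exact_mod_cast (Real.exp_pos a).ne') z.coe_ne_zero,
      toCircle_ofReal (Real.exp_pos a), toCircle_coe, one_mul]
  · exact (toSphere_smul (Real.exp_pos b) _).trans (toSphere_val x)
  · exact (toSphere_smul (Real.exp_pos c) _).trans (toSphere_val y)

theorem radialExp_radialProj {w : ℂ × (VThree × VSign k₁ k₂)}
    (hw : w ∈ nonzeroTriples ℂ VThree (VSign k₁ k₂)) :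
    radialExp (radialProj w, radialLog w) = w := by
  obtain ⟨z, x, y⟩ := w
  obtain ⟨hz, hx, hy⟩ := hw
  have hz' := norm_pos_iff.2 hz
  have hx' := norm_pos_iff.2 hx
  have hy' := norm_pos_iff.2 hy
  refine Prod.ext ?_ (Prod.ext ?_ ?_)
  · change Real.exp (Real.log ‖z‖) • (toCircle z : ℂ) = z
    have h0 : (‖z‖ : ℂ) ≠ 0 := by exact_mod_cast hz'.ne'
    rw [Real.exp_log hz', coe_toCircle hz, Complex.real_smul, mul_div_cancel₀ _ h0]
  · change Real.exp (Real.log ‖x‖) • (toSphere _ x : SThree).val = x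
    rw [Real.exp_log hx', val_toSphere hx, smul_inv_smul₀ hx'.ne']
  · change Real.exp (Real.log ‖y‖) • (toSphere _ y : SSign k₁ k₂).val = y
    rw [Real.exp_log hy', val_toSphere hy, smul_inv_smul₀ hy'.ne']

theorem contMDiff_radialExp : ContMDiff ((ICover k₁ k₂).prod 𝓘(ℝ, ℝ × (ℝ × ℝ)))
    𝓘(ℝ, ℂ × (VThree × VSign k₁ k₂)) ∞ (radialExp (k₁ := k₁) (k₂ := k₂)) := by
  have h1 : ContMDiff ((ICover k₁ k₂).prod 𝓘(ℝ, ℝ × (ℝ × ℝ))) 𝓘(ℝ, ℝ × (ℝ × ℝ)) ∞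
      (fun p : (Circle × (SThree × SSign k₁ k₂)) × (ℝ × (ℝ × ℝ)) => p.2) := contMDiff_snd
  have hexp : ContDiff ℝ ∞ Real.exp := Real.contDiff_exp
  have e1 := ((hexp.comp contDiff_fst).contMDiff.comp h1).smul
    (contMDiff_circle_coe.comp (contMDiff_fst.comp contMDiff_fst))
  have e2 := ((hexp.comp (contDiff_fst.comp contDiff_snd)).contMDiff.comp h1).smul
    (RepSphere.contMDiff_val.comp (contMDiff_fst.comp (contMDiff_snd.comp contMDiff_fst)))
  have e3 := ((hexp.comp (contDiff_snd.comp contDiff_snd)).contMDiff.comp h1).smul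
    (RepSphere.contMDiff_val.comp (contMDiff_snd.comp (contMDiff_snd.comp contMDiff_fst)))
  exact e1.prodMk_space (e2.prodMk_space e3)

theorem contMDiffAt_radialProj {w : ℂ × (VThree × VSign k₁ k₂)}
    (hw : w ∈ nonzeroTriples ℂ VThree (VSign k₁ k₂)) :
    ContMDiffAt 𝓘(ℝ, ℂ × (VThree × VSign k₁ k₂)) (ICover k₁ k₂) ∞ radialProj w := by
  obtain ⟨h1, h2, h3⟩ := hw
  refine ContMDiffAt.prodMk ?_ (ContMDiffAt.prodMk ?_ ?_)
  · exact (contMDiffAt_toCircle h1).comp w contDiff_fst.contMDiff.contMDiffAt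
  · exact (contMDiffAt_toSphere (ρ := trivThreeSignRep) (n := 3) h2).comp w
      (contDiff_fst.comp contDiff_snd).contMDiff.contMDiffAt
  · exact (contMDiffAt_toSphere (ρ := signTrivRep (2 * k₁ - 1) (2 * k₂ - 2))
      (n := 2 * k₁ + 2 * k₂ - 4) h3).comp w
      (contDiff_snd.comp contDiff_snd).contMDiff.contMDiffAt

/-- The presentation `(z, x, y) ↦ [z / |z|, [x], y / |y|]` of `M₂`. -/
def MTwo.present (w : ℂ × (VThree × VSign k₁ k₂)) : MTwo k₁ k₂ := MTwo.cover (radialProj w)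

theorem MTwo.contMDiffAt_present {w : ℂ × (VThree × VSign k₁ k₂)}
    (hw : w ∈ nonzeroTriples ℂ VThree (VSign k₁ k₂)) :
    ContMDiffAt 𝓘(ℝ, ℂ × (VThree × VSign k₁ k₂)) (ITwo k₁ k₂) ∞ MTwo.present w :=
  (MTwo.isLocalDiffeomorph_cover.contMDiff _).comp w (contMDiffAt_radialProj hw)

theorem MTwo.hasLocalSection_present {w : ℂ × (VThree × VSign k₁ k₂)}
    (hw : w ∈ nonzeroTriples ℂ VThree (VSign k₁ k₂)) :
    HasLocalSection 𝓘(ℝ, ℂ × (VThree × VSign k₁ k₂)) (ITwo k₁ k₂) MTwo.present w := by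
  refine HasLocalSection.comp (MTwo.isLocalDiffeomorph_cover.hasLocalSection (radialProj w))
    ⟨fun p => radialExp (p, radialLog w), univ, isOpen_univ, mem_univ _, ?_,
      radialExp_radialProj hw, fun p _ => radialProj_radialExp p _⟩
  exact (contMDiff_radialExp.comp (contMDiff_id.prodMk contMDiff_const)).contMDiffOn

/-- A point is determined smoothly by its image in `M₂` and its radial coordinates. -/
theorem MTwo.exists_leftInverse {w : ℂ × (VThree × VSign k₁ k₂)}
    (hw : w ∈ nonzeroTriples ℂ VThree (VSign k₁ k₂)) :
    ∃ h : MTwo k₁ k₂ × (ℝ × (ℝ × ℝ)) → ℂ × (VThree × VSign k₁ k₂),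
      MDifferentiableAt ((ITwo k₁ k₂).prod 𝓘(ℝ, ℝ × (ℝ × ℝ))) 𝓘(ℝ, ℂ × (VThree × VSign k₁ k₂)) h
        (MTwo.present w, radialLog w) ∧
      ∀ᶠ y in 𝓝 w, h (MTwo.present y, radialLog y) = y := by
  obtain ⟨Φ, hx, hΦ⟩ := MTwo.isLocalDiffeomorph_cover (k₁ := k₁) (k₂ := k₂) (radialProj w)
  have hmem : MTwo.present w ∈ Φ.target := by
    have h1 := Φ.toPartialEquiv.map_source hx
    rwa [← hΦ hx] at h1
  have hsymm : ContMDiffAt (ITwo k₁ k₂) (ICover k₁ k₂) ∞ Φ.symm (MTwo.present w) :=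
    Φ.contMDiffOn_invFun.contMDiffAt (Φ.open_target.mem_nhds hmem)
  refine ⟨fun p => radialExp (Φ.symm p.1, p.2), ?_, ?_⟩
  · have h1 : ContMDiffAt ((ITwo k₁ k₂).prod 𝓘(ℝ, ℝ × (ℝ × ℝ)))
        ((ICover k₁ k₂).prod 𝓘(ℝ, ℝ × (ℝ × ℝ))) ∞
        (fun p : MTwo k₁ k₂ × (ℝ × (ℝ × ℝ)) => (Φ.symm p.1, p.2))
        (MTwo.present w, radialLog w) :=
      (ContMDiffAt.comp (g := Φ.symm) (MTwo.present w, radialLog w) hsymm contMDiffAt_fst).prodMk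
        contMDiffAt_snd
    exact ((contMDiff_radialExp.contMDiffAt).comp _ h1).mdifferentiableAt (by simp)
  · have h2 := (contMDiffAt_radialProj hw).continuousAt.eventually (Φ.open_source.mem_nhds hx)
    filter_upwards [h2, (isOpen_nonzeroTriples _ _ _).mem_nhds hw] with y hy hy'
    have h3 : Φ.symm (MTwo.present y) = radialProj y := by
      change Φ.symm (MTwo.cover (radialProj y)) = _
      rw [hΦ hy]
      exact Φ.toPartialEquiv.left_inv hy
    rw [h3]
    exact radialExp_radialProj hy'

theorem isPresentation_MTwo : IsPresentation (ITwo k₁ k₂) (MTwo.present (k₁ := k₁) (k₂ := k₂))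
    radialLog (nonzeroTriples ℂ VThree (VSign k₁ k₂)) where
  isOpen := isOpen_nonzeroTriples _ _ _
  contMDiffOn _ hw := ((MTwo.contMDiffAt_present hw).of_le (by simp)).contMDiffWithinAt
  contDiffOn _ hw := (contDiffAt_radialLog hw).contDiffWithinAt
  leftInverse _ hw := MTwo.exists_leftInverse hw

end MTwo

/-! ### Orientation and fixed points of `M₂` -/

section ScaleMap

variable {A B C : Type*} [NormedAddCommGroup A] [NormedSpace ℝ A] [NormedAddCommGroup B]
  [NormedSpace ℝ B] [NormedAddCommGroup C] [NormedSpace ℝ C]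

/-- The linear map `(z, x, y) ↦ (a e₁ z, b e₂ x, c e₃ y)`. -/
def scaleMap (a b c : ℝ) (e₁ : A ≃ₗᵢ[ℝ] A) (e₂ : B ≃ₗᵢ[ℝ] B) (e₃ : C ≃ₗᵢ[ℝ] C) :
    A × (B × C) →L[ℝ] A × (B × C) :=
  (a • (e₁.toContinuousLinearEquiv : A →L[ℝ] A)).prodMap
    ((b • (e₂.toContinuousLinearEquiv : B →L[ℝ] B)).prodMap
      (c • (e₃.toContinuousLinearEquiv : C →L[ℝ] C)))

variable {a b c : ℝ} {e₁ : A ≃ₗᵢ[ℝ] A} {e₂ : B ≃ₗᵢ[ℝ] B} {e₃ : C ≃ₗᵢ[ℝ] C}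

theorem scaleMap_apply (w : A × (B × C)) :
    scaleMap a b c e₁ e₂ e₃ w = (a • e₁ w.1, b • e₂ w.2.1, c • e₃ w.2.2) := rfl

theorem det_scaleMap [FiniteDimensional ℝ A] [FiniteDimensional ℝ B] [FiniteDimensional ℝ C] :
    (scaleMap a b c e₁ e₂ e₃).det =
      a ^ Module.finrank ℝ A * LinearMap.det (e₁.toLinearEquiv : A →ₗ[ℝ] A) *
        (b ^ Module.finrank ℝ B * LinearMap.det (e₂.toLinearEquiv : B →ₗ[ℝ] B) *
          (c ^ Module.finrank ℝ C * LinearMap.det (e₃.toLinearEquiv : C →ₗ[ℝ] C))) := by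
  rw [← LinearMap.det_smul, ← LinearMap.det_smul, ← LinearMap.det_smul, ← LinearMap.det_prodMap,
    ← LinearMap.det_prodMap]
  rfl

theorem radialLog_scaleMap (ha : a ≠ 0) (hb : b ≠ 0) (hc : c ≠ 0) {w : A × (B × C)}
    (hw : w ∈ nonzeroTriples A B C) : radialLog (scaleMap a b c e₁ e₂ e₃ w) =
      radialLog w + (Real.log |a|, Real.log |b|, Real.log |c|) := by
  have key : ∀ (t : ℝ) (_ : t ≠ 0) (u : ℝ) (_ : u ≠ 0),
      Real.log (|t| * u) = Real.log u + Real.log |t| := fun t ht u hu => by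
    rw [Real.log_mul (abs_ne_zero.2 ht) hu, add_comm]
  rw [scaleMap_apply]
  unfold radialLog
  simp only [norm_smul, LinearIsometryEquiv.norm_map, Real.norm_eq_abs]
  rw [key a ha _ (norm_ne_zero_iff.2 hw.1), key b hb _ (norm_ne_zero_iff.2 hw.2.1),
    key c hc _ (norm_ne_zero_iff.2 hw.2.2)]
  rfl

end ScaleMap

/-- Two normed spaces of the same dimension are isomorphic. -/
def equivOfFinrankEq {E F : Type*} [NormedAddCommGroup E] [NormedSpace ℝ E] [FiniteDimensional ℝ E]
    [NormedAddCommGroup F] [NormedSpace ℝ F] [FiniteDimensional ℝ F]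
    (h : Module.finrank ℝ E = Module.finrank ℝ F) : E ≃L[ℝ] F :=
  ContinuousLinearEquiv.ofFinrankEq h

section MTwo

variable {k₁ k₂ : ℕ} [h₁ : Fact (1 ≤ k₁)] [h₂ : Fact (2 ≤ k₂)]

theorem toSphere_units_smul {G : Type} [Group G] {E : Type} [NormedAddCommGroup E]
    [InnerProductSpace ℝ E] {ρ : G →* (E ≃ₗᵢ[ℝ] E)} [Nonempty (RepSphere ρ)] {x : E} (h : x ≠ 0)
    (δ : ℤˣ) : toSphere ρ (((δ : ℤ) : ℝ) • x) = δ • toSphere ρ x := by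
  rcases Int.units_eq_one_or δ with rfl | rfl
  · simp
  · simpa using toSphere_neg (ρ := ρ) h

theorem finrank_triples : Module.finrank ℝ (ℂ × (VThree × VSign k₁ k₂)) = 2 * k₁ + 2 * k₂ + 3 := by
  have := h₁.out
  have := h₂.out
  rw [Module.finrank_prod, Module.finrank_prod, Complex.finrank_real_complex, finrank_sum_euclidean,
    finrank_sum_euclidean]
  omega

/-- The deck transformations of the presentation of `M₂` preserve orientation: the signs
contributed by the two spheres cancel. -/
theorem det_deck_pos {a b c : ℝ} (ha : 0 < a) (hb : b ≠ 0) (hc : 0 < c) (ε : Z2) :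
    0 < (scaleMap a b c (rotation (ε : Circle)) (trivThreeSignRep ε)
      (signTrivRep (2 * k₁ - 1) (2 * k₂ - 2) ε)).det := by
  have h0 : LinearMap.det ((rotation (ε : Circle)).toLinearEquiv : ℂ →ₗ[ℝ] ℂ) = 1 := det_rotation _
  have h3 : Module.finrank ℝ VThree = 4 := finrank_sum_euclidean 3 1
  rw [det_scaleMap, h0]
  unfold trivThreeSignRep signTrivRep
  rw [det_sumRep, det_sumRep, det_trivRep, det_trivRep, det_signRep, det_signRep, h3]
  have h4 : Z2.sign ε ^ 1 * Z2.sign ε ^ (2 * k₁ - 1) = 1 := by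
    have := h₁.out
    rw [← pow_add, show 1 + (2 * k₁ - 1) = 2 * k₁ by omega, pow_mul, sq, Z2.sign_mul_self, one_pow]
  have h5 : 0 < b ^ 4 := by positivity
  have h6 := fun n : ℕ => pow_pos hc n
  have h7 : ∀ u v s t : ℝ, u * 1 * (v * (1 * s ^ 1) * (t * (s ^ (2 * k₁ - 1) * 1))) =
      u * v * t * (s ^ 1 * s ^ (2 * k₁ - 1)) := fun u v s t => by ring
  rw [h7, h4]
  have := h6 (Module.finrank ℝ (VSign k₁ k₂))
  have := pow_pos ha (Module.finrank ℝ ℂ)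
  positivity

theorem radialProj_scaleMap {a b c : ℝ} (ha : 0 < a) (hb : 0 < b) (hc : 0 < c) (ε : Z2) (δ : ℤˣ)
    {w : ℂ × (VThree × VSign k₁ k₂)} (hw : w ∈ nonzeroTriples ℂ VThree (VSign k₁ k₂)) :
    radialProj (scaleMap a (b * ((δ : ℤ) : ℝ)) c (rotation (ε : Circle)) (trivThreeSignRep ε)
      (signTrivRep (2 * k₁ - 1) (2 * k₂ - 2) ε) w) =
    ((ε : Circle) * (radialProj w).1, δ • ε • (radialProj w).2.1, ε • (radialProj w).2.2) := by
  obtain ⟨z, x, y⟩ := w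
  obtain ⟨hz, hx, hy⟩ := hw
  have hx' : trivThreeSignRep ε x ≠ 0 := by simpa using hx
  refine Prod.ext ?_ (Prod.ext ?_ ?_)
  · change toCircle (a • rotation (ε : Circle) z) = (ε : Circle) * toCircle z
    rw [rotation_apply, Complex.real_smul,
      toCircle_mul _ _ (by exact_mod_cast ha.ne') (mul_ne_zero (Circle.coe_ne_zero _) hz),
      toCircle_ofReal ha, one_mul, toCircle_mul _ _ (Circle.coe_ne_zero _) hz, toCircle_coe]
  · change toSphere _ ((b * ((δ : ℤ) : ℝ)) • trivThreeSignRep ε x) = δ • ε • toSphere _ x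
    rw [mul_smul, toSphere_smul hb, toSphere_units_smul hx', smul_toSphere hx]
  · change toSphere _ (c • signTrivRep (2 * k₁ - 1) (2 * k₂ - 2) ε y) = ε • toSphere _ y
    rw [toSphere_smul hc, smul_toSphere hy]

/-- `M₂` is orientable: two points of a fibre of its presentation differ by a deck transformation of
positive determinant. -/
theorem MTwo.orientable : Orientable (ITwo k₁ k₂) (MTwo k₁ k₂) := by
  have hJ : Module.finrank ℝ ((EuclideanSpace ℝ (Fin 1) × (EuclideanSpace ℝ (Fin 3) ×
      EuclideanSpace ℝ (Fin (2 * k₁ + 2 * k₂ - 4)))) × (ℝ × (ℝ × ℝ))) =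
      Module.finrank ℝ (ℂ × (VThree × VSign k₁ k₂)) := by
    have := h₁.out
    have := h₂.out
    rw [finrank_triples]
    simp only [Module.finrank_prod, finrank_euclideanSpace_fin, Module.finrank_self]
    omega
  have J := equivOfFinrankEq hJ
  refine isPresentation_MTwo.orientable J ?_ ?_ ?_
  · refine eq_univ_of_forall fun p => ?_
    obtain ⟨⟨z, x, y⟩, rfl⟩ := MTwo.surjective_cover p
    refine ⟨((z : ℂ), x.val, y.val), ⟨z.coe_ne_zero, x.val_ne_zero, y.val_ne_zero⟩, ?_⟩
    change MTwo.cover (toCircle (z : ℂ), toSphere _ x.val, toSphere _ y.val) = _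
    rw [toCircle_coe, toSphere_val, toSphere_val]
  · exact fun w hw U hU => (MTwo.hasLocalSection_present hw).image_mem_nhds hU
  · intro w hw w' hw' heq
    obtain ⟨ε, δ, h1, h2, h3⟩ := MTwo.cover_eq_iff.1 heq.symm
    have hpos := norm_pos_iff.2 hw.1
    have hpos2 := norm_pos_iff.2 hw.2.1
    have hpos3 := norm_pos_iff.2 hw.2.2
    have ha : 0 < ‖w'.1‖ / ‖w.1‖ := div_pos (norm_pos_iff.2 hw'.1) hpos
    have hb : 0 < ‖w'.2.1‖ / ‖w.2.1‖ := div_pos (norm_pos_iff.2 hw'.2.1) hpos2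
    have hc : 0 < ‖w'.2.2‖ / ‖w.2.2‖ := div_pos (norm_pos_iff.2 hw'.2.2) hpos3
    have hδ : ((δ : ℤ) : ℝ) ≠ 0 := by exact_mod_cast δ.ne_zero
    have hδ' : |((δ : ℤ) : ℝ)| = 1 := by
      rcases Int.units_eq_one_or δ with rfl | rfl <;> simp
    have hbδ := mul_ne_zero hb.ne' hδ
    set A := scaleMap (‖w'.1‖ / ‖w.1‖) (‖w'.2.1‖ / ‖w.2.1‖ * ((δ : ℤ) : ℝ)) (‖w'.2.2‖ / ‖w.2.2‖)
      (rotation (ε : Circle)) (trivThreeSignRep ε) (signTrivRep (2 * k₁ - 1) (2 * k₂ - 2) ε) with hA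
    have hnear := (isOpen_nonzeroTriples ℂ VThree (VSign k₁ k₂)).mem_nhds hw
    refine ⟨A, det_deck_pos ha hbδ hc ε, ?_, ?_, (Real.log |‖w'.1‖ / ‖w.1‖|,
      Real.log |‖w'.2.1‖ / ‖w.2.1‖ * ((δ : ℤ) : ℝ)|, Real.log |‖w'.2.2‖ / ‖w.2.2‖|), ?_⟩
    · have e1 : radialProj (A w) = radialProj w' := by
        rw [hA, radialProj_scaleMap ha hb hc ε δ hw]
        exact (Prod.ext h1 (Prod.ext h2 h3)).symm
      have e2 : radialLog (A w) = radialLog w' := by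
        have key : ∀ t u : ℝ, 0 < t → 0 < u → Real.log u + Real.log |t / u| = Real.log t :=
          fun t u ht hu => by
            rw [abs_of_pos (div_pos ht hu), Real.log_div ht.ne' hu.ne']; ring
        rw [hA, radialLog_scaleMap ha.ne' hbδ hc.ne' hw, abs_mul, hδ', mul_one]
        exact Prod.ext (key _ _ (norm_pos_iff.2 hw'.1) hpos)
          (Prod.ext (key _ _ (norm_pos_iff.2 hw'.2.1) hpos2)
            (key _ _ (norm_pos_iff.2 hw'.2.2) hpos3))
      have hAw : A w ∈ nonzeroTriples ℂ VThree (VSign k₁ k₂) :=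
        ⟨smul_ne_zero ha.ne' (by simpa using hw.1), smul_ne_zero hbδ (by simpa using hw.2.1),
          smul_ne_zero hc.ne' (by simpa using hw.2.2)⟩
      rw [← radialExp_radialProj hAw, e1, e2, radialExp_radialProj hw']
    · filter_upwards [hnear] with y hy
      change MTwo.cover (radialProj (A y)) = MTwo.cover (radialProj y)
      rw [hA, radialProj_scaleMap ha hb hc ε δ hy]
      exact MTwo.cover_eq_iff.2 ⟨ε, δ, rfl, rfl, rfl⟩
    · filter_upwards [hnear] with y hy
      exact radialLog_scaleMap ha.ne' hbδ hc.ne' hy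

end MTwo

section ComponentTwo

variable {k₁ k₂ : ℕ} [h₁ : Fact (1 ≤ k₁)] [h₂ : Fact (2 ≤ k₂)]

theorem val_Z2_smul_three (ε : Z2) (x : SThree) :
    (ε • x).val = WithLp.toLp 2 (x.val.fst, Z2.sign ε • x.val.snd) :=
  trivThreeSignRep_apply ε x.val

theorem val_Z2_smul_sign (ε : Z2) (y : SSign k₁ k₂) :
    (ε • y).val = WithLp.toLp 2 (Z2.sign ε • y.val.fst, y.val.snd) :=
  signTrivRep_apply _ _ ε y.val

theorem Z2.sign_ne_zero (ε : Z2) : Z2.sign ε ≠ 0 := fun h => by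
  have := Z2.sign_mul_self ε
  rw [h, zero_mul] at this
  exact zero_ne_one this

theorem Z2.sign_eq_neg_one_of {ε : Z2} {z : Circle} (h : -z = ε * z) : Z2.sign ε = -1 := by
  have h1 : (ε : Circle) = -1 := by
    rw [← mul_right_cancel_iff (a := z), ← h, neg_one_mul]
  have h2 := Z2.coe_eq_sign ε
  rw [h1, coe_neg_one_circle] at h2
  exact_mod_cast h2.symm

theorem MTwo.cover_mem_iff (P : VThree → Prop) (hP : ∀ (c : ℝ) (x : VThree) (ε : Z2), c ≠ 0 →
      P (c • WithLp.toLp 2 (x.fst, Z2.sign ε • x.snd)) → P x)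
    {z : Circle} {x : SThree} {y : SSign k₁ k₂} :
    MTwo.cover (z, x, y) ∈ {p : MTwo k₁ k₂ | ∃ (z : Circle) (x : SThree) (y : SSign k₁ k₂),
      P x.val ∧ y.val.fst = 0 ∧ p = MTwo.cover (z, x, y)} ↔ P x.val ∧ y.val.fst = 0 := by
  constructor
  · rintro ⟨z', x', y', hx, hy, h⟩
    obtain ⟨ε, δ, -, rfl, rfl⟩ := MTwo.cover_eq_iff.1 h.symm
    rw [RepSphere.val_units_smul, val_Z2_smul_three] at hx
    rw [val_Z2_smul_sign] at hy
    exact ⟨hP _ _ ε (by exact_mod_cast δ.ne_zero) hx, (smul_eq_zero.1 hy).resolve_left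
      (Z2.sign_ne_zero ε)⟩
  · exact fun h => ⟨z, x, y, h.1, h.2, rfl⟩

theorem MTwo.cover_mem_componentTwo {z : Circle} {x : SThree} {y : SSign k₁ k₂} :
    MTwo.cover (z, x, y) ∈ componentTwo k₁ k₂ ↔ x.val.snd = 0 ∧ y.val.fst = 0 :=
  MTwo.cover_mem_iff (fun v => v.snd = 0) fun _ _ ε hc h =>
    (smul_eq_zero.1 ((smul_eq_zero.1 h).resolve_left hc)).resolve_left (Z2.sign_ne_zero ε)

variable (k₁ k₂) in
/-- The part of the fixed point set of `ℤ₂` in `M₂` outside of `C₂`. -/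
def otherComponentTwo : Set (MTwo k₁ k₂) :=
  {p | ∃ (z : Circle) (x : SThree) (y : SSign k₁ k₂),
    x.val.fst = 0 ∧ y.val.fst = 0 ∧ p = MTwo.cover (z, x, y)}

theorem MTwo.cover_mem_otherComponentTwo {z : Circle} {x : SThree} {y : SSign k₁ k₂} :
    MTwo.cover (z, x, y) ∈ otherComponentTwo k₁ k₂ ↔ x.val.fst = 0 ∧ y.val.fst = 0 :=
  MTwo.cover_mem_iff (fun v => v.fst = 0) fun _ _ _ hc h => (smul_eq_zero.1 h).resolve_left hc

/-- If `[z, [x], y]` is fixed by `-1`, then `y` has no component in `ℝ₋^{2k₁-1}`, and `x` is an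
eigenvector of the reflection of `ℝ³ ⊕ ℝ₋`, so that it lies in one of the two summands. -/
theorem MTwo.fixedPoints_Z2 :
    fixedPoints Z2 (MTwo k₁ k₂) = componentTwo k₁ k₂ ∪ otherComponentTwo k₁ k₂ := by
  ext p
  obtain ⟨⟨z, x, y⟩, rfl⟩ := MTwo.surjective_cover p
  rw [mem_union, MTwo.cover_mem_componentTwo, MTwo.cover_mem_otherComponentTwo, fixedPoints_Z2_iff]
  have h0 : (-1 : Circle) • MTwo.cover (z, x, y) = MTwo.cover (-z, x, y) := by
    change MTwo.cover (-1 * z, x, y) = _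
    rw [neg_one_mul]
  rw [h0, MTwo.cover_eq_iff]
  constructor
  · rintro ⟨ε, δ, hz, hx, hy⟩
    have hε := Z2.sign_eq_neg_one_of hz
    have hx' := congrArg RepSphere.val hx
    have hy' := congrArg RepSphere.val hy
    rw [RepSphere.val_units_smul, val_Z2_smul_three, hε] at hx'
    rw [val_Z2_smul_sign, hε] at hy'
    have hy0 : y.val.fst = 0 := by
      have h := congrArg (fun v => v.fst) hy'
      simp only [neg_smul, one_smul] at h
      exact eq_zero_of_neg_eq_self h.symm
    rcases Int.units_eq_one_or δ with rfl | rfl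
    · left
      have h := congrArg (fun v => v.snd) hx'
      simp only [Units.val_one, Int.cast_one, neg_smul, one_smul] at h
      exact ⟨eq_zero_of_neg_eq_self h.symm, hy0⟩
    · right
      have h := congrArg (fun v => v.fst) hx'
      simp only [Units.val_neg, Units.val_one, Int.cast_neg, Int.cast_one, neg_smul, one_smul] at h
      exact ⟨eq_zero_of_neg_eq_self h.symm, hy0⟩
  · intro h
    have hz : -z = ((⟨-1, neg_one_mem_Z2⟩ : Z2) : Circle) * z := (neg_one_mul z).symm
    have hy' : y.val.fst = 0 → y = (⟨-1, neg_one_mem_Z2⟩ : Z2) • y := fun hy => RepSphere.ext <| by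
      rw [val_Z2_smul_sign, Z2.sign_neg_one]
      exact withLp_eq (by simp [hy]) rfl
    rcases h with ⟨hx, hy⟩ | ⟨hx, hy⟩
    · refine ⟨⟨-1, neg_one_mem_Z2⟩, 1, hz, RepSphere.ext ?_, hy' hy⟩
      rw [one_smul, val_Z2_smul_three, Z2.sign_neg_one]
      exact withLp_eq rfl (by simp [hx])
    · refine ⟨⟨-1, neg_one_mem_Z2⟩, -1, hz, RepSphere.ext ?_, hy' hy⟩
      rw [RepSphere.val_units_smul, val_Z2_smul_three, Z2.sign_neg_one]
      exact withLp_eq (by simp [hx]) (by simp)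

theorem disjoint_otherComponentTwo : Disjoint (componentTwo k₁ k₂) (otherComponentTwo k₁ k₂) := by
  rw [Set.disjoint_left]
  intro p
  obtain ⟨⟨z, x, y⟩, rfl⟩ := MTwo.surjective_cover p
  rw [MTwo.cover_mem_componentTwo, MTwo.cover_mem_otherComponentTwo]
  rintro ⟨h, -⟩ ⟨h', -⟩
  exact x.val_ne_zero (withLp_eq h' h)

theorem MTwo.continuous_cover :
    Continuous (MTwo.cover : Circle × (SThree × SSign k₁ k₂) → MTwo k₁ k₂) :=
  MTwo.isLocalDiffeomorph_cover.contMDiff.continuous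

theorem isClosed_of_cover {S : Set (MTwo k₁ k₂)}
    (h : IsClosed ((MTwo.cover : Circle × (SThree × SSign k₁ k₂) → MTwo k₁ k₂) ⁻¹' S)) :
    IsClosed S := by
  have h1 := (h.isCompact.image MTwo.continuous_cover).isClosed
  rwa [image_preimage_eq _ MTwo.surjective_cover] at h1

theorem continuous_val_three_fst : Continuous fun x : SThree => x.val.fst :=
  (contDiff_withLp_fst (m := 0)).continuous.comp RepSphere.continuous_val

theorem continuous_val_three_snd : Continuous fun x : SThree => x.val.snd :=
  (contDiff_withLp_snd (m := 0)).continuous.comp RepSphere.continuous_val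

theorem continuous_val_sign_fst : Continuous fun x : SSign k₁ k₂ => x.val.fst :=
  (contDiff_withLp_fst (m := 0)).continuous.comp RepSphere.continuous_val

theorem isClosed_componentTwo : IsClosed (componentTwo k₁ k₂) := by
  apply isClosed_of_cover
  have h : (MTwo.cover : Circle × (SThree × SSign k₁ k₂) → MTwo k₁ k₂) ⁻¹' componentTwo k₁ k₂ =
      {p | p.2.1.val.snd = 0} ∩ {p | p.2.2.val.fst = 0} := by
    ext ⟨z, x, y⟩
    exact MTwo.cover_mem_componentTwo
  rw [h]
  exact (isClosed_eq (continuous_val_three_snd.comp (continuous_fst.comp continuous_snd))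
    continuous_const).inter (isClosed_eq (continuous_val_sign_fst.comp
      (continuous_snd.comp continuous_snd)) continuous_const)

theorem isClosed_otherComponentTwo : IsClosed (otherComponentTwo k₁ k₂) := by
  apply isClosed_of_cover
  have h : (MTwo.cover : Circle × (SThree × SSign k₁ k₂) → MTwo k₁ k₂) ⁻¹' otherComponentTwo k₁ k₂ =
      {p | p.2.1.val.fst = 0} ∩ {p | p.2.2.val.fst = 0} := by
    ext ⟨z, x, y⟩
    exact MTwo.cover_mem_otherComponentTwo
  rw [h]
  exact (isClosed_eq (continuous_val_three_fst.comp (continuous_fst.comp continuous_snd))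
    continuous_const).inter (isClosed_eq (continuous_val_sign_fst.comp
      (continuous_snd.comp continuous_snd)) continuous_const)

/-- The space `ℂ × ℝ³ × ℝ^{2k₂-2}`, of which nonzero triples present `C₂`. -/
abbrev VFixed (k₂ : ℕ) : Type :=
  ℂ × (EuclideanSpace ℝ (Fin 3) × EuclideanSpace ℝ (Fin (2 * k₂ - 2)))

/-- The inclusion `(z, x, y) ↦ (z, (x, 0), (0, y))`. -/
def fixedIncl (k₁ k₂ : ℕ) (w : VFixed k₂) : ℂ × (VThree × VSign k₁ k₂) :=
  (w.1, WithLp.toLp 2 (w.2.1, 0), WithLp.toLp 2 (0, w.2.2))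

theorem contDiff_fixedIncl {m : WithTop ℕ∞} : ContDiff ℝ m (fixedIncl k₁ k₂) :=
  contDiff_fst.prodMk (((contDiff_fst.comp contDiff_snd).withLp_mk contDiff_const).prodMk
    (contDiff_const.withLp_mk (contDiff_snd.comp contDiff_snd)))

theorem fixedIncl_mem {w : VFixed k₂}
    (hw : w ∈ nonzeroTriples ℂ (EuclideanSpace ℝ (Fin 3)) (EuclideanSpace ℝ (Fin (2 * k₂ - 2)))) :
    fixedIncl k₁ k₂ w ∈ nonzeroTriples ℂ VThree (VSign k₁ k₂) :=
  ⟨hw.1, fun h => hw.2.1 (congrArg (fun v => v.fst) h),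
    fun h => hw.2.2 (congrArg (fun v => v.snd) h)⟩

theorem radialLog_fixedIncl (w : VFixed k₂) :
    radialLog (fixedIncl k₁ k₂ w) = radialLog w := by
  refine Prod.ext rfl (Prod.ext (congrArg Real.log ?_) (congrArg Real.log ?_))
  · change ‖(WithLp.toLp 2 (w.2.1, (0 : EuclideanSpace ℝ (Fin 1))) : VThree)‖ = _
    rw [WithLp.prod_norm_eq_of_L2]; simp
  · change ‖(WithLp.toLp 2 ((0 : EuclideanSpace ℝ (Fin (2 * k₁ - 1))), w.2.2) : VSign k₁ k₂)‖ = _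
    rw [WithLp.prod_norm_eq_of_L2]; simp

theorem present_fixedIncl_mem {w : VFixed k₂}
    (hw : w ∈ nonzeroTriples ℂ (EuclideanSpace ℝ (Fin 3)) (EuclideanSpace ℝ (Fin (2 * k₂ - 2)))) :
    MTwo.present (fixedIncl k₁ k₂ w) ∈ componentTwo k₁ k₂ := by
  have h := fixedIncl_mem (k₁ := k₁) hw
  refine MTwo.cover_mem_componentTwo.2 ⟨?_, ?_⟩
  · rw [val_toSphere h.2.1]; simp [fixedIncl]
  · rw [val_toSphere h.2.2]; simp [fixedIncl]

theorem isConnected_componentTwo : IsConnected (componentTwo k₁ k₂) := by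
  have := h₂.out
  have hc1 := isConnected_compl_singleton_of_one_lt_rank (E := ℂ) (by simp) 0
  have hc2 := isConnected_compl_singleton_of_one_lt_rank (E := EuclideanSpace ℝ (Fin 3))
    (Module.lt_rank_of_lt_finrank (n := 1) (by rw [finrank_euclideanSpace_fin]; omega)) 0
  have hc3 := isConnected_compl_singleton_of_one_lt_rank
    (E := EuclideanSpace ℝ (Fin (2 * k₂ - 2)))
    (Module.lt_rank_of_lt_finrank (n := 1) (by rw [finrank_euclideanSpace_fin]; omega)) 0
  have hc := hc1.prod (hc2.prod hc3)
  have hcont : ContinuousOn (fun w => MTwo.present (fixedIncl k₁ k₂ w))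
      (({0}ᶜ : Set ℂ) ×ˢ (({0}ᶜ : Set (EuclideanSpace ℝ (Fin 3))) ×ˢ
        ({0}ᶜ : Set (EuclideanSpace ℝ (Fin (2 * k₂ - 2)))))) := fun w hw =>
    ((MTwo.contMDiffAt_present (fixedIncl_mem (k₁ := k₁) hw)).continuousAt.comp
      (f := fixedIncl k₁ k₂) (contDiff_fixedIncl (m := 0)).continuous.continuousAt).continuousWithinAt
  convert hc.image _ hcont
  refine Subset.antisymm ?_ ?_
  · intro p hp
    obtain ⟨⟨z, x, y⟩, rfl⟩ := MTwo.surjective_cover p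
    obtain ⟨hx, hy⟩ := MTwo.cover_mem_componentTwo.1 hp
    have hx' : (WithLp.toLp 2 (x.val.fst, 0) : VThree) = x.val := withLp_eq rfl hx.symm
    have hy' : (WithLp.toLp 2 (0, y.val.snd) : VSign k₁ k₂) = y.val := withLp_eq hy.symm rfl
    refine ⟨((z : ℂ), x.val.fst, y.val.snd), ⟨z.coe_ne_zero, ?_, ?_⟩, ?_⟩
    · exact fun h => x.val_ne_zero (withLp_eq h hx)
    · exact fun h => y.val_ne_zero (withLp_eq hy h)
    · change MTwo.cover (toCircle (z : ℂ), toSphere _ (WithLp.toLp 2 (x.val.fst, 0)),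
        toSphere _ (WithLp.toLp 2 (0, y.val.snd))) = _
      rw [hx', hy', toCircle_coe, toSphere_val, toSphere_val]
  · rintro _ ⟨w, hw, rfl⟩
    exact present_fixedIncl_mem hw

theorem isComponentOf_componentTwo :
    IsComponentOf (componentTwo k₁ k₂) (fixedPoints Z2 (MTwo k₁ k₂)) :=
  isComponentOf_of_isClosed isConnected_componentTwo
    (by rw [MTwo.fixedPoints_Z2]; exact subset_union_left) isClosed_componentTwo
    isClosed_otherComponentTwo MTwo.fixedPoints_Z2.subset disjoint_otherComponentTwo

theorem Circle.hasSliceAt (z : Circle) :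
    HasSliceAt (𝓡 1) (EuclideanSpace ℝ (Fin 1)) (EuclideanSpace ℝ (Fin 0)) univ z := by
  have : IsManifold (𝓡 1) ∞ Circle := inferInstance
  refine (isSmoothChart_extChartHomeo (I := 𝓡 1) z).hasSliceAt
    (T := (0 : EuclideanSpace ℝ (Fin 1) →ₗ[ℝ] EuclideanSpace ℝ (Fin 0)))
    (fun a => ⟨0, Subsingleton.elim _ _⟩) (by simp) ?_ (mem_extChartHomeo_source z)
  exact fun y _ => ⟨fun _ => rfl, fun _ => mem_univ y⟩

theorem componentTwo_hasSliceAt {D K : Type} [NormedAddCommGroup D] [NormedSpace ℝ D]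
    [FiniteDimensional ℝ D] [NormedAddCommGroup K] [NormedSpace ℝ K] [FiniteDimensional ℝ K]
    (hD : Module.finrank ℝ D = 2 * k₂) (hK : Module.finrank ℝ K = 2 * k₁) {p : MTwo k₁ k₂}
    (hp : p ∈ componentTwo k₁ k₂) : HasSliceAt (ITwo k₁ k₂) D K (componentTwo k₁ k₂) p := by
  have := h₁.out
  have := h₂.out
  obtain ⟨⟨z, x, y⟩, rfl⟩ := MTwo.surjective_cover p
  obtain ⟨hx, hy⟩ := MTwo.cover_mem_componentTwo.1 hp
  have s1 := Circle.hasSliceAt z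
  have s2 := RepSphere.hasSliceAt (ρ := trivThreeSignRep) (n := 3) (D := EuclideanSpace ℝ (Fin 2))
    (T := WithLp.sndₗ 2 ℝ (EuclideanSpace ℝ (Fin 3)) (EuclideanSpace ℝ (Fin 1)))
    (fun a => ⟨WithLp.toLp 2 (0, a), rfl⟩) (by simp) hx
  have s3 := RepSphere.hasSliceAt (ρ := signTrivRep (2 * k₁ - 1) (2 * k₂ - 2))
    (n := 2 * k₁ + 2 * k₂ - 4) (D := EuclideanSpace ℝ (Fin (2 * k₂ - 3)))
    (T := WithLp.fstₗ 2 ℝ (EuclideanSpace ℝ (Fin (2 * k₁ - 1)))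
      (EuclideanSpace ℝ (Fin (2 * k₂ - 2))))
    (fun a => ⟨WithLp.toLp 2 (a, 0), rfl⟩)
    (by rw [finrank_euclideanSpace_fin, finrank_euclideanSpace_fin]; omega) hy
  have s := ((s1.prod (s2.prod s3)).image (MTwo.isLocalDiffeomorph_cover (z, x, y))
    (C' := componentTwo k₁ k₂) (Eventually.of_forall ?_))
  · refine s.congr_equiv (ContinuousLinearEquiv.ofFinrankEq ?_)
      (ContinuousLinearEquiv.ofFinrankEq ?_)
    · rw [hD]; simp only [Module.finrank_prod, finrank_euclideanSpace_fin]; omega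
    · rw [hK]; simp only [Module.finrank_prod, finrank_euclideanSpace_fin]; omega
  · rintro ⟨z', x', y'⟩
    rw [MTwo.cover_mem_componentTwo]
    exact ⟨fun h => ⟨mem_univ _, h.1, h.2⟩, fun h => ⟨h.2.1, h.2.2⟩⟩

end ComponentTwo

/-! ### Non-orientability of `C₂` -/

section Nonorientable

variable {k₁ k₂ : ℕ} [h₁ : Fact (1 ≤ k₁)] [h₂ : Fact (2 ≤ k₂)]

/-- The linear map `(z, x, y) ↦ (z, -x, y)`. -/
def flipMap (k₂ : ℕ) : VFixed k₂ →L[ℝ] VFixed k₂ :=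
  scaleMap 1 (-1) 1 (LinearIsometryEquiv.refl ℝ _) (LinearIsometryEquiv.refl ℝ _)
    (LinearIsometryEquiv.refl ℝ _)

theorem flipMap_apply (w : VFixed k₂) : flipMap k₂ w = (w.1, -w.2.1, w.2.2) := by
  unfold flipMap
  rw [scaleMap_apply]
  simp

theorem det_flipMap : (flipMap k₂).det = -1 := by
  have h : ∀ (E : Type) [NormedAddCommGroup E] [NormedSpace ℝ E],
      LinearMap.det ((LinearIsometryEquiv.refl ℝ E).toLinearEquiv : E →ₗ[ℝ] E) = 1 :=
    fun E _ _ => LinearMap.det_id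
  unfold flipMap
  rw [det_scaleMap, h, h, h, finrank_euclideanSpace_fin]
  norm_num

theorem present_flipMap (w : VFixed k₂)
    (hw : w ∈ nonzeroTriples ℂ (EuclideanSpace ℝ (Fin 3)) (EuclideanSpace ℝ (Fin (2 * k₂ - 2)))) :
    MTwo.present (fixedIncl k₁ k₂ (flipMap k₂ w)) = MTwo.present (fixedIncl k₁ k₂ w) := by
  have h0 := fixedIncl_mem (k₁ := k₁) hw
  have h : fixedIncl k₁ k₂ (flipMap k₂ w) = (w.1, -(fixedIncl k₁ k₂ w).2.1,
      (fixedIncl k₁ k₂ w).2.2) := by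
    rw [flipMap_apply]
    refine Prod.ext rfl (Prod.ext (withLp_eq rfl ?_) rfl)
    simp [fixedIncl]
  refine MTwo.cover_eq_iff.2 ⟨1, -1, ?_, ?_, ?_⟩
  · rw [h]; simp [fixedIncl]
  · rw [h, one_smul]; exact toSphere_neg h0.2.1
  · rw [h, one_smul]

/-- The part of `ℂ × ℝ³ × ℝ^{2k₂-2}` consisting of nonzero triples whose last component lies in an
open half-space. -/
def halfTriples (y₀ : EuclideanSpace ℝ (Fin (2 * k₂ - 2))) : Set (VFixed k₂) :=
  ({0}ᶜ : Set ℂ) ×ˢ (({0}ᶜ : Set (EuclideanSpace ℝ (Fin 3))) ×ˢ {y | inner ℝ y₀ y < 0})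

theorem halfTriples_subset (y₀ : EuclideanSpace ℝ (Fin (2 * k₂ - 2))) : halfTriples y₀ ⊆
    nonzeroTriples ℂ (EuclideanSpace ℝ (Fin 3)) (EuclideanSpace ℝ (Fin (2 * k₂ - 2))) := by
  rintro ⟨z, x, y⟩ ⟨hz, hx, hy⟩
  refine ⟨hz, hx, ?_⟩
  rintro rfl
  simp at hy

theorem isOpen_halfTriples (y₀ : EuclideanSpace ℝ (Fin (2 * k₂ - 2))) : IsOpen (halfTriples y₀) :=
  isOpen_compl_singleton.prod (isOpen_compl_singleton.prod
    (isOpen_lt (continuous_const.inner continuous_id) continuous_const))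

theorem isPreconnected_halfTriples (y₀ : EuclideanSpace ℝ (Fin (2 * k₂ - 2))) :
    IsPreconnected (halfTriples y₀) := by
  have hc1 := isConnected_compl_singleton_of_one_lt_rank (E := ℂ) (by simp) 0
  have hc2 := isConnected_compl_singleton_of_one_lt_rank (E := EuclideanSpace ℝ (Fin 3))
    (Module.lt_rank_of_lt_finrank (n := 1) (by rw [finrank_euclideanSpace_fin]; omega)) 0
  exact hc1.isPreconnected.prod (hc2.isPreconnected.prod
    (convex_halfSpace_lt (innerSL ℝ y₀).isLinear 0).isPreconnected)

/-- Let `F` be a submanifold of `M` which, near a piece of `C₂` presented by a set of half-triples,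
is the image of `C₂` under a local diffeomorphism. Then `F` is not orientable: the map
`(z, x, y) ↦ (z, -x, y)` preserves the fibres of the presentation and reverses orientation. -/
theorem HasSliceAt.isNonorientableSubmanifold {E H M : Type} [NormedAddCommGroup E]
    [NormedSpace ℝ E] [FiniteDimensional ℝ E] [TopologicalSpace H] {I : ModelWithCorners ℝ E H}
    [I.Boundaryless] [TopologicalSpace M] [ChartedSpace H M] [IsManifold I ∞ M]
    (hE : Module.finrank ℝ E = 2 * k₁ + 2 * k₂) {F : Set M}
    (hF : ∀ p ∈ F, HasSliceAt I (EuclideanSpace ℝ (Fin (2 * k₂)))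
      (EuclideanSpace ℝ (Fin (2 * k₁))) F p)
    {y₀ : EuclideanSpace ℝ (Fin (2 * k₂ - 2))} (hy₀ : y₀ ≠ 0) {j : MTwo k₁ k₂ → M}
    (hj : ∀ w ∈ halfTriples y₀,
      IsLocalDiffeomorphAt (ITwo k₁ k₂) I ∞ j (MTwo.present (fixedIncl k₁ k₂ w)))
    (hjF : ∀ w ∈ halfTriples y₀, j (MTwo.present (fixedIncl k₁ k₂ w)) ∈ F) :
    IsNonorientableSubmanifold I (2 * k₂) F := by
  have hk₂ := h₂.out
  have hL : Module.finrank ℝ (EuclideanSpace ℝ (Fin (2 * k₂)) × EuclideanSpace ℝ (Fin (2 * k₁))) =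
      Module.finrank ℝ E := by
    rw [hE, Module.finrank_prod, finrank_euclideanSpace_fin, finrank_euclideanSpace_fin, add_comm]
  have hJ : Module.finrank ℝ (EuclideanSpace ℝ (Fin (2 * k₂)) × (ℝ × (ℝ × ℝ))) =
      Module.finrank ℝ (VFixed k₂) := by
    simp only [Module.finrank_prod, finrank_euclideanSpace_fin, Module.finrank_self,
      Complex.finrank_real_complex]
    omega
  have hsub := halfTriples_subset y₀
  refine IsLocallyFlat.isNonorientableSubmanifold (V := VFixed k₂) (K' := ℝ × (ℝ × ℝ)) hF
    (equivOfFinrankEq hL) (f := fun w => j (MTwo.present (fixedIncl k₁ k₂ w))) (r := radialLog)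
    (W := halfTriples y₀) ?_ (isOpen_halfTriples y₀)
    (fun w hw => (contDiffAt_radialLog (hsub hw)).contDiffWithinAt) ?_ (equivOfFinrankEq hJ)
    (isPreconnected_halfTriples y₀) hjF (A := flipMap k₂) (by rw [det_flipMap]; norm_num) ?_ ?_ ?_ ?_
  · intro w hw
    have h1 : ContMDiffAt 𝓘(ℝ, VFixed k₂) (ITwo k₁ k₂) ∞
        (fun w => MTwo.present (fixedIncl k₁ k₂ w)) w :=
      (MTwo.contMDiffAt_present (fixedIncl_mem (hsub hw))).comp w
        contDiff_fixedIncl.contMDiff.contMDiffAt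
    exact ((hj w hw).contMDiffAt.comp w h1).of_le (by simp)
  · intro w hw
    obtain ⟨h, hh, hh'⟩ := MTwo.exists_leftInverse (k₁ := k₁) (fixedIncl_mem (hsub hw))
    obtain ⟨Φ, hx, hΦ⟩ := hj w hw
    set p := MTwo.present (fixedIncl k₁ k₂ w) with hp
    have hmem : j p ∈ Φ.target := by
      have h1 := Φ.toPartialEquiv.map_source hx
      rwa [← hΦ hx] at h1
    have hsymm : MDifferentiableAt I (ITwo k₁ k₂) Φ.symm (j p) :=
      (Φ.contMDiffOn_invFun.contMDiffAt (Φ.open_target.mem_nhds hmem)).mdifferentiableAt (by simp)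
    have hleft : ∀ q ∈ Φ.source, Φ.symm (j q) = q := fun q hq => by
      rw [hΦ hq]; exact Φ.toPartialEquiv.left_inv hq
    let π : ℂ × (VThree × VSign k₁ k₂) → VFixed k₂ := fun v => (v.1, v.2.1.fst, v.2.2.snd)
    have hπ : ContDiff ℝ 1 π := contDiff_fst.prodMk
      ((contDiff_withLp_fst.comp (contDiff_fst.comp contDiff_snd)).prodMk
        (contDiff_withLp_snd.comp (contDiff_snd.comp contDiff_snd)))
    refine ⟨fun q => π (h (Φ.symm q.1, q.2)), ?_, ?_⟩
    · have h1 : MDifferentiableAt (I.prod 𝓘(ℝ, ℝ × (ℝ × ℝ)))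
          ((ITwo k₁ k₂).prod 𝓘(ℝ, ℝ × (ℝ × ℝ)))
          (fun q : M × (ℝ × (ℝ × ℝ)) => (Φ.symm q.1, q.2)) (j p, radialLog w) :=
        (MDifferentiableAt.comp (g := Φ.symm) (j p, radialLog w) hsymm
          mdifferentiableAt_fst).prodMk mdifferentiableAt_snd
      have h2 : MDifferentiableAt ((ITwo k₁ k₂).prod 𝓘(ℝ, ℝ × (ℝ × ℝ)))
          𝓘(ℝ, ℂ × (VThree × VSign k₁ k₂)) h (Φ.symm (j p), radialLog w) := by
        rw [hleft p hx]
        rwa [radialLog_fixedIncl] at hh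
      exact ((hπ.contMDiff.mdifferentiable (by simp)) _).comp _
        (MDifferentiableAt.comp (j p, radialLog w) h2 h1)
    · have hι : ContinuousAt (fixedIncl k₁ k₂) w :=
        (contDiff_fixedIncl (m := 0)).continuous.continuousAt
      have h3 := hι.eventually hh'
      have h4 : ContinuousAt (fun w => MTwo.present (fixedIncl k₁ k₂ w)) w :=
        (MTwo.contMDiffAt_present (fixedIncl_mem (hsub hw))).continuousAt.comp hι
      filter_upwards [h3, h4.eventually (Φ.open_source.mem_nhds hx)] with y hy hy'
      rw [hleft _ hy']
      rw [radialLog_fixedIncl] at hy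
      rw [hy]
      rfl
  · rintro ⟨z, x, y⟩ ⟨hz, hx, hy⟩
    rw [flipMap_apply]
    exact ⟨hz, neg_ne_zero.2 hx, hy⟩
  · refine ⟨(1, EuclideanSpace.single 0 1, -y₀), one_ne_zero, ?_, ?_⟩
    · simp
    · change inner ℝ y₀ (-y₀) < 0
      rw [inner_neg_right, real_inner_self_eq_norm_sq, neg_lt_zero]
      exact pow_pos (norm_pos_iff.2 hy₀) 2
  · exact fun w hw => congrArg j (present_flipMap w (hsub hw))
  · intro w hw
    rw [flipMap_apply]
    unfold radialLog
    simp

theorem isNonorientableSubmanifold_componentTwo :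
    IsNonorientableSubmanifold (ITwo k₁ k₂) (2 * k₂) (componentTwo k₁ k₂) := by
  have hk₁ := h₁.out
  have hk₂ := h₂.out
  refine HasSliceAt.isNonorientableSubmanifold (k₁ := k₁) (j := id)
    (y₀ := EuclideanSpace.single ⟨0, by omega⟩ 1) ?_
    (fun p hp => componentTwo_hasSliceAt finrank_euclideanSpace_fin finrank_euclideanSpace_fin hp)
    (by simp) (fun w _ => isLocalDiffeomorph_id _)
    (fun w hw => present_fixedIncl_mem (halfTriples_subset _ hw))
  simp only [Module.finrank_prod, finrank_euclideanSpace_fin]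
  omega

end Nonorientable

/-! ### Tubes from slices -/

theorem HasLocalSection.of_comp {E H X E' H' Y E'' H'' Z : Type*}
    [NormedAddCommGroup E] [NormedSpace ℝ E] [TopologicalSpace H] {I : ModelWithCorners ℝ E H}
    [TopologicalSpace X] [ChartedSpace H X]
    [NormedAddCommGroup E'] [NormedSpace ℝ E'] [TopologicalSpace H']
    {I' : ModelWithCorners ℝ E' H'} [TopologicalSpace Y] [ChartedSpace H' Y]
    [NormedAddCommGroup E''] [NormedSpace ℝ E''] [TopologicalSpace H'']
    {I'' : ModelWithCorners ℝ E'' H''} [TopologicalSpace Z] [ChartedSpace H'' Z]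
    {f : Y → X} {g : Z → Y} {z : Z} (h : HasLocalSection I'' I (f ∘ g) z)
    (hg : ContMDiff I'' I' ∞ g) : HasLocalSection I' I f (g z) := by
  obtain ⟨σ, U, hU, hfU, hσ, hσf, hfσ⟩ := h
  exact ⟨g ∘ σ, U, hU, hfU, hg.comp_contMDiffOn hσ, congrArg g hσf, hfσ⟩

/-- The map `S¹ ×_{ℤ₂} X → M`, `[z, x] ↦ z • ψ x`, given by an equivariant map `ψ`. -/
def AssocBundle.lift {X M : Type} [MulAction Z2 X] [MulAction Circle M] (ψ : X → M)
    (hψ : ∀ (ε : Z2) (x : X), ψ (ε • x) = ε • ψ x) : AssocBundle X → M :=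
  Quotient.lift (fun p : Circle × X => p.1 • ψ p.2) (by
    rintro _ ⟨z, x⟩ ⟨ε, rfl⟩
    change ((ε : Circle) * z) • ψ (ε • x) = z • ψ x
    rw [hψ]
    change ((ε : Circle) * z) • (ε : Circle) • ψ x = z • ψ x
    have h : (ε : Circle) * (ε : Circle) = 1 := by
      have h1 : (ε : Circle) ^ 2 = 1 := ε.2
      rwa [sq] at h1
    rw [smul_smul, mul_right_comm, h, one_mul])

section Lift

variable {k₁ k₂ : ℕ}

/-- The linear slice `ℝ₋^{2k₁} ⊕ ℝ^{2k₂-1}`. -/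
abbrev Slice (k₁ k₂ : ℕ) : Type := RepSpace (signTrivRep (2 * k₁) (2 * k₂ - 1))

theorem contMDiff_Z2_smul_slice (ε : Z2) :
    ContMDiff 𝓘(ℝ, Slice k₁ k₂) 𝓘(ℝ, Slice k₁ k₂) ∞ (fun w : Slice k₁ k₂ => ε • w) :=
  (signTrivRep (2 * k₁) (2 * k₂ - 1) ε).contDiff.contMDiff

variable {E H M : Type} [NormedAddCommGroup E] [NormedSpace ℝ E] [TopologicalSpace H]
  {I : ModelWithCorners ℝ E H} [TopologicalSpace M] [ChartedSpace H M] [MulAction Circle M]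

/-- A smooth equivariant map of the slice to `M` gives a tube if it meets the orbits properly and
nearby orbits can be written in its coordinates. -/
theorem isTube_lift (hsm : ContMDiffSMul (𝓡 1) I ∞ Circle M) {ψ : Slice k₁ k₂ → M}
    (hψ : ContMDiff 𝓘(ℝ, Slice k₁ k₂) I ∞ ψ) (heq : ∀ (ε : Z2) w, ψ (ε • w) = ε • ψ w)
    (hinj : Function.Injective ψ)
    (horb : ∀ (z z' : Circle) w w', z • ψ w = z' • ψ w' → ∃ ε : Z2, z = ε * z')
    (hsec : ∀ w, HasLocalSection (ITube k₁ k₂) I (fun p : Circle × Slice k₁ k₂ => p.1 • ψ p.2)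
      (1, w)) :
    IsTube I (AssocBundle.lift ψ heq : Tube k₁ k₂ → M) := by
  have hφ : ContMDiff (ITube k₁ k₂) I ∞ (fun p : Circle × Slice k₁ k₂ => p.1 • ψ p.2) :=
    contMDiff_fst.smul (hψ.comp contMDiff_snd)
  have hq := AssocBundle.isLocalDiffeomorph_proj (contMDiff_Z2_smul_slice (k₁ := k₁) (k₂ := k₂))
  have hsm' : ∀ z : Circle, ContMDiff I I ∞ (fun p : M => z • p) := fun z =>
    (contMDiff_const (I := I) (I' := 𝓡 1) (c := z)).smul contMDiff_id
  have hinj' : Function.Injective (AssocBundle.lift ψ heq : Tube k₁ k₂ → M) := by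
    intro p q h
    obtain ⟨⟨z, w⟩, rfl⟩ := AssocBundle.surjective_proj p
    obtain ⟨⟨z', w'⟩, rfl⟩ := AssocBundle.surjective_proj q
    have h' : z • ψ w = z' • ψ w' := h
    obtain ⟨ε, rfl⟩ := horb z z' w w' h'
    refine AssocBundle.mk_eq_iff.2 ⟨ε, rfl, ?_⟩
    have h1 : z' • ψ (ε • w) = z' • ψ w' := by
      rw [← h', heq, mul_comm, mul_smul]
      rfl
    have h2 := hinj (smul_left_cancel z' h1)
    have h3 : ε * ε = 1 := Subtype.ext (by
      have h1 : (ε : Circle) ^ 2 = 1 := ε.2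
      rwa [sq] at h1)
    rw [← h2, smul_smul, h3, one_smul]
  refine ⟨hinj', ?_, ?_⟩
  · rw [isLocalDiffeomorph_iff_isLocalDiffeomorphOn_univ]
    refine isLocalDiffeomorphOn_of_hasLocalSection isOpen_univ (fun p _ => ?_) hinj'.injOn
      fun p _ => ?_
    · obtain ⟨q, rfl⟩ := AssocBundle.surjective_proj p
      exact ((hq.hasLocalSection q).contMDiffAt (hφ q)).contMDiffWithinAt
    · obtain ⟨⟨z, w⟩, rfl⟩ := AssocBundle.surjective_proj p
      refine HasLocalSection.of_comp (f := AssocBundle.lift ψ heq)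
        (g := AssocBundle.proj) (z := (z, w)) ?_ hq.contMDiff
      obtain ⟨σ, U, hU, hfU, hσ, hσf, hfσ⟩ := hsec w
      have hfU' : ψ w ∈ U := by simpa using hfU
      have hσf' : σ (ψ w) = (1, w) := by simpa using hσf
      refine ⟨fun p => (z * (σ (z⁻¹ • p)).1, (σ (z⁻¹ • p)).2), (fun p => z⁻¹ • p) ⁻¹' U,
        hU.preimage (hsm' z⁻¹).continuous, ?_, ?_, ?_, ?_⟩
      · change z⁻¹ • z • ψ w ∈ U
        rwa [inv_smul_smul]
      · have h1 : ContMDiffOn I (ITube k₁ k₂) ∞ (fun p => σ (z⁻¹ • p))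
            ((fun p => z⁻¹ • p) ⁻¹' U) :=
          hσ.comp (hsm' z⁻¹).contMDiffOn fun p hp => hp
        exact (contMDiffOn_const.mul (contMDiff_fst.comp_contMDiffOn h1)).prodMk
          (contMDiff_snd.comp_contMDiffOn h1)
      · change (z * (σ (z⁻¹ • z • ψ w)).1, (σ (z⁻¹ • z • ψ w)).2) = (z, w)
        rw [inv_smul_smul, hσf', mul_one]
      · intro p hp
        have h1 : (σ (z⁻¹ • p)).1 • ψ (σ (z⁻¹ • p)).2 = z⁻¹ • p := hfσ _ hp
        change (z * (σ (z⁻¹ • p)).1) • ψ (σ (z⁻¹ • p)).2 = p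
        rw [mul_smul]
        rw [h1, smul_inv_smul]
  · intro z p
    obtain ⟨⟨z', w⟩, rfl⟩ := AssocBundle.surjective_proj p
    exact mul_smul z z' (ψ w)

end Lift

/-! ### A tube in `M₁` -/

section RealPart

/-- The direction of `‖u‖ + u` is a square root of the direction of `u`, depending smoothly on `u` away
from the negative real axis. -/
theorem toCircle_sq_mul_norm {u : ℂ} (h : (‖u‖ : ℂ) + u ≠ 0) :
    (toCircle (‖u‖ + u) : ℂ) ^ 2 * ‖u‖ = u := by
  have h1 : (‖(‖u‖ : ℂ) + u‖ : ℂ) ≠ 0 := by exact_mod_cast norm_ne_zero_iff.2 h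
  have h2 : (‖(‖u‖ : ℂ) + u‖ : ℂ) ^ 2 = ((‖u‖ : ℂ) + u) * (‖u‖ + (starRingEnd ℂ) u) := by
    rw [← Complex.mul_conj']
    simp
  have h3 : (‖u‖ : ℂ) ^ 2 = u * (starRingEnd ℂ) u := (Complex.mul_conj' u).symm
  rw [coe_toCircle h, div_pow, h2, div_mul_eq_mul_div, div_eq_iff (by rw [← h2]; positivity)]
  linear_combination ((‖u‖ : ℂ) + u) * h3

end RealPart

section TubeOne

variable {k₁ k₂ : ℕ} [h₁ : Fact (1 ≤ k₁)] [h₂ : Fact (2 ≤ k₂)]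

/-- The ambient space `V₁^{k₁} ⊕ V₂^{k₂} ⊕ ℝ` of `M₁`. -/
abbrev VOne (k₁ k₂ : ℕ) : Type :=
  WithLp 2 (WithLp 2 (EuclideanSpace ℂ (Fin k₁) × EuclideanSpace ℂ (Fin k₂)) × ℝ)

/-- The `i`-th coordinate of the summand `V₂^{k₂}`. -/
def coordOne (i : Fin k₂) : EuclideanSpace ℂ (Fin k₂) × ℝ →ₗ[ℝ] ℂ where
  toFun p := p.1 i
  map_add' _ _ := rfl
  map_smul' _ _ := rfl

/-- The affine embedding of the slice onto the set of vectors of `V₁^{k₁} ⊕ V₂^{k₂} ⊕ ℝ` with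
distinguished coordinate `1`. -/
def sliceVecOne (α : EuclideanSpace ℝ (Fin (2 * k₁)) ≃L[ℝ] EuclideanSpace ℂ (Fin k₁))
    (e : (EuclideanSpace ℂ (Fin k₂) × ℝ) ≃L[ℝ] EuclideanSpace ℝ (Fin (2 * k₂ - 1)) × ℂ)
    (w : Slice k₁ k₂) :
    VOne k₁ k₂ :=
  WithLp.toLp 2 (WithLp.toLp 2 (α (WithLp.fst w), (e.symm (WithLp.snd w, 1)).1), (e.symm (WithLp.snd w, 1)).2)

/-- A left inverse of `sliceVecOne` up to scaling. -/
def sliceInvOne (α : EuclideanSpace ℝ (Fin (2 * k₁)) ≃L[ℝ] EuclideanSpace ℂ (Fin k₁))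
    (e : (EuclideanSpace ℂ (Fin k₂) × ℝ) ≃L[ℝ] EuclideanSpace ℝ (Fin (2 * k₂ - 1)) × ℂ)
    (c : ℝ) (v : VOne k₁ k₂) :
    Slice k₁ k₂ :=
  WithLp.toLp 2 (α.symm (c • v.fst.fst), (e (c • (v.fst.snd, v.snd))).1)

variable {α : EuclideanSpace ℝ (Fin (2 * k₁)) ≃L[ℝ] EuclideanSpace ℂ (Fin k₁)}
  {i : Fin k₂} {e : (EuclideanSpace ℂ (Fin k₂) × ℝ) ≃L[ℝ] EuclideanSpace ℝ (Fin (2 * k₂ - 1)) × ℂ}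

theorem sliceVecOne_coord (he : ∀ x, (e x).2 = coordOne i x) (w) :
    (sliceVecOne α e w).fst.snd i = 1 := by
  have h := he (e.symm (WithLp.snd w, 1))
  rw [e.apply_symm_apply] at h
  exact h.symm

theorem sliceVecOne_ne_zero (he : ∀ x, (e x).2 = coordOne i x) (w) : sliceVecOne α e w ≠ 0 := by
  intro h
  have := sliceVecOne_coord (α := α) he w
  rw [h] at this
  exact zero_ne_one this

theorem sliceInvOne_sliceVecOne {c : ℝ} (hc : c ≠ 0) (w) :
    sliceInvOne α e c⁻¹ (c • sliceVecOne α e w) = w := by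
  refine withLp_eq ?_ ?_
  · change α.symm (c⁻¹ • (c • α (WithLp.fst w))) = WithLp.fst w
    rw [inv_smul_smul₀ hc, α.symm_apply_apply]
  · change (e (c⁻¹ • (c • e.symm (WithLp.snd w, 1)))).1 = WithLp.snd w
    rw [inv_smul_smul₀ hc, e.apply_symm_apply]

theorem sliceVecOne_sliceInvOne (he : ∀ x, (e x).2 = coordOne i x) {c : ℝ} {v : VOne k₁ k₂}
    (hv : c • v.fst.snd i = 1) : sliceVecOne α e (sliceInvOne α e c v) = c • v := by
  have h : ((e (c • (v.fst.snd, v.snd))).1, (1 : ℂ)) = e (c • (v.fst.snd, v.snd)) := by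
    refine Prod.ext rfl ?_
    rw [he]
    exact hv.symm
  have h' : e.symm ((e (c • (v.fst.snd, v.snd))).1, (1 : ℂ)) = c • (v.fst.snd, v.snd) := by
    rw [h, e.symm_apply_apply]
  refine withLp_eq (withLp_eq ?_ ?_) ?_
  · exact α.apply_symm_apply _
  · exact congrArg Prod.fst h'
  · change (e.symm ((e (c • (v.fst.snd, v.snd))).1, (1 : ℂ))).2 = c • v.snd
    rw [h']
    rfl

theorem contDiff_sliceVecOne : ContDiff ℝ ∞ (sliceVecOne (k₁ := k₁) (k₂ := k₂) α e) := by
  have h : ContDiff ℝ ∞ (fun w : WithLp 2 (EuclideanSpace ℝ (Fin (2 * k₁)) ×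
      EuclideanSpace ℝ (Fin (2 * k₂ - 1))) => e.symm (WithLp.snd w, 1)) :=
    e.symm.contDiff.comp (contDiff_withLp_snd.prodMk contDiff_const)
  exact ((α.contDiff.comp contDiff_withLp_fst).withLp_mk h.fst).withLp_mk h.snd

theorem contDiff_sliceInvOne :
    ContDiff ℝ ∞ (fun p : ℝ × VOne k₁ k₂ => sliceInvOne α e p.1 p.2) := by
  have h1 : ContDiff ℝ ∞ (fun p : ℝ × VOne k₁ k₂ => p.2.fst) := contDiff_withLp_fst.comp contDiff_snd
  have h2 : ContDiff ℝ ∞ (fun p : ℝ × VOne k₁ k₂ => (p.2.fst.snd, p.2.snd)) :=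
    (contDiff_withLp_snd.comp h1).prodMk (contDiff_withLp_snd.comp contDiff_snd)
  exact (α.symm.contDiff.comp (contDiff_fst.smul (contDiff_withLp_fst.comp h1))).withLp_mk
    (e.contDiff.comp (contDiff_fst.smul h2)).fst

theorem repOne_sliceVecOne (ε : Z2) (w : Slice k₁ k₂) :
    repOne k₁ k₂ (ε : Circle) (sliceVecOne α e w) = sliceVecOne α e (ε • w : Slice k₁ k₂) := by
  have h : (ε • w : Slice k₁ k₂) = _ := signTrivRep_apply (2 * k₁) (2 * k₂ - 1) ε w
  rw [h, repOne_apply, Z2.coe_eq_sign]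
  have h2 : ((Z2.sign ε : ℝ) : ℂ) ^ 2 = 1 := by
    rw [sq]; exact_mod_cast Z2.sign_mul_self ε
  refine withLp_eq (withLp_eq ?_ ?_) rfl
  · change ((Z2.sign ε : ℝ) : ℂ) • α (WithLp.fst w) = α (Z2.sign ε • WithLp.fst w)
    rw [map_smul]
    exact Complex.coe_smul _ _
  · change ((Z2.sign ε : ℝ) : ℂ) ^ 2 • (sliceVecOne α e w).fst.snd = (sliceVecOne α e w).fst.snd
    rw [h2, one_smul]

/-- Near the slice, rotating the distinguished coordinate, which has weight `2`, to the positive real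
axis recovers the element of the circle. -/
theorem hasLocalSection_sliceOne (he : ∀ x, (e x).2 = coordOne i x) (w₀ : Slice k₁ k₂) :
    HasLocalSection (ITube k₁ k₂) (IOne k₁ k₂) (fun p : Circle × Slice k₁ k₂ =>
      p.1 • toSphere (repOne k₁ k₂) (sliceVecOne α e p.2)) (1, w₀) := by
  let u : MOne k₁ k₂ → ℂ := fun p => p.val.fst.snd i
  let ζ : MOne k₁ k₂ → ℂ := fun p => (‖u p‖ : ℂ) + u p
  let q : MOne k₁ k₂ → MOne k₁ k₂ := fun p => (toCircle (ζ p))⁻¹ • p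
  have hcoord : ContDiff ℝ ∞ (fun v : VOne k₁ k₂ => v.fst.snd i) :=
    (contDiff_piLp_apply (𝕜 := ℝ) (E := fun _ : Fin k₂ => ℂ) (i := i) 2).comp
      (contDiff_withLp_snd.comp contDiff_withLp_fst)
  have hu : ContMDiff (IOne k₁ k₂) 𝓘(ℝ, ℂ) ∞ u := hcoord.contMDiff.comp RepSphere.contMDiff_val
  have hζc : Continuous ζ := by
    have := hu.continuous
    fun_prop
  have hsm := MOne.contMDiffSMul (k₁ := k₁) (k₂ := k₂)
  have hv0 := sliceVecOne_ne_zero (α := α) he w₀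
  set v := sliceVecOne α e w₀ with hv
  have hvpos := norm_pos_iff.2 hv0
  have hval0 : (toSphere (repOne k₁ k₂) v).val = ‖v‖⁻¹ • v := val_toSphere hv0
  have hu0 : u (toSphere (repOne k₁ k₂) v) = ((‖v‖⁻¹ : ℝ) : ℂ) := by
    change (toSphere (repOne k₁ k₂) v).val.fst.snd i = _
    rw [hval0]
    have hc : v.fst.snd i = 1 := sliceVecOne_coord he w₀
    change ‖v‖⁻¹ • v.fst.snd i = _
    rw [hc, Complex.real_smul, mul_one]
  have hζ0 : ζ (toSphere (repOne k₁ k₂) v) = ((2 * ‖v‖⁻¹ : ℝ) : ℂ) := by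
    change (‖u _‖ : ℂ) + u _ = _
    rw [hu0, Complex.norm_real, Real.norm_of_nonneg (inv_nonneg.2 hvpos.le)]
    push_cast; ring
  have hq0 : q (toSphere (repOne k₁ k₂) v) = toSphere (repOne k₁ k₂) v := by
    change (toCircle (ζ _))⁻¹ • _ = _
    rw [hζ0, toCircle_ofReal (by positivity), inv_one, one_smul]
  -- the distinguished coordinate of `q p` is a positive real number
  have huq : ∀ p, ζ p ≠ 0 → u (q p) = ‖u p‖ := by
    intro p hp
    have h1 : u (q p) = (((toCircle (ζ p))⁻¹ : Circle) : ℂ) ^ 2 * u p := by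
      change ((toCircle (ζ p))⁻¹ • p : MOne k₁ k₂).val.fst.snd i = _
      rw [RepSphere.val_smul, repOne_apply]
      rfl
    have h2 := toCircle_sq_mul_norm hp
    have h3 : (toCircle (ζ p) : ℂ) ≠ 0 := Circle.coe_ne_zero _
    rw [h1, Circle.coe_inv, inv_pow, inv_mul_eq_iff_eq_mul₀ (pow_ne_zero 2 h3)]
    exact h2.symm
  refine ⟨fun p => (toCircle (ζ p), sliceInvOne α e (‖u p‖)⁻¹ (q p).val),
    {p | u p ≠ 0 ∧ ζ p ≠ 0}, (isOpen_ne.preimage hu.continuous).inter (isOpen_ne.preimage hζc),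
    ?_, ?_, ?_, ?_⟩
  · change (1 : Circle) • toSphere (repOne k₁ k₂) v ∈ _
    rw [one_smul]
    refine ⟨?_, ?_⟩
    · rw [hu0]; exact_mod_cast (inv_pos.2 hvpos).ne'
    · rw [hζ0]; exact_mod_cast (mul_pos two_pos (inv_pos.2 hvpos)).ne'
  · intro p hp
    have hn : ContMDiffAt (IOne k₁ k₂) 𝓘(ℝ, ℝ) ∞ (fun p => ‖u p‖) p :=
      (contDiffAt_norm ℝ hp.1).contMDiffAt.comp p (hu p)
    have hζ : ContMDiffAt (IOne k₁ k₂) 𝓘(ℝ, ℂ) ∞ ζ p :=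
      (Complex.ofRealCLM.contDiff.contMDiff.contMDiffAt.comp p hn).add (hu p)
    have hz : ContMDiffAt (IOne k₁ k₂) (𝓡 1) ∞ (fun p => toCircle (ζ p)) p :=
      (contMDiffAt_toCircle hp.2).comp p hζ
    have hq : ContMDiffAt (IOne k₁ k₂) (IOne k₁ k₂) ∞ q p := hz.inv.smul contMDiffAt_id
    have hni : ContMDiffAt (IOne k₁ k₂) 𝓘(ℝ, ℝ) ∞ (fun p => (‖u p‖)⁻¹) p :=
      (contDiffAt_inv ℝ (norm_ne_zero_iff.2 hp.1)).contMDiffAt.comp p hn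
    have hω : ContMDiffAt (IOne k₁ k₂) 𝓘(ℝ, Slice k₁ k₂) ∞
        (fun p => sliceInvOne α e (‖u p‖)⁻¹ (q p).val) p :=
      contDiff_sliceInvOne.contMDiff.contMDiffAt.comp p
        (hni.prodMk_space (RepSphere.contMDiff_val.contMDiffAt.comp p hq))
    exact (hz.prodMk hω).contMDiffWithinAt
  · change (toCircle (ζ ((1 : Circle) • toSphere (repOne k₁ k₂) v)), _) = _
    simp only [one_smul]
    refine Prod.ext ?_ ?_
    · change toCircle (ζ _) = 1
      rw [hζ0, toCircle_ofReal (by positivity)]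
    · change sliceInvOne α e (‖u (toSphere (repOne k₁ k₂) v)‖)⁻¹
        (q (toSphere (repOne k₁ k₂) v)).val = w₀
      rw [hq0, hu0, hval0, Complex.norm_real, Real.norm_of_nonneg (inv_nonneg.2 hvpos.le), hv]
      exact sliceInvOne_sliceVecOne (inv_pos.2 hvpos).ne' w₀
  · rintro p ⟨hp, hp'⟩
    have hpos := norm_pos_iff.2 hp
    change toCircle (ζ p) • toSphere (repOne k₁ k₂)
      (sliceVecOne α e (sliceInvOne α e (‖u p‖)⁻¹ (q p).val)) = p
    have h1 : (‖u p‖)⁻¹ • (q p).val.fst.snd i = 1 := by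
      have := huq p hp'
      change (‖u p‖)⁻¹ • u (q p) = 1
      rw [this, Complex.real_smul]
      push_cast
      exact inv_mul_cancel₀ (by exact_mod_cast hpos.ne')
    rw [sliceVecOne_sliceInvOne he h1, toSphere_smul (inv_pos.2 hpos), toSphere_val]
    exact smul_inv_smul _ _

/-- There is a tube around an orbit of `M₁` with isotropy group `ℤ₂`. -/
theorem exists_isTube_one : ∃ φ₁ : Tube k₁ k₂ → MOne k₁ k₂, IsTube (IOne k₁ k₂) φ₁ ∧
    φ₁ '' tubeCore k₁ k₂ ⊆ fixedPoints Z2 (MOne k₁ k₂) := by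
  have hk₂ := h₂.out
  have α : EuclideanSpace ℝ (Fin (2 * k₁)) ≃L[ℝ] EuclideanSpace ℂ (Fin k₁) :=
    equivOfFinrankEq (by rw [finrank_euclideanSpace_fin, finrank_euclideanSpace_complex])
  let i : Fin k₂ := ⟨0, by omega⟩
  obtain ⟨e, he⟩ := exists_equiv_prod_of_surjective (D := EuclideanSpace ℝ (Fin (2 * k₂ - 1)))
    (T := coordOne i) (fun c => ⟨(EuclideanSpace.single i c, 0),
      by change EuclideanSpace.single i c i = c; simp⟩) (by
      rw [Module.finrank_prod, finrank_euclideanSpace_complex, finrank_euclideanSpace_fin,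
        Complex.finrank_real_complex, Module.finrank_self]
      omega)
  let ψ : Slice k₁ k₂ → MOne k₁ k₂ := fun w => toSphere (repOne k₁ k₂) (sliceVecOne α e w)
  have hval : ∀ w, (ψ w).val = ‖sliceVecOne α e w‖⁻¹ • sliceVecOne α e w := fun w =>
    val_toSphere (sliceVecOne_ne_zero he w)
  have hpos : ∀ w, 0 < ‖sliceVecOne α e w‖⁻¹ := fun w =>
    inv_pos.2 (norm_pos_iff.2 (sliceVecOne_ne_zero he w))
  have hcoord : ∀ (z : Circle) w, (z • ψ w).val.fst.snd i =
      (z : ℂ) ^ 2 * (‖sliceVecOne α e w‖⁻¹ : ℝ) := by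
    intro z w
    rw [RepSphere.val_smul, hval, repOne_apply]
    have hc : (sliceVecOne α e w).fst.snd i = 1 := sliceVecOne_coord he w
    generalize sliceVecOne α e w = v at hc ⊢
    change (z : ℂ) ^ 2 * (‖v‖⁻¹ • v.fst.snd i) = _
    rw [hc, Complex.real_smul, mul_one]
  have hnorm : ∀ (z z' : Circle) w w', z • ψ w = z' • ψ w' →
      ‖sliceVecOne α e w‖⁻¹ = ‖sliceVecOne α e w'‖⁻¹ := by
    intro z z' w w' h
    have h1 := congrArg (fun p : MOne k₁ k₂ => ‖p.val.fst.snd i‖) h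
    simp only [hcoord, norm_mul, norm_pow, Circle.norm_coe, one_pow, one_mul, Complex.norm_real,
      norm_inv, norm_norm] at h1
    exact h1
  have heq : ∀ (ε : Z2) w, ψ (ε • w) = ε • ψ w := fun ε w => by
    change _ = (ε : Circle) • toSphere (repOne k₁ k₂) _
    rw [smul_toSphere (sliceVecOne_ne_zero he w), repOne_sliceVecOne]
  refine ⟨AssocBundle.lift ψ heq, isTube_lift MOne.contMDiffSMul ?_ heq ?_ ?_ ?_, ?_⟩
  · intro w
    exact (contMDiffAt_toSphere (n := 2 * k₁ + 2 * k₂) (sliceVecOne_ne_zero he w)).comp w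
      contDiff_sliceVecOne.contMDiff.contMDiffAt
  · intro w w' h
    have h1 := hnorm 1 1 w w' (by rw [h])
    have h2 := congrArg RepSphere.val h
    rw [hval, hval, ← h1] at h2
    have h3 := sliceInvOne_sliceVecOne (α := α) (e := e) (hpos w).ne' w
    rw [h2] at h3
    exact h3.symm.trans (sliceInvOne_sliceVecOne (hpos w).ne' w')
  · intro z z' w w' h
    have h1 := congrArg (fun p : MOne k₁ k₂ => p.val.fst.snd i) h
    simp only [hcoord] at h1
    rw [hnorm z z' w w' h] at h1
    have h2 : (z : ℂ) ^ 2 = (z' : ℂ) ^ 2 :=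
      mul_right_cancel₀ (by exact_mod_cast (hpos w').ne') h1
    rcases sq_eq_sq_iff_eq_or_eq_neg.1 h2 with h3 | h3
    · exact ⟨1, by rw [Circle.ext h3]; simp⟩
    · refine ⟨⟨-1, neg_one_mem_Z2⟩, Circle.ext ?_⟩
      rw [h3, Circle.coe_mul, coe_neg_one_circle, neg_one_mul]
  · exact hasLocalSection_sliceOne he
  · rintro _ ⟨_, ⟨z, rfl⟩, rfl⟩
    have h1 : ∀ ε : Z2, ε • ψ 0 = ψ 0 := fun ε => by
      rw [← heq]
      congr 1
      exact map_zero (signTrivRep (2 * k₁) (2 * k₂ - 1) ε)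
    intro ε
    change (ε : Circle) • z • ψ 0 = z • ψ 0
    rw [smul_comm]
    exact congrArg (fun p => z • p) (h1 ε)

end TubeOne

/-! ### A tube in `M₂` -/

section TubeTwo

variable {k₁ k₂ : ℕ} [h₁ : Fact (1 ≤ k₁)] [h₂ : Fact (2 ≤ k₂)]

/-- A coordinate of the summand `ℝ³` and one of `ℝ^{2k₂-2}`. -/
def coordTwo (i : Fin (2 * k₂ - 2)) :
    EuclideanSpace ℝ (Fin 3) × EuclideanSpace ℝ (Fin (2 * k₂ - 2)) →ₗ[ℝ] ℝ × ℝ where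
  toFun p := (p.1 0, p.2 i)
  map_add' _ _ := rfl
  map_smul' _ _ := rfl

/-- The affine embedding of the slice onto the set of pairs of vectors of `ℝ³ ⊕ ℝ₋` and
`ℝ₋^{2k₁-1} ⊕ ℝ^{2k₂-2}` whose distinguished coordinates are equal to `1`. -/
def sliceVecTwo (β : EuclideanSpace ℝ (Fin (2 * k₁)) ≃L[ℝ]
      EuclideanSpace ℝ (Fin 1) × EuclideanSpace ℝ (Fin (2 * k₁ - 1)))
    (e : (EuclideanSpace ℝ (Fin 3) × EuclideanSpace ℝ (Fin (2 * k₂ - 2))) ≃L[ℝ]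
      EuclideanSpace ℝ (Fin (2 * k₂ - 1)) × (ℝ × ℝ)) (w : Slice k₁ k₂) : VThree × VSign k₁ k₂ :=
  (WithLp.toLp 2 ((e.symm (WithLp.snd w, (1, 1))).1, (β (WithLp.fst w)).1),
    WithLp.toLp 2 ((β (WithLp.fst w)).2, (e.symm (WithLp.snd w, (1, 1))).2))

/-- A left inverse of `sliceVecTwo`, up to scaling of the two vectors. -/
def sliceInvTwo (β : EuclideanSpace ℝ (Fin (2 * k₁)) ≃L[ℝ]
      EuclideanSpace ℝ (Fin 1) × EuclideanSpace ℝ (Fin (2 * k₁ - 1)))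
    (e : (EuclideanSpace ℝ (Fin 3) × EuclideanSpace ℝ (Fin (2 * k₂ - 2))) ≃L[ℝ]
      EuclideanSpace ℝ (Fin (2 * k₂ - 1)) × (ℝ × ℝ)) (c d : ℝ) (v : VThree × VSign k₁ k₂) :
    Slice k₁ k₂ :=
  WithLp.toLp 2 (β.symm (c • v.1.snd, d • v.2.fst), (e (c • v.1.fst, d • v.2.snd)).1)

variable {β : EuclideanSpace ℝ (Fin (2 * k₁)) ≃L[ℝ]
    EuclideanSpace ℝ (Fin 1) × EuclideanSpace ℝ (Fin (2 * k₁ - 1))} {i : Fin (2 * k₂ - 2)}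
  {e : (EuclideanSpace ℝ (Fin 3) × EuclideanSpace ℝ (Fin (2 * k₂ - 2))) ≃L[ℝ]
    EuclideanSpace ℝ (Fin (2 * k₂ - 1)) × (ℝ × ℝ)}

theorem sliceVecTwo_coord (he : ∀ x, (e x).2 = coordTwo i x) (w : Slice k₁ k₂) :
    (sliceVecTwo β e w).1.fst 0 = 1 ∧ (sliceVecTwo β e w).2.snd i = 1 := by
  have h := he (e.symm (WithLp.snd w, (1, 1)))
  rw [e.apply_symm_apply] at h
  exact ⟨(congrArg Prod.fst h).symm, (congrArg Prod.snd h).symm⟩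

theorem sliceVecTwo_ne_zero (he : ∀ x, (e x).2 = coordTwo i x) (w : Slice k₁ k₂) :
    (sliceVecTwo β e w).1 ≠ 0 ∧ (sliceVecTwo β e w).2 ≠ 0 := by
  obtain ⟨h1, h2⟩ := sliceVecTwo_coord (β := β) he w
  refine ⟨fun h => ?_, fun h => ?_⟩
  · rw [h] at h1
    exact zero_ne_one h1
  · rw [h] at h2
    exact zero_ne_one h2

theorem sliceInvTwo_sliceVecTwo {c d : ℝ} (hc : c ≠ 0) (hd : d ≠ 0) (w : Slice k₁ k₂) :
    sliceInvTwo β e c⁻¹ d⁻¹ (c • (sliceVecTwo β e w).1, d • (sliceVecTwo β e w).2) = w := by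
  refine withLp_eq ?_ ?_
  · change β.symm (c⁻¹ • (c • (β (WithLp.fst w)).1), d⁻¹ • (d • (β (WithLp.fst w)).2)) =
      WithLp.fst w
    rw [inv_smul_smul₀ hc, inv_smul_smul₀ hd]
    exact β.symm_apply_apply _
  · change (e (c⁻¹ • (c • (e.symm (WithLp.snd w, (1, 1))).1),
      d⁻¹ • (d • (e.symm (WithLp.snd w, (1, 1))).2))).1 = WithLp.snd w
    rw [inv_smul_smul₀ hc, inv_smul_smul₀ hd, Prod.mk.eta, e.apply_symm_apply]

theorem sliceVecTwo_sliceInvTwo (he : ∀ x, (e x).2 = coordTwo i x) {c d : ℝ}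
    {v : VThree × VSign k₁ k₂} (hc : c * v.1.fst 0 = 1) (hd : d * v.2.snd i = 1) :
    sliceVecTwo β e (sliceInvTwo β e c d v) = (c • v.1, d • v.2) := by
  have h : ((e (c • v.1.fst, d • v.2.snd)).1, ((1 : ℝ), (1 : ℝ))) =
      e (c • v.1.fst, d • v.2.snd) := by
    refine Prod.ext rfl ?_
    rw [he]
    exact (Prod.ext hc hd).symm
  have h1 : e.symm ((e (c • v.1.fst, d • v.2.snd)).1, ((1 : ℝ), (1 : ℝ))) =
      (c • v.1.fst, d • v.2.snd) := by
    rw [h, e.symm_apply_apply]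
  have h2 := β.apply_symm_apply (c • v.1.snd, d • v.2.fst)
  refine Prod.ext (withLp_eq ?_ ?_) (withLp_eq ?_ ?_)
  · exact (congrArg Prod.fst h1 :)
  · exact (congrArg Prod.fst h2 :)
  · exact (congrArg Prod.snd h2 :)
  · exact (congrArg Prod.snd h1 :)

theorem contDiff_sliceVecTwo : ContDiff ℝ ∞ (sliceVecTwo (k₁ := k₁) (k₂ := k₂) β e) := by
  have h : ContDiff ℝ ∞ (fun w : WithLp 2 (EuclideanSpace ℝ (Fin (2 * k₁)) ×
      EuclideanSpace ℝ (Fin (2 * k₂ - 1))) => e.symm (w.snd, (1, 1))) :=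
    e.symm.contDiff.comp (contDiff_withLp_snd.prodMk contDiff_const)
  have h' : ContDiff ℝ ∞ (fun w : WithLp 2 (EuclideanSpace ℝ (Fin (2 * k₁)) ×
      EuclideanSpace ℝ (Fin (2 * k₂ - 1))) => β w.fst) := β.contDiff.comp contDiff_withLp_fst
  exact (h.fst.withLp_mk h'.fst).prodMk (h'.snd.withLp_mk h.snd)

theorem contDiff_sliceInvTwo : ContDiff ℝ ∞ (fun p : (ℝ × ℝ) × (VThree × VSign k₁ k₂) =>
    sliceInvTwo β e p.1.1 p.1.2 p.2) := by
  have hc : ContDiff ℝ ∞ (fun p : (ℝ × ℝ) × (VThree × VSign k₁ k₂) => p.1.1) :=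
    contDiff_fst.comp contDiff_fst
  have hd : ContDiff ℝ ∞ (fun p : (ℝ × ℝ) × (VThree × VSign k₁ k₂) => p.1.2) :=
    contDiff_snd.comp contDiff_fst
  have h1 : ContDiff ℝ ∞ (fun p : (ℝ × ℝ) × (VThree × VSign k₁ k₂) => p.2.1) :=
    contDiff_fst.comp contDiff_snd
  have h2 : ContDiff ℝ ∞ (fun p : (ℝ × ℝ) × (VThree × VSign k₁ k₂) => p.2.2) :=
    contDiff_snd.comp contDiff_snd
  exact (β.symm.contDiff.comp ((hc.smul (contDiff_withLp_snd.comp h1)).prodMk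
    (hd.smul (contDiff_withLp_fst.comp h2)))).withLp_mk
    (e.contDiff.comp ((hc.smul (contDiff_withLp_fst.comp h1)).prodMk
      (hd.smul (contDiff_withLp_snd.comp h2)))).fst

/-- The two unit vectors given by a point of the slice. -/
def sliceSpheres (β : EuclideanSpace ℝ (Fin (2 * k₁)) ≃L[ℝ]
      EuclideanSpace ℝ (Fin 1) × EuclideanSpace ℝ (Fin (2 * k₁ - 1)))
    (e : (EuclideanSpace ℝ (Fin 3) × EuclideanSpace ℝ (Fin (2 * k₂ - 2))) ≃L[ℝ]
      EuclideanSpace ℝ (Fin (2 * k₂ - 1)) × (ℝ × ℝ)) (w : Slice k₁ k₂) : SThree × SSign k₁ k₂ :=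
  (toSphere _ (sliceVecTwo β e w).1, toSphere _ (sliceVecTwo β e w).2)

theorem sliceSpheres_smul (he : ∀ x, (e x).2 = coordTwo i x) (ε : Z2) (w : Slice k₁ k₂) :
    sliceSpheres β e (ε • w) = (ε • (sliceSpheres β e w).1, ε • (sliceSpheres β e w).2) := by
  have h : (ε • w : Slice k₁ k₂) = _ := signTrivRep_apply (2 * k₁) (2 * k₂ - 1) ε w
  obtain ⟨h1, h2⟩ := sliceVecTwo_ne_zero (β := β) he w
  have h3 : sliceVecTwo β e (ε • w) = (trivThreeSignRep ε (sliceVecTwo β e w).1,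
      signTrivRep (2 * k₁ - 1) (2 * k₂ - 2) ε (sliceVecTwo β e w).2) := by
    have hβ : β (Z2.sign ε • WithLp.fst w) = Z2.sign ε • β (WithLp.fst w) := map_smul _ _ _
    rw [h, trivThreeSignRep_apply, signTrivRep_apply]
    refine Prod.ext (withLp_eq rfl ?_) (withLp_eq ?_ rfl)
    · exact congrArg Prod.fst hβ
    · exact congrArg Prod.snd hβ
  unfold sliceSpheres
  rw [smul_toSphere h1, smul_toSphere h2, h3]

theorem contMDiff_sliceSpheres (he : ∀ x, (e x).2 = coordTwo i x) :
    ContMDiff 𝓘(ℝ, Slice k₁ k₂) ((𝓡 3).prod (𝓡 (2 * k₁ + 2 * k₂ - 4))) ∞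
      (sliceSpheres (k₁ := k₁) (k₂ := k₂) β e) := by
  intro w
  obtain ⟨h1, h2⟩ := sliceVecTwo_ne_zero (β := β) he w
  have h := contDiff_sliceVecTwo (k₁ := k₁) (k₂ := k₂) (β := β) (e := e)
  exact ((contMDiffAt_toSphere (ρ := trivThreeSignRep) (n := 3) h1).comp w
    h.fst.contMDiff.contMDiffAt).prodMk
    ((contMDiffAt_toSphere (ρ := signTrivRep (2 * k₁ - 1) (2 * k₂ - 2))
      (n := 2 * k₁ + 2 * k₂ - 4) h2).comp w h.snd.contMDiff.contMDiffAt)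

theorem sliceSpheres_coord (he : ∀ x, (e x).2 = coordTwo i x) (w : Slice k₁ k₂) :
    (sliceSpheres β e w).1.val.fst 0 = ‖(sliceVecTwo β e w).1‖⁻¹ ∧
      (sliceSpheres β e w).2.val.snd i = ‖(sliceVecTwo β e w).2‖⁻¹ := by
  obtain ⟨h1, h2⟩ := sliceVecTwo_ne_zero (β := β) he w
  obtain ⟨h3, h4⟩ := sliceVecTwo_coord (β := β) he w
  have h5 : (sliceSpheres β e w).1.val = _ := val_toSphere h1
  have h6 : (sliceSpheres β e w).2.val = _ := val_toSphere h2
  rw [h5, h6]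
  generalize sliceVecTwo β e w = v at h3 h4 ⊢
  change ‖v.1‖⁻¹ * v.1.fst 0 = _ ∧ ‖v.2‖⁻¹ * v.2.snd i = _
  rw [h3, h4, mul_one, mul_one]
  exact ⟨rfl, rfl⟩

/-- The point of the slice is recovered from its two unit vectors by normalizing the distinguished
coordinates. -/
theorem sliceInvTwo_sliceSpheres (he : ∀ x, (e x).2 = coordTwo i x) (w : Slice k₁ k₂) :
    sliceInvTwo β e ((sliceSpheres β e w).1.val.fst 0)⁻¹ ((sliceSpheres β e w).2.val.snd i)⁻¹
      ((sliceSpheres β e w).1.val, (sliceSpheres β e w).2.val) = w := by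
  obtain ⟨h1, h2⟩ := sliceVecTwo_ne_zero (β := β) he w
  obtain ⟨h3, h4⟩ := sliceSpheres_coord (β := β) he w
  have h5 : (sliceSpheres β e w).1.val = _ := val_toSphere h1
  have h6 : (sliceSpheres β e w).2.val = _ := val_toSphere h2
  rw [h3, h4, h5, h6]
  exact sliceInvTwo_sliceVecTwo (inv_ne_zero (norm_ne_zero_iff.2 h1))
    (inv_ne_zero (norm_ne_zero_iff.2 h2)) w

/-- The coordinates of the slice are recovered by rescaling both vectors so that their distinguished
coordinates become `1`. -/
theorem hasLocalSection_sliceSpheres (he : ∀ x, (e x).2 = coordTwo i x) (w₀ : Slice k₁ k₂) :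
    HasLocalSection (ITube k₁ k₂) (ICover k₁ k₂)
      (fun p : Circle × Slice k₁ k₂ => (p.1, sliceSpheres β e p.2)) (1, w₀) := by
  have hx : ContMDiff (ICover k₁ k₂) 𝓘(ℝ, VThree) ∞
      (fun p : Circle × (SThree × SSign k₁ k₂) => p.2.1.val) :=
    (RepSphere.contMDiff_val (ρ := trivThreeSignRep) (n := 3)).comp
      (contMDiff_fst.comp contMDiff_snd)
  have hy : ContMDiff (ICover k₁ k₂) 𝓘(ℝ, VSign k₁ k₂) ∞
      (fun p : Circle × (SThree × SSign k₁ k₂) => p.2.2.val) :=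
    (RepSphere.contMDiff_val (ρ := signTrivRep (2 * k₁ - 1) (2 * k₂ - 2))
      (n := 2 * k₁ + 2 * k₂ - 4)).comp (contMDiff_snd.comp contMDiff_snd)
  have hcx : ContDiff ℝ ∞ (fun v : VThree => v.fst 0) :=
    (contDiff_piLp_apply (𝕜 := ℝ) (E := fun _ : Fin 3 => ℝ) (i := 0) 2).comp contDiff_withLp_fst
  have hcy : ContDiff ℝ ∞ (fun v : VSign k₁ k₂ => v.snd i) :=
    (contDiff_piLp_apply (𝕜 := ℝ) (E := fun _ : Fin (2 * k₂ - 2) => ℝ) (i := i) 2).comp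
      contDiff_withLp_snd
  have hx' : ContMDiff (ICover k₁ k₂) 𝓘(ℝ, ℝ) ∞
      (fun p : Circle × (SThree × SSign k₁ k₂) => p.2.1.val.fst 0) := hcx.contMDiff.comp hx
  have hy' : ContMDiff (ICover k₁ k₂) 𝓘(ℝ, ℝ) ∞
      (fun p : Circle × (SThree × SSign k₁ k₂) => p.2.2.val.snd i) := hcy.contMDiff.comp hy
  refine ⟨fun p => (p.1, sliceInvTwo β e (p.2.1.val.fst 0)⁻¹ (p.2.2.val.snd i)⁻¹
      (p.2.1.val, p.2.2.val)), {p | 0 < p.2.1.val.fst 0 ∧ 0 < p.2.2.val.snd i},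
    (isOpen_lt continuous_const hx'.continuous).inter
      (isOpen_lt continuous_const hy'.continuous), ?_, ?_, ?_, ?_⟩
  · obtain ⟨h1, h2⟩ := sliceVecTwo_ne_zero (β := β) he w₀
    obtain ⟨h3, h4⟩ := sliceSpheres_coord (β := β) he w₀
    refine ⟨h3 ▸ ?_, h4 ▸ ?_⟩
    · exact inv_pos.2 (norm_pos_iff.2 h1)
    · exact inv_pos.2 (norm_pos_iff.2 h2)
  · intro p hp
    have h1 := (contDiffAt_inv ℝ hp.1.ne').contMDiffAt.comp p (hx' p)
    have h2 := (contDiffAt_inv ℝ hp.2.ne').contMDiffAt.comp p (hy' p)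
    exact (contMDiffAt_fst.prodMk (contDiff_sliceInvTwo.contMDiff.contMDiffAt.comp p
      ((h1.prodMk_space h2).prodMk_space ((hx p).prodMk_space (hy p))))).contMDiffWithinAt
  · exact Prod.ext rfl (sliceInvTwo_sliceSpheres he w₀)
  · rintro ⟨z, x, y⟩ ⟨hx, hy⟩
    have h1 := sliceVecTwo_sliceInvTwo (β := β) (e := e) he (v := (x.val, y.val))
      (inv_mul_cancel₀ hx.ne') (inv_mul_cancel₀ hy.ne')
    refine Prod.ext rfl ?_
    change sliceSpheres β e (sliceInvTwo β e (x.val.fst 0)⁻¹ (y.val.snd i)⁻¹ (x.val, y.val)) =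
      (x, y)
    unfold sliceSpheres
    rw [h1, toSphere_smul (inv_pos.2 hx), toSphere_smul (inv_pos.2 hy), toSphere_val, toSphere_val]

theorem MTwo.smul_cover (w z : Circle) (q : SThree × SSign k₁ k₂) :
    w • MTwo.cover (z, q) = MTwo.cover (w * z, q) := rfl

/-- There is a tube around an orbit in `C₂`. -/
theorem exists_isTube_two : ∃ φ₂ : Tube k₁ k₂ → MTwo k₁ k₂, IsTube (ITwo k₁ k₂) φ₂ ∧
    φ₂ '' tubeCore k₁ k₂ ⊆ componentTwo k₁ k₂ := by
  have hk₁ := h₁.out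
  have hk₂ := h₂.out
  have β : EuclideanSpace ℝ (Fin (2 * k₁)) ≃L[ℝ]
      EuclideanSpace ℝ (Fin 1) × EuclideanSpace ℝ (Fin (2 * k₁ - 1)) :=
    equivOfFinrankEq (by
      rw [Module.finrank_prod, finrank_euclideanSpace_fin, finrank_euclideanSpace_fin,
        finrank_euclideanSpace_fin]
      omega)
  let i : Fin (2 * k₂ - 2) := ⟨0, by omega⟩
  obtain ⟨e, he⟩ := exists_equiv_prod_of_surjective (D := EuclideanSpace ℝ (Fin (2 * k₂ - 1)))
    (T := coordTwo i) (fun c => ⟨(EuclideanSpace.single 0 c.1, EuclideanSpace.single i c.2), by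
      refine Prod.ext ?_ ?_
      · change EuclideanSpace.single (0 : Fin 3) c.1 0 = c.1; simp
      · change EuclideanSpace.single i c.2 i = c.2; simp⟩) (by
      rw [Module.finrank_prod, Module.finrank_prod, finrank_euclideanSpace_fin,
        finrank_euclideanSpace_fin, finrank_euclideanSpace_fin, Module.finrank_self]
      omega)
  let ψ : Slice k₁ k₂ → MTwo k₁ k₂ := fun w => MTwo.cover (1, sliceSpheres β e w)
  have hsmul : ∀ (z : Circle) w, z • ψ w = MTwo.cover (z, sliceSpheres β e w) := fun z w => by
    change z • MTwo.cover (1, _) = _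
    rw [MTwo.smul_cover, mul_one]
  have heq : ∀ (ε : Z2) w, ψ (ε • w) = ε • ψ w := fun ε w => by
    have h : (ε : Circle) * ε = 1 := by
      have h1 : (ε : Circle) ^ 2 = 1 := ε.2
      rwa [sq] at h1
    change MTwo.cover (1, sliceSpheres β e (ε • w)) = (ε : Circle) • ψ w
    rw [hsmul, sliceSpheres_smul he]
    exact MTwo.cover_eq_iff.2 ⟨ε, 1, h.symm, (one_smul _ _).symm, rfl⟩
  refine ⟨AssocBundle.lift ψ heq,
    isTube_lift MTwo.isClosedCircleManifold.contMDiffSMul ?_ heq ?_ ?_ ?_, ?_⟩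
  · exact MTwo.isLocalDiffeomorph_cover.contMDiff.comp
      (contMDiff_const.prodMk (contMDiff_sliceSpheres he))
  · intro w w' h
    obtain ⟨ε, δ, h1, h2, h3⟩ := MTwo.cover_eq_iff.1 h
    have hε : ε = 1 := Subtype.ext (by rw [mul_one] at h1; exact h1.symm)
    subst hε
    replace h2 : (sliceSpheres β e w).1 = δ • (sliceSpheres β e w').1 := by
      rwa [one_smul] at h2
    replace h3 : (sliceSpheres β e w).2 = (sliceSpheres β e w').2 := by rwa [one_smul] at h3
    have hpos : ∀ w, 0 < (sliceSpheres β e w).1.val.fst 0 := fun w => by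
      rw [(sliceSpheres_coord he w).1]
      exact inv_pos.2 (norm_pos_iff.2 (sliceVecTwo_ne_zero he w).1)
    -- a sign `δ = -1` would change the sign of the distinguished coordinate
    have hδ : δ = 1 := by
      rcases Int.units_eq_one_or δ with h4 | rfl
      · exact h4
      · have h5 : (sliceSpheres β e w).1.val.fst 0 =
            (((-1 : ℤˣ) : ℤ) : ℝ) * (sliceSpheres β e w').1.val.fst 0 := by
          rw [h2]
          rfl
        have h6 := hpos w
        have h7 := hpos w'
        rw [h5] at h6
        simp at h6
        linarith
    rw [hδ, one_smul] at h2
    have h4 := sliceInvTwo_sliceSpheres (β := β) he w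
    rw [h2, h3] at h4
    exact h4.symm.trans (sliceInvTwo_sliceSpheres he w')
  · intro z z' w w' h
    rw [hsmul, hsmul] at h
    obtain ⟨ε, δ, h1, -⟩ := MTwo.cover_eq_iff.1 h
    exact ⟨ε, h1⟩
  · intro w
    have h : (fun p : Circle × Slice k₁ k₂ => p.1 • ψ p.2) =
        MTwo.cover ∘ (fun p : Circle × Slice k₁ k₂ => (p.1, sliceSpheres β e p.2)) :=
      funext fun p => hsmul p.1 p.2
    rw [h]
    exact HasLocalSection.comp (MTwo.isLocalDiffeomorph_cover.hasLocalSection _)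
      (hasLocalSection_sliceSpheres he w)
  · rintro _ ⟨_, ⟨z, rfl⟩, rfl⟩
    change z • ψ 0 ∈ _
    rw [hsmul]
    refine MTwo.cover_mem_componentTwo.2 ⟨?_, ?_⟩
    · have h := val_toSphere (ρ := trivThreeSignRep) (sliceVecTwo_ne_zero (β := β) he 0).1
      change (toSphere trivThreeSignRep (sliceVecTwo β e 0).1).val.snd = 0
      rw [h]
      change _ • (β 0).1 = 0
      rw [map_zero]
      exact smul_zero _
    · have h := val_toSphere (ρ := signTrivRep (2 * k₁ - 1) (2 * k₂ - 2))
        (sliceVecTwo_ne_zero (β := β) he 0).2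
      change (toSphere (signTrivRep (2 * k₁ - 1) (2 * k₂ - 2)) (sliceVecTwo β e 0).2).val.fst = 0
      rw [h]
      change _ • (β 0).2 = 0
      rw [map_zero]
      exact smul_zero _

end TubeTwo

/-! ### Geometry of the tube -/

section TubeGeometry

variable {k₁ k₂ : ℕ}

theorem norm_Z2_smul_slice (ε : Z2) (w : Slice k₁ k₂) : ‖ε • w‖ = ‖w‖ :=
  (signTrivRep (2 * k₁) (2 * k₂ - 1) ε).norm_map w

theorem Z2_smul_smul_slice (ε : Z2) (c : ℝ) (w : Slice k₁ k₂) : ε • c • w = c • ε • w :=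
  map_smul (signTrivRep (2 * k₁) (2 * k₂ - 1) ε) c w

/-- The distance of a point of the tube from the centre. -/
def tubeNorm : Tube k₁ k₂ → ℝ :=
  Quotient.lift (fun p : Circle × Slice k₁ k₂ => ‖p.2‖) (by
    rintro _ ⟨z, w⟩ ⟨ε, rfl⟩
    exact norm_Z2_smul_slice ε w)

theorem tubeNorm_mk (z : Circle) (w : Slice k₁ k₂) : tubeNorm (AssocBundle.mk z w) = ‖w‖ := rfl

theorem exists_eq_mk (p : Tube k₁ k₂) : ∃ (z : Circle) (w : Slice k₁ k₂), AssocBundle.mk z w = p := by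
  obtain ⟨⟨z, w⟩, h⟩ := AssocBundle.surjective_proj p
  exact ⟨z, w, h⟩

theorem tubeNorm_nonneg (p : Tube k₁ k₂) : 0 ≤ tubeNorm p := by
  obtain ⟨z, w, rfl⟩ := exists_eq_mk p
  exact norm_nonneg w

theorem tubeNorm_smul (z : Circle) (p : Tube k₁ k₂) : tubeNorm (z • p) = tubeNorm p := by
  obtain ⟨z, w, rfl⟩ := exists_eq_mk p
  rfl

theorem continuous_tubeNorm : Continuous (tubeNorm (k₁ := k₁) (k₂ := k₂)) :=
  continuous_quot_lift _ (continuous_norm.comp continuous_snd)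

theorem mem_tubeCore_iff {p : Tube k₁ k₂} : p ∈ tubeCore k₁ k₂ ↔ tubeNorm p = 0 := by
  constructor
  · rintro ⟨z, rfl⟩
    exact norm_zero
  · intro h
    obtain ⟨z, w, rfl⟩ := exists_eq_mk p
    rw [tubeNorm_mk, norm_eq_zero] at h
    exact ⟨z, by rw [h]⟩

theorem tubeNorm_pos_iff {p : Tube k₁ k₂} : 0 < tubeNorm p ↔ p ∉ tubeCore k₁ k₂ := by
  rw [mem_tubeCore_iff]
  exact (tubeNorm_nonneg p).lt_iff_ne.trans ne_comm

theorem mem_tubeOpenDisc_iff {p : Tube k₁ k₂} : p ∈ tubeOpenDisc k₁ k₂ ↔ tubeNorm p < 1 := by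
  constructor
  · rintro ⟨z, w, h, rfl⟩
    exact h
  · intro h
    obtain ⟨z, w, rfl⟩ := exists_eq_mk p
    exact ⟨z, w, h, rfl⟩

theorem mem_tubeBoundary_iff {p : Tube k₁ k₂} : p ∈ tubeBoundary k₁ k₂ ↔ tubeNorm p = 1 := by
  constructor
  · rintro ⟨z, w, h, rfl⟩
    exact h
  · intro h
    obtain ⟨z, w, rfl⟩ := exists_eq_mk p
    exact ⟨z, w, h, rfl⟩

theorem isCompact_tubeNorm_le (r : ℝ) : IsCompact {p : Tube k₁ k₂ | tubeNorm p ≤ r} := by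
  have h : {p : Tube k₁ k₂ | tubeNorm p ≤ r} =
      AssocBundle.proj '' ((univ : Set Circle) ×ˢ Metric.closedBall (0 : Slice k₁ k₂) r) := by
    ext p
    constructor
    · intro hp
      obtain ⟨z, w, rfl⟩ := exists_eq_mk p
      exact ⟨(z, w), ⟨mem_univ _, mem_closedBall_zero_iff.2 hp⟩, rfl⟩
    · rintro ⟨⟨z, w⟩, ⟨-, hw⟩, rfl⟩
      exact mem_closedBall_zero_iff.1 hw
  have : ProperSpace (Slice k₁ k₂) := FiniteDimensional.proper_real _
  rw [h]
  exact (isCompact_univ.prod (isCompact_closedBall _ _)).image AssocBundle.continuous_proj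

theorem isCompact_tubeCore : IsCompact (tubeCore k₁ k₂) := by
  have h : tubeCore k₁ k₂ = {p : Tube k₁ k₂ | tubeNorm p ≤ 0} := by
    ext p
    rw [mem_tubeCore_iff]
    exact ⟨fun h => h.le, fun h => le_antisymm h (tubeNorm_nonneg p)⟩
  rw [h]
  exact isCompact_tubeNorm_le 0

theorem smul_mem_tubeCore_iff (z : Circle) {p : Tube k₁ k₂} :
    z • p ∈ tubeCore k₁ k₂ ↔ p ∈ tubeCore k₁ k₂ := by
  rw [mem_tubeCore_iff, mem_tubeCore_iff, tubeNorm_smul]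

/-- The inversion `[z, w] ↦ [z, w / ‖w‖²]` of the tube in the boundary of the disc bundle. It fixes
the points of the centre. -/
def tubeInv : Tube k₁ k₂ → Tube k₁ k₂ :=
  Quotient.lift (fun p : Circle × Slice k₁ k₂ => AssocBundle.mk p.1 ((‖p.2‖ ^ 2)⁻¹ • p.2)) (by
    rintro _ ⟨z, w⟩ ⟨ε, rfl⟩
    change AssocBundle.mk ((ε : Circle) * z) ((‖ε • w‖ ^ 2)⁻¹ • ε • w) = _
    rw [norm_Z2_smul_slice, ← Z2_smul_smul_slice]
    exact AssocBundle.mk_eq_iff.2 ⟨ε, rfl, rfl⟩)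

theorem tubeInv_mk (z : Circle) (w : Slice k₁ k₂) :
    tubeInv (AssocBundle.mk z w) = AssocBundle.mk z ((‖w‖ ^ 2)⁻¹ • w) := rfl

theorem tubeInv_smul (z : Circle) (p : Tube k₁ k₂) : tubeInv (z • p) = z • tubeInv p := by
  obtain ⟨z, w, rfl⟩ := exists_eq_mk p
  rfl

theorem tubeNorm_tubeInv (p : Tube k₁ k₂) : tubeNorm (tubeInv p) = (tubeNorm p)⁻¹ := by
  obtain ⟨z, w, rfl⟩ := exists_eq_mk p
  rw [tubeInv_mk, tubeNorm_mk, tubeNorm_mk, norm_smul, norm_inv, norm_pow, norm_norm]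
  rcases eq_or_ne ‖w‖ 0 with h | h
  · simp [h]
  · field_simp

theorem tubeInv_tubeInv (p : Tube k₁ k₂) : tubeInv (tubeInv p) = p := by
  obtain ⟨z, w, rfl⟩ := exists_eq_mk p
  have h1 := tubeNorm_tubeInv (AssocBundle.mk z w : Tube k₁ k₂)
  rw [tubeInv_mk, tubeNorm_mk, tubeNorm_mk] at h1
  rw [tubeInv_mk, tubeInv_mk, h1, smul_smul]
  rcases eq_or_ne w 0 with rfl | h
  · rw [smul_zero]
  · have h2 : ‖w‖ ≠ 0 := norm_ne_zero_iff.2 h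
    rw [show ((‖w‖⁻¹ ^ 2)⁻¹ * (‖w‖ ^ 2)⁻¹) = 1 by field_simp, one_smul]

theorem tubeInv_eq_self {p : Tube k₁ k₂} (h : tubeNorm p = 1) : tubeInv p = p := by
  obtain ⟨z, w, rfl⟩ := exists_eq_mk p
  rw [tubeNorm_mk] at h
  rw [tubeInv_mk, h]
  norm_num

theorem tubeInv_mem_tubeCore_iff {p : Tube k₁ k₂} :
    tubeInv p ∈ tubeCore k₁ k₂ ↔ p ∈ tubeCore k₁ k₂ := by
  rw [mem_tubeCore_iff, mem_tubeCore_iff, tubeNorm_tubeInv, inv_eq_zero]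

theorem contMDiffAt_tubeInv {p : Tube k₁ k₂} (hp : p ∉ tubeCore k₁ k₂) :
    ContMDiffAt (ITube k₁ k₂) (ITube k₁ k₂) ∞ tubeInv p := by
  obtain ⟨⟨z, w⟩, rfl⟩ := AssocBundle.surjective_proj p
  have hw : w ≠ 0 := fun h => hp (mem_tubeCore_iff.2 (norm_eq_zero.2 h))
  have hq := AssocBundle.isLocalDiffeomorph_proj (contMDiff_Z2_smul_slice (k₁ := k₁) (k₂ := k₂))
  refine (hq.hasLocalSection (z, w)).contMDiffAt ?_
  have h1 : ContDiffAt ℝ ∞ (fun w : Slice k₁ k₂ => (‖w‖ ^ 2)⁻¹ • w) w :=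
    ((contDiff_norm_sq ℝ).contDiffAt.inv (pow_ne_zero 2 (norm_ne_zero_iff.2 hw))).smul
      contDiffAt_id
  have h2 : ContMDiffAt (ITube k₁ k₂) (ITube k₁ k₂) ∞
      (fun p : Circle × Slice k₁ k₂ => (p.1, (‖p.2‖ ^ 2)⁻¹ • p.2)) (z, w) :=
    contMDiffAt_fst.prodMk (ContMDiffAt.comp (g := fun w : Slice k₁ k₂ => (‖w‖ ^ 2)⁻¹ • w) (z, w)
      h1.contMDiffAt contMDiffAt_snd)
  exact (hq.contMDiff _).comp (z, w) h2

/-- The points of the tube which are fixed by `ℤ₂`. -/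
theorem neg_one_smul_mk_iff {z : Circle} {w : Slice k₁ k₂} :
    (-1 : Circle) • (AssocBundle.mk z w : Tube k₁ k₂) = AssocBundle.mk z w ↔ WithLp.fst w = 0 := by
  rw [AssocBundle.smul_mk, neg_one_mul, AssocBundle.mk_eq_iff]
  have h (ε : Z2) : (ε • w : Slice k₁ k₂) = _ := signTrivRep_apply (2 * k₁) (2 * k₂ - 1) ε w
  constructor
  · rintro ⟨ε, hz, hw⟩
    have h1 : WithLp.fst w = Z2.sign ε • WithLp.fst w :=
      congrArg WithLp.fst (hw.trans (h ε))
    rw [Z2.sign_eq_neg_one_of hz, neg_smul, one_smul] at h1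
    exact eq_zero_of_neg_eq_self h1.symm
  · intro hw
    refine ⟨⟨-1, neg_one_mem_Z2⟩, (neg_one_mul z).symm, ?_⟩
    rw [h]
    refine withLp_eq ?_ rfl
    change WithLp.fst w = Z2.sign _ • WithLp.fst w
    rw [hw]
    exact (smul_zero _).symm

/-- No point of the tube is fixed by the circle group. -/
theorem exists_smul_ne (p : Tube k₁ k₂) : ∃ z : Circle, z • p ≠ p := by
  refine ⟨circleOfNorm Complex.I Complex.norm_I, fun h => ?_⟩
  obtain ⟨z, w, rfl⟩ := exists_eq_mk p
  rw [AssocBundle.smul_mk, AssocBundle.mk_eq_iff] at h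
  obtain ⟨ε, h, -⟩ := h
  have h1 := congrArg (fun z : Circle => (z : ℂ).im) (mul_right_cancel h)
  simp only [coe_circleOfNorm, Z2.coe_eq_sign, Complex.I_im, Complex.ofReal_im] at h1
  exact one_ne_zero h1

/-- The complement of the zero section is connected since the slice has dimension at least two. -/
theorem isPreconnected_compl_tubeCore [h₁ : Fact (1 ≤ k₁)] :
    IsPreconnected ((tubeCore k₁ k₂)ᶜ) := by
  have hk₁ := h₁.out
  have h : (tubeCore k₁ k₂)ᶜ =
      AssocBundle.proj '' ((univ : Set Circle) ×ˢ ({0}ᶜ : Set (Slice k₁ k₂))) := by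
    ext p
    constructor
    · intro hp
      obtain ⟨z, w, rfl⟩ := exists_eq_mk p
      refine ⟨(z, w), ⟨mem_univ _, fun hw : w = 0 => hp ?_⟩, rfl⟩
      exact mem_tubeCore_iff.2 (norm_eq_zero.2 hw)
    · rintro ⟨⟨z, w⟩, ⟨-, hw⟩, rfl⟩ hp
      exact hw (norm_eq_zero.1 (mem_tubeCore_iff.1 hp))
  have hrank : 1 < Module.rank ℝ (Slice k₁ k₂) := by
    rw [← Module.finrank_eq_rank]
    have h1 : Module.finrank ℝ (Slice k₁ k₂) = 2 * k₁ + (2 * k₂ - 1) := finrank_sum_euclidean _ _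
    rw [h1]
    exact_mod_cast (by omega : 1 < 2 * k₁ + (2 * k₂ - 1))
  rw [h]
  exact (isPreconnected_univ.prod
    (isConnected_compl_singleton_of_one_lt_rank hrank 0).isPreconnected).image _
    AssocBundle.continuous_proj.continuousOn

/-- The inclusion of the summand `ℝ^{2k₂-1}` into the slice. -/
def fixedSlice (k₁ k₂ : ℕ) (v : EuclideanSpace ℝ (Fin (2 * k₂ - 1))) : Slice k₁ k₂ :=
  WithLp.toLp 2 (0, v)

theorem continuous_fixedSlice : Continuous (fixedSlice k₁ k₂) :=
  ((contDiff_const (n := 0)).withLp_mk contDiff_id).continuous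

/-- The inclusion of `S¹ × ℝ^{2k₂-1}` onto the points of the tube which are fixed by `ℤ₂`. -/
def tubeFixedMap (q : Circle × EuclideanSpace ℝ (Fin (2 * k₂ - 1))) : Tube k₁ k₂ :=
  AssocBundle.mk q.1 (fixedSlice k₁ k₂ q.2)

theorem continuous_tubeFixedMap : Continuous (tubeFixedMap (k₁ := k₁) (k₂ := k₂)) :=
  AssocBundle.continuous_proj.comp
    (continuous_fst.prodMk (continuous_fixedSlice.comp continuous_snd))

theorem tubeNorm_tubeFixedMap (q : Circle × EuclideanSpace ℝ (Fin (2 * k₂ - 1))) :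
    tubeNorm (tubeFixedMap q : Tube k₁ k₂) = ‖q.2‖ := by
  change ‖(WithLp.toLp 2 (0, q.2) : WithLp 2 (EuclideanSpace ℝ (Fin (2 * k₁)) × _))‖ = _
  simp

theorem range_tubeFixedMap :
    range (tubeFixedMap (k₁ := k₁) (k₂ := k₂)) = {p | (-1 : Circle) • p = p} := by
  ext p
  constructor
  · rintro ⟨q, rfl⟩
    exact neg_one_smul_mk_iff.2 rfl
  · intro hp
    obtain ⟨z, w, rfl⟩ := exists_eq_mk p
    have h := neg_one_smul_mk_iff.1 hp
    refine ⟨(z, WithLp.snd w), congrArg (AssocBundle.mk z) ?_⟩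
    exact withLp_eq h.symm rfl

theorem isPreconnected_tubeFixed : IsPreconnected {p : Tube k₁ k₂ | (-1 : Circle) • p = p} := by
  rw [← range_tubeFixedMap]
  exact isPreconnected_range continuous_tubeFixedMap

/-- The fixed part of the slice has dimension `2k₂-1 ≥ 3`, so it remains connected when the centre is
removed. -/
theorem isConnected_tubeFixed_diff [h₂ : Fact (2 ≤ k₂)] :
    IsConnected ({p : Tube k₁ k₂ | (-1 : Circle) • p = p} \ tubeCore k₁ k₂) := by
  have hk₂ := h₂.out
  have h : {p : Tube k₁ k₂ | (-1 : Circle) • p = p} \ tubeCore k₁ k₂ =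
      tubeFixedMap '' ((univ : Set Circle) ×ˢ ({0}ᶜ : Set (EuclideanSpace ℝ (Fin (2 * k₂ - 1))))) := by
    rw [← range_tubeFixedMap]
    ext p
    constructor
    · rintro ⟨⟨q, rfl⟩, hp⟩
      refine ⟨q, ⟨mem_univ _, fun hw : q.2 = 0 => hp ?_⟩, rfl⟩
      rw [mem_tubeCore_iff, tubeNorm_tubeFixedMap, hw, norm_zero]
    · rintro ⟨q, ⟨-, hw⟩, rfl⟩
      refine ⟨⟨q, rfl⟩, fun hp => hw ?_⟩
      rw [mem_tubeCore_iff, tubeNorm_tubeFixedMap] at hp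
      exact norm_eq_zero.1 hp
  have hrank : 1 < Module.rank ℝ (EuclideanSpace ℝ (Fin (2 * k₂ - 1))) := by
    rw [← Module.finrank_eq_rank, finrank_euclideanSpace_fin]
    exact_mod_cast (by omega : 1 < 2 * k₂ - 1)
  rw [h]
  exact (isConnected_univ.prod (isConnected_compl_singleton_of_one_lt_rank hrank 0)).image _
    continuous_tubeFixedMap.continuousOn

end TubeGeometry

section IsTube

variable {k₁ k₂ : ℕ} {E H X : Type} [NormedAddCommGroup E] [NormedSpace ℝ E] [TopologicalSpace H]
  {I : ModelWithCorners ℝ E H} [TopologicalSpace X] [ChartedSpace H X] [MulAction Circle X]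
  {φ : Tube k₁ k₂ → X}

theorem IsTube.continuous (h : IsTube I φ) : Continuous φ := h.isLocalDiffeomorph.contMDiff.continuous

theorem IsTube.isOpenEmbedding (h : IsTube I φ) : IsOpenEmbedding φ :=
  .of_continuous_injective_isOpenMap h.continuous h.injective h.isLocalDiffeomorph.isOpenMap

theorem IsTube.smul_eq_iff (h : IsTube I φ) (z : Circle) (p : Tube k₁ k₂) :
    z • φ p = φ p ↔ z • p = p := by
  rw [← h.equivariant]
  exact h.injective.eq_iff

theorem IsTube.notMem_fixedPoints (h : IsTube I φ) (p : Tube k₁ k₂) :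
    φ p ∉ fixedPoints Circle X := fun hp => by
  obtain ⟨z, hz⟩ := exists_smul_ne p
  exact hz ((h.smul_eq_iff z p).1 (hp z))

theorem IsTube.mem_outside_iff (h : IsTube I φ) {p : Tube k₁ k₂} :
    φ p ∈ outside φ ↔ 1 ≤ tubeNorm p := by
  rw [outside, mem_compl_iff, h.injective.mem_set_image, mem_tubeOpenDisc_iff, not_lt]

theorem IsTube.outside_subset_compl_core (φ : Tube k₁ k₂ → X) : outside φ ⊆ (φ '' tubeCore k₁ k₂)ᶜ := by
  refine compl_subset_compl.2 (image_mono fun p hp => ?_)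
  rw [mem_tubeOpenDisc_iff, mem_tubeCore_iff.1 hp]
  exact one_pos

theorem IsTube.isClosed_outside (h : IsTube I φ) : IsClosed (outside φ) := by
  have h1 : IsOpen (tubeOpenDisc k₁ k₂) := by
    have : tubeOpenDisc k₁ k₂ = {p | tubeNorm p < 1} := by
      ext p; exact mem_tubeOpenDisc_iff
    rw [this]
    exact isOpen_lt continuous_tubeNorm continuous_const
  exact (h.isOpenEmbedding.isOpenMap _ h1).isClosed_compl

theorem IsTube.isClosed_image_core [T2Space X] (h : IsTube I φ) : IsClosed (φ '' tubeCore k₁ k₂) :=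
  (isCompact_tubeCore.image h.continuous).isClosed

theorem IsTube.smul_mem_compl_core (h : IsTube I φ) (z : Circle) {x : X}
    (hx : x ∈ (φ '' tubeCore k₁ k₂)ᶜ) : z • x ∈ (φ '' tubeCore k₁ k₂)ᶜ := by
  rintro ⟨p, hp, hpx⟩
  refine hx ⟨z⁻¹ • p, (smul_mem_tubeCore_iff _).2 hp, ?_⟩
  rw [h.equivariant, hpx, inv_smul_smul]

end IsTube

/-! ### Gluing along tubes -/

section TubeGluing

variable {k₁ k₂ : ℕ}

instance : Nonempty (Tube k₁ k₂) := ⟨AssocBundle.mk 1 0⟩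

theorem isOpen_compl_tubeCore : IsOpen (tubeCore k₁ k₂)ᶜ := isCompact_tubeCore.isClosed.isOpen_compl

/-- The inversion of the tube outside of its centre. -/
def tubeInvHomeo (k₁ k₂ : ℕ) : OpenPartialHomeomorph (Tube k₁ k₂) (Tube k₁ k₂) where
  toFun := tubeInv
  invFun := tubeInv
  source := (tubeCore k₁ k₂)ᶜ
  target := (tubeCore k₁ k₂)ᶜ
  map_source' _ hp := fun h => hp (tubeInv_mem_tubeCore_iff.1 h)
  map_target' _ hp := fun h => hp (tubeInv_mem_tubeCore_iff.1 h)
  left_inv' p _ := tubeInv_tubeInv p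
  right_inv' p _ := tubeInv_tubeInv p
  open_source := isOpen_compl_tubeCore
  open_target := isOpen_compl_tubeCore
  continuousOn_toFun _ hp := (contMDiffAt_tubeInv hp).continuousAt.continuousWithinAt
  continuousOn_invFun _ hp := (contMDiffAt_tubeInv hp).continuousAt.continuousWithinAt

variable {E₁ H₁ X₁ E₂ H₂ X₂ : Type}
  [NormedAddCommGroup E₁] [NormedSpace ℝ E₁] [TopologicalSpace H₁]
  {I₁ : ModelWithCorners ℝ E₁ H₁} [TopologicalSpace X₁] [ChartedSpace H₁ X₁] [MulAction Circle X₁]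
  [NormedAddCommGroup E₂] [NormedSpace ℝ E₂] [TopologicalSpace H₂]
  {I₂ : ModelWithCorners ℝ E₂ H₂} [TopologicalSpace X₂] [ChartedSpace H₂ X₂] [MulAction Circle X₂]
  {φ₁ : Tube k₁ k₂ → X₁} {φ₂ : Tube k₁ k₂ → X₂}

/-- A tube as a homeomorphism onto an open subset. -/
def IsTube.homeo (h : IsTube I₁ φ₁) : OpenPartialHomeomorph (Tube k₁ k₂) X₁ :=
  h.isOpenEmbedding.toOpenPartialHomeomorph φ₁

theorem IsTube.homeo_source (h : IsTube I₁ φ₁) : h.homeo.source = univ := rfl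

theorem IsTube.homeo_target (h : IsTube I₁ φ₁) : h.homeo.target = range φ₁ := by
  rw [← h.homeo.image_source_eq_target, h.homeo_source, image_univ]
  rfl

theorem IsTube.homeo_symm_apply (h : IsTube I₁ φ₁) (p : Tube k₁ k₂) : h.homeo.symm (φ₁ p) = p :=
  h.homeo.left_inv (mem_univ p)

/-- The identification of the complements of the centres of two tubes which exchanges the inner and
the outer parts of the tubes. -/
def tubeGluingMap (h₁ : IsTube I₁ φ₁) (h₂ : IsTube I₂ φ₂) : OpenPartialHomeomorph X₁ X₂ :=
  h₁.homeo.symm ≫ₕ (tubeInvHomeo k₁ k₂ ≫ₕ h₂.homeo)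

theorem tubeGluingMap_apply (h₁ : IsTube I₁ φ₁) (h₂ : IsTube I₂ φ₂) (p : Tube k₁ k₂) :
    tubeGluingMap h₁ h₂ (φ₁ p) = φ₂ (tubeInv p) := by
  change φ₂ (tubeInv (h₁.homeo.symm (φ₁ p))) = _
  rw [h₁.homeo_symm_apply]

theorem tubeGluingMap_symm_apply (h₁ : IsTube I₁ φ₁) (h₂ : IsTube I₂ φ₂) (p : Tube k₁ k₂) :
    (tubeGluingMap h₁ h₂).symm (φ₂ p) = φ₁ (tubeInv p) := by
  change φ₁ (tubeInv (h₂.homeo.symm (φ₂ p))) = _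
  rw [h₂.homeo_symm_apply]

theorem tubeGluingMap_source (h₁ : IsTube I₁ φ₁) (h₂ : IsTube I₂ φ₂) :
    (tubeGluingMap h₁ h₂).source = φ₁ '' (tubeCore k₁ k₂)ᶜ := by
  have h : (tubeGluingMap h₁ h₂).source =
      h₁.homeo.target ∩ h₁.homeo.symm ⁻¹' ((tubeCore k₁ k₂)ᶜ ∩ tubeInv ⁻¹' univ) := rfl
  rw [h, h₁.homeo_target, preimage_univ, inter_univ]
  ext x
  constructor
  · rintro ⟨⟨p, rfl⟩, hp⟩
    rw [mem_preimage, h₁.homeo_symm_apply] at hp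
    exact ⟨p, hp, rfl⟩
  · rintro ⟨p, hp, rfl⟩
    refine ⟨⟨p, rfl⟩, ?_⟩
    rwa [mem_preimage, h₁.homeo_symm_apply]

theorem tubeGluingMap_target (h₁ : IsTube I₁ φ₁) (h₂ : IsTube I₂ φ₂) :
    (tubeGluingMap h₁ h₂).target = φ₂ '' (tubeCore k₁ k₂)ᶜ := by
  rw [← (tubeGluingMap h₁ h₂).image_source_eq_target, tubeGluingMap_source, ← image_comp]
  ext y
  constructor
  · rintro ⟨p, hp, rfl⟩
    exact ⟨tubeInv p, fun h => hp (tubeInv_mem_tubeCore_iff.1 h),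
      (tubeGluingMap_apply h₁ h₂ p).symm⟩
  · rintro ⟨p, hp, rfl⟩
    refine ⟨tubeInv p, fun h => hp (tubeInv_mem_tubeCore_iff.1 h), ?_⟩
    rw [Function.comp_apply, tubeGluingMap_apply, tubeInv_tubeInv]

theorem image_compl_tubeCore_subset (h₁ : IsTube I₁ φ₁) :
    φ₁ '' (tubeCore k₁ k₂)ᶜ ⊆ (φ₁ '' tubeCore k₁ k₂)ᶜ := by
  rintro _ ⟨p, hp, rfl⟩ ⟨q, hq, hqp⟩
  rw [h₁.injective hqp] at hq
  exact hp hq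

/-- A map given by the inversion in terms of two tubes is smooth. -/
theorem contMDiffOn_of_tubeInv (h₁ : IsTube I₁ φ₁) (h₂ : IsTube I₂ φ₂) {f : X₁ → X₂}
    (hf : ∀ p, f (φ₁ p) = φ₂ (tubeInv p)) :
    ContMDiffOn I₁ I₂ ∞ f (φ₁ '' (tubeCore k₁ k₂)ᶜ) := by
  rintro _ ⟨p, hp, rfl⟩
  refine ((h₁.isLocalDiffeomorph.hasLocalSection p).contMDiffAt ?_).contMDiffWithinAt
  exact ((h₂.isLocalDiffeomorph.contMDiff _).comp p (contMDiffAt_tubeInv hp)).congr_of_eventuallyEq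
    (Eventually.of_forall hf)

section Space

variable [hk₂ : Fact (2 ≤ k₂)] [T2Space X₁] [T2Space X₂]

/-- The gluing of the complements of the centres of two tubes. -/
def tubeGluing (h₁ : IsTube I₁ φ₁) (h₂ : IsTube I₂ φ₂) : GluingData X₁ X₂ where
  left := (φ₁ '' tubeCore k₁ k₂)ᶜ
  right := (φ₂ '' tubeCore k₁ k₂)ᶜ
  map := tubeGluingMap h₁ h₂
  isOpen_left := h₁.isClosed_image_core.isOpen_compl
  isOpen_right := h₂.isClosed_image_core.isOpen_compl
  source_subset := by
    rw [tubeGluingMap_source]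
    exact image_compl_tubeCore_subset h₁
  target_subset := by
    rw [tubeGluingMap_target]
    exact image_compl_tubeCore_subset h₂
  left_nonempty := by
    obtain ⟨p, -, hp⟩ := (isConnected_tubeFixed_diff (k₁ := k₁) (k₂ := k₂)).nonempty
    exact ⟨φ₁ p, image_compl_tubeCore_subset h₁ ⟨p, hp, rfl⟩⟩
  right_nonempty := by
    obtain ⟨p, -, hp⟩ := (isConnected_tubeFixed_diff (k₁ := k₁) (k₂ := k₂)).nonempty
    exact ⟨φ₂ p, image_compl_tubeCore_subset h₂ ⟨p, hp, rfl⟩⟩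

variable (h₁ : IsTube I₁ φ₁) (h₂ : IsTube I₂ φ₂)

theorem mem_left_of_notMem_core {p : Tube k₁ k₂} (hp : p ∉ tubeCore k₁ k₂) :
    φ₁ p ∈ (tubeGluing h₁ h₂).left := image_compl_tubeCore_subset h₁ ⟨p, hp, rfl⟩

theorem mem_right_of_notMem_core {p : Tube k₁ k₂} (hp : p ∉ tubeCore k₁ k₂) :
    φ₂ p ∈ (tubeGluing h₁ h₂).right := image_compl_tubeCore_subset h₂ ⟨p, hp, rfl⟩

theorem tubeGluing_inl_eq_inr {p : Tube k₁ k₂} (hp : p ∉ tubeCore k₁ k₂) :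
    (tubeGluing h₁ h₂).inl (φ₁ p) = (tubeGluing h₁ h₂).inr (φ₂ (tubeInv p)) := by
  have hs : φ₁ p ∈ (tubeGluing h₁ h₂).map.source := by
    change φ₁ p ∈ (tubeGluingMap h₁ h₂).source
    rw [tubeGluingMap_source]
    exact ⟨p, hp, rfl⟩
  rw [GluingData.inl_eq_inr_map hs]
  exact congrArg _ (tubeGluingMap_apply h₁ h₂ p)

theorem tubeGluing_exists_of_eq {x : X₁} {y : X₂} (hx : x ∈ (tubeGluing h₁ h₂).left)
    (hy : y ∈ (tubeGluing h₁ h₂).right)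
    (h : (tubeGluing h₁ h₂).inl x = (tubeGluing h₁ h₂).inr y) :
    ∃ p ∉ tubeCore k₁ k₂, x = φ₁ p ∧ y = φ₂ (tubeInv p) := by
  obtain ⟨hs, rfl⟩ := (GluingData.inl_eq_inr_iff hx hy).1 h
  have hs' : x ∈ (tubeGluingMap h₁ h₂).source := hs
  rw [tubeGluingMap_source] at hs'
  obtain ⟨p, hp, rfl⟩ := hs'
  exact ⟨p, hp, rfl, tubeGluingMap_apply h₁ h₂ p⟩

/-- Every point of the glued space lies in the outer part of one of the two spaces. -/
theorem tubeGluing_exists_rep (q : (tubeGluing h₁ h₂).Space) :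
    (∃ x ∈ outside φ₁, (tubeGluing h₁ h₂).inl x = q) ∨
      ∃ y ∈ outside φ₂, (tubeGluing h₁ h₂).inr y = q := by
  have hn : ∀ {p : Tube k₁ k₂}, p ∉ tubeCore k₁ k₂ → tubeNorm p < 1 → 1 ≤ tubeNorm (tubeInv p) := by
    intro p hp h
    rw [tubeNorm_tubeInv]
    exact (one_le_inv₀ (tubeNorm_pos_iff.2 hp)).2 h.le
  rcases GluingData.exists_rep q with ⟨x, hx, rfl⟩ | ⟨y, hy, rfl⟩
  · by_cases ho : x ∈ outside φ₁
    · exact Or.inl ⟨x, ho, rfl⟩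
    · obtain ⟨p, hp, rfl⟩ := not_not.1 ho
      have hp' : p ∉ tubeCore k₁ k₂ := fun h => hx ⟨p, h, rfl⟩
      exact Or.inr ⟨φ₂ (tubeInv p), h₂.mem_outside_iff.2 (hn hp' (mem_tubeOpenDisc_iff.1 hp)),
        (tubeGluing_inl_eq_inr h₁ h₂ hp').symm⟩
  · by_cases ho : y ∈ outside φ₂
    · exact Or.inr ⟨y, ho, rfl⟩
    · obtain ⟨p, hp, rfl⟩ := not_not.1 ho
      have hp' : p ∉ tubeCore k₁ k₂ := fun h => hy ⟨p, h, rfl⟩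
      have h3 := tubeGluing_inl_eq_inr h₁ h₂ (p := tubeInv p)
        fun h => hp' (tubeInv_mem_tubeCore_iff.1 h)
      rw [tubeInv_tubeInv] at h3
      exact Or.inl ⟨φ₁ (tubeInv p), h₁.mem_outside_iff.2 (hn hp' (mem_tubeOpenDisc_iff.1 hp)), h3⟩

theorem tubeGluing_union : (tubeGluing h₁ h₂).inl '' outside φ₁ ∪
    (tubeGluing h₁ h₂).inr '' outside φ₂ = univ := eq_univ_of_forall (tubeGluing_exists_rep h₁ h₂)

theorem tubeGluing_glue {p : Tube k₁ k₂} (hp : p ∈ tubeBoundary k₁ k₂) :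
    (tubeGluing h₁ h₂).inl (φ₁ p) = (tubeGluing h₁ h₂).inr (φ₂ p) := by
  rw [mem_tubeBoundary_iff] at hp
  have hp' : p ∉ tubeCore k₁ k₂ := tubeNorm_pos_iff.1 (hp ▸ one_pos)
  rw [tubeGluing_inl_eq_inr h₁ h₂ hp', tubeInv_eq_self hp]

theorem tubeGluing_inter : (tubeGluing h₁ h₂).inl '' outside φ₁ ∩
    (tubeGluing h₁ h₂).inr '' outside φ₂ =
      (tubeGluing h₁ h₂).inl '' (φ₁ '' tubeBoundary k₁ k₂) := by
  ext q
  constructor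
  · rintro ⟨⟨x, hx, rfl⟩, y, hy, hxy⟩
    obtain ⟨p, hp, rfl, rfl⟩ := tubeGluing_exists_of_eq h₁ h₂ (IsTube.outside_subset_compl_core φ₁ hx)
      (IsTube.outside_subset_compl_core φ₂ hy) hxy.symm
    rw [h₁.mem_outside_iff] at hx
    rw [h₂.mem_outside_iff, tubeNorm_tubeInv, one_le_inv₀ (tubeNorm_pos_iff.2 hp)] at hy
    exact ⟨φ₁ p, ⟨p, mem_tubeBoundary_iff.2 (le_antisymm hy hx), rfl⟩, rfl⟩
  · rintro ⟨_, ⟨p, hp, rfl⟩, rfl⟩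
    have hp' := mem_tubeBoundary_iff.1 hp
    exact ⟨⟨φ₁ p, h₁.mem_outside_iff.2 hp'.ge, rfl⟩, φ₂ p, h₂.mem_outside_iff.2 hp'.ge,
      (tubeGluing_glue h₁ h₂ hp).symm⟩

instance : T2Space (tubeGluing h₁ h₂).Space := by
  have hcl : IsCompact {p : Tube k₁ k₂ | tubeNorm p ≤ 1} := isCompact_tubeNorm_le 1
  -- the parts outside of the closed unit disc bundles have disjoint images
  refine GluingData.t2Space (A := (φ₁ '' {p | tubeNorm p ≤ 1})ᶜ)
    (B := (φ₂ '' {p | tubeNorm p ≤ 1})ᶜ) (hcl.image h₁.continuous).isClosed.isOpen_compl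
    (hcl.image h₂.continuous).isClosed.isOpen_compl ?_ ?_ ?_
  · rintro x ⟨hx, hxs⟩ ⟨p, -, rfl⟩
    refine hxs ?_
    change φ₁ p ∈ (tubeGluingMap h₁ h₂).source
    rw [tubeGluingMap_source]
    exact ⟨p, fun h => hx ⟨p, h, rfl⟩, rfl⟩
  · rintro x ⟨hx, hxs⟩ ⟨p, -, rfl⟩
    refine hxs ?_
    change φ₂ p ∈ (tubeGluingMap h₁ h₂).target
    rw [tubeGluingMap_target]
    exact ⟨p, fun h => hx ⟨p, h, rfl⟩, rfl⟩
  · intro x hx hxA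
    change x ∈ (tubeGluingMap h₁ h₂).source at hx
    rw [tubeGluingMap_source] at hx
    obtain ⟨p, hp, rfl⟩ := hx
    change tubeGluingMap h₁ h₂ (φ₁ p) ∉ _
    rw [tubeGluingMap_apply]
    refine fun h => h ⟨tubeInv p, ?_, rfl⟩
    have h3 : 1 < tubeNorm p := not_le.1 fun h => hxA ⟨p, h, rfl⟩
    change tubeNorm (tubeInv p) ≤ 1
    rw [tubeNorm_tubeInv]
    exact inv_le_one_of_one_le₀ h3.le

instance [CompactSpace X₁] [CompactSpace X₂] : CompactSpace (tubeGluing h₁ h₂).Space :=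
  GluingData.compactSpace h₁.isClosed_outside.isCompact h₂.isClosed_outside.isCompact
    (IsTube.outside_subset_compl_core φ₁) (IsTube.outside_subset_compl_core φ₂) (tubeGluing_union h₁ h₂)

theorem tubeGluing_exists_chartedSpace [I₁.Boundaryless] [IsManifold I₁ ∞ X₁] [I₂.Boundaryless]
    [IsManifold I₂ ∞ X₂] {E : Type} [NormedAddCommGroup E] [NormedSpace ℝ E] (L₁ : E₁ ≃L[ℝ] E)
    (L₂ : E₂ ≃L[ℝ] E) : ∃ _ : ChartedSpace E (tubeGluing h₁ h₂).Space,
      IsManifold 𝓘(ℝ, E) ∞ (tubeGluing h₁ h₂).Space ∧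
      IsLocalDiffeomorphOn I₁ 𝓘(ℝ, E) ∞ (tubeGluing h₁ h₂).inl (tubeGluing h₁ h₂).left ∧
      IsLocalDiffeomorphOn I₂ 𝓘(ℝ, E) ∞ (tubeGluing h₁ h₂).inr (tubeGluing h₁ h₂).right := by
  refine GluingData.exists_chartedSpace L₁ L₂ ?_ ?_
  · change ContMDiffOn I₁ I₂ ∞ (tubeGluingMap h₁ h₂) (tubeGluingMap h₁ h₂).source
    rw [tubeGluingMap_source]
    exact contMDiffOn_of_tubeInv h₁ h₂ (tubeGluingMap_apply h₁ h₂)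
  · change ContMDiffOn I₂ I₁ ∞ (tubeGluingMap h₁ h₂).symm (tubeGluingMap h₁ h₂).target
    rw [tubeGluingMap_target]
    exact contMDiffOn_of_tubeInv h₂ h₁ (tubeGluingMap_symm_apply h₁ h₂)

theorem tubeGluing_exists_mulAction : ∃ _ : MulAction Circle (tubeGluing h₁ h₂).Space,
    (∀ (z : Circle), ∀ x ∈ (tubeGluing h₁ h₂).left,
      (tubeGluing h₁ h₂).inl (z • x) = z • (tubeGluing h₁ h₂).inl x) ∧
    ∀ (z : Circle), ∀ y ∈ (tubeGluing h₁ h₂).right,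
      (tubeGluing h₁ h₂).inr (z • y) = z • (tubeGluing h₁ h₂).inr y := by
  refine GluingData.exists_mulAction (fun z x => h₁.smul_mem_compl_core z)
    (fun z y => h₂.smul_mem_compl_core z) fun z x hx => ?_
  change x ∈ (tubeGluingMap h₁ h₂).source at hx
  change z • x ∈ (tubeGluingMap h₁ h₂).source ∧
    tubeGluingMap h₁ h₂ (z • x) = z • tubeGluingMap h₁ h₂ x
  rw [tubeGluingMap_source] at hx ⊢
  obtain ⟨p, hp, rfl⟩ := hx
  rw [← h₁.equivariant, tubeGluingMap_apply, tubeGluingMap_apply, tubeInv_smul, h₂.equivariant]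
  exact ⟨⟨z • p, fun h => hp ((smul_mem_tubeCore_iff z).1 h), rfl⟩, rfl⟩

theorem tubeGluing_isPreconnected_inter [hk₁ : Fact (1 ≤ k₁)] :
    IsPreconnected ((tubeGluing h₁ h₂).inl '' (tubeGluing h₁ h₂).left ∩
      (tubeGluing h₁ h₂).inr '' (tubeGluing h₁ h₂).right) := by
  have h : (tubeGluing h₁ h₂).inl '' (tubeGluing h₁ h₂).left ∩
      (tubeGluing h₁ h₂).inr '' (tubeGluing h₁ h₂).right =
        (tubeGluing h₁ h₂).inl '' (φ₁ '' (tubeCore k₁ k₂)ᶜ) := by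
    ext q
    constructor
    · rintro ⟨⟨x, hx, rfl⟩, y, hy, hxy⟩
      obtain ⟨p, hp, rfl, rfl⟩ := tubeGluing_exists_of_eq h₁ h₂ hx hy hxy.symm
      exact ⟨φ₁ p, ⟨p, hp, rfl⟩, rfl⟩
    · rintro ⟨_, ⟨p, hp, rfl⟩, rfl⟩
      exact ⟨⟨φ₁ p, mem_left_of_notMem_core h₁ h₂ hp, rfl⟩, φ₂ (tubeInv p),
        mem_right_of_notMem_core h₁ h₂ fun h => hp (tubeInv_mem_tubeCore_iff.1 h),
        (tubeGluing_inl_eq_inr h₁ h₂ hp).symm⟩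
  rw [h]
  exact (isPreconnected_compl_tubeCore.image _ h₁.continuous.continuousOn).image _
    (GluingData.continuousOn_inl.mono (image_compl_tubeCore_subset h₁))

theorem tubeGluing_image_union : (tubeGluing h₁ h₂).inl '' (tubeGluing h₁ h₂).left ∪
    (tubeGluing h₁ h₂).inr '' (tubeGluing h₁ h₂).right = univ :=
  eq_univ_of_forall GluingData.exists_rep

end Space

end TubeGluing

/-- A smooth action on an open piece of a manifold is smooth on the whole if it extends the one of
another manifold along a local diffeomorphism. -/
theorem contMDiffAt_smul_of_isLocalDiffeomorphOn {E H X E' H' M : Type}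
    [NormedAddCommGroup E] [NormedSpace ℝ E] [TopologicalSpace H] {I : ModelWithCorners ℝ E H}
    [TopologicalSpace X] [ChartedSpace H X] [MulAction Circle X]
    [NormedAddCommGroup E'] [NormedSpace ℝ E'] [TopologicalSpace H']
    {I' : ModelWithCorners ℝ E' H'} [TopologicalSpace M] [ChartedSpace H' M] [MulAction Circle M]
    (hX : ContMDiffSMul (𝓡 1) I ∞ Circle X) {j : X → M} {N : Set X} (hN : IsOpen N)
    (hj : IsLocalDiffeomorphOn I I' ∞ j N) (hNs : ∀ (z : Circle), ∀ x ∈ N, z • x ∈ N)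
    (heq : ∀ (z : Circle), ∀ x ∈ N, j (z • x) = z • j x) (z : Circle) {x : X} (hx : x ∈ N) :
    ContMDiffAt ((𝓡 1).prod I') I' ∞ (fun p : Circle × M => p.1 • p.2) (z, j x) := by
  have h1 : IsLocalDiffeomorphAt ((𝓡 1).prod I) ((𝓡 1).prod I') ∞ (Prod.map id j) (z, x) :=
    (isLocalDiffeomorph_id (I := 𝓡 1) (M := Circle) z).prodMap (hj ⟨x, hx⟩)
  refine h1.hasLocalSection.contMDiffAt ?_
  have h2 : ContMDiffAt ((𝓡 1).prod I) I' ∞ (fun p : Circle × X => j (p.1 • p.2)) (z, x) :=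
    ContMDiffAt.comp (g := j) (z, x) (hj ⟨z • x, hNs z x hx⟩).contMDiffAt (hX.contMDiff_smul _)
  refine h2.congr_of_eventuallyEq ?_
  filter_upwards [(hN.preimage continuous_snd).mem_nhds (show (z, x) ∈ Prod.snd ⁻¹' N from hx)]
    with p hp
  exact (heq p.1 p.2 hp).symm

/-! ### The glued component of the fixed point set -/

section GluedSet

variable {k₁ k₂ : ℕ} [hk₂ : Fact (2 ≤ k₂)] {E₁ H₁ X₁ E₂ H₂ X₂ : Type}
  [NormedAddCommGroup E₁] [NormedSpace ℝ E₁] [TopologicalSpace H₁]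
  {I₁ : ModelWithCorners ℝ E₁ H₁} [TopologicalSpace X₁] [ChartedSpace H₁ X₁] [MulAction Circle X₁]
  [NormedAddCommGroup E₂] [NormedSpace ℝ E₂] [TopologicalSpace H₂]
  {I₂ : ModelWithCorners ℝ E₂ H₂} [TopologicalSpace X₂] [ChartedSpace H₂ X₂] [MulAction Circle X₂]
  {φ₁ : Tube k₁ k₂ → X₁} {φ₂ : Tube k₁ k₂ → X₂} [T2Space X₁] [T2Space X₂]
  (h₁ : IsTube I₁ φ₁) (h₂ : IsTube I₂ φ₂) {C₁ : Set X₁} {C₂ : Set X₂}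

/-- The subset of the glued space given by the outer parts of two subsets. -/
def gluedSet (C₁ : Set X₁) (C₂ : Set X₂) : Set (tubeGluing h₁ h₂).Space :=
  (tubeGluing h₁ h₂).inl '' (C₁ ∩ outside φ₁) ∪ (tubeGluing h₁ h₂).inr '' (C₂ ∩ outside φ₂)

theorem neg_one_smul_tubeInv_iff {p : Tube k₁ k₂} :
    (-1 : Circle) • tubeInv p = tubeInv p ↔ (-1 : Circle) • p = p := by
  rw [← tubeInv_smul]
  exact (Function.LeftInverse.injective (tubeInv_tubeInv (k₁ := k₁) (k₂ := k₂))).eq_iff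

variable (hC₁ : ∀ p, φ₁ p ∈ C₁ ↔ (-1 : Circle) • p = p)
  (hC₂ : ∀ p, φ₂ p ∈ C₂ ↔ (-1 : Circle) • p = p)
include hC₁ hC₂

theorem inl_mem_gluedSet_iff {x : X₁} (hx : x ∈ (tubeGluing h₁ h₂).left) :
    (tubeGluing h₁ h₂).inl x ∈ gluedSet h₁ h₂ C₁ C₂ ↔ x ∈ C₁ := by
  constructor
  · rintro (⟨x', ⟨hx', ho⟩, h⟩ | ⟨y, ⟨hy, ho⟩, h⟩)
    · rwa [← GluingData.injOn_inl (IsTube.outside_subset_compl_core φ₁ ho) hx h]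
    · obtain ⟨p, hp, rfl, rfl⟩ :=
        tubeGluing_exists_of_eq h₁ h₂ hx (IsTube.outside_subset_compl_core φ₂ ho) h.symm
      rw [hC₂, neg_one_smul_tubeInv_iff] at hy
      exact (hC₁ p).2 hy
  · intro hxC
    rcases tubeGluing_exists_rep h₁ h₂ ((tubeGluing h₁ h₂).inl x) with ⟨x', ho, h⟩ | ⟨y, ho, h⟩
    · have h3 := GluingData.injOn_inl (IsTube.outside_subset_compl_core φ₁ ho) hx h
      exact Or.inl ⟨x', ⟨h3 ▸ hxC, ho⟩, h⟩
    · refine Or.inr ⟨y, ⟨?_, ho⟩, h⟩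
      obtain ⟨p, hp, rfl, rfl⟩ :=
        tubeGluing_exists_of_eq h₁ h₂ hx (IsTube.outside_subset_compl_core φ₂ ho) h.symm
      rw [hC₂, neg_one_smul_tubeInv_iff]
      exact (hC₁ p).1 hxC

theorem inr_mem_gluedSet_iff {y : X₂} (hy : y ∈ (tubeGluing h₁ h₂).right) :
    (tubeGluing h₁ h₂).inr y ∈ gluedSet h₁ h₂ C₁ C₂ ↔ y ∈ C₂ := by
  constructor
  · rintro (⟨x, ⟨hx, ho⟩, h⟩ | ⟨y', ⟨hy', ho⟩, h⟩)
    · obtain ⟨p, hp, rfl, rfl⟩ :=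
        tubeGluing_exists_of_eq h₁ h₂ (IsTube.outside_subset_compl_core φ₁ ho) hy h
      rw [hC₂, neg_one_smul_tubeInv_iff]
      exact (hC₁ p).1 hx
    · rwa [← GluingData.injOn_inr (IsTube.outside_subset_compl_core φ₂ ho) hy h]
  · intro hyC
    rcases tubeGluing_exists_rep h₁ h₂ ((tubeGluing h₁ h₂).inr y) with ⟨x, ho, h⟩ | ⟨y', ho, h⟩
    · refine Or.inl ⟨x, ⟨?_, ho⟩, h⟩
      obtain ⟨p, hp, rfl, rfl⟩ :=
        tubeGluing_exists_of_eq h₁ h₂ (IsTube.outside_subset_compl_core φ₁ ho) hy h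
      rw [hC₂, neg_one_smul_tubeInv_iff] at hyC
      exact (hC₁ p).2 hyC
    · have h3 := GluingData.injOn_inr (IsTube.outside_subset_compl_core φ₂ ho) hy h
      exact Or.inr ⟨y', ⟨h3 ▸ hyC, ho⟩, h⟩

/-- The punctured disc bundle around one centre is identified with the outer part of the other tube, so
the glued set may be described by the complements of the centres as well. -/
theorem gluedSet_eq : gluedSet h₁ h₂ C₁ C₂ =
    (tubeGluing h₁ h₂).inl '' (C₁ ∩ (tubeGluing h₁ h₂).left) ∪
      (tubeGluing h₁ h₂).inr '' (C₂ ∩ (tubeGluing h₁ h₂).right) := by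
  refine Subset.antisymm ?_ ?_
  · exact union_subset_union
      (image_mono (inter_subset_inter_right _ (IsTube.outside_subset_compl_core φ₁)))
      (image_mono (inter_subset_inter_right _ (IsTube.outside_subset_compl_core φ₂)))
  · rintro _ (⟨x, ⟨hx, hl⟩, rfl⟩ | ⟨y, ⟨hy, hr⟩, rfl⟩)
    · exact (inl_mem_gluedSet_iff h₁ h₂ hC₁ hC₂ hl).2 hx
    · exact (inr_mem_gluedSet_iff h₁ h₂ hC₁ hC₂ hr).2 hy

omit hC₂ in
/-- Removing the centre of a tube does not disconnect a set which the tube meets in its fixed part. -/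
theorem isPreconnected_inter_compl_core (h : IsPreconnected C₁) (h₁ : IsTube I₁ φ₁) :
    IsPreconnected (C₁ ∩ (φ₁ '' tubeCore k₁ k₂)ᶜ) := by
  refine h.diff_of_isOpen h₁.isClosed_image_core h₁.isOpenEmbedding.isOpen_range
    (fun x hx => image_subset_range _ _ hx.2) ?_
  have h3 : (C₁ ∩ range φ₁) \ (φ₁ '' tubeCore k₁ k₂) =
      φ₁ '' ({p | (-1 : Circle) • p = p} \ tubeCore k₁ k₂) := by
    ext x
    constructor
    · rintro ⟨⟨hx, p, rfl⟩, hp⟩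
      exact ⟨p, ⟨(hC₁ p).1 hx, fun h => hp ⟨p, h, rfl⟩⟩, rfl⟩
    · rintro ⟨p, ⟨hp, hp'⟩, rfl⟩
      exact ⟨⟨(hC₁ p).2 hp, p, rfl⟩, image_compl_tubeCore_subset h₁ ⟨p, hp', rfl⟩⟩
  rw [h3]
  exact isConnected_tubeFixed_diff.isPreconnected.image _ h₁.continuous.continuousOn

/-- Both parts of the glued set are connected, and they meet in the overlap. -/
theorem isConnected_gluedSet (hc₁ : IsPreconnected C₁) (hc₂ : IsPreconnected C₂) :
    IsConnected (gluedSet h₁ h₂ C₁ C₂) := by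
  obtain ⟨p, hp, hp'⟩ := (isConnected_tubeFixed_diff (k₁ := k₁) (k₂ := k₂)).nonempty
  have hx : (tubeGluing h₁ h₂).inl (φ₁ p) ∈
      (tubeGluing h₁ h₂).inl '' (C₁ ∩ (tubeGluing h₁ h₂).left) :=
    ⟨φ₁ p, ⟨(hC₁ p).2 hp, mem_left_of_notMem_core h₁ h₂ hp'⟩, rfl⟩
  have hy : (tubeGluing h₁ h₂).inl (φ₁ p) ∈
      (tubeGluing h₁ h₂).inr '' (C₂ ∩ (tubeGluing h₁ h₂).right) :=
    ⟨φ₂ (tubeInv p), ⟨(hC₂ _).2 (neg_one_smul_tubeInv_iff.2 hp),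
      mem_right_of_notMem_core h₁ h₂ fun h => hp' (tubeInv_mem_tubeCore_iff.1 h)⟩,
      (tubeGluing_inl_eq_inr h₁ h₂ hp').symm⟩
  rw [gluedSet_eq h₁ h₂ hC₁ hC₂]
  refine ⟨⟨_, Or.inl hx⟩, IsPreconnected.union _ hx hy ?_ ?_⟩
  · exact (isPreconnected_inter_compl_core hC₁ hc₁ h₁).image _
      (GluingData.continuousOn_inl.mono inter_subset_right)
  · exact (isPreconnected_inter_compl_core hC₂ hc₂ h₂).image _
      (GluingData.continuousOn_inr.mono inter_subset_right)

omit hC₁ hC₂ in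
theorem isClosed_gluedSet [CompactSpace X₁] [CompactSpace X₂] (hc₁ : IsClosed C₁)
    (hc₂ : IsClosed C₂) : IsClosed (gluedSet h₁ h₂ C₁ C₂) := by
  refine IsClosed.union (IsCompact.isClosed ?_) (IsCompact.isClosed ?_)
  · exact (hc₁.inter h₁.isClosed_outside).isCompact.image_of_continuousOn
      (GluingData.continuousOn_inl.mono fun x hx => IsTube.outside_subset_compl_core φ₁ hx.2)
  · exact (hc₂.inter h₂.isClosed_outside).isCompact.image_of_continuousOn
      (GluingData.continuousOn_inr.mono fun x hx => IsTube.outside_subset_compl_core φ₂ hx.2)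

theorem gluedSet_hasSliceAt {E H D K : Type} [NormedAddCommGroup E] [NormedSpace ℝ E]
    [TopologicalSpace H] {I : ModelWithCorners ℝ E H} [ChartedSpace H (tubeGluing h₁ h₂).Space]
    [NormedAddCommGroup D] [NormedSpace ℝ D] [NormedAddCommGroup K] [NormedSpace ℝ K]
    (hl : IsLocalDiffeomorphOn I₁ I ∞ (tubeGluing h₁ h₂).inl (tubeGluing h₁ h₂).left)
    (hr : IsLocalDiffeomorphOn I₂ I ∞ (tubeGluing h₁ h₂).inr (tubeGluing h₁ h₂).right)
    (hs₁ : ∀ x ∈ C₁, HasSliceAt I₁ D K C₁ x) (hs₂ : ∀ y ∈ C₂, HasSliceAt I₂ D K C₂ y)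
    {q : (tubeGluing h₁ h₂).Space} (hq : q ∈ gluedSet h₁ h₂ C₁ C₂) :
    HasSliceAt I D K (gluedSet h₁ h₂ C₁ C₂) q := by
  rcases hq with ⟨x, ⟨hx, ho⟩, rfl⟩ | ⟨y, ⟨hy, ho⟩, rfl⟩
  · have hl' : x ∈ (tubeGluing h₁ h₂).left := IsTube.outside_subset_compl_core φ₁ ho
    refine (hs₁ x hx).image (hl ⟨x, hl'⟩) ?_
    filter_upwards [(tubeGluing h₁ h₂).isOpen_left.mem_nhds hl'] with x' hx'
    exact inl_mem_gluedSet_iff h₁ h₂ hC₁ hC₂ hx'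
  · have hr' : y ∈ (tubeGluing h₁ h₂).right := IsTube.outside_subset_compl_core φ₂ ho
    refine (hs₂ y hy).image (hr ⟨y, hr'⟩) ?_
    filter_upwards [(tubeGluing h₁ h₂).isOpen_right.mem_nhds hr'] with y' hy'
    exact inr_mem_gluedSet_iff h₁ h₂ hC₁ hC₂ hy'

end GluedSet

section TubesInPieces

variable {k₁ k₂ : ℕ} [h₁ : Fact (1 ≤ k₁)] [h₂ : Fact (2 ≤ k₂)] {φ₁ : Tube k₁ k₂ → MOne k₁ k₂}
  {φ₂ : Tube k₁ k₂ → MTwo k₁ k₂}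

theorem IsTube.mem_fixedPoints_Z2_iff {E H X : Type} [NormedAddCommGroup E] [NormedSpace ℝ E]
    [TopologicalSpace H] {I : ModelWithCorners ℝ E H} [TopologicalSpace X] [ChartedSpace H X]
    [MulAction Circle X] {φ : Tube k₁ k₂ → X} (h : IsTube I φ) (p : Tube k₁ k₂) :
    φ p ∈ fixedPoints Z2 X ↔ (-1 : Circle) • p = p :=
  fixedPoints_Z2_iff.trans (h.smul_eq_iff _ p)

/-- The part of the tube fixed by `ℤ₂` is connected, so it lies in a single component of the fixed
point set of `M₂`. -/
theorem IsTube.mem_componentTwo_iff (h : IsTube (ITwo k₁ k₂) φ₂)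
    (hc : φ₂ '' tubeCore k₁ k₂ ⊆ componentTwo k₁ k₂) (p : Tube k₁ k₂) :
    φ₂ p ∈ componentTwo k₁ k₂ ↔ (-1 : Circle) • p = p := by
  constructor
  · intro hp
    rw [← h.mem_fixedPoints_Z2_iff, MTwo.fixedPoints_Z2]
    exact Or.inl hp
  · intro hp
    have h0 : (AssocBundle.mk 1 0 : Tube k₁ k₂) ∈ {p : Tube k₁ k₂ | (-1 : Circle) • p = p} :=
      neg_one_smul_mk_iff.2 rfl
    have hmem : φ₂ (AssocBundle.mk 1 0) ∈ componentTwo k₁ k₂ := hc ⟨_, ⟨1, rfl⟩, rfl⟩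
    have h3 : φ₂ '' {p : Tube k₁ k₂ | (-1 : Circle) • p = p} ⊆
        connectedComponentIn (fixedPoints Z2 (MTwo k₁ k₂)) (φ₂ (AssocBundle.mk 1 0)) := by
      refine (isPreconnected_tubeFixed.image _
        h.continuous.continuousOn).subset_connectedComponentIn ⟨_, h0, rfl⟩ ?_
      rintro _ ⟨q, hq, rfl⟩
      exact (h.mem_fixedPoints_Z2_iff q).2 hq
    obtain ⟨x, -, hx⟩ := isComponentOf_componentTwo (k₁ := k₁) (k₂ := k₂)
    rw [hx] at hmem ⊢
    rw [connectedComponentIn_eq hmem]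
    exact h3 ⟨p, hp, rfl⟩

/-- The circle acts on `M₂` without fixed points, since it acts on `S¹/ℤ₂` without fixed points. -/
theorem MTwo.notMem_fixedPoints_circle (p : MTwo k₁ k₂) : p ∉ fixedPoints Circle (MTwo k₁ k₂) := by
  intro hp
  obtain ⟨⟨z, x, y⟩, rfl⟩ := MTwo.surjective_cover p
  have h := hp (circleOfNorm Complex.I Complex.norm_I)
  obtain ⟨ε, δ, h, -⟩ := MTwo.cover_eq_iff.1 h
  have h1 := congrArg (fun z : Circle => (z : ℂ).im) (mul_right_cancel h)
  simp only [coe_circleOfNorm, Z2.coe_eq_sign, Complex.I_im, Complex.ofReal_im] at h1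
  exact one_ne_zero h1

/-- The centre of a tube is an orbit, so it misses a half of `C₂`. -/
theorem IsTube.exists_halfTriples (h : IsTube (ITwo k₁ k₂) φ₂)
    (hc : φ₂ '' tubeCore k₁ k₂ ⊆ componentTwo k₁ k₂) :
    ∃ y₀ : EuclideanSpace ℝ (Fin (2 * k₂ - 2)), y₀ ≠ 0 ∧ ∀ w ∈ halfTriples y₀,
      MTwo.present (fixedIncl k₁ k₂ w) ∉ φ₂ '' tubeCore k₁ k₂ := by
  obtain ⟨⟨z₀, x₀, y₀⟩, hp⟩ := MTwo.surjective_cover (φ₂ (AssocBundle.mk 1 0))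
  have hy₀ : y₀.val.fst = 0 := by
    refine (MTwo.cover_mem_componentTwo (z := z₀) (x := x₀)).1 ?_ |>.2
    rw [hp]
    exact hc ⟨_, ⟨1, rfl⟩, rfl⟩
  refine ⟨y₀.val.snd, fun h0 => y₀.val_ne_zero (withLp_eq hy₀ h0), ?_⟩
  rintro w hw ⟨_, ⟨z, rfl⟩, hz⟩
  have hz' : MTwo.cover (z * z₀, x₀, y₀) = MTwo.present (fixedIncl k₁ k₂ w) := by
    rw [← hz, ← MTwo.smul_cover, hp, ← h.equivariant, AssocBundle.smul_mk, mul_one]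
  obtain ⟨ε, δ, -, -, h3⟩ := MTwo.cover_eq_iff.1 hz'
  have hne := (fixedIncl_mem (k₁ := k₁) (halfTriples_subset _ hw)).2.2
  have h4 : y₀.val.snd = ‖(fixedIncl k₁ k₂ w).2.2‖⁻¹ • w.2.2 := by
    rw [h3, val_Z2_smul_sign, val_toSphere hne]
    rfl
  have h5 : inner ℝ y₀.val.snd w.2.2 < 0 := hw.2.2
  rw [h4, real_inner_smul_left] at h5
  exact h5.not_ge (mul_nonneg (inv_nonneg.2 (norm_nonneg _)) real_inner_self_nonneg)

end TubesInPieces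

/-! ### The glued manifold -/

/-- The overlap of the two pieces is connected, so the orientations of the pieces agree on it after
possibly reversing one of them. -/
theorem tubeGluing_orientable {k₁ k₂ : ℕ} [Fact (1 ≤ k₁)] [Fact (2 ≤ k₂)]
    {E₁ H₁ X₁ E₂ H₂ X₂ E : Type}
    [NormedAddCommGroup E₁] [NormedSpace ℝ E₁] [FiniteDimensional ℝ E₁] [TopologicalSpace H₁]
    {I₁ : ModelWithCorners ℝ E₁ H₁} [I₁.Boundaryless] [TopologicalSpace X₁] [ChartedSpace H₁ X₁]
    [IsManifold I₁ ∞ X₁] [MulAction Circle X₁]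
    [NormedAddCommGroup E₂] [NormedSpace ℝ E₂] [FiniteDimensional ℝ E₂] [TopologicalSpace H₂]
    {I₂ : ModelWithCorners ℝ E₂ H₂} [I₂.Boundaryless] [TopologicalSpace X₂] [ChartedSpace H₂ X₂]
    [IsManifold I₂ ∞ X₂] [MulAction Circle X₂]
    [NormedAddCommGroup E] [NormedSpace ℝ E] [FiniteDimensional ℝ E] [T2Space X₁] [T2Space X₂]
    {φ₁ : Tube k₁ k₂ → X₁} {φ₂ : Tube k₁ k₂ → X₂} (h₁ : IsTube I₁ φ₁) (h₂ : IsTube I₂ φ₂)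
    (L₁ : E ≃L[ℝ] E₁) (L₂ : E ≃L[ℝ] E₂) [ChartedSpace E (tubeGluing h₁ h₂).Space]
    [IsManifold 𝓘(ℝ, E) ∞ (tubeGluing h₁ h₂).Space]
    (hl : IsLocalDiffeomorphOn I₁ 𝓘(ℝ, E) ∞ (tubeGluing h₁ h₂).inl (tubeGluing h₁ h₂).left)
    (hr : IsLocalDiffeomorphOn I₂ 𝓘(ℝ, E) ∞ (tubeGluing h₁ h₂).inr (tubeGluing h₁ h₂).right)
    (ho₁ : Orientable I₁ X₁) (ho₂ : Orientable I₂ X₂) :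
    Orientable 𝓘(ℝ, E) (tubeGluing h₁ h₂).Space := by
  obtain ⟨s₁, hs₁⟩ := ho₁.exists_isOrientationOn
  obtain ⟨s₂, hs₂⟩ := ho₂.exists_isOrientationOn
  have hs₁' : IsOrientationOn I₁ s₁ (tubeGluing h₁ h₂).left := fun x _ => hs₁ x (mem_univ x)
  have hs₂' : IsOrientationOn I₂ s₂ (tubeGluing h₁ h₂).right := fun x _ => hs₂ x (mem_univ x)
  obtain ⟨t₁, ht₁⟩ := hs₁'.exists_image (tubeGluing h₁ h₂).isOpen_left L₁ hl GluingData.injOn_inl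
  obtain ⟨t₂, ht₂⟩ := hs₂'.exists_image (tubeGluing h₁ h₂).isOpen_right L₂ hr GluingData.injOn_inr
  obtain ⟨r, hr⟩ := IsOrientationOn.exists_union
    (GluingData.isOpen_image_inl (tubeGluing h₁ h₂).isOpen_left subset_rfl)
    (GluingData.isOpen_image_inr (tubeGluing h₁ h₂).isOpen_right subset_rfl) ht₁ ht₂
    (tubeGluing_isPreconnected_inter h₁ h₂)
  rw [tubeGluing_image_union] at hr
  exact hr.orientable

theorem tubeGluing_contMDiffSMul {k₁ k₂ : ℕ} [Fact (2 ≤ k₂)]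
    {E₁ H₁ X₁ E₂ H₂ X₂ E : Type}
    [NormedAddCommGroup E₁] [NormedSpace ℝ E₁] [TopologicalSpace H₁]
    {I₁ : ModelWithCorners ℝ E₁ H₁} [TopologicalSpace X₁] [ChartedSpace H₁ X₁] [MulAction Circle X₁]
    [NormedAddCommGroup E₂] [NormedSpace ℝ E₂] [TopologicalSpace H₂]
    {I₂ : ModelWithCorners ℝ E₂ H₂} [TopologicalSpace X₂] [ChartedSpace H₂ X₂] [MulAction Circle X₂]
    [NormedAddCommGroup E] [NormedSpace ℝ E] [T2Space X₁] [T2Space X₂]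
    {φ₁ : Tube k₁ k₂ → X₁} {φ₂ : Tube k₁ k₂ → X₂} (h₁ : IsTube I₁ φ₁) (h₂ : IsTube I₂ φ₂)
    [ChartedSpace E (tubeGluing h₁ h₂).Space] [MulAction Circle (tubeGluing h₁ h₂).Space]
    (hl : IsLocalDiffeomorphOn I₁ 𝓘(ℝ, E) ∞ (tubeGluing h₁ h₂).inl (tubeGluing h₁ h₂).left)
    (hr : IsLocalDiffeomorphOn I₂ 𝓘(ℝ, E) ∞ (tubeGluing h₁ h₂).inr (tubeGluing h₁ h₂).right)
    (hla : ∀ (z : Circle), ∀ x ∈ (tubeGluing h₁ h₂).left,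
      (tubeGluing h₁ h₂).inl (z • x) = z • (tubeGluing h₁ h₂).inl x)
    (hra : ∀ (z : Circle), ∀ y ∈ (tubeGluing h₁ h₂).right,
      (tubeGluing h₁ h₂).inr (z • y) = z • (tubeGluing h₁ h₂).inr y)
    (hs₁ : ContMDiffSMul (𝓡 1) I₁ ∞ Circle X₁) (hs₂ : ContMDiffSMul (𝓡 1) I₂ ∞ Circle X₂) :
    ContMDiffSMul (𝓡 1) 𝓘(ℝ, E) ∞ Circle (tubeGluing h₁ h₂).Space := by
  refine ⟨?_⟩
  rintro ⟨z, q⟩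
  rcases GluingData.exists_rep q with ⟨x, hx, rfl⟩ | ⟨y, hy, rfl⟩
  · exact contMDiffAt_smul_of_isLocalDiffeomorphOn hs₁ (tubeGluing h₁ h₂).isOpen_left hl
      (fun z x => h₁.smul_mem_compl_core z) hla z hx
  · exact contMDiffAt_smul_of_isLocalDiffeomorphOn hs₂ (tubeGluing h₁ h₂).isOpen_right hr
      (fun z x => h₂.smul_mem_compl_core z) hra z hy

section GluedManifold

variable {k₁ k₂ : ℕ} [hk₁ : Fact (1 ≤ k₁)] [hk₂ : Fact (2 ≤ k₂)] {φ₁ : Tube k₁ k₂ → MOne k₁ k₂}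
  {φ₂ : Tube k₁ k₂ → MTwo k₁ k₂}

/-- The `ℤ₂`-fixed points of the gluing outside of the glued set come from the remaining part of
`M₂^{ℤ₂}`, which the tube does not meet. -/
theorem fixedPoints_Z2_tubeGluing (h₁ : IsTube (IOne k₁ k₂) φ₁) (h₂ : IsTube (ITwo k₁ k₂) φ₂)
    (hc₂ : φ₂ '' tubeCore k₁ k₂ ⊆ componentTwo k₁ k₂)
    [MulAction Circle (tubeGluing h₁ h₂).Space]
    (hla : ∀ (z : Circle), ∀ x ∈ (tubeGluing h₁ h₂).left,
      (tubeGluing h₁ h₂).inl (z • x) = z • (tubeGluing h₁ h₂).inl x)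
    (hra : ∀ (z : Circle), ∀ y ∈ (tubeGluing h₁ h₂).right,
      (tubeGluing h₁ h₂).inr (z • y) = z • (tubeGluing h₁ h₂).inr y) :
    fixedPoints Z2 (tubeGluing h₁ h₂).Space =
      gluedSet h₁ h₂ (fixedPoints Z2 (MOne k₁ k₂)) (componentTwo k₁ k₂) ∪
        (tubeGluing h₁ h₂).inr '' otherComponentTwo k₁ k₂ := by
  have hC₁ := h₁.mem_fixedPoints_Z2_iff
  have hC₂ := h₂.mem_componentTwo_iff hc₂
  have hright : otherComponentTwo k₁ k₂ ⊆ (tubeGluing h₁ h₂).right := fun y hy hyc =>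
    Set.disjoint_left.1 disjoint_otherComponentTwo (hc₂ hyc) hy
  ext q
  rw [fixedPoints_Z2_iff]
  constructor
  · intro hq
    rcases GluingData.exists_rep q with ⟨x, hx, rfl⟩ | ⟨y, hy, rfl⟩
    · left
      rw [← hla _ x hx] at hq
      rw [inl_mem_gluedSet_iff h₁ h₂ hC₁ hC₂ hx, fixedPoints_Z2_iff]
      exact GluingData.injOn_inl (h₁.smul_mem_compl_core _ hx) hx hq
    · rw [← hra _ y hy] at hq
      have h3 : y ∈ fixedPoints Z2 (MTwo k₁ k₂) :=
        fixedPoints_Z2_iff.2 (GluingData.injOn_inr (h₂.smul_mem_compl_core _ hy) hy hq)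
      rw [MTwo.fixedPoints_Z2] at h3
      rcases h3 with h3 | h3
      · exact Or.inl ((inr_mem_gluedSet_iff h₁ h₂ hC₁ hC₂ hy).2 h3)
      · exact Or.inr ⟨y, h3, rfl⟩
  · have h3 : componentTwo k₁ k₂ ∪ otherComponentTwo k₁ k₂ = _ :=
      (MTwo.fixedPoints_Z2 (k₁ := k₁) (k₂ := k₂)).symm
    rintro ((⟨x, ⟨hx, ho⟩, rfl⟩ | ⟨y, ⟨hy, ho⟩, rfl⟩) | ⟨y, hy, rfl⟩)
    · rw [← hla _ x (IsTube.outside_subset_compl_core φ₁ ho), fixedPoints_Z2_iff.1 hx]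
    · rw [← hra _ y (IsTube.outside_subset_compl_core φ₂ ho),
        fixedPoints_Z2_iff.1 (h3 ▸ Or.inl hy : y ∈ fixedPoints Z2 (MTwo k₁ k₂))]
    · rw [← hra _ y (hright hy),
        fixedPoints_Z2_iff.1 (h3 ▸ Or.inr hy : y ∈ fixedPoints Z2 (MTwo k₁ k₂))]

/-- The glued set is connected and its complement in the fixed point set is closed. -/
theorem isComponentOf_gluedSet (h₁ : IsTube (IOne k₁ k₂) φ₁) (h₂ : IsTube (ITwo k₁ k₂) φ₂)
    (hc₂ : φ₂ '' tubeCore k₁ k₂ ⊆ componentTwo k₁ k₂)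
    [MulAction Circle (tubeGluing h₁ h₂).Space]
    (hla : ∀ (z : Circle), ∀ x ∈ (tubeGluing h₁ h₂).left,
      (tubeGluing h₁ h₂).inl (z • x) = z • (tubeGluing h₁ h₂).inl x)
    (hra : ∀ (z : Circle), ∀ y ∈ (tubeGluing h₁ h₂).right,
      (tubeGluing h₁ h₂).inr (z • y) = z • (tubeGluing h₁ h₂).inr y) :
    IsComponentOf (gluedSet h₁ h₂ (fixedPoints Z2 (MOne k₁ k₂)) (componentTwo k₁ k₂))
      (fixedPoints Z2 (tubeGluing h₁ h₂).Space) := by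
  have hC₁ := h₁.mem_fixedPoints_Z2_iff
  have hC₂ := h₂.mem_componentTwo_iff hc₂
  have hk₂' := hk₂.out
  have hright : otherComponentTwo k₁ k₂ ⊆ (tubeGluing h₁ h₂).right := fun y hy hyc =>
    Set.disjoint_left.1 disjoint_otherComponentTwo (hc₂ hyc) hy
  have hclosed : IsClosed (fixedPoints Z2 (MOne k₁ k₂)) := by
    have h : fixedPoints Z2 (MOne k₁ k₂) = {x | (-1 : Circle) • x = x} := by
      ext x; exact fixedPoints_Z2_iff
    rw [h]
    exact isClosed_eq (continuous_const_smul _) continuous_id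
  have hF := fixedPoints_Z2_tubeGluing h₁ h₂ hc₂ hla hra
  refine isComponentOf_of_isClosed (B := (tubeGluing h₁ h₂).inr '' otherComponentTwo k₁ k₂)
    (isConnected_gluedSet h₁ h₂ hC₁ hC₂
      (MOne.isConnected_fixedPoints_Z2 (by omega)).isPreconnected
      isConnected_componentTwo.isPreconnected)
    (hF ▸ subset_union_left) (isClosed_gluedSet h₁ h₂ hclosed isClosed_componentTwo) ?_ hF.subset ?_
  · exact (isClosed_otherComponentTwo.isCompact.image_of_continuousOn
      (GluingData.continuousOn_inr.mono hright)).isClosed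
  · rw [Set.disjoint_right]
    rintro _ ⟨y, hy, rfl⟩ h
    exact Set.disjoint_left.1 disjoint_otherComponentTwo
      ((inr_mem_gluedSet_iff h₁ h₂ hC₁ hC₂ (hright hy)).1 h) hy

/-- The circle has no fixed points in `M₂`, nor in a tube. -/
theorem fixedPoints_circle_tubeGluing (h₁ : IsTube (IOne k₁ k₂) φ₁) (h₂ : IsTube (ITwo k₁ k₂) φ₂)
    [MulAction Circle (tubeGluing h₁ h₂).Space]
    (hla : ∀ (z : Circle), ∀ x ∈ (tubeGluing h₁ h₂).left,
      (tubeGluing h₁ h₂).inl (z • x) = z • (tubeGluing h₁ h₂).inl x)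
    (hra : ∀ (z : Circle), ∀ y ∈ (tubeGluing h₁ h₂).right,
      (tubeGluing h₁ h₂).inr (z • y) = z • (tubeGluing h₁ h₂).inr y) :
    fixedPoints Circle (tubeGluing h₁ h₂).Space =
      (tubeGluing h₁ h₂).inl '' fixedPoints Circle (MOne k₁ k₂) := by
  ext q
  constructor
  · intro hq
    rcases GluingData.exists_rep q with ⟨x, hx, rfl⟩ | ⟨y, hy, rfl⟩
    · refine ⟨x, fun z => ?_, rfl⟩
      have h3 := hq z
      rw [← hla _ x hx] at h3
      exact GluingData.injOn_inl (h₁.smul_mem_compl_core _ hx) hx h3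
    · refine (MTwo.notMem_fixedPoints_circle y fun z => ?_).elim
      have h3 := hq z
      rw [← hra _ y hy] at h3
      exact GluingData.injOn_inr (h₂.smul_mem_compl_core _ hy) hy h3
  · rintro ⟨x, hx, rfl⟩ z
    rw [← hla z x, hx z]
    rintro ⟨p, -, rfl⟩
    exact h₁.notMem_fixedPoints p hx

/-- The gluing of `M₁` and `M₂` along tubes around orbits in `M₁^{ℤ₂}` and `C₂`. -/
theorem exists_glued_manifold (h₁ : IsTube (IOne k₁ k₂) φ₁) (h₂ : IsTube (ITwo k₁ k₂) φ₂)
    (hc₂ : φ₂ '' tubeCore k₁ k₂ ⊆ componentTwo k₁ k₂) :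
    ∃ (M : Type) (_ : TopologicalSpace M)
      (_ : ChartedSpace (EuclideanSpace ℝ (Fin (2 * k₁ + 2 * k₂))) M)
      (_ : MulAction Circle M) (j₁ : MOne k₁ k₂ → M) (j₂ : MTwo k₁ k₂ → M) (F : Set M),
      IsGluing φ₁ φ₂ j₁ j₂ ∧
      IsClosedCircleManifold (𝓡 (2 * k₁ + 2 * k₂)) M ∧
      Orientable (𝓡 (2 * k₁ + 2 * k₂)) M ∧
      F = j₁ '' (fixedPoints Z2 (MOne k₁ k₂) ∩ outside φ₁) ∪
          j₂ '' (componentTwo k₁ k₂ ∩ outside φ₂) ∧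
      IsComponentOf F (fixedPoints Z2 M) ∧
      (fixedPoints Circle M).Nonempty ∧
      fixedPoints Circle M ⊆ F ∧
      IsNonorientableSubmanifold (𝓡 (2 * k₁ + 2 * k₂)) (2 * k₂) F := by
  have hk₁' := hk₁.out
  have hk₂' := hk₂.out
  have L₂ : EuclideanSpace ℝ (Fin (2 * k₁ + 2 * k₂)) ≃L[ℝ] EuclideanSpace ℝ (Fin 1) ×
      (EuclideanSpace ℝ (Fin 3) × EuclideanSpace ℝ (Fin (2 * k₁ + 2 * k₂ - 4))) :=
    equivOfFinrankEq (by
      simp only [Module.finrank_prod, finrank_euclideanSpace_fin]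
      omega)
  obtain ⟨cs, hman, hl, hr⟩ := tubeGluing_exists_chartedSpace h₁ h₂
    (ContinuousLinearEquiv.refl ℝ (EuclideanSpace ℝ (Fin (2 * k₁ + 2 * k₂)))) L₂.symm
  obtain ⟨ma, hla, hra⟩ := tubeGluing_exists_mulAction h₁ h₂
  have hC₁ := h₁.mem_fixedPoints_Z2_iff
  have hC₂ := h₂.mem_componentTwo_iff hc₂
  have hfix := fixedPoints_circle_tubeGluing h₁ h₂ hla hra
  have hcomp := isComponentOf_gluedSet h₁ h₂ hc₂ hla hra
  have hglue : IsGluing φ₁ φ₂ (tubeGluing h₁ h₂).inl (tubeGluing h₁ h₂).inr :=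
    { piece_one := ⟨⟨_, (tubeGluing h₁ h₂).isOpen_left, IsTube.outside_subset_compl_core φ₁,
        GluingData.injOn_inl, hl⟩, fun z x hx => hla z x (IsTube.outside_subset_compl_core φ₁ hx)⟩
      piece_two := ⟨⟨_, (tubeGluing h₁ h₂).isOpen_right, IsTube.outside_subset_compl_core φ₂,
        GluingData.injOn_inr, hr⟩, fun z x hx => hra z x (IsTube.outside_subset_compl_core φ₂ hx)⟩
      union_eq := tubeGluing_union h₁ h₂
      inter_eq := tubeGluing_inter h₁ h₂
      glue := fun p hp => tubeGluing_glue h₁ h₂ hp }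
  refine ⟨(tubeGluing h₁ h₂).Space, inferInstance, cs, ma, (tubeGluing h₁ h₂).inl,
    (tubeGluing h₁ h₂).inr, gluedSet h₁ h₂ (fixedPoints Z2 (MOne k₁ k₂)) (componentTwo k₁ k₂),
    hglue,
    ⟨hman, inferInstance, inferInstance, ?_⟩, ?_, rfl, hcomp, ?_, ?_, ?_⟩
  · exact tubeGluing_contMDiffSMul h₁ h₂ hl hr hla hra MOne.contMDiffSMul
      MTwo.isClosedCircleManifold.contMDiffSMul
  · exact tubeGluing_orientable h₁ h₂
      (ContinuousLinearEquiv.refl ℝ (EuclideanSpace ℝ (Fin (2 * k₁ + 2 * k₂)))) L₂ hl hr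
      (RepSphere.orientable _) MTwo.orientable
  · rw [hfix, MOne.fixedPoints_circle]
    exact ⟨_, _, Or.inl rfl, rfl⟩
  · rw [hfix]
    rintro _ ⟨x, hx, rfl⟩
    refine (inl_mem_gluedSet_iff h₁ h₂ hC₁ hC₂ ?_).2 (fixedPoints_circle_subset _ hx)
    rintro ⟨p, -, rfl⟩
    exact h₁.notMem_fixedPoints p hx
  · obtain ⟨y₀, hy₀, hcore⟩ := h₂.exists_halfTriples hc₂
    refine HasSliceAt.isNonorientableSubmanifold finrank_euclideanSpace_fin (fun q hq => ?_) hy₀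
      (j := (tubeGluing h₁ h₂).inr) (fun w hw => hr ⟨_, hcore w hw⟩) fun w hw => ?_
    · exact gluedSet_hasSliceAt h₁ h₂ hC₁ hC₂ hl hr
        (fun x hx => MOne.hasSliceAt finrank_euclideanSpace_fin finrank_euclideanSpace_fin hx)
        (fun y hy => componentTwo_hasSliceAt finrank_euclideanSpace_fin
          finrank_euclideanSpace_fin hy) hq
    · exact (inr_mem_gluedSet_iff h₁ h₂ hC₁ hC₂ (hcore w hw)).2
        (present_fixedIncl_mem (halfTriples_subset _ hw))

end GluedManifold

end

theorem mainTheorem9 (k₁ k₂ : ℕ) [Fact (1 ≤ k₁)] [Fact (2 ≤ k₂)] :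
    -- the sphere `M₁`
    (IsClosedCircleManifold (IOne k₁ k₂) (MOne k₁ k₂) ∧ Orientable (IOne k₁ k₂) (MOne k₁ k₂) ∧
      fixedPoints Z2 (MOne k₁ k₂) = {x | x.val.fst.fst = 0} ∧
      IsConnected (fixedPoints Z2 (MOne k₁ k₂)) ∧
      (fixedPoints Circle (MOne k₁ k₂)).ncard = 2 ∧
      fixedPoints Circle (MOne k₁ k₂) ⊆ fixedPoints Z2 (MOne k₁ k₂)) ∧
    -- the manifold `M₂`
    (IsClosedCircleManifold (ITwo k₁ k₂) (MTwo k₁ k₂) ∧ Orientable (ITwo k₁ k₂) (MTwo k₁ k₂) ∧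
      IsComponentOf (componentTwo k₁ k₂) (fixedPoints Z2 (MTwo k₁ k₂)) ∧
      IsNonorientableSubmanifold (ITwo k₁ k₂) (2 * k₂) (componentTwo k₁ k₂)) ∧
    -- the common orbit neighbourhoods
    (∃ φ₁ : Tube k₁ k₂ → MOne k₁ k₂, IsTube (IOne k₁ k₂) φ₁ ∧
      φ₁ '' tubeCore k₁ k₂ ⊆ fixedPoints Z2 (MOne k₁ k₂)) ∧
    (∃ φ₂ : Tube k₁ k₂ → MTwo k₁ k₂, IsTube (ITwo k₁ k₂) φ₂ ∧
      φ₂ '' tubeCore k₁ k₂ ⊆ componentTwo k₁ k₂) ∧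
    -- the glued manifold `M`
    ∀ (φ₁ : Tube k₁ k₂ → MOne k₁ k₂) (φ₂ : Tube k₁ k₂ → MTwo k₁ k₂),
      IsTube (IOne k₁ k₂) φ₁ → φ₁ '' tubeCore k₁ k₂ ⊆ fixedPoints Z2 (MOne k₁ k₂) →
      IsTube (ITwo k₁ k₂) φ₂ → φ₂ '' tubeCore k₁ k₂ ⊆ componentTwo k₁ k₂ →
      ∃ (M : Type) (_ : TopologicalSpace M)
        (_ : ChartedSpace (EuclideanSpace ℝ (Fin (2 * k₁ + 2 * k₂))) M)
        (_ : MulAction Circle M) (j₁ : MOne k₁ k₂ → M) (j₂ : MTwo k₁ k₂ → M) (F : Set M),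
        IsGluing φ₁ φ₂ j₁ j₂ ∧
        IsClosedCircleManifold (𝓡 (2 * k₁ + 2 * k₂)) M ∧
        Orientable (𝓡 (2 * k₁ + 2 * k₂)) M ∧
        F = j₁ '' (fixedPoints Z2 (MOne k₁ k₂) ∩ outside φ₁) ∪
            j₂ '' (componentTwo k₁ k₂ ∩ outside φ₂) ∧
        IsComponentOf F (fixedPoints Z2 M) ∧
        (fixedPoints Circle M).Nonempty ∧
        fixedPoints Circle M ⊆ F ∧
        IsNonorientableSubmanifold (𝓡 (2 * k₁ + 2 * k₂)) (2 * k₂) F := by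
  have hk₂ := (inferInstance : Fact (2 ≤ k₂)).out
  exact ⟨⟨MOne.isClosedCircleManifold, RepSphere.orientable _, MOne.fixedPoints_Z2,
      MOne.isConnected_fixedPoints_Z2 (by omega), MOne.ncard_fixedPoints_circle,
      fixedPoints_circle_subset _⟩,
    ⟨MTwo.isClosedCircleManifold, MTwo.orientable, isComponentOf_componentTwo,
      isNonorientableSubmanifold_componentTwo⟩, exists_isTube_one, exists_isTube_two,
    fun _ _ h₁ _ h₂ hc₂ => exists_glued_manifold h₁ h₂ hc₂⟩
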